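/- \textbf{Setting.} Let $m\ge 2$ and let $G\le \mathrm{SU}(m-1)$ be a compact connected subgroup with Lie algebra $\mathfrak g$ and standard moment map $\mu:\mathbb C^{m-1}\to\mathfrak g$, $\mu(z)=-\tfrac12\pi_{\mathfrak g}(iz\bar z^T)$. Let $Z$ be a connected component of $\mu^{-1}(0)$ which contains a (non-empty) $G$-invariant cohomogeneity-one Lagrangian submanifold of $\mathbb C^{m-1}$, i.e. one all of whose points have a single isotropy type $(H)$ and with $\dim(G/H)=m-2$. Let $G$ act on $\mathbb C^m=\mathbb C^{m-1}\times\mathbb C$ trivially on the last factor. Let $z'\in Z\setminus\{0\}$, $P=\mathbb C z'$, and let $\Phi:P\to\mathbb C$ be a complex linear isometry. Let $e_m=(0,\dots,0,1)$. A curve $\gamma$ in $\mathbb C$ solves the \emph{profile equation} with constant $a$ if $\vec\kappa_\gamma-(m-2)\frac{\gamma^\perp}{|\gamma|^2}=a\,\gamma^\perp$. An \emph{Anciaux shrinker profile} $\sigma$ is a closed polar graph $\sigma(s)=r(s)e^{is}$, $s\in\mathbb R$ (with $r>0$ smooth, and $\sigma$ of period $2\pi p$ for some integer $p\ge1$) solving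 it with $a=-1$. An \emph{Anciaux expander profile} $\varepsilon$ spanning the angle $\alpha\in(0,\frac{\pi}{m-1})$ is a polar graph $\varepsilon(s)=r(s)e^{is}$, $s\in(-\frac\alpha2,\frac\alpha2)$, with $r>0$ smooth and even and $r\to\infty$ at both ends, solving it with $a=1$. Put $\beta_\gamma(s)=-\int_{s_0}^s\langle\gamma,i\gamma'\rangle\,dt$. For curves $\gamma:I_1\to\mathbb C$, $\xi:I_2\to\mathbb C$ put $$\check F(x,y)=\Big(\gamma(x)\xi(y),\ \tfrac12\big(|\xi(y)|^2-|\gamma(x)|^2\big)+i\big(\beta_\xi(y)-\beta_\gamma(x)\big)\Big),\qquad F(g,x,y)=g\cdot(\Phi\oplus\mathrm{Id})^{-1}\check F(x,y)$$ on $G\times I_1\times I_2$. For $\phi\in\mathbb R$, let $L_{(d)}$, $L_{(e)}$, $L_{(f)}$ be the images of $F$ for $(\gamma,\xi)=(e^{i\phi}s,\sigma)$, $(\varepsilon,e^{i\phi}s)$, $(e^{i\phi}\varepsilon,\sigma)$ respectively, where $s\mapsto e^{i\phi}s$, $s\in\mathbb R$, is a line. Let $S_{(d)}\subset L_{(d)}$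 and $S_{(e)}\subset L_{(e)}$ be the images of $\{x=0\}$ and $\{y=0\}$. A Lagrangian is \emph{exact} if the Liouville form $\lambda=\frac1{2i}\sum_j(\bar z_jdz_j-z_jd\bar z_j)$ restricts to an exact form on it, \emph{zero-Maslov} if for some orientation there is a (globally defined, continuous) function $\theta$ with $dz_1\wedge\dots\wedge dz_m|_L=e^{i\theta}\mathrm{vol}_L$, \emph{almost-calibrated} if $\theta$ can be chosen with range of length less than $\pi$, and a \emph{translating soliton in the direction $v$} if $\vec H=v^\perp$. \textbf{Proposition.} \begin{enumerate} \item $L_{(d)}\setminus S_{(d)}$ and $L_{(e)}\setminus S_{(e)}$ are smoothly embedded exact zero-Maslov Lagrangian translating solitons in the direction $-e_m$, and $L_{(e)}\setminus S_{(e)}$ is almost-calibrated; the primitive of $\lambda$ and the Lagrangian angle can be chosen to extend continuously to $L_{(d)}$ and $L_{(e)}$. The sets $S_{(d)}$, $S_{(e)}$ are embedded $1$-dimensional submanifolds. If the orbit $G\cdot z'$ spans a real subspace of dimension greater than $m-1$, they consist of genuine singularities: near no point of $S_{(d)}$ (resp. $S_{(e)}$) is $L_{(d)}$ (resp. $L_{(e)}$)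 an embedded $m$-dimensional submanifold. \item If $G=\mathrm{SO}(m-1)$ (the real matrices in $\mathrm{SU}(m-1)$), then all of $L_{(d)}$ and all of $L_{(e)}$ are smoothly embedded exact zero-Maslov Lagrangian translating solitons in the direction $-e_m$, and $L_{(e)}$ is almost-calibrated. \item For every $G$, $F$ induces a smooth immersion $(G/\mathrm{Stab}(z'))\times I_1\times I_2\to\mathbb C^m$ with image $L_{(f)}$, and this immersion is an exact zero-Maslov Lagrangian translating soliton in the direction $-e_m$. \end{enumerate} -/

import Mathlib

open scoped ContDiff Real Topology

noncomputable section

namespace LagTrans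

/-- Complex Euclidean space `ℂ^d`; its real metric is `Re ⟪·,·⟫`, its complex structure is
multiplication by `I`, and its Kähler form is `ω₀(v, w) = ∑ dxᵢ ∧ dyᵢ (v, w) = Im ⟪v, w⟫`. -/
abbrev Cn (d : ℕ) := EuclideanSpace ℂ (Fin d)

/-- Real Euclidean space `ℝ^k`. -/
abbrev Rn (k : ℕ) := EuclideanSpace ℝ (Fin k)

/-- The standard basis vector `e_i` of `ℝ^k`. -/
def stdBasis (k : ℕ) (i : Fin k) : Rn k := EuclideanSpace.single i 1

/-! ### Immersed and embedded submanifolds of `ℂ^d` -/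

section Immersions

variable {X : Type*} [TopologicalSpace X] {d : ℕ}

/-- A `k`-dimensional chart `φ` of `X` in which `f : X → ℂ^d` becomes a smooth immersion. Two such
charts are always smoothly compatible, so that, if they cover `X`, they form the unique smooth
structure on `X` for which `f` is an immersion. -/
def IsAdaptedChart (k : ℕ) (f : X → Cn d) (φ : OpenPartialHomeomorph X (Rn k)) : Prop :=
  ContDiffOn ℝ ∞ (f ∘ φ.symm) φ.target ∧
    ∀ u ∈ φ.target, Function.Injective (fderiv ℝ (f ∘ φ.symm) u)

/-- `f` is a smooth immersion of the (topological) `k`-manifold `X`. -/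
def IsSmoothImmersion (k : ℕ) (f : X → Cn d) : Prop :=
  ∀ x : X, ∃ φ : OpenPartialHomeomorph X (Rn k), IsAdaptedChart k f φ ∧ x ∈ φ.source

/-- `f` is a Lagrangian immersion: its domain has dimension `d` and `f^* ω₀ = 0`. -/
def IsLagrangianImmersion (f : X → Cn d) : Prop :=
  IsSmoothImmersion d f ∧
    ∀ φ : OpenPartialHomeomorph X (Rn d), IsAdaptedChart d f φ → ∀ u ∈ φ.target, ∀ v w : Rn d,
      (inner ℂ (fderiv ℝ (f ∘ φ.symm) u v) (fderiv ℝ (f ∘ φ.symm) u w)).im = 0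

/-- `h` is a primitive of the restricted Liouville form, `f^* λ = dh`, where
`λ = (1 / 2i) ∑ (z̄ᵢ dzᵢ - zᵢ dz̄ᵢ)`, that is, `λ_z(w) = Im ⟪z, w⟫`. -/
def IsLiouvillePrimitive (f : X → Cn d) (h : X → ℝ) : Prop :=
  ∀ φ : OpenPartialHomeomorph X (Rn d), IsAdaptedChart d f φ → ∀ u ∈ φ.target,
    DifferentiableAt ℝ (h ∘ φ.symm) u ∧
      ∀ v : Rn d, fderiv ℝ (h ∘ φ.symm) u v =
        (inner ℂ (f (φ.symm u)) (fderiv ℝ (f ∘ φ.symm) u v)).im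

/-- `θ` is a Lagrangian angle of `f` for some orientation of `X`: `f^* Ω₀ = e^{iθ} vol`, with
`Ω₀ = dz₁ ∧ ⋯ ∧ dz_d` and `vol` the induced volume form. (The charts in which the displayed
equation holds are the positively oriented ones: for a Lagrangian immersion two of them always
differ by a coordinate change with positive Jacobian determinant.) -/
def IsLagrangianAngle (f : X → Cn d) (θ : X → ℝ) : Prop :=
  Continuous θ ∧
    ∀ x : X, ∃ φ : OpenPartialHomeomorph X (Rn d), IsAdaptedChart d f φ ∧ x ∈ φ.source ∧
      ∀ u ∈ φ.target,
        (Matrix.of fun i j : Fin d => fderiv ℝ (f ∘ φ.symm) u (stdBasis d j) i).det =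
          Complex.exp (Complex.I * (θ (φ.symm u) : ℂ)) *
            (√(Matrix.of fun i j : Fin d =>
              (inner ℂ (fderiv ℝ (f ∘ φ.symm) u (stdBasis d i))
                (fderiv ℝ (f ∘ φ.symm) u (stdBasis d j))).re).det : ℝ)

/-- The tangent space at `u` of a parametrized submanifold `p : ℝ^k → ℂ^d`. -/
def tangentSpace {k : ℕ} (p : Rn k → Cn d) (u : Rn k) : Submodule ℝ (Cn d) :=
  LinearMap.range (fderiv ℝ p u : Rn k →ₗ[ℝ] Cn d)

/-- The component of `v` normal to the parametrized submanifold `p` at `u`. -/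
def normalPart {k : ℕ} (p : Rn k → Cn d) (u : Rn k) (v : Cn d) : Cn d :=
  v - (tangentSpace p u).starProjection v

/-- The mean curvature vector `H = ∑ g^{ij} (∂ᵢ∂ⱼ p)^⊥` of a parametrized submanifold. -/
def meanCurvature {k : ℕ} (p : Rn k → Cn d) (u : Rn k) : Cn d :=
  ∑ i : Fin k, ∑ j : Fin k,
    ((Matrix.of fun a b : Fin k =>
      (inner ℂ (fderiv ℝ p u (stdBasis k a)) (fderiv ℝ p u (stdBasis k b))).re)⁻¹ i j) •
      normalPart p u (fderiv ℝ (fderiv ℝ p) u (stdBasis k i) (stdBasis k j))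

/-- `f` is a translating soliton of mean curvature flow with velocity `v`: `H = v^⊥`. -/
def IsTranslatingSoliton (k : ℕ) (v : Cn d) (f : X → Cn d) : Prop :=
  IsSmoothImmersion k f ∧
    ∀ φ : OpenPartialHomeomorph X (Rn k), IsAdaptedChart k f φ → ∀ u ∈ φ.target,
      meanCurvature (f ∘ φ.symm) u = normalPart (f ∘ φ.symm) u v

/-- `f` is an exact, zero-Maslov Lagrangian translating soliton with velocity `v`. -/
def IsExactZeroMaslovTranslator (v : Cn d) (f : X → Cn d) : Prop :=
  IsLagrangianImmersion f ∧ (∃ h : X → ℝ, Continuous h ∧ IsLiouvillePrimitive f h) ∧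
    (∃ θ : X → ℝ, IsLagrangianAngle f θ) ∧ IsTranslatingSoliton d v f

end Immersions

/-- `M ⊆ ℂ^d` is a smooth embedded `k`-dimensional submanifold: the inclusion of `M`, with its
subspace topology, is an immersion. -/
def IsEmbeddedSubmanifold {d : ℕ} (k : ℕ) (M : Set (Cn d)) : Prop :=
  IsSmoothImmersion k (Subtype.val : M → Cn d)

/-- The set `L`, away from its subset `S`, is an embedded exact zero-Maslov Lagrangian translating
soliton with velocity `v`; moreover a primitive of the Liouville form and a Lagrangian angle can be
chosen which extend continuously across `S`. For `S = ∅` this says that the whole of `L` is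
an embedded exact zero-Maslov Lagrangian translating soliton. -/
def IsEmbeddedTranslatorOff {d : ℕ} (v : Cn d) (L S : Set (Cn d)) : Prop :=
  IsEmbeddedSubmanifold d (L \ S) ∧
  IsLagrangianImmersion (Subtype.val : ↥(L \ S) → Cn d) ∧
  (∃ h : Cn d → ℝ, ContinuousOn h L ∧
    IsLiouvillePrimitive (Subtype.val : ↥(L \ S) → Cn d) fun p => h p) ∧
  (∃ θ : Cn d → ℝ, ContinuousOn θ L ∧
    IsLagrangianAngle (Subtype.val : ↥(L \ S) → Cn d) fun p => θ p) ∧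
  IsTranslatingSoliton d v (Subtype.val : ↥(L \ S) → Cn d)

/-- `L`, away from `S`, is almost-calibrated: it has a Lagrangian angle (extending continuously
across `S`) whose range is contained in an interval of length less than `π`. -/
def IsAlmostCalibratedOff {d : ℕ} (L S : Set (Cn d)) : Prop :=
  ∃ θ : Cn d → ℝ, ContinuousOn θ L ∧
    IsLagrangianAngle (Subtype.val : ↥(L \ S) → Cn d) (fun p => θ p) ∧
    ∃ c c' : ℝ, c' - c < π ∧ ∀ p ∈ L, θ p ∈ Set.Icc c c'

/-- Every point of `S` is a genuine singularity of `L`: near no point of `S` is `L` an embedded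
submanifold of dimension `d`. -/
def IsSingularAlong {d : ℕ} (L S : Set (Cn d)) : Prop :=
  ∀ p ∈ S, ∀ U : Set (Cn d), IsOpen U → p ∈ U → ¬ IsEmbeddedSubmanifold d (L ∩ U)

/-! ### Group actions and the moment map -/

/-- The special unitary group `SU(n)`. -/
abbrev SU (n : ℕ) := Matrix.specialUnitaryGroup (Fin n) ℂ

/-- The natural action of `SU(n)` on `ℂ^n`. -/
def act {n : ℕ} (g : SU n) (z : Cn n) : Cn n :=
  WithLp.toLp 2 ((g : Matrix (Fin n) (Fin n) ℂ).mulVec z.ofLp)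

/-- The point `(z', w)` of `ℂ^n × ℂ = ℂ^{n+1}`. -/
def pair {n : ℕ} (z : Cn n) (w : ℂ) : Cn (n + 1) :=
  WithLp.toLp 2 (Fin.snoc (α := fun _ => ℂ) z.ofLp w)

/-- The action of `SU(n)` on `ℂ^{n+1} = ℂ^n × ℂ`, trivial on the last coordinate. -/
def actExt {n : ℕ} (g : SU n) (p : Cn (n + 1)) : Cn (n + 1) :=
  pair (act g (WithLp.toLp 2 (Fin.init p.ofLp))) (p (Fin.last n))

/-- The last standard basis vector `e_m` of `ℂ^m`, `m = n + 1`. -/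
def eLast (n : ℕ) : Cn (n + 1) := EuclideanSpace.single (Fin.last n) 1

/-- The Lie algebra `{X | exp(tX) ∈ K for all t ∈ ℝ}` of a subgroup `K` of `SU(n)`. (For closed `K`
that set is a real subspace, and equals its span.) -/
def lieAlg {n : ℕ} (K : Subgroup (SU n)) : Submodule ℝ (Matrix (Fin n) (Fin n) ℂ) :=
  Submodule.span ℝ {X | ∀ t : ℝ, ∃ g ∈ K,
    (g : Matrix (Fin n) (Fin n) ℂ) = NormedSpace.exp (t • X)}

/-- The dimension of a closed subgroup of `SU(n)`. -/
def lieDim {n : ℕ} (K : Subgroup (SU n)) : ℕ := Module.finrank ℝ (lieAlg K)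

/-- The standard moment map `μ(z) = -½ π_𝔤(i z z̄ᵀ)`, the Lie algebra `𝔤` being identified with its
dual by the `Ad`-invariant inner product `⟨A, B⟩ = Re tr(Aᴴ B)`: the value of `μ(z)` at `X ∈ 𝔤` is
`⟨-½ i z z̄ᵀ, X⟩`. -/
def momentMap {n : ℕ} (G : Subgroup (SU n)) (z : Cn n) (X : lieAlg G) : ℝ :=
  ((((-(1 / 2 : ℂ) * Complex.I) • Matrix.vecMulVec z.ofLp (star z.ofLp)).conjTranspose *
    (X : Matrix (Fin n) (Fin n) ℂ)).trace).re

/-- The zero level set `μ⁻¹(0)` in `ℂ^n`. -/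
def zeroLevel {n : ℕ} (G : Subgroup (SU n)) : Set (Cn n) := {z | momentMap G z = 0}

theorem act_one {n : ℕ} (z : Cn n) : act (1 : SU n) z = z := by
  simp [act]

theorem act_mul {n : ℕ} (g h : SU n) (z : Cn n) : act (g * h) z = act g (act h z) := by
  simp [act, Matrix.mulVec_mulVec]

/-- The stabiliser `G_z` of a point. -/
def stab {n : ℕ} (G : Subgroup (SU n)) (z : Cn n) : Subgroup (SU n) where
  carrier := {g | g ∈ G ∧ act g z = z}
  mul_mem' := by
    rintro a b ⟨ha, ha'⟩ ⟨hb, hb'⟩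
    exact ⟨G.mul_mem ha hb, by rw [act_mul, hb', ha']⟩
  one_mem' := ⟨G.one_mem, act_one z⟩
  inv_mem' := by
    rintro a ⟨ha, ha'⟩
    refine ⟨G.inv_mem ha, ?_⟩
    conv_lhs => rw [← ha']
    rw [← act_mul, inv_mul_cancel, act_one]

/-- `L` is a (non-empty) `G`-invariant cohomogeneity-one Lagrangian submanifold of `ℂ^n`: all its
points have one isotropy type `(H)`, and `dim(G/H) = n - 1`. -/
def IsCohomogeneityOneLagrangian {n : ℕ} (G : Subgroup (SU n)) (L : Set (Cn n)) : Prop :=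
  L.Nonempty ∧ IsLagrangianImmersion (Subtype.val : L → Cn n) ∧
  (∀ g ∈ G, ∀ z ∈ L, act g z ∈ L) ∧
  ∃ H : Subgroup (SU n), H ≤ G ∧
    (∀ z ∈ L, ∃ g ∈ G, stab G z = H.map (MulAut.conj g).toMonoidHom) ∧
    lieDim G + 1 = lieDim H + n

/-- `G` is the standard `SO(n) ⊆ SU(n)`, the group of real matrices in `SU(n)`. -/
def IsStandardSO {n : ℕ} (G : Subgroup (SU n)) : Prop :=
  ∀ g : SU n, g ∈ G ↔ ∃ O ∈ Matrix.specialOrthogonalGroup (Fin n) ℝ,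
    (g : Matrix (Fin n) (Fin n) ℂ) = O.map (fun t : ℝ => (t : ℂ))

/-! ### Profile curves -/

/-- The component of `w` normal to the plane curve `γ` at `s`. -/
def curveNormal (γ : ℝ → ℂ) (s : ℝ) (w : ℂ) : ℂ :=
  w - (((starRingEnd ℂ (deriv γ s) * w).re / ‖deriv γ s‖ ^ 2 : ℝ) : ℂ) * deriv γ s

/-- The curvature vector of a regular plane curve in an arbitrary parametrization. -/
def curvatureVector (γ : ℝ → ℂ) (s : ℝ) : ℂ :=
  (((1 : ℝ) / ‖deriv γ s‖ ^ 2 : ℝ) : ℂ) * curveNormal γ s (deriv (deriv γ) s)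

/-- The profile curve equation `κ - (m - 2) γ^⊥ / |γ|² = a γ^⊥` on `I`, where `m = n + 1`. -/
def ProfileEq (n : ℕ) (a : ℝ) (I : Set ℝ) (γ : ℝ → ℂ) : Prop :=
  ∀ s ∈ I, curvatureVector γ s
      - ((((n : ℝ) - 1) / ‖γ s‖ ^ 2 : ℝ) : ℂ) * curveNormal γ s (γ s)
    = (a : ℂ) * curveNormal γ s (γ s)

/-- `σ` is the profile curve (at scale one) of an Anciaux shrinker: a closed curve, winding some
number `p` of times around the origin, which is a polar graph `σ(s) = r(s) e^{is}`, `s ∈ ℝ`, and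
solves the profile curve equation with `a = -1`. -/
def IsAnciauxShrinkerProfile (n : ℕ) (σ : ℝ → ℂ) : Prop :=
  ∃ r : ℝ → ℝ, ContDiff ℝ ∞ r ∧ (∀ s, 0 < r s) ∧
    (∀ s, σ s = (r s : ℂ) * Complex.exp ((s : ℂ) * Complex.I)) ∧
    (∃ p : ℕ, 0 < p ∧ ∀ s, σ (s + 2 * π * p) = σ s) ∧
    ProfileEq n (-1) Set.univ σ

/-- `ε` is the profile curve (at scale one) of the Anciaux expander centred on the positive real
axis and spanning the angle `α ∈ (0, π / n)`, `n = m - 1`: a polar graph `ε(s) = r(s) e^{is}`,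
`s ∈ (-α/2, α/2)`, complete (`r → ∞` at both ends), symmetric in the real axis,
which solves the profile curve equation with `a = 1`. -/
def IsAnciauxExpanderProfile (n : ℕ) (α : ℝ) (ε : ℝ → ℂ) : Prop :=
  0 < α ∧ α < π / n ∧
  ∃ r : ℝ → ℝ, ContDiffOn ℝ ∞ r (Set.Ioo (-(α / 2)) (α / 2)) ∧
    (∀ s ∈ Set.Ioo (-(α / 2)) (α / 2), 0 < r s ∧ r (-s) = r s ∧
      ε s = (r s : ℂ) * Complex.exp ((s : ℂ) * Complex.I)) ∧
    Filter.Tendsto r (𝓝[<] (α / 2)) Filter.atTop ∧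
    Filter.Tendsto r (𝓝[>] (-(α / 2))) Filter.atTop ∧
    ProfileEq n 1 (Set.Ioo (-(α / 2)) (α / 2)) ε

/-- The line `e^{iφ} c`, `c(s) = s`, through the origin. -/
def line (φ : ℝ) : ℝ → ℂ := fun s => Complex.exp (Complex.I * φ) * s

/-- The rotated curve `e^{iφ} γ`. -/
def rotate (φ : ℝ) (γ : ℝ → ℂ) : ℝ → ℂ := fun s => Complex.exp (Complex.I * φ) * γ s

/-! ### The Lagrangians built from two curves -/

/-- `β_γ(s) = -∫_{s₀}^{s} ⟨γ, i γ'⟩ dt`. -/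
def beta (γ : ℝ → ℂ) (s₀ s : ℝ) : ℝ :=
  -∫ t in s₀..s, (starRingEnd ℂ (γ t) * (Complex.I * deriv γ t)).re

/-- The profile surface `(γ(x) ξ(y), ½ (|ξ(y)|² - |γ(x)|²) + i (β_ξ(y) - β_γ(x)))` in `ℂ²`, with
base points `x₀`, `y₀` for `β_γ`, `β_ξ`. -/
def profileSurface (γ ξ : ℝ → ℂ) (x₀ y₀ x y : ℝ) : ℂ × ℂ :=
  (γ x * ξ y,
    (((‖ξ y‖ ^ 2 - ‖γ x‖ ^ 2) / 2 : ℝ) : ℂ) +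
      Complex.I * ((beta ξ y₀ y - beta γ x₀ x : ℝ) : ℂ))

section Ansatz

variable {n : ℕ} {z' : Cn n}

/-- The embedding `(Φ ⊕ Id)⁻¹ : ℂ² → P × ℂ ⊆ ℂ^{n+1}`, where `P = ℂ z'` and `Φ : P ≃ ℂ`. -/
def planeEmbedding (Φ : (Submodule.span ℂ {z'}) ≃ₗᵢ[ℂ] ℂ) (w : ℂ × ℂ) : Cn (n + 1) :=
  pair (Φ.symm w.1 : Cn n) w.2

/-- The map `F(g, x, y) = g · (Φ ⊕ Id)⁻¹(F̌(x, y))`. -/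
def ansatzMap (Φ : (Submodule.span ℂ {z'}) ≃ₗᵢ[ℂ] ℂ) (γ ξ : ℝ → ℂ) (x₀ y₀ : ℝ)
    (g : SU n) (x y : ℝ) : Cn (n + 1) :=
  actExt g (planeEmbedding Φ (profileSurface γ ξ x₀ y₀ x y))

/-- The image of `G × I₁ × I₂` under `F`. -/
def ansatzImage (G : Subgroup (SU n)) (Φ : (Submodule.span ℂ {z'}) ≃ₗᵢ[ℂ] ℂ) (γ ξ : ℝ → ℂ)
    (x₀ y₀ : ℝ) (I₁ I₂ : Set ℝ) : Set (Cn (n + 1)) :=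
  {p | ∃ g ∈ G, ∃ x ∈ I₁, ∃ y ∈ I₂, p = ansatzMap Φ γ ξ x₀ y₀ g x y}

/-- The `G`-orbit of `Φ⁻¹(1)`, which is `G / Stab(z')`. -/
def orbitSet (G : Subgroup (SU n)) (Φ : (Submodule.span ℂ {z'}) ≃ₗᵢ[ℂ] ℂ) : Set (Cn n) :=
  {v | ∃ g ∈ G, v = act g (Φ.symm 1 : Cn n)}

/-- The map induced by `F` on `(G / Stab(z')) × I₁ × I₂`. -/
def reducedMap (G : Subgroup (SU n)) (Φ : (Submodule.span ℂ {z'}) ≃ₗᵢ[ℂ] ℂ) (γ ξ : ℝ → ℂ)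
    (x₀ y₀ : ℝ) (I₁ I₂ : Set ℝ) (q : orbitSet G Φ × I₁ × I₂) : Cn (n + 1) :=
  pair ((profileSurface γ ξ x₀ y₀ q.2.1 q.2.2).1 • (q.1 : Cn n))
    (profileSurface γ ξ x₀ y₀ q.2.1 q.2.2).2

/-- `F` factors through the map of `(G / Stab(z')) × I₁ × I₂`. -/
theorem ansatzMap_eq_reducedMap (G : Subgroup (SU n)) (Φ : (Submodule.span ℂ {z'}) ≃ₗᵢ[ℂ] ℂ)
    (γ ξ : ℝ → ℂ) (x₀ y₀ : ℝ) (I₁ I₂ : Set ℝ) (g : SU n) (hg : g ∈ G) (x : I₁) (y : I₂) :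
    ansatzMap Φ γ ξ x₀ y₀ g x y =
      reducedMap G Φ γ ξ x₀ y₀ I₁ I₂ (⟨act g (Φ.symm 1 : Cn n), g, hg, rfl⟩, x, y) := by
  have h : Φ.symm (profileSurface γ ξ x₀ y₀ x y).1 =
      (profileSurface γ ξ x₀ y₀ x y).1 • Φ.symm 1 := by
    rw [← map_smul, smul_eq_mul, mul_one]
  simp [ansatzMap, reducedMap, planeEmbedding, actExt, pair, act, h, Matrix.mulVec_smul]

/-- The Lagrangian is the image of that map. -/
theorem range_reducedMap (G : Subgroup (SU n)) (Φ : (Submodule.span ℂ {z'}) ≃ₗᵢ[ℂ] ℂ)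
    (γ ξ : ℝ → ℂ) (x₀ y₀ : ℝ) (I₁ I₂ : Set ℝ) :
    Set.range (reducedMap G Φ γ ξ x₀ y₀ I₁ I₂) = ansatzImage G Φ γ ξ x₀ y₀ I₁ I₂ := by
  ext p
  constructor
  · rintro ⟨⟨⟨v, g, hg, rfl⟩, x, y⟩, rfl⟩
    exact ⟨g, hg, x, x.2, y, y.2, (ansatzMap_eq_reducedMap G Φ γ ξ x₀ y₀ I₁ I₂ g hg x y).symm⟩
  · rintro ⟨g, hg, x, hx, y, hy, rfl⟩
    exact ⟨_, (ansatzMap_eq_reducedMap G Φ γ ξ x₀ y₀ I₁ I₂ g hg ⟨x, hx⟩ ⟨y, hy⟩).symm⟩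

/-- `L_(d)`: the line `e^{iφ} c` and a shrinker profile `σ`. -/
def Ld (G : Subgroup (SU n)) (Φ : (Submodule.span ℂ {z'}) ≃ₗᵢ[ℂ] ℂ) (φ : ℝ) (σ : ℝ → ℂ)
    (s₀ : ℝ) : Set (Cn (n + 1)) :=
  ansatzImage G Φ (line φ) σ 0 s₀ Set.univ Set.univ

/-- The part `{x = 0}` of `L_(d)`. -/
def Sd (G : Subgroup (SU n)) (Φ : (Submodule.span ℂ {z'}) ≃ₗᵢ[ℂ] ℂ) (φ : ℝ) (σ : ℝ → ℂ)
    (s₀ : ℝ) : Set (Cn (n + 1)) :=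
  ansatzImage G Φ (line φ) σ 0 s₀ {0} Set.univ

/-- `L_(e)`: an expander profile `ε` spanning the angle `α`, and the line `e^{iφ} c`. -/
def Le (G : Subgroup (SU n)) (Φ : (Submodule.span ℂ {z'}) ≃ₗᵢ[ℂ] ℂ) (φ α : ℝ) (ε : ℝ → ℂ) :
    Set (Cn (n + 1)) :=
  ansatzImage G Φ ε (line φ) 0 0 (Set.Ioo (-(α / 2)) (α / 2)) Set.univ

/-- The part `{y = 0}` of `L_(e)`. -/
def Se (G : Subgroup (SU n)) (Φ : (Submodule.span ℂ {z'}) ≃ₗᵢ[ℂ] ℂ) (φ α : ℝ) (ε : ℝ → ℂ) :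
    Set (Cn (n + 1)) :=
  ansatzImage G Φ ε (line φ) 0 0 (Set.Ioo (-(α / 2)) (α / 2)) {0}

/-- `L_(f)`, as a map with image `L_(f)`: an expander profile `e^{iφ} ε` and a shrinker profile
`σ`. -/
def Ff (G : Subgroup (SU n)) (Φ : (Submodule.span ℂ {z'}) ≃ₗᵢ[ℂ] ℂ) (φ α : ℝ) (ε σ : ℝ → ℂ)
    (s₀ : ℝ) : orbitSet G Φ × Set.Ioo (-(α / 2)) (α / 2) × (Set.univ : Set ℝ) → Cn (n + 1) :=
  reducedMap G Φ (rotate φ ε) σ 0 s₀ (Set.Ioo (-(α / 2)) (α / 2)) Set.univ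

end Ansatz

end LagTrans

end

/-! Write n = m - 1 = k + 1. On a Lagrangian immersion with angle θ one has H = J∇θ
(`im_inner_meanCurvature`), and the Kähler form pairs a tangent vector x with -e_m to Im x_m. Hence
an isotropic immersion whose angle is Im z_m plus a constant translates in the direction -e_m.
Everything is therefore reduced to covering the domain by charts in which the map is isotropic, has
a given primitive of λ, and has Jacobian determinant of phase Im z_m + c up to a real factor
(`IsCalibratedChart`, `calibrated_conclusions`).

Such charts come from one computation, `link_calibrated`. Let N be a special Legendrian in the unit
sphere of ℂ^n, and let k arg γ + arg γ' = const - β_γ and k arg ξ + arg ξ' = const + β_ξ. Then (q,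
x, y) ↦ (γξq, ½(|ξ|² - |γ|²) + i(β_ξ - β_γ)) is isotropic with phase β_ξ - β_γ + const. Integrating
the profile equation of a polar graph gives exactly these relations (`IsPolarGraph.exists_angle`): a
= -1 suits ξ, a = 1 suits γ, and a line, where β = 0, suits both.

The link is the orbit of a unit multiple of z'. An orbit in the zero level of the moment map is
isotropic and orthogonal to its position vector, so it is special Legendrian as soon as its
dimension is n - 1. This is known at some point z of the given Lagrangian and has to be carried over
to z' (`IsUnitaryGroup.finrank_orbitTangent_eq`). If the orbit of z has dimension n - 1, the
complexified group moves ℂz over an open set, so homogeneous holomorphic invariants of equal degree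
are proportional. Let u be a unit zero of the moment map outside ℂ·Gz. The averages over G of powers
of ⟨Az, ·⟩ and ⟨Au, ·⟩ are such invariants. Their cross values decay like powers of ρ = max |⟨Az,
u⟩| < 1, whereas their values at z and u themselves do not decay exponentially
(`IsInvariantMeasure.exists_lt_norm_integral_pow`); this contradicts proportionality.

When one curve is a line, β of the other curve is strictly increasing, so y can be read off from Im
z_m, and then x and q follow: the complement of {x = 0} is embedded. The pairs (q, x) and (-q, -x)
have the same image, so x > 0 is taken over N ∪ -N. At x = 0 all rulings meet. If the orbit spans
too large a space their velocities do not fit into a tangent space. If G = SO(n), the products xq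
fill a real n-plane up to a phase, and X = xq, y are smooth coordinates across the vertex.
Almost-calibration is the bound π - α/2 for the variation of β along an expander profile. -/

noncomputable section

/-! ### Adapted charts, calibrated charts and the Gram matrix -/

namespace LagTrans

/-- An immersion has local smooth left inverses. -/
theorem exists_contDiffAt_leftInverse {E F : Type*} [NormedAddCommGroup E] [NormedSpace ℝ E]
    [FiniteDimensional ℝ E] [NormedAddCommGroup F] [NormedSpace ℝ F] [FiniteDimensional ℝ F]
    {p : E → F} {u : E} (hp : ContDiffAt ℝ ∞ p u) (hinj : Function.Injective (fderiv ℝ p u)) :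
    ∃ l : F → E, ContDiffAt ℝ ∞ l (p u) ∧ ∀ᶠ v in 𝓝 u, l (p v) = v := by
  have : CompleteSpace E := FiniteDimensional.complete ℝ E
  -- After composition with a linear left inverse of the differential the derivative at `u` is the
  -- identity, so the inverse function theorem applies to `A' ∘ p`.
  obtain ⟨A, hA⟩ := LinearMap.exists_leftInverse_of_injective (fderiv ℝ p u : E →ₗ[ℝ] F)
    (LinearMap.ker_eq_bot.2 hinj)
  let A' : F →L[ℝ] E := A.toContinuousLinearMap
  have hq : ContDiffAt ℝ ∞ (A' ∘ p) u := A'.contDiff.contDiffAt.comp u hp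
  have hd : HasFDerivAt (A' ∘ p) ((ContinuousLinearEquiv.refl ℝ E : E ≃L[ℝ] E) : E →L[ℝ] E) u := by
    have h := A'.hasFDerivAt.comp u (hp.differentiableAt (by simp)).hasFDerivAt
    convert h using 1
    ext v
    exact (LinearMap.congr_fun hA v).symm
  have hs := hq.hasStrictFDerivAt' hd (by simp)
  refine ⟨hs.localInverse ∘ A', ?_, hs.eventually_left_inverse⟩
  exact ContDiffAt.comp (p u) (hq.to_localInverse hd (by simp)) A'.contDiff.contDiffAt

variable {X : Type*} [TopologicalSpace X] {d k : ℕ}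

theorem IsAdaptedChart.contDiffAt {f : X → Cn d} {φ : OpenPartialHomeomorph X (Rn k)}
    (h : IsAdaptedChart k f φ) {u : Rn k} (hu : u ∈ φ.target) :
    ContDiffAt ℝ ∞ (f ∘ φ.symm) u :=
  h.1.contDiffAt (φ.open_target.mem_nhds hu)

/-- Two adapted charts are smoothly compatible. -/
theorem IsAdaptedChart.transition {f : X → Cn d} {φ ψ : OpenPartialHomeomorph X (Rn k)}
    (hφ : IsAdaptedChart k f φ) (hψ : IsAdaptedChart k f ψ) {u : Rn k} (hu : u ∈ φ.target)
    (hs : φ.symm u ∈ ψ.source) :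
    ContDiffAt ℝ ∞ (ψ ∘ φ.symm) u ∧
      (fun v => φ.symm v) =ᶠ[𝓝 u] fun v => ψ.symm ((ψ ∘ φ.symm) v) := by
  have hev : ∀ᶠ v in 𝓝 u, φ.symm v ∈ ψ.source :=
    (φ.continuousAt_symm hu).eventually (ψ.open_source.mem_nhds hs)
  have heq : (fun v => φ.symm v) =ᶠ[𝓝 u] fun v => ψ.symm ((ψ ∘ φ.symm) v) := by
    filter_upwards [hev] with v hv
    exact (ψ.left_inv hv).symm
  refine ⟨?_, heq⟩
  have ht : (ψ ∘ φ.symm) u ∈ ψ.target := ψ.map_source hs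
  obtain ⟨l, hl, hl'⟩ := exists_contDiffAt_leftInverse (hψ.contDiffAt ht) (hψ.2 _ ht)
  have hc : ContinuousAt (ψ ∘ φ.symm) u :=
    (ψ.continuousAt hs).comp (φ.continuousAt_symm hu)
  -- A priori the coordinate change is only continuous. A smooth left inverse of `f ∘ ψ.symm`
  -- recovers it from the smooth map `f ∘ φ.symm`.
  have hτ : (ψ ∘ φ.symm) =ᶠ[𝓝 u] l ∘ (f ∘ φ.symm) := by
    filter_upwards [hc.eventually hl', heq] with v hv hv'
    rw [Function.comp_apply (f := l), Function.comp_apply (f := f), hv']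
    exact hv.symm
  refine ContDiffAt.congr_of_eventuallyEq ?_ hτ
  refine ContDiffAt.comp u ?_ (hφ.contDiffAt hu)
  have hval : (f ∘ φ.symm) u = (f ∘ ψ.symm) ((ψ ∘ φ.symm) u) := by
    simp [ψ.left_inv hs]
  rw [hval]
  exact hl

/-- The Jacobian matrix of a parametrized submanifold. -/
def jac (p : Rn d → Cn d) (u : Rn d) : Matrix (Fin d) (Fin d) ℂ :=
  Matrix.of fun i j => fderiv ℝ p u (stdBasis d j) i

/-- The induced metric of a parametrized submanifold. -/
def gram (p : Rn k → Cn d) (u : Rn k) : Matrix (Fin k) (Fin k) ℝ :=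
  Matrix.of fun i j => (inner ℂ (fderiv ℝ p u (stdBasis k i)) (fderiv ℝ p u (stdBasis k j))).re

theorem sum_stdBasis (v : Rn k) : ∑ j, v j • stdBasis k j = v := by
  ext i
  simp [stdBasis, Finset.sum_apply, Pi.single_apply]

theorem map_eq_sum_stdBasis {F : Type*} [NormedAddCommGroup F] [NormedSpace ℝ F]
    (L : Rn k →L[ℝ] F) (v : Rn k) : L v = ∑ j, v j • L (stdBasis k j) := by
  conv_lhs => rw [← sum_stdBasis v]
  simp [map_sum]

theorem jac_comp {p : Rn d → Cn d} {τ : Rn d → Rn d} {u : Rn d}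
    (hp : DifferentiableAt ℝ p (τ u)) (hτ : DifferentiableAt ℝ τ u) :
    jac (p ∘ τ) u = jac p (τ u) *
      (Matrix.of fun i j => fderiv ℝ τ u (stdBasis d j) i).map (fun t : ℝ => (t : ℂ)) := by
  ext i j
  simp only [jac, Matrix.mul_apply, Matrix.of_apply, Matrix.map_apply]
  rw [fderiv_comp u hp hτ, ContinuousLinearMap.comp_apply, map_eq_sum_stdBasis]
  simp [mul_comm]

/-- A chart in which `f` is an isotropic immersion, `h` is a primitive of the Liouville form and
the complex volume form has phase `θ`. -/
def IsCalibratedChart (f : X → Cn d) (h θ : X → ℝ) (φ : OpenPartialHomeomorph X (Rn d)) : Prop :=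
  IsAdaptedChart d f φ ∧ ∀ u ∈ φ.target,
    (∀ v w : Rn d,
      (inner ℂ (fderiv ℝ (f ∘ φ.symm) u v) (fderiv ℝ (f ∘ φ.symm) u w)).im = 0) ∧
    (DifferentiableAt ℝ (h ∘ φ.symm) u ∧
      ∀ v : Rn d, fderiv ℝ (h ∘ φ.symm) u v =
        (inner ℂ (f (φ.symm u)) (fderiv ℝ (f ∘ φ.symm) u v)).im) ∧
    ∃ R : ℝ, (jac (f ∘ φ.symm) u).det = R * Complex.exp (Complex.I * θ (φ.symm u))

/-- If the domain is covered by calibrated charts then every adapted chart is calibrated. -/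
theorem IsCalibratedChart.of_adapted {f : X → Cn d} {h θ : X → ℝ}
    (H : ∀ x, ∃ ψ, IsCalibratedChart f h θ ψ ∧ x ∈ ψ.source)
    {φ : OpenPartialHomeomorph X (Rn d)} (hφ : IsAdaptedChart d f φ) :
    IsCalibratedChart f h θ φ := by
  refine ⟨hφ, fun u hu => ?_⟩
  obtain ⟨ψ, ⟨hψ, hψ'⟩, hs⟩ := H (φ.symm u)
  obtain ⟨hτ, heq⟩ := hφ.transition hψ hu hs
  have ht : (ψ ∘ φ.symm) u ∈ ψ.target := ψ.map_source hs
  obtain ⟨h1, ⟨h2, h2'⟩, R, h3⟩ := hψ' _ ht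
  have hτd : DifferentiableAt ℝ (ψ ∘ φ.symm) u := hτ.differentiableAt (by simp)
  have hpd : DifferentiableAt ℝ (f ∘ ψ.symm) ((ψ ∘ φ.symm) u) :=
    (hψ.contDiffAt ht).differentiableAt (by simp)
  have hff : f ∘ φ.symm =ᶠ[𝓝 u] (f ∘ ψ.symm) ∘ (ψ ∘ φ.symm) := heq.fun_comp f
  have hhh : h ∘ φ.symm =ᶠ[𝓝 u] (h ∘ ψ.symm) ∘ (ψ ∘ φ.symm) := heq.fun_comp h
  have hval : ψ.symm ((ψ ∘ φ.symm) u) = φ.symm u := ψ.left_inv hs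
  rw [hval] at h2' h3
  have hD : fderiv ℝ (f ∘ φ.symm) u =
      (fderiv ℝ (f ∘ ψ.symm) ((ψ ∘ φ.symm) u)).comp (fderiv ℝ (ψ ∘ φ.symm) u) := by
    rw [hff.fderiv_eq, fderiv_comp u hpd hτd]
  refine ⟨fun v w => ?_, ⟨?_, fun v => ?_⟩, ?_⟩
  · rw [hD]; exact h1 _ _
  · exact (h2.comp u hτd).congr_of_eventuallyEq hhh
  · rw [hhh.fderiv_eq, fderiv_comp u h2 hτd, hD]
    exact h2' _
  -- The factor in the phase condition may be any real number, so coordinate changes of either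
  -- orientation are harmless: their real Jacobian determinant is absorbed.
  · refine ⟨R * (Matrix.of fun i j => fderiv ℝ (ψ ∘ φ.symm) u (stdBasis d j) i).det, ?_⟩
    have hj : jac (f ∘ φ.symm) u = jac ((f ∘ ψ.symm) ∘ (ψ ∘ φ.symm)) u := by
      unfold jac; rw [hff.fderiv_eq]
    rw [hj, jac_comp hpd hτd, Matrix.det_mul, h3]
    have hdet := (RingHom.map_det Complex.ofRealHom
      (Matrix.of fun i j => fderiv ℝ (ψ ∘ φ.symm) u (stdBasis d j) i)).symm
    have hdet' : ((Matrix.of fun i j => fderiv ℝ (ψ ∘ φ.symm) u (stdBasis d j) i).map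
        (fun t : ℝ => (t : ℂ))).det =
        ((Matrix.of fun i j => fderiv ℝ (ψ ∘ φ.symm) u (stdBasis d j) i).det : ℂ) := hdet
    rw [hdet']
    push_cast
    ring

/-- For an isotropic parametrization the Gram matrix is `Aᴴ A`, with `A` the Jacobian matrix. -/
theorem gram_map_eq {p : Rn d → Cn d} {u : Rn d}
    (hiso : ∀ v w : Rn d, (inner ℂ (fderiv ℝ p u v) (fderiv ℝ p u w)).im = 0) :
    (gram p u).map (fun t : ℝ => (t : ℂ)) = (jac p u).conjTranspose * jac p u := by
  ext i j
  have h : ((inner ℂ (fderiv ℝ p u (stdBasis d i)) (fderiv ℝ p u (stdBasis d j))).re : ℂ) =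
      inner ℂ (fderiv ℝ p u (stdBasis d i)) (fderiv ℝ p u (stdBasis d j)) :=
    Complex.ext (by simp) (by simp [hiso])
  simp only [Matrix.map_apply, gram, Matrix.of_apply]
  rw [h]
  simp only [Matrix.mul_apply, jac, Matrix.of_apply,
    Matrix.conjTranspose_apply, PiLp.inner_apply, RCLike.inner_apply]
  exact Finset.sum_congr rfl fun _ _ => mul_comm _ _

/-- The quadratic form of the Gram matrix at `c` is the squared length of the image of `c`, so a
null vector would lie in the kernel of the differential. -/
theorem gram_det_ne_zero {p : Rn k → Cn d} {u : Rn k}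
    (hinj : Function.Injective (fderiv ℝ p u)) : (gram p u).det ≠ 0 := by
  intro h0
  obtain ⟨c, hc, hc0⟩ := Matrix.exists_mulVec_eq_zero_iff.2 h0
  apply hc
  have key : (inner ℂ (fderiv ℝ p u (WithLp.toLp 2 c)) (fderiv ℝ p u (WithLp.toLp 2 c))).re
      = c ⬝ᵥ (gram p u).mulVec c := by
    rw [map_eq_sum_stdBasis (fderiv ℝ p u)]
    simp only [sum_inner, inner_sum, dotProduct, Matrix.mulVec, gram, Matrix.of_apply,
      Complex.re_sum]
    refine Finset.sum_congr rfl fun i _ => ?_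
    rw [Finset.mul_sum]
    refine Finset.sum_congr rfl fun j _ => ?_
    rw [← Complex.coe_smul, ← Complex.coe_smul, inner_smul_left, inner_smul_right]
    have hsymm := inner_re_symm (𝕜 := ℂ) (fderiv ℝ p u (stdBasis k j))
      (fderiv ℝ p u (stdBasis k i))
    simp only [RCLike.re_eq_complex_re] at hsymm
    simp [hsymm]
    ring
  rw [hc0, dotProduct_zero, ← RCLike.re_eq_complex_re, inner_self_eq_norm_sq] at key
  have h1 : fderiv ℝ p u (WithLp.toLp 2 c) = 0 := by simpa using key
  have h2 : (WithLp.toLp 2 c : Rn k) = 0 := hinj (by simpa using h1)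
  simpa using congrArg WithLp.ofLp h2

/-- Determinants in `gram_map_eq`. It identifies the modulus of the complex determinant with the
Riemannian volume density. -/
theorem jac_normSq_det {p : Rn d → Cn d} {u : Rn d}
    (hiso : ∀ v w : Rn d, (inner ℂ (fderiv ℝ p u v) (fderiv ℝ p u w)).im = 0) :
    ‖(jac p u).det‖ ^ 2 = (gram p u).det := by
  have h := congrArg Matrix.det (gram_map_eq hiso)
  rw [Matrix.det_mul, Matrix.det_conjTranspose] at h
  have h2 : ((gram p u).map (fun t : ℝ => (t : ℂ))).det = ((gram p u).det : ℂ) :=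
    (RingHom.map_det Complex.ofRealHom (gram p u)).symm
  rw [h2] at h
  have h3 : star (jac p u).det * (jac p u).det = ((‖(jac p u).det‖ ^ 2 : ℝ) : ℂ) := by
    rw [Complex.star_def, ← Complex.normSq_eq_conj_mul_self, Complex.normSq_eq_norm_sq]
  rw [h3] at h
  exact_mod_cast h.symm

theorem jac_det_ne_zero {p : Rn d → Cn d} {u : Rn d}
    (hinj : Function.Injective (fderiv ℝ p u))
    (hiso : ∀ v w : Rn d, (inner ℂ (fderiv ℝ p u v) (fderiv ℝ p u w)).im = 0) :
    (jac p u).det ≠ 0 := by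
  intro h
  have := jac_normSq_det hiso
  rw [h] at this
  exact gram_det_ne_zero hinj (by simpa using this.symm)

end LagTrans
end

/-! ### The mean curvature of a Lagrangian and its angle -/

noncomputable section

namespace LagTrans

theorem real_inner_eq_re_inner' {d : ℕ} (x y : Cn d) : inner ℝ x y = (inner ℂ x y).re := by
  simp [PiLp.inner_apply, Complex.inner]

/-- Jacobi's formula for the derivative of a determinant. -/
theorem hasDerivAt_det {n : ℕ} {A : ℝ → Matrix (Fin n) (Fin n) ℂ} {A' : Matrix (Fin n) (Fin n) ℂ}
    {t : ℝ} (hA : ∀ i j, HasDerivAt (fun s => A s i j) (A' i j) t) :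
    HasDerivAt (fun s => (A s).det) (((A t).adjugate * A').trace) t := by
  have h1 : HasDerivAt (fun s => ∑ σ : Equiv.Perm (Fin n),
      ((Equiv.Perm.sign σ : ℤ) : ℂ) * ∏ i, A s (σ i) i)
      (∑ σ : Equiv.Perm (Fin n), ((Equiv.Perm.sign σ : ℤ) : ℂ) *
        ∑ i, (∏ j ∈ Finset.univ.erase i, A t (σ j) j) • A' (σ i) i) t :=
    HasDerivAt.fun_sum fun σ _ => (HasDerivAt.fun_finsetProd fun i _ => hA (σ i) i).const_mul _
  have h2 : (fun s => (A s).det) = fun s => ∑ σ : Equiv.Perm (Fin n),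
      ((Equiv.Perm.sign σ : ℤ) : ℂ) * ∏ i, A s (σ i) i := by
    funext s; exact Matrix.det_apply' _
  rw [h2]
  convert h1 using 1
  -- By Cramer's rule the diagonal entries of adj(A) A' are determinants of A with one column
  -- replaced by the corresponding column of A'.
  have h3 : ∀ i, ((A t).adjugate * A') i i = ((A t).updateCol i fun k => A' k i).det := by
    intro i
    rw [← Matrix.cramer_apply, Matrix.cramer_eq_adjugate_mulVec]
    rfl
  simp only [Matrix.trace, Matrix.diag_apply, h3, Matrix.det_apply', Finset.mul_sum]
  rw [Finset.sum_comm]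
  refine Finset.sum_congr rfl fun σ _ => Finset.sum_congr rfl fun i _ => ?_
  rw [← Finset.mul_prod_erase _ _ (Finset.mem_univ i), Matrix.updateCol_self, smul_eq_mul,
    mul_comm (A' (σ i) i)]
  congr 2
  exact Finset.prod_congr rfl fun j hj => by rw [Matrix.updateCol_ne (Finset.ne_of_mem_erase hj)]

variable {d : ℕ}

theorem inner_normalPart_re {p : Rn d → Cn d} {u : Rn d} (v : Rn d) (x : Cn d) :
    (inner ℂ (fderiv ℝ p u v) (normalPart p u x)).re = 0 := by
  rw [← real_inner_eq_re_inner']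
  have h : fderiv ℝ p u v ∈ tangentSpace p u := ⟨v, rfl⟩
  exact Submodule.inner_right_of_mem_orthogonal h
    (Submodule.sub_starProjection_mem_orthogonal x)

/-- A vector and its normal part differ by a tangent vector, on which the Kähler form vanishes. -/
theorem inner_normalPart_im {p : Rn d → Cn d} {u : Rn d}
    (hiso : ∀ v w : Rn d, (inner ℂ (fderiv ℝ p u v) (fderiv ℝ p u w)).im = 0)
    (v : Rn d) (x : Cn d) :
    (inner ℂ (fderiv ℝ p u v) (normalPart p u x)).im = (inner ℂ (fderiv ℝ p u v) x).im := by
  obtain ⟨w, hw⟩ : (tangentSpace p u).starProjection x ∈ tangentSpace p u :=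
    Submodule.starProjection_apply_mem _ _
  rw [normalPart, ← hw, inner_sub_right, Complex.sub_im]
  simp [hiso]

/-- The coordinate vectors of a Lagrangian tangent space form a complex basis of ℂ^d. Identities
between normal vectors are thus checked on Hermitian products with tangent vectors, real and
imaginary parts separately. -/
theorem eq_zero_of_inner_jac {p : Rn d → Cn d} {u : Rn d} (hdet : (jac p u).det ≠ 0) {x : Cn d}
    (h : ∀ k, inner ℂ (fderiv ℝ p u (stdBasis d k)) x = 0) : x = 0 := by
  have h1 : (jac p u).conjTranspose.mulVec x.ofLp = 0 := by
    ext k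
    have := h k
    simp only [PiLp.inner_apply, RCLike.inner_apply] at this
    simp only [Matrix.mulVec, dotProduct, jac, Matrix.conjTranspose_apply, Matrix.of_apply,
      Pi.zero_apply]
    rw [← this]
    exact Finset.sum_congr rfl fun _ _ => mul_comm _ _
  have h2 : (jac p u).conjTranspose.det ≠ 0 := by
    rw [Matrix.det_conjTranspose]; simpa using hdet
  have h3 := Matrix.eq_zero_of_mulVec_eq_zero h2 h1
  ext i
  simpa using congrFun h3 i

/-- The mean curvature vector of a Lagrangian is `J ∇θ`, with `θ` the Lagrangian angle. -/
theorem im_inner_meanCurvature {p : Rn d → Cn d} {u : Rn d} {θ : Rn d → ℝ} {R : Rn d → ℝ}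
    (hp : ContDiffAt ℝ ∞ p u) (hdet : (jac p u).det ≠ 0)
    (hiso : ∀ᶠ x in 𝓝 u, ∀ v w : Rn d, (inner ℂ (fderiv ℝ p x v) (fderiv ℝ p x w)).im = 0)
    (hθ : DifferentiableAt ℝ θ u)
    (hR : ∀ᶠ x in 𝓝 u, (jac p x).det = R x * Complex.exp (Complex.I * θ x)) (k : Fin d) :
    (inner ℂ (fderiv ℝ p u (stdBasis d k)) (meanCurvature p u)).im =
      fderiv ℝ θ u (stdBasis d k) := by
  have hiso0 := hiso.self_of_nhds
  set a : Fin d → Cn d := fun i => fderiv ℝ p u (stdBasis d i) with ha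
  set D : Fin d → Fin d → Cn d :=
    fun i j => fderiv ℝ (fderiv ℝ p) u (stdBasis d i) (stdBasis d j) with hD
  have hsymm : ∀ i j, D i j = D j i := fun i j =>
    (hp.isSymmSndFDerivAt (by simp; exact WithTop.coe_le_coe.2 le_top)).eq (stdBasis d i) (stdBasis d j)
  have hp1 : DifferentiableAt ℝ (fderiv ℝ p) u :=
    (hp.fderiv_right (m := 1) (by norm_cast)).differentiableAt (by simp)
  have hpd : ∀ v, HasFDerivAt (fun x => fderiv ℝ p x v)
      ((ContinuousLinearMap.apply ℝ (Cn d) v).comp (fderiv ℝ (fderiv ℝ p) u)) u := fun v =>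
    (ContinuousLinearMap.apply ℝ (Cn d) v).hasFDerivAt.comp u hp1.hasFDerivAt
  have hline : ∀ k, HasDerivAt (fun t : ℝ => u + t • stdBasis d k) (stdBasis d k) 0 := by
    intro k
    simpa using ((hasDerivAt_id (0 : ℝ)).smul_const (stdBasis d k)).const_add u
  have hline0 : ∀ k, u + (0 : ℝ) • stdBasis d k = u := by simp
  have hlinec : ∀ k, Filter.Tendsto (fun t : ℝ => u + t • stdBasis d k) (𝓝 0) (𝓝 u) := by
    intro k
    simpa using (hline k).continuousAt.tendsto
  have hpl : ∀ k v, HasDerivAt (fun t : ℝ => fderiv ℝ p (u + t • stdBasis d k) v)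
      (fderiv ℝ (fderiv ℝ p) u (stdBasis d k) v) 0 := by
    intro k v
    have h1 := hpd v
    rw [← hline0 k] at h1
    simpa [Function.comp_def] using h1.comp_hasDerivAt (0 : ℝ) (hline k)
  -- the second fundamental form is totally symmetric
  have hcod : ∀ i j l, (inner ℂ (a j) (D i l)).im = (inner ℂ (a l) (D i j)).im := by
    intro i j l
    have h1 := (hpl i (stdBasis d j)).inner ℂ (hpl i (stdBasis d l))
    have h2 : HasDerivAt (fun t : ℝ => (inner ℂ (fderiv ℝ p (u + t • stdBasis d i) (stdBasis d j))
        (fderiv ℝ p (u + t • stdBasis d i) (stdBasis d l))).im)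
        (inner ℂ (a j) (D i l) + inner ℂ (D i j) (a l)).im 0 := by
      have := Complex.imCLM.hasFDerivAt.comp_hasDerivAt (0 : ℝ) h1
      simpa [ha, hD, Function.comp_def] using this
    have h3 : (fun t : ℝ => (inner ℂ (fderiv ℝ p (u + t • stdBasis d i) (stdBasis d j))
        (fderiv ℝ p (u + t • stdBasis d i) (stdBasis d l))).im) =ᶠ[𝓝 0] fun _ => 0 := by
      filter_upwards [(hlinec i).eventually hiso] with t ht using ht _ _
    have h4 := h2.unique ((hasDerivAt_const (0 : ℝ) (0 : ℝ)).congr_of_eventuallyEq h3)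
    rw [Complex.add_im, ← inner_conj_symm (D i j) (a l), Complex.conj_im] at h4
    linarith
  -- the derivative of the angle
  have hdetd : HasDerivAt (fun t : ℝ => (jac p (u + t • stdBasis d k)).det)
      (((jac p u).adjugate * Matrix.of fun i j => (D k j) i).trace) 0 := by
    have h1 : ∀ i j, HasDerivAt (fun t : ℝ => jac p (u + t • stdBasis d k) i j)
        ((Matrix.of fun i j => (D k j) i) i j) 0 := by
      intro i j
      exact ((PiLp.proj 2 (𝕜 := ℝ) (fun _ : Fin d => ℂ) i).hasFDerivAt.comp_hasDerivAt
        (0 : ℝ) (hpl k (stdBasis d j)))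
    simpa using hasDerivAt_det h1
  set A := jac p u with hA
  have hθl : HasDerivAt (fun t : ℝ => θ (u + t • stdBasis d k)) (fderiv ℝ θ u (stdBasis d k)) 0 := by
    have h1 := hθ.hasFDerivAt
    rw [← hline0 k] at h1
    simpa [Function.comp_def] using h1.comp_hasDerivAt (0 : ℝ) (hline k)
  set θ' := fderiv ℝ θ u (stdBasis d k) with hθ'
  have hexp : HasDerivAt (fun t : ℝ => Complex.exp (-(Complex.I * θ (u + t • stdBasis d k))))
      (Complex.exp (-(Complex.I * θ u)) * -(Complex.I * θ')) 0 := by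
    have := ((hθl.ofReal_comp.const_mul Complex.I).neg).cexp
    simpa using this
  -- The factor `R` is not known to be differentiable. What is differentiated is det A · e^{-iθ}, by
  -- Jacobi's formula; its imaginary part vanishes near `u`.
  have htr : (A⁻¹ * Matrix.of fun i j => (D k j) i).trace.im = θ' := by
    have h1 := hdetd.mul hexp
    have h2 := Complex.imCLM.hasFDerivAt.comp_hasDerivAt (0 : ℝ) h1
    have h3 : (⇑Complex.imCLM ∘ ((fun t : ℝ => (jac p (u + t • stdBasis d k)).det) *
        fun t : ℝ => Complex.exp (-(Complex.I * θ (u + t • stdBasis d k))))) =ᶠ[𝓝 0]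
        fun _ => 0 := by
      filter_upwards [(hlinec k).eventually hR] with t ht
      simp only [Function.comp_apply, Pi.mul_apply, ht, mul_assoc, ← Complex.exp_add]
      simp
    have h4 := h2.unique ((hasDerivAt_const (0 : ℝ) (0 : ℝ)).congr_of_eventuallyEq h3)
    have hR0 := hR.self_of_nhds
    have hR0' : A.det * Complex.exp (-(Complex.I * θ u)) = R u := by
      rw [hR0, mul_assoc, ← Complex.exp_add]; simp
    have hRne : R u ≠ 0 := by
      intro h0
      rw [h0] at hR0
      exact hdet (by simpa using hR0)
    have hadj : A.adjugate = A.det • A⁻¹ := by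
      rw [Matrix.inv_def, smul_smul, Ring.mul_inverse_cancel _ (isUnit_iff_ne_zero.2 hdet), one_smul]
    have hR0'' : (jac p (u + (0 : ℝ) • stdBasis d k)).det = A.det := by rw [hline0]
    rw [hadj, Matrix.smul_mul, Matrix.trace_smul, hR0'', hline0, smul_eq_mul] at h4
    have h5 : A.det * (A⁻¹ * Matrix.of fun i j => (D k j) i).trace *
        Complex.exp (-(Complex.I * θ u)) + A.det * (Complex.exp (-(Complex.I * θ u)) *
          -(Complex.I * θ')) = R u * ((A⁻¹ * Matrix.of fun i j => (D k j) i).trace -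
            Complex.I * θ') := by
      rw [← hR0']; ring
    rw [h5] at h4
    have h6 : R u * ((A⁻¹ * Matrix.of fun i j => (D k j) i).trace.im - θ') = 0 := by
      simpa using h4
    have := (mul_eq_zero.1 h6).resolve_left hRne
    linarith
  -- expand the mean curvature
  have hg : ((gram p u).map (fun t : ℝ => (t : ℂ)))⁻¹ * A.conjTranspose = A⁻¹ := by
    rw [gram_map_eq hiso0, Matrix.mul_inv_rev, Matrix.mul_assoc, Matrix.nonsing_inv_mul, mul_one]
    rw [Matrix.det_conjTranspose]
    simpa using hdet
  have hginv : ((gram p u).map (fun t : ℝ => (t : ℂ)))⁻¹ =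
      ((gram p u)⁻¹).map (fun t : ℝ => (t : ℂ)) := by
    have hu : IsUnit (gram p u).det := by
      rw [isUnit_iff_ne_zero, ← jac_normSq_det hiso0]
      simpa using hdet
    apply Matrix.inv_eq_left_inv
    have h1 := congrArg (fun B : Matrix (Fin d) (Fin d) ℝ => B.map Complex.ofRealHom)
      (Matrix.nonsing_inv_mul _ hu)
    simp only [Matrix.map_mul] at h1
    rw [Matrix.map_one _ (map_zero _) (map_one _)] at h1
    exact h1
  rw [← htr, ← hg, hginv]
  have hmc : meanCurvature p u = ∑ i : Fin d, ∑ j : Fin d, ((gram p u)⁻¹ i j) •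
      normalPart p u (D i j) := rfl
  rw [hmc]
  simp only [inner_sum, Complex.im_sum, Matrix.trace, Matrix.diag_apply, Matrix.mul_apply,
    Finset.sum_mul]
  refine Finset.sum_congr rfl fun i _ => ?_
  rw [Finset.sum_comm]
  refine Finset.sum_congr rfl fun j _ => ?_
  -- Total symmetry moves the free index `k` into the second derivative. Contraction with g⁻¹ then
  -- gives the trace of g⁻¹ Aᴴ ∂ₖA = A⁻¹ ∂ₖA.
  have h1 : (inner ℂ (fderiv ℝ p u (stdBasis d k)) (D i j)).im = (inner ℂ (a j) (D k i)).im := by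
    rw [hsymm k i, ← hcod i k j]
  rw [← Complex.coe_smul, inner_smul_right, Complex.im_ofReal_mul, inner_normalPart_im hiso0, h1,
    ← Complex.im_ofReal_mul, PiLp.inner_apply, Finset.mul_sum, Complex.im_sum]
  refine Finset.sum_congr rfl fun l _ => ?_
  simp only [RCLike.inner_apply, Matrix.map_apply, Matrix.conjTranspose_apply, Matrix.of_apply, hA,
    jac, ha]
  congr 1
  rw [Complex.star_def]
  ring

end LagTrans
end

/-! ### From calibrated charts to translating solitons -/

noncomputable section

namespace LagTrans

variable {X : Type*} [TopologicalSpace X] {d k n : ℕ}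

theorem IsAdaptedChart.continuousAt {f : X → Cn d} {φ : OpenPartialHomeomorph X (Rn k)}
    (h : IsAdaptedChart k f φ) {x : X} (hx : x ∈ φ.source) : ContinuousAt f x := by
  have h1 : ContinuousAt ((f ∘ φ.symm) ∘ φ) x :=
    ContinuousAt.comp (h.contDiffAt (φ.map_source hx)).continuousAt (φ.continuousAt hx)
  refine h1.congr ?_
  filter_upwards [φ.open_source.mem_nhds hx] with y hy
  simp [φ.left_inv hy]

theorem IsCalibratedChart.of_subset {f : X → Cn d} {h θ : X → ℝ}
    {φ ψ : OpenPartialHomeomorph X (Rn d)} (H : IsCalibratedChart f h θ φ)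
    (hs : (ψ.symm : Rn d → X) = φ.symm) (ht : ψ.target ⊆ φ.target) :
    IsCalibratedChart f h θ ψ := by
  unfold IsCalibratedChart IsAdaptedChart at *
  rw [hs]
  exact ⟨⟨H.1.1.mono ht, fun u hu => H.1.2 u (ht hu)⟩, fun u hu => H.2 u (ht hu)⟩

/-- Reflection in the last coordinate. -/
def reflectLast (n : ℕ) : Rn (n + 1) ≃ₗᵢ[ℝ] Rn (n + 1) :=
  LinearIsometryEquiv.piLpCongrRight 2 fun i =>
    if i = Fin.last n then LinearIsometryEquiv.neg ℝ else LinearIsometryEquiv.refl ℝ ℝ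

theorem det_reflectLast :
    (Matrix.of fun i j => reflectLast n (stdBasis (n + 1) j) i).det = -1 := by
  have h : (Matrix.of fun i j => reflectLast n (stdBasis (n + 1) j) i) =
      Matrix.diagonal fun i : Fin (n + 1) => if i = Fin.last n then (-1 : ℝ) else 1 := by
    ext i j
    by_cases hij : i = j
    · subst hij
      by_cases hi : i = Fin.last n <;> simp [reflectLast, stdBasis, hi]
    · rw [Matrix.diagonal_apply_ne _ hij]
      by_cases hi : i = Fin.last n <;> simp [reflectLast, stdBasis, hi, hij]
      intro h
      exact absurd (hi.trans h) hij
  rw [h, Matrix.det_diagonal]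
  simp

theorem IsAdaptedChart.reflect {f : X → Cn d} {φ : OpenPartialHomeomorph X (Rn (n + 1))}
    (h : IsAdaptedChart (n + 1) f φ) :
    IsAdaptedChart (n + 1) f
      (φ.trans (reflectLast n).toHomeomorph.toOpenPartialHomeomorph) := by
  have hsymm : f ∘ (φ.trans (reflectLast n).toHomeomorph.toOpenPartialHomeomorph).symm =
      (f ∘ φ.symm) ∘ (reflectLast n).symm := by
    funext u; simp
  have ht : ∀ u ∈ (φ.trans (reflectLast n).toHomeomorph.toOpenPartialHomeomorph).target,
      (reflectLast n).symm u ∈ φ.target := by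
    intro u hu
    simpa using hu
  unfold IsAdaptedChart
  rw [hsymm]
  refine ⟨fun u hu => ?_, fun u hu => ?_⟩
  · exact ((h.contDiffAt (ht u hu)).comp u
      (reflectLast n).symm.contDiff.contDiffAt).contDiffWithinAt
  · rw [fderiv_comp u ((h.contDiffAt (ht u hu)).differentiableAt (by simp))
      (reflectLast n).symm.differentiable.differentiableAt]
    have h2 : fderiv ℝ (reflectLast n).symm u =
      ((reflectLast n).symm.toContinuousLinearEquiv : Rn (n + 1) →L[ℝ] Rn (n + 1)) :=
      (reflectLast n).symm.toContinuousLinearEquiv.fderiv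
    rw [h2]
    exact (h.2 _ (ht u hu)).comp (reflectLast n).symm.injective

theorem IsCalibratedChart.differentiableAt_angle {f : X → Cn (n + 1)} {h θ : X → ℝ} {c : ℝ}
    {φ : OpenPartialHomeomorph X (Rn (n + 1))} (H : IsCalibratedChart f h θ φ)
    (hθ : ∀ x, θ x = (f x (Fin.last n)).im + c) {u : Rn (n + 1)} (hu : u ∈ φ.target) :
    HasFDerivAt (θ ∘ φ.symm) (Complex.imCLM.comp ((PiLp.proj 2 (𝕜 := ℝ)
      (fun _ : Fin (n + 1) => ℂ) (Fin.last n)).comp (fderiv ℝ (f ∘ φ.symm) u))) u := by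
  have h1 : (θ ∘ φ.symm) = fun v => Complex.imCLM ((PiLp.proj 2 (𝕜 := ℝ)
      (fun _ : Fin (n + 1) => ℂ) (Fin.last n)) ((f ∘ φ.symm) v)) + c := by
    funext v; simp [hθ]
  rw [h1]
  have h2 := ((H.1.contDiffAt hu).differentiableAt (by simp)).hasFDerivAt
  exact (Complex.imCLM.hasFDerivAt.comp u
    ((PiLp.proj 2 (𝕜 := ℝ) (fun _ : Fin (n + 1) => ℂ) (Fin.last n)).hasFDerivAt.comp u
      h2)).add_const c

/-- The phase condition can be written with a positive real factor after a change of orientation. -/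
theorem IsCalibratedChart.isLagrangianAngle {f : X → Cn (n + 1)} {h θ : X → ℝ} {c : ℝ}
    (H : ∀ x, ∃ ψ, IsCalibratedChart f h θ ψ ∧ x ∈ ψ.source)
    (hθ : ∀ x, θ x = (f x (Fin.last n)).im + c) : IsLagrangianAngle f θ := by
  have hfc : Continuous f := continuous_iff_continuousAt.2 fun x => by
    obtain ⟨ψ, hψ, hx⟩ := H x
    exact hψ.1.continuousAt hx
  refine ⟨?_, fun x => ?_⟩
  · have h1 : θ = fun x => (f x (Fin.last n)).im + c := funext hθ
    rw [h1]
    fun_prop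
  -- The real factor of the phase condition, written so that its continuity is visible.
  let ρ (φ : OpenPartialHomeomorph X (Rn (n + 1))) (u : Rn (n + 1)) : ℝ :=
    ((jac (f ∘ φ.symm) u).det * Complex.exp (-(Complex.I * θ (φ.symm u)))).re
  have hρ : ∀ φ, IsCalibratedChart f h θ φ → ∀ u ∈ φ.target,
      (jac (f ∘ φ.symm) u).det = ρ φ u * Complex.exp (Complex.I * θ (φ.symm u)) := by
    intro φ hφ u hu
    obtain ⟨-, -, R, hR⟩ := hφ.2 u hu
    have : ρ φ u = R := by
      simp only [ρ, hR, mul_assoc, ← Complex.exp_add]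
      simp
    rw [this, hR]
  have hρ0 : ∀ φ, IsCalibratedChart f h θ φ → ∀ u ∈ φ.target, ρ φ u ≠ 0 := by
    intro φ hφ u hu h0
    have h1 := hρ φ hφ u hu
    rw [h0] at h1
    exact jac_det_ne_zero (hφ.1.2 u hu) (hφ.2 u hu).1 (by simpa using h1)
  have hρc : ∀ φ, IsCalibratedChart f h θ φ → ContinuousOn (ρ φ) φ.target := by
    intro φ hφ u hu
    have h1 : ContinuousAt (fun v => fderiv ℝ (f ∘ φ.symm) v) u :=
      ((hφ.1.contDiffAt hu).fderiv_right (m := 0) (by simp)).continuousAt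
    have h2 : ContinuousAt (fun v => (jac (f ∘ φ.symm) v).det) u := by
      refine (Continuous.matrix_det continuous_id).continuousAt.comp
        (f := fun v => jac (f ∘ φ.symm) v) ?_
      refine continuousAt_pi.2 fun i => continuousAt_pi.2 fun j => ?_
      have h3 : ContinuousAt (fun v => fderiv ℝ (f ∘ φ.symm) v (stdBasis (n + 1) j)) u :=
        h1.clm_apply continuousAt_const
      exact (PiLp.proj 2 (𝕜 := ℝ) (fun _ : Fin (n + 1) => ℂ) i).continuous.continuousAt.comp h3
    have h4 : ContinuousAt (θ ∘ φ.symm) u := (hφ.differentiableAt_angle hθ hu).continuousAt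
    have h5 : ContinuousAt (fun v => Complex.exp (-(Complex.I * θ (φ.symm v)))) u := by
      refine Complex.continuous_exp.continuousAt.comp (f := fun v => -(Complex.I * θ (φ.symm v))) ?_
      exact (continuousAt_const.mul (Complex.continuous_ofReal.continuousAt.comp h4)).neg
    exact (Complex.continuous_re.continuousAt.comp (h2.mul h5)).continuousWithinAt
  -- a chart with positive factor at `x`
  obtain ⟨φ, hφ, hx, hpos⟩ : ∃ φ, IsCalibratedChart f h θ φ ∧ x ∈ φ.source ∧ 0 < ρ φ (φ x) := by
    obtain ⟨ψ, hψ, hx⟩ := H x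
    rcases lt_or_gt_of_ne (hρ0 ψ hψ (ψ x) (ψ.map_source hx)) with hneg | hpos
    -- A negative factor becomes positive when one coordinate is reflected; a coordinate to reflect
    -- exists because the dimension is n + 1.
    · have hψ' := hψ.1.reflect
      refine ⟨_, IsCalibratedChart.of_adapted H hψ', by simpa using hx, ?_⟩
      have h1 : f ∘ (ψ.trans (reflectLast n).toHomeomorph.toOpenPartialHomeomorph).symm =
          (f ∘ ψ.symm) ∘ (reflectLast n).symm := by
        funext u; simp
      have hsymm : (reflectLast n).symm = reflectLast n := by
        ext u i
        by_cases hi : i = Fin.last n <;> simp [reflectLast, hi]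
        rfl
      have h2 : (jac ((f ∘ ψ.symm) ∘ (reflectLast n).symm) (reflectLast n (ψ x))).det =
          -(jac (f ∘ ψ.symm) (ψ x)).det := by
        rw [jac_comp]
        · have h3 : fderiv ℝ (reflectLast n).symm (reflectLast n (ψ x)) =
              ((reflectLast n).symm.toContinuousLinearEquiv : Rn (n + 1) →L[ℝ] Rn (n + 1)) :=
            (reflectLast n).symm.toContinuousLinearEquiv.fderiv
          rw [h3, Matrix.det_mul]
          have h4 := (RingHom.map_det Complex.ofRealHom
            (Matrix.of fun i j => reflectLast n (stdBasis (n + 1) j) i)).symm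
          rw [det_reflectLast] at h4
          have h5 : ((Matrix.of fun i j => (reflectLast n).symm (stdBasis (n + 1) j) i).map
              (fun t : ℝ => (t : ℂ))).det = -1 := by
            rw [hsymm]
            refine Eq.trans h4 ?_
            simp
          have h6 : ((Matrix.of fun i j => ((reflectLast n).symm.toContinuousLinearEquiv :
              Rn (n + 1) →L[ℝ] Rn (n + 1)) (stdBasis (n + 1) j) i).map
              (fun t : ℝ => (t : ℂ))).det = -1 := h5
          rw [h6]
          simp
        · rw [LinearIsometryEquiv.symm_apply_apply]
          exact (hψ.1.contDiffAt (ψ.map_source hx)).differentiableAt (by simp)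
        · exact (reflectLast n).symm.differentiable.differentiableAt
      have h7 : (ψ.trans (reflectLast n).toHomeomorph.toOpenPartialHomeomorph) x =
          reflectLast n (ψ x) := rfl
      have h8 : (ψ.trans (reflectLast n).toHomeomorph.toOpenPartialHomeomorph).symm
          (reflectLast n (ψ x)) = ψ.symm (ψ x) := by simp
      simp only [ρ]
      rw [h7, h1, h2, h8, neg_mul, Complex.neg_re]
      exact neg_pos.2 hneg
    · exact ⟨ψ, hψ, hx, hpos⟩
  -- The chart is shrunk to the open set where the factor is positive; there it equals the modulus
  -- of the determinant, which is the volume density.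
  have hV : IsOpen (φ.target ∩ ρ φ ⁻¹' Set.Ioi 0) :=
    (hρc φ hφ).isOpen_inter_preimage φ.open_target isOpen_Ioi
  have hres : IsCalibratedChart f h θ (φ.symm.restrOpen _ hV).symm :=
    hφ.of_subset rfl (by simp [OpenPartialHomeomorph.restrOpen])
  refine ⟨_, hres.1, ?_, fun u hu => ?_⟩
  · simp [OpenPartialHomeomorph.restrOpen, hx, hpos]
  · have hu' : u ∈ φ.target ∧ 0 < ρ φ u := by
      have : u ∈ φ.target ∩ (φ.target ∩ ρ φ ⁻¹' Set.Ioi 0) := hu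
      exact this.2
    have h1 := hρ φ hφ u hu'.1
    have h2 := jac_normSq_det (hφ.2 u hu'.1).1
    have h3 : ‖(jac (f ∘ φ.symm) u).det‖ = ρ φ u := by
      rw [h1, norm_mul, mul_comm Complex.I, Complex.norm_exp_ofReal_mul_I, mul_one,
        Complex.norm_real, Real.norm_of_nonneg hu'.2.le]
    have h4 : √(gram (f ∘ φ.symm) u).det = ρ φ u := by
      rw [← h2, h3, Real.sqrt_sq hu'.2.le]
    have h5 : (jac (f ∘ φ.symm) u).det = Complex.exp (Complex.I * θ (φ.symm u)) *
        (√(gram (f ∘ φ.symm) u).det : ℝ) := by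
      rw [h4, mul_comm]; exact h1
    exact h5

/-- This sign fixes the direction of translation: ω(x, -e_m) is the differential of Im z_m at x. -/
theorem inner_eLast (x : Cn (n + 1)) : (inner ℂ x (-eLast n)).im = (x (Fin.last n)).im := by
  rw [eLast, inner_neg_right, EuclideanSpace.inner_single_right]
  simp

/-- A Lagrangian immersion whose angle is the last imaginary coordinate, up to a constant, is a
translating soliton. -/
theorem IsCalibratedChart.meanCurvature_eq {f : X → Cn (n + 1)} {h θ : X → ℝ} {c : ℝ}
    {φ : OpenPartialHomeomorph X (Rn (n + 1))} (H : IsCalibratedChart f h θ φ)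
    (hθ : ∀ x, θ x = (f x (Fin.last n)).im + c) {u : Rn (n + 1)} (hu : u ∈ φ.target) :
    meanCurvature (f ∘ φ.symm) u = normalPart (f ∘ φ.symm) u (-eLast n) := by
  have hiso := (H.2 u hu).1
  have hdet := jac_det_ne_zero (H.1.2 u hu) hiso
  have hev : ∀ᶠ x in 𝓝 u, x ∈ φ.target := φ.open_target.mem_nhds hu
  choose! R hR using fun x (hx : x ∈ φ.target) => (H.2 x hx).2.2
  rw [← sub_eq_zero]
  refine eq_zero_of_inner_jac hdet fun k => ?_
  rw [inner_sub_right]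
  -- Real parts vanish because both vectors are normal. Imaginary parts agree because both are dθ,
  -- on one side by H = J∇θ and on the other by `inner_eLast`.
  apply Complex.ext
  · have h1 : (inner ℂ (fderiv ℝ (f ∘ φ.symm) u (stdBasis (n + 1) k))
        (meanCurvature (f ∘ φ.symm) u)).re = 0 := by
      simp only [meanCurvature, inner_sum, Complex.re_sum]
      refine Finset.sum_eq_zero fun i _ => Finset.sum_eq_zero fun j _ => ?_
      rw [← Complex.coe_smul, inner_smul_right, Complex.re_ofReal_mul, inner_normalPart_re, mul_zero]
    rw [Complex.sub_re, h1, inner_normalPart_re, sub_zero, Complex.zero_re]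
  · have hd := H.differentiableAt_angle hθ hu
    rw [Complex.sub_im, inner_normalPart_im hiso, inner_eLast,
      im_inner_meanCurvature (θ := θ ∘ φ.symm) (R := R) (H.1.contDiffAt hu) hdet
        (hev.mono fun x hx => (H.2 x hx).1) hd.differentiableAt (hev.mono fun x hx => hR x hx),
      hd.fderiv]
    simp

/-- The interface for all constructions: only calibrated charts with angle Im z_m + c have to be
exhibited. -/
theorem calibrated_conclusions {f : X → Cn (n + 1)} {h θ : X → ℝ} {c : ℝ}
    (H : ∀ x, ∃ ψ, IsCalibratedChart f h θ ψ ∧ x ∈ ψ.source)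
    (hθ : ∀ x, θ x = (f x (Fin.last n)).im + c) :
    IsLagrangianImmersion f ∧ IsLiouvillePrimitive f h ∧ IsLagrangianAngle f θ ∧
      IsTranslatingSoliton (n + 1) (-eLast n) f := by
  have him : IsSmoothImmersion (n + 1) f := fun x => by
    obtain ⟨ψ, hψ, hx⟩ := H x
    exact ⟨ψ, hψ.1, hx⟩
  refine ⟨⟨him, fun φ hφ u hu => ((IsCalibratedChart.of_adapted H hφ).2 u hu).1⟩,
    fun φ hφ u hu => ((IsCalibratedChart.of_adapted H hφ).2 u hu).2.1,
    IsCalibratedChart.isLagrangianAngle H hθ, him, fun φ hφ u hu =>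
      (IsCalibratedChart.of_adapted H hφ).meanCurvature_eq hθ hu⟩

/-- Calibrated charts can be transported along a homeomorphism. -/
theorem IsCalibratedChart.transport {Y : Type*} [TopologicalSpace Y] {f : X → Cn d} {h θ : X → ℝ}
    {f' : Y → Cn d} {h' θ' : Y → ℝ} (e : Y ≃ₜ X) (hf : ∀ y, f' y = f (e y))
    (hh : ∀ y, h' y = h (e y)) (hθ : ∀ y, θ' y = θ (e y))
    {ψ : OpenPartialHomeomorph X (Rn d)} (H : IsCalibratedChart f h θ ψ) :
    IsCalibratedChart f' h' θ' (e.toOpenPartialHomeomorph.trans ψ) := by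
  have h1 : f' ∘ (e.toOpenPartialHomeomorph.trans ψ).symm = f ∘ ψ.symm := by
    funext u; simp [hf]
  have h2 : h' ∘ (e.toOpenPartialHomeomorph.trans ψ).symm = h ∘ ψ.symm := by
    funext u; simp [hh]
  have h3 : ∀ u, f' ((e.toOpenPartialHomeomorph.trans ψ).symm u) = f (ψ.symm u) := congrFun h1
  have h4 : ∀ u, θ' ((e.toOpenPartialHomeomorph.trans ψ).symm u) = θ (ψ.symm u) := by
    intro u; simp [hθ]
  have ht : (e.toOpenPartialHomeomorph.trans ψ).target = ψ.target := by simp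
  unfold IsCalibratedChart IsAdaptedChart at *
  simp only [h1, h2, h3, h4, ht]
  exact H

end LagTrans
end

noncomputable section

namespace LagTrans

/-! ### Legendrian links and the reduced map -/

/-- `pair` as a continuous linear map. -/
def pairCLM (n : ℕ) : (Cn n × ℂ) →L[ℝ] Cn (n + 1) :=
  LinearMap.toContinuousLinearMap
    { toFun := fun p => pair p.1 p.2
      map_add' := fun p q => by
        ext i
        refine Fin.lastCases ?_ (fun i => ?_) i <;> simp [pair]
      map_smul' := fun c p => by
        ext i
        refine Fin.lastCases ?_ (fun i => ?_) i <;> simp [pair] }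

theorem pairCLM_apply {n : ℕ} (p : Cn n × ℂ) : pairCLM n p = pair p.1 p.2 := rfl

@[simp] theorem pair_castSucc {n : ℕ} (z : Cn n) (w : ℂ) (i : Fin n) :
    pair z w i.castSucc = z i := by simp [pair]

@[simp] theorem pair_last {n : ℕ} (z : Cn n) (w : ℂ) : pair z w (Fin.last n) = w := by
  simp [pair]

theorem inner_pair {n : ℕ} (z z' : Cn n) (w w' : ℂ) :
    inner ℂ (pair z w) (pair z' w') = inner ℂ z z' + w' * (starRingEnd ℂ) w := by
  simp [PiLp.inner_apply, Fin.sum_univ_castSucc]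

theorem pair_eq_zero {n : ℕ} {z : Cn n} {w : ℂ} : pair z w = 0 ↔ z = 0 ∧ w = 0 := by
  constructor
  · intro h
    refine ⟨?_, by simpa using congrArg (fun v : Cn (n + 1) => v (Fin.last n)) h⟩
    ext i
    simpa using congrArg (fun v : Cn (n + 1) => v i.castSucc) h
  · rintro ⟨rfl, rfl⟩
    ext i
    refine Fin.lastCases ?_ (fun i => ?_) i <;> simp

/-- The matrix with columns `∂₁p, …, ∂ₖp, p`. -/
def coneMatrix {k : ℕ} (p : Rn k → Cn (k + 1)) (u : Rn k) :
    Matrix (Fin (k + 1)) (Fin (k + 1)) ℂ :=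
  Matrix.of fun i => Fin.snoc (α := fun _ => ℂ) (fun j => fderiv ℝ p u (stdBasis k j) i) (p u i)

/-- An adapted chart of `N ⊆ S^{2k+1}` on which `N` is special Legendrian of phase `θ₀`. -/
def IsLegendrianChart {k : ℕ} (N : Set (Cn (k + 1))) (θ₀ : ℝ)
    (ρ : OpenPartialHomeomorph N (Rn k)) : Prop :=
  IsAdaptedChart k (Subtype.val : N → Cn (k + 1)) ρ ∧ ∀ u ∈ ρ.target,
    (∀ v, inner ℂ (ρ.symm u : Cn (k + 1)) (fderiv ℝ (Subtype.val ∘ ρ.symm) u v) = 0) ∧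
    (∀ v w, (inner ℂ (fderiv ℝ (Subtype.val ∘ ρ.symm) u v)
      (fderiv ℝ (Subtype.val ∘ ρ.symm) u w)).im = 0) ∧
    ∃ R : ℝ, (coneMatrix (Subtype.val ∘ ρ.symm) u).det = R * Complex.exp (Complex.I * θ₀)

/-- `N ⊆ S^{2k+1}` is a special Legendrian submanifold of phase `θ₀`: the cone over it is special
Lagrangian. -/
def IsSpecialLegendrian {k : ℕ} (N : Set (Cn (k + 1))) (θ₀ : ℝ) : Prop :=
  (∀ q ∈ N, ‖q‖ = 1) ∧ ∀ q : N, ∃ ρ, IsLegendrianChart N θ₀ ρ ∧ q ∈ ρ.source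

/-- A regular curve `γ` avoiding the origin for which `k arg γ + arg γ' = θ + s β`. -/
structure IsPhaseCurve (k : ℕ) (s : ℝ) (J : Set ℝ) (γ : ℝ → ℂ) (β : ℝ → ℝ) (θ : ℝ) : Prop where
  isOpen : IsOpen J
  smooth : ContDiffOn ℝ ∞ γ J
  smooth_beta : ContDiffOn ℝ ∞ β J
  ne_zero : ∀ x ∈ J, γ x ≠ 0
  deriv_ne_zero : ∀ x ∈ J, deriv γ x ≠ 0
  hasDerivAt_beta : ∀ x ∈ J, HasDerivAt β ((starRingEnd ℂ) (γ x) * deriv γ x).im x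
  phase : ∀ x ∈ J, ∃ R : ℝ, γ x ^ k * deriv γ x = R * Complex.exp (Complex.I * (θ + s * β x : ℝ))

theorem IsPhaseCurve.hasDerivAt {k : ℕ} {s θ : ℝ} {J : Set ℝ} {γ : ℝ → ℂ} {β : ℝ → ℝ}
    (h : IsPhaseCurve k s J γ β θ) {x : ℝ} (hx : x ∈ J) : HasDerivAt γ (deriv γ x) x :=
  ((h.smooth.contDiffAt (h.isOpen.mem_nhds hx)).differentiableAt (by simp)).hasDerivAt

/-- The function `½|γ|² + iβ`, whose derivative is `γ̄ γ'`. -/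
def halfSq (γ : ℝ → ℂ) (β : ℝ → ℝ) (x : ℝ) : ℂ :=
  ((‖γ x‖ ^ 2 / 2 : ℝ) : ℂ) + Complex.I * (β x : ℂ)

theorem halfSq_re (γ : ℝ → ℂ) (β : ℝ → ℝ) (x : ℝ) : (halfSq γ β x).re = ‖γ x‖ ^ 2 / 2 := by
  rw [halfSq, Complex.add_re, Complex.ofReal_re, Complex.I_mul_re, Complex.ofReal_im]
  ring

theorem halfSq_im (γ : ℝ → ℂ) (β : ℝ → ℝ) (x : ℝ) : (halfSq γ β x).im = β x := by
  rw [halfSq, Complex.add_im, Complex.ofReal_im, Complex.I_mul_im, Complex.ofReal_re]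
  ring

theorem hasDerivAt_normSq_half {γ : ℝ → ℂ} {γ' : ℂ} {x : ℝ} (h : HasDerivAt γ γ' x) :
    HasDerivAt (fun x => ‖γ x‖ ^ 2 / 2) ((starRingEnd ℂ) (γ x) * γ').re x := by
  have h1 := (h.norm_sq).div_const 2
  refine h1.congr_deriv ?_
  rw [Complex.inner]
  ring

theorem hasDerivAt_halfSq {γ : ℝ → ℂ} {β : ℝ → ℝ} {γ' : ℂ} {x : ℝ} (h : HasDerivAt γ γ' x)
    (hβ : HasDerivAt β ((starRingEnd ℂ) (γ x) * γ').im x) :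
    HasDerivAt (halfSq γ β) ((starRingEnd ℂ) (γ x) * γ') x := by
  have h2 := (hasDerivAt_normSq_half h).ofReal_comp.add (hβ.ofReal_comp.const_mul Complex.I)
  refine h2.congr_deriv ?_
  rw [mul_comm Complex.I, Complex.re_add_im]

theorem IsPhaseCurve.contDiffOn_halfSq {k : ℕ} {s θ : ℝ} {J : Set ℝ} {γ : ℝ → ℂ} {β : ℝ → ℝ}
    (h : IsPhaseCurve k s J γ β θ) : ContDiffOn ℝ ∞ (halfSq γ β) J := by
  have h1 : ContDiffOn ℝ ∞ (fun x => ‖γ x‖ ^ 2 / 2) J := (h.smooth.norm_sq ℝ).div_const 2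
  exact (Complex.ofRealCLM.contDiff.comp_contDiffOn h1).add
    (contDiffOn_const.mul (Complex.ofRealCLM.contDiff.comp_contDiffOn h.smooth_beta))

theorem profileSurface_snd (γ ξ : ℝ → ℂ) (x₀ y₀ x y : ℝ) :
    (profileSurface γ ξ x₀ y₀ x y).2 = halfSq ξ (beta ξ y₀) y - halfSq γ (beta γ x₀) x := by
  simp [profileSurface, halfSq]
  ring

/-- Expansion along the last row, which has only two non-zero entries. Both minors are `C` with
rescaled columns; in the application `C` is the `coneMatrix` of the link. -/
theorem det_reduced {k : ℕ} {M : Matrix (Fin (k + 2)) (Fin (k + 2)) ℂ}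
    {C : Matrix (Fin (k + 1)) (Fin (k + 1)) ℂ} {c a₁ a₂ b₁ b₂ : ℂ}
    (h0 : ∀ j : Fin k, M (Fin.last _) j.castSucc.castSucc = 0)
    (h1 : M (Fin.last _) (Fin.last k).castSucc = b₁) (h2 : M (Fin.last _) (Fin.last _) = b₂)
    (hP : ∀ i (j : Fin k), M (Fin.castSucc i) j.castSucc.castSucc = c * C i j.castSucc)
    (hq₁ : ∀ i, M (Fin.castSucc i) (Fin.last k).castSucc = a₁ * C i (Fin.last k))
    (hq₂ : ∀ i, M (Fin.castSucc i) (Fin.last _) = a₂ * C i (Fin.last k)) :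
    M.det = c ^ k * (a₁ * b₂ - a₂ * b₁) * C.det := by
  have key : ∀ a : ℂ, (Matrix.of fun i j =>
      (Fin.snoc (α := fun _ => ℂ) (fun _ : Fin k => c) a : Fin (k + 1) → ℂ) j * C i j).det =
      c ^ k * a * C.det := by
    intro a
    rw [Matrix.det_mul_row]
    simp [Fin.prod_univ_castSucc]
  rw [Matrix.det_succ_row M (Fin.last _), Fin.sum_univ_castSucc, Fin.sum_univ_castSucc]
  simp only [h0, h1, h2]
  have hm1 : M.submatrix (Fin.last (k + 1)).succAbove (Fin.last k).castSucc.succAbove =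
      Matrix.of fun i j =>
      (Fin.snoc (α := fun _ => ℂ) (fun _ : Fin k => c) a₂ : Fin (k + 1) → ℂ) j * C i j := by
    ext i j
    refine Fin.lastCases ?_ (fun j => ?_) j
    · have : (Fin.last k).castSucc.succAbove (Fin.last k) = Fin.last (k + 1) := by
        simp
      simp only [Matrix.submatrix_apply, this, Fin.succAbove_last, hq₂, Matrix.of_apply, Fin.snoc_last]
    · have : (Fin.last k).castSucc.succAbove j.castSucc = j.castSucc.castSucc :=
        Fin.succAbove_castSucc_of_lt _ _ (Fin.castSucc_lt_last j)
      simp only [Matrix.submatrix_apply, this, Fin.succAbove_last, hP, Matrix.of_apply,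
        Fin.snoc_castSucc]
  have hm2 : M.submatrix (Fin.last (k + 1)).succAbove (Fin.last (k + 1)).succAbove =
      Matrix.of fun i j =>
      (Fin.snoc (α := fun _ => ℂ) (fun _ : Fin k => c) a₁ : Fin (k + 1) → ℂ) j * C i j := by
    ext i j
    refine Fin.lastCases ?_ (fun j => ?_) j
    · simp only [Matrix.submatrix_apply, Fin.succAbove_last, hq₁, Matrix.of_apply, Fin.snoc_last]
    · simp only [Matrix.submatrix_apply, Fin.succAbove_last, hP, Matrix.of_apply,
        Fin.snoc_castSucc]
  rw [hm1, hm2, key, key]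
  simp only [Fin.val_last, Fin.val_castSucc, mul_zero, zero_mul, Finset.sum_const_zero, zero_add]
  have e1 : ((-1 : ℂ)) ^ (k + 1 + k) = -1 := by
    rw [show k + 1 + k = 2 * k + 1 by ring, pow_succ, pow_mul]; simp
  have e2 : ((-1 : ℂ)) ^ (k + 1 + (k + 1)) = 1 := by
    rw [show k + 1 + (k + 1) = 2 * (k + 1) by ring, pow_mul]; simp
  rw [e1, e2]
  ring

/-- Splitting off the last two coordinates. -/
def splitTwo (k : ℕ) : Rn (k + 2) ≃L[ℝ] Rn k × ℝ × ℝ :=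
  LinearEquiv.toContinuousLinearEquiv
    { toFun := fun u => (WithLp.toLp 2 fun i => u i.castSucc.castSucc,
        u (Fin.last k).castSucc, u (Fin.last (k + 1)))
      map_add' := fun u v => by ext <;> simp
      map_smul' := fun c u => by ext <;> simp
      invFun := fun p => WithLp.toLp 2 (Fin.snoc (α := fun _ => ℝ)
        (Fin.snoc (α := fun _ => ℝ) p.1.ofLp p.2.1) p.2.2)
      left_inv := fun u => by
        ext i
        refine Fin.lastCases ?_ (fun i => Fin.lastCases ?_ (fun i => ?_) i) i <;> simp
      right_inv := fun p => by
        ext <;> simp }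

theorem splitTwo_apply {k : ℕ} (u : Rn (k + 2)) :
    splitTwo k u = (WithLp.toLp 2 fun i => u i.castSucc.castSucc,
      u (Fin.last k).castSucc, u (Fin.last (k + 1))) := rfl

theorem splitTwo_castSucc {k : ℕ} (j : Fin k) :
    splitTwo k (stdBasis (k + 2) j.castSucc.castSucc) = (stdBasis k j, 0, 0) := by
  rw [splitTwo_apply]
  refine Prod.ext ?_ (Prod.ext ?_ ?_)
  · ext i; simp [stdBasis]
  · simp [stdBasis, Fin.ext_iff]; omega
  · simp [stdBasis, Fin.ext_iff]; omega

theorem splitTwo_last_castSucc {k : ℕ} :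
    splitTwo k (stdBasis (k + 2) (Fin.last k).castSucc) = (0, 1, 0) := by
  rw [splitTwo_apply]
  refine Prod.ext ?_ (Prod.ext ?_ ?_)
  · ext i; simp [stdBasis, Fin.ext_iff]; omega
  · simp [stdBasis]
  · simp [stdBasis, Fin.ext_iff]

theorem splitTwo_last {k : ℕ} :
    splitTwo k (stdBasis (k + 2) (Fin.last (k + 1))) = (0, 0, 1) := by
  rw [splitTwo_apply]
  refine Prod.ext ?_ (Prod.ext ?_ ?_)
  · ext i; simp [stdBasis, Fin.ext_iff]; omega
  · simp [stdBasis, Fin.ext_iff]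
  · simp [stdBasis]

/-- The map `(v, x, y) ↦ (γ(x) ξ(y) p(v), w(x, y))`. -/
def reducedParam {k : ℕ} (p : Rn k → Cn (k + 1)) (γ ξ : ℝ → ℂ) (β δ : ℝ → ℝ)
    (q : Rn k × ℝ × ℝ) : Cn (k + 2) :=
  pairCLM (k + 1) ((γ q.2.1 * ξ q.2.2) • p q.1, halfSq ξ δ q.2.2 - halfSq γ β q.2.1)

theorem hasFDerivAt_reducedParam {k : ℕ} {p : Rn k → Cn (k + 1)} {γ ξ : ℝ → ℂ} {β δ : ℝ → ℝ}
    {v : Rn k} {x y : ℝ} (hp : DifferentiableAt ℝ p v) {γ' ξ' : ℂ} (hγ : HasDerivAt γ γ' x)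
    (hξ : HasDerivAt ξ ξ' y) (hβ : HasDerivAt β ((starRingEnd ℂ) (γ x) * γ').im x)
    (hδ : HasDerivAt δ ((starRingEnd ℂ) (ξ y) * ξ').im y) :
    ∃ L : (Rn k × ℝ × ℝ) →L[ℝ] Cn (k + 2), HasFDerivAt (reducedParam p γ ξ β δ) L (v, x, y) ∧
      ∀ t : Rn k × ℝ × ℝ, L t = pair ((γ x * ξ y) • fderiv ℝ p v t.1 +
        (t.2.1 * (γ' * ξ y) + t.2.2 * (γ x * ξ')) • p v)
        (t.2.2 * ((starRingEnd ℂ) (ξ y) * ξ') - t.2.1 * ((starRingEnd ℂ) (γ x) * γ')) := by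
  have e1 : HasFDerivAt (fun q : Rn k × ℝ × ℝ => q.1) (ContinuousLinearMap.fst ℝ (Rn k) (ℝ × ℝ))
    (v, x, y) := hasFDerivAt_fst
  have e2 : HasFDerivAt (fun q : Rn k × ℝ × ℝ => q.2.1) ((ContinuousLinearMap.fst ℝ ℝ ℝ).comp
    (ContinuousLinearMap.snd ℝ (Rn k) (ℝ × ℝ))) (v, x, y) :=
    hasFDerivAt_fst.comp (v, x, y) hasFDerivAt_snd
  have e3 : HasFDerivAt (fun q : Rn k × ℝ × ℝ => q.2.2) ((ContinuousLinearMap.snd ℝ ℝ ℝ).comp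
    (ContinuousLinearMap.snd ℝ (Rn k) (ℝ × ℝ))) (v, x, y) :=
    hasFDerivAt_snd.comp (v, x, y) hasFDerivAt_snd
  have g1 := hp.hasFDerivAt.comp (v, x, y) e1
  have g2 := hγ.hasFDerivAt.comp (v, x, y) e2
  have g3 := hξ.hasFDerivAt.comp (v, x, y) e3
  have g4 := (hasDerivAt_halfSq hγ hβ).hasFDerivAt.comp (v, x, y) e2
  have g5 := (hasDerivAt_halfSq hξ hδ).hasFDerivAt.comp (v, x, y) e3
  refine ⟨_, (pairCLM (k + 1)).hasFDerivAt.comp (v, x, y)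
    (((g2.mul g3).smul g1).prodMk (g5.sub g4)), fun t => ?_⟩
  simp only [ContinuousLinearMap.comp_apply, pairCLM_apply]
  congr 1
  simp
  congr 1
  ring

end LagTrans
end

/-! ### The product of a special Legendrian link with two phase curves -/

noncomputable section

namespace LagTrans

/-- The map induced by a pair of curves on the product of a link with two intervals. -/
def linkMap {k : ℕ} (N : Set (Cn (k + 1))) (γ ξ : ℝ → ℂ) (x₀ y₀ : ℝ) (J₁ J₂ : Set ℝ)
    (q : N × J₁ × J₂) : Cn (k + 2) :=
  pair ((profileSurface γ ξ x₀ y₀ q.2.1 q.2.2).1 • (q.1 : Cn (k + 1)))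
    (profileSurface γ ξ x₀ y₀ q.2.1 q.2.2).2

/-- The inclusion of an open set, as a chart. -/
def coeChart {E : Type*} [TopologicalSpace E] {J : Set E} (hJ : IsOpen J) (x : J) : OpenPartialHomeomorph J E :=
  haveI : Nonempty J := ⟨x⟩
  Topology.IsOpenEmbedding.toOpenPartialHomeomorph Subtype.val hJ.isOpenEmbedding_subtypeVal

@[simp] theorem coeChart_source {E : Type*} [TopologicalSpace E] {J : Set E} (hJ : IsOpen J) (x : J) :
    (coeChart hJ x).source = Set.univ := by simp [coeChart]

@[simp] theorem coeChart_target {E : Type*} [TopologicalSpace E] {J : Set E} (hJ : IsOpen J) (x : J) :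
    (coeChart hJ x).target = J := by simp [coeChart]

theorem coeChart_symm {E : Type*} [TopologicalSpace E] {J : Set E} (hJ : IsOpen J) (x : J) {t : E} (ht : t ∈ J) :
    (coeChart hJ x).symm t = ⟨t, ht⟩ :=
  haveI : Nonempty J := ⟨x⟩
  Topology.IsOpenEmbedding.toOpenPartialHomeomorph_left_inv (x := (⟨t, ht⟩ : J)) ..

/-- The product chart of a chart of the link and two intervals. -/
def productChart {k : ℕ} {N : Set (Cn (k + 1))} (ρ : OpenPartialHomeomorph N (Rn k))
    {J₁ J₂ : Set ℝ} (h₁ : IsOpen J₁) (h₂ : IsOpen J₂) (x : J₁) (y : J₂) :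
    OpenPartialHomeomorph (N × J₁ × J₂) (Rn (k + 2)) :=
  (ρ.prod ((coeChart h₁ x).prod (coeChart h₂ y))).trans
    (splitTwo k).symm.toHomeomorph.toOpenPartialHomeomorph

theorem mem_productChart_target {k : ℕ} {N : Set (Cn (k + 1))}
    {ρ : OpenPartialHomeomorph N (Rn k)} {J₁ J₂ : Set ℝ} {h₁ : IsOpen J₁} {h₂ : IsOpen J₂} {x : J₁}
    {y : J₂} {u : Rn (k + 2)} (hu : u ∈ (productChart ρ h₁ h₂ x y).target) :
    (splitTwo k u).1 ∈ ρ.target ∧ ∃ (hx : (splitTwo k u).2.1 ∈ J₁) (hy : (splitTwo k u).2.2 ∈ J₂),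
      (productChart ρ h₁ h₂ x y).symm u =
        (ρ.symm (splitTwo k u).1, ⟨(splitTwo k u).2.1, hx⟩, ⟨(splitTwo k u).2.2, hy⟩) := by
  have hu' : (splitTwo k u).1 ∈ ρ.target ∧ (splitTwo k u).2.1 ∈ J₁ ∧ (splitTwo k u).2.2 ∈ J₂ := by
    simpa [productChart] using hu
  exact ⟨hu'.1, hu'.2.1, hu'.2.2,
    Prod.ext rfl (Prod.ext (coeChart_symm h₁ x hu'.2.1) (coeChart_symm h₂ y hu'.2.2))⟩

/-- The primitive of the Liouville form on the product of a link with two curves. -/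
def linkPrimitive (γ ξ : ℝ → ℂ) (β δ Kγ Kξ : ℝ → ℝ) (x y : ℝ) : ℝ :=
  ‖ξ y‖ ^ 2 / 2 * β x + ‖γ x‖ ^ 2 / 2 * δ y + Kξ y + Kγ x

/-- The central computation. The signs -1 and 1 in the two phase conditions are those with which the
phases of γ^k γ' and ξ^k ξ' add up to β_ξ - β_γ, the imaginary part of the last coordinate. `Kγ` and
`Kξ` absorb the terms of the Liouville form that involve one curve only. -/
theorem link_calibrated {k : ℕ} {N : Set (Cn (k + 1))} {θ₀ θ₁ θ₂ : ℝ}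
    (hN : IsSpecialLegendrian N θ₀) {γ ξ : ℝ → ℂ} {x₀ y₀ : ℝ} {J₁ J₂ : Set ℝ}
    (hγ : IsPhaseCurve k (-1) J₁ γ (beta γ x₀) θ₁) (hξ : IsPhaseCurve k 1 J₂ ξ (beta ξ y₀) θ₂)
    {Kγ Kξ : ℝ → ℝ}
    (hKγ : ∀ x ∈ J₁, HasDerivAt Kγ (‖γ x‖ ^ 2 / 2 * ((starRingEnd ℂ) (γ x) * deriv γ x).im -
      beta γ x₀ x * ((starRingEnd ℂ) (γ x) * deriv γ x).re) x)
    (hKξ : ∀ y ∈ J₂, HasDerivAt Kξ (‖ξ y‖ ^ 2 / 2 * ((starRingEnd ℂ) (ξ y) * deriv ξ y).im -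
      beta ξ y₀ y * ((starRingEnd ℂ) (ξ y) * deriv ξ y).re) y) (q : N × J₁ × J₂) :
    ∃ ψ, IsCalibratedChart (linkMap N γ ξ x₀ y₀ J₁ J₂)
      (fun q => linkPrimitive γ ξ (beta γ x₀) (beta ξ y₀) Kγ Kξ q.2.1 q.2.2)
      (fun q => (linkMap N γ ξ x₀ y₀ J₁ J₂ q (Fin.last _)).im + (θ₀ + θ₁ + θ₂)) ψ ∧
      q ∈ ψ.source := by
  obtain ⟨ρ, ⟨hρ, hρ'⟩, hqρ⟩ := hN.2 q.1
  set β := beta γ x₀ with hβ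
  set δ := beta ξ y₀ with hδ
  set p : Rn k → Cn (k + 1) := Subtype.val ∘ ρ.symm with hp
  set ψ := productChart ρ hγ.isOpen hξ.isOpen q.2.1 q.2.2 with hψ
  set f := linkMap N γ ξ x₀ y₀ J₁ J₂ with hf
  have hfψ : ∀ u ∈ ψ.target, (f ∘ ψ.symm) u = (reducedParam p γ ξ β δ ∘ splitTwo k) u := by
    intro u hu
    obtain ⟨h1, hx, hy, h2⟩ := mem_productChart_target hu
    simp only [Function.comp_apply, hψ, h2, hf, linkMap, profileSurface_snd, reducedParam,
      pairCLM_apply, hp]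
    rfl
  have hfψ' : ∀ u ∈ ψ.target, (f ∘ ψ.symm) =ᶠ[𝓝 u] (reducedParam p γ ξ β δ ∘ splitTwo k) :=
    fun u hu => by filter_upwards [ψ.open_target.mem_nhds hu] with v hv using hfψ v hv
  have hD : ∀ u ∈ ψ.target, ∀ t : Rn (k + 2), fderiv ℝ (f ∘ ψ.symm) u t =
      pair ((γ (splitTwo k u).2.1 * ξ (splitTwo k u).2.2) •
          fderiv ℝ p (splitTwo k u).1 (splitTwo k t).1 +
        ((splitTwo k t).2.1 * (deriv γ (splitTwo k u).2.1 * ξ (splitTwo k u).2.2) +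
          (splitTwo k t).2.2 * (γ (splitTwo k u).2.1 * deriv ξ (splitTwo k u).2.2)) •
            p (splitTwo k u).1)
        ((splitTwo k t).2.2 * ((starRingEnd ℂ) (ξ (splitTwo k u).2.2) * deriv ξ (splitTwo k u).2.2)
          - (splitTwo k t).2.1 *
            ((starRingEnd ℂ) (γ (splitTwo k u).2.1) * deriv γ (splitTwo k u).2.1)) := by
    intro u hu t
    obtain ⟨h1, hx, hy, -⟩ := mem_productChart_target hu
    obtain ⟨L, hL, hL'⟩ := hasFDerivAt_reducedParam
      ((hρ.contDiffAt h1).differentiableAt (by simp)) (hγ.hasDerivAt hx) (hξ.hasDerivAt hy)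
      (hγ.hasDerivAt_beta _ hx) (hξ.hasDerivAt_beta _ hy)
    have h2 : HasFDerivAt (f ∘ ψ.symm) (L.comp (splitTwo k : Rn (k + 2) →L[ℝ] Rn k × ℝ × ℝ)) u :=
      (HasFDerivAt.comp (g := reducedParam p γ ξ β δ) u hL
        (splitTwo k).hasFDerivAt).congr_of_eventuallyEq (hfψ' u hu)
    rw [h2.fderiv, ContinuousLinearMap.comp_apply, hL']
    rfl
  have hpn : ∀ v ∈ ρ.target, inner ℂ (p v) (p v) = 1 := by
    intro v _
    rw [inner_self_eq_norm_sq_to_K]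
    simp [hp, hN.1 _ (ρ.symm v).2]
  -- Since `p` is a unit vector orthogonal to its derivatives, the mixed x, y terms of the link
  -- coordinates cancel against those of the last coordinate. The induced metric is |γξ|² g_N +
  -- (|γ|² + |ξ|²)(|γ'|² dx² + |ξ'|² dy²), which gives isotropy and immersivity at once.
  have hinner : ∀ u ∈ ψ.target, ∀ t t' : Rn (k + 2),
      inner ℂ (fderiv ℝ (f ∘ ψ.symm) u t) (fderiv ℝ (f ∘ ψ.symm) u t') =
      ((‖γ (splitTwo k u).2.1 * ξ (splitTwo k u).2.2‖ ^ 2 : ℝ) : ℂ) *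
        inner ℂ (fderiv ℝ p (splitTwo k u).1 (splitTwo k t).1)
          (fderiv ℝ p (splitTwo k u).1 (splitTwo k t').1) +
      (((‖γ (splitTwo k u).2.1‖ ^ 2 + ‖ξ (splitTwo k u).2.2‖ ^ 2) *
        (‖deriv γ (splitTwo k u).2.1‖ ^ 2 * ((splitTwo k t).2.1 * (splitTwo k t').2.1) +
          ‖deriv ξ (splitTwo k u).2.2‖ ^ 2 * ((splitTwo k t).2.2 * (splitTwo k t').2.2)) : ℝ) : ℂ) := by
    intro u hu t t'
    obtain ⟨h1, hx, hy, -⟩ := mem_productChart_target hu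
    obtain ⟨hq1, -, -⟩ := hρ' _ h1
    have hq2 : ∀ v, inner ℂ (fderiv ℝ p (splitTwo k u).1 v) (p (splitTwo k u).1) = 0 := by
      intro v
      rw [← inner_conj_symm, show inner ℂ (p (splitTwo k u).1) (fderiv ℝ p (splitTwo k u).1 v) = 0
        from hq1 v, map_zero]
    have hq1' : ∀ v, inner ℂ (p (splitTwo k u).1) (fderiv ℝ p (splitTwo k u).1 v) = 0 := hq1
    rw [hD u hu, hD u hu, inner_pair]
    simp only [inner_add_left, inner_add_right, inner_smul_left, inner_smul_right, hq1', hq2,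
      hpn _ h1]
    push_cast
    simp only [norm_mul, mul_pow, Complex.ofReal_mul, ← Complex.conj_mul', map_mul, map_add, map_sub,
      Complex.conj_ofReal, Complex.conj_conj]
    ring
  have hadapt : IsAdaptedChart (k + 2) f ψ := by
    refine ⟨fun u hu => ?_, fun u hu => ?_⟩
    · obtain ⟨h1, hx, hy, -⟩ := mem_productChart_target hu
      refine ContDiffAt.contDiffWithinAt (ContDiffAt.congr_of_eventuallyEq ?_ (hfψ' u hu))
      refine ContDiffAt.comp u ?_ (splitTwo k).contDiff.contDiffAt
      refine (pairCLM (k + 1)).contDiff.contDiffAt.comp _ ?_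
      have g1 : ContDiffAt ℝ ∞ (fun q : Rn k × ℝ × ℝ => p q.1) (splitTwo k u) :=
        (hρ.contDiffAt h1).comp (splitTwo k u) contDiffAt_fst
      have m1 : ContDiffAt ℝ ∞ (fun q : Rn k × ℝ × ℝ => q.2.1) (splitTwo k u) := by fun_prop
      have m2 : ContDiffAt ℝ ∞ (fun q : Rn k × ℝ × ℝ => q.2.2) (splitTwo k u) := by fun_prop
      have g2 : ContDiffAt ℝ ∞ (fun q : Rn k × ℝ × ℝ => γ q.2.1) (splitTwo k u) :=
        (hγ.smooth.contDiffAt (hγ.isOpen.mem_nhds hx)).comp (splitTwo k u) m1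
      have g3 : ContDiffAt ℝ ∞ (fun q : Rn k × ℝ × ℝ => ξ q.2.2) (splitTwo k u) :=
        (hξ.smooth.contDiffAt (hξ.isOpen.mem_nhds hy)).comp (splitTwo k u) m2
      have g4 : ContDiffAt ℝ ∞ (fun q : Rn k × ℝ × ℝ => halfSq γ β q.2.1) (splitTwo k u) :=
        ContDiffAt.comp (g := halfSq γ β) (splitTwo k u) (hγ.contDiffOn_halfSq.contDiffAt (hγ.isOpen.mem_nhds hx)) m1
      have g5 : ContDiffAt ℝ ∞ (fun q : Rn k × ℝ × ℝ => halfSq ξ δ q.2.2) (splitTwo k u) :=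
        ContDiffAt.comp (g := halfSq ξ δ) (splitTwo k u) (hξ.contDiffOn_halfSq.contDiffAt (hξ.isOpen.mem_nhds hy)) m2
      exact ((g2.mul g3).smul g1).prodMk (g5.sub g4)
    · obtain ⟨h1, hx, hy, -⟩ := mem_productChart_target hu
      have hγ0 := hγ.ne_zero _ hx
      have hξ0 := hξ.ne_zero _ hy
      have hγ0' := hγ.deriv_ne_zero _ hx
      have hξ0' := hξ.deriv_ne_zero _ hy
      refine (injective_iff_map_eq_zero _).2 fun t ht => ?_
      have h2 := hinner u hu t t
      rw [ht, inner_zero_left] at h2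
      have h3 : 0 = ‖γ (splitTwo k u).2.1 * ξ (splitTwo k u).2.2‖ ^ 2 *
        ‖fderiv ℝ p (splitTwo k u).1 (splitTwo k t).1‖ ^ 2 +
        (‖γ (splitTwo k u).2.1‖ ^ 2 + ‖ξ (splitTwo k u).2.2‖ ^ 2) *
        (‖deriv γ (splitTwo k u).2.1‖ ^ 2 * ((splitTwo k t).2.1 * (splitTwo k t).2.1) +
          ‖deriv ξ (splitTwo k u).2.2‖ ^ 2 * ((splitTwo k t).2.2 * (splitTwo k t).2.2)) := by
        rw [inner_self_eq_norm_sq_to_K] at h2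
        apply Complex.ofReal_injective
        simp only [Complex.ofReal_add, Complex.ofReal_mul, Complex.ofReal_pow,
          Complex.ofReal_zero] at h2 ⊢
        exact h2
      have p1 : 0 < ‖γ (splitTwo k u).2.1‖ := norm_pos_iff.2 hγ0
      have p2 : 0 < ‖ξ (splitTwo k u).2.2‖ := norm_pos_iff.2 hξ0
      have p3 : 0 < ‖deriv γ (splitTwo k u).2.1‖ := norm_pos_iff.2 hγ0'
      have p4 : 0 < ‖deriv ξ (splitTwo k u).2.2‖ := norm_pos_iff.2 hξ0'
      have p5 : 0 < ‖γ (splitTwo k u).2.1 * ξ (splitTwo k u).2.2‖ := by rw [norm_mul]; positivity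
      have q1 := mul_self_nonneg (splitTwo k t).2.1
      have q2 := mul_self_nonneg (splitTwo k t).2.2
      have s1 : 0 ≤ ‖γ (splitTwo k u).2.1 * ξ (splitTwo k u).2.2‖ ^ 2 *
        ‖fderiv ℝ p (splitTwo k u).1 (splitTwo k t).1‖ ^ 2 := by positivity
      have s2 : 0 ≤ ‖deriv γ (splitTwo k u).2.1‖ ^ 2 * ((splitTwo k t).2.1 * (splitTwo k t).2.1) := by
        positivity
      have s3 : 0 ≤ ‖deriv ξ (splitTwo k u).2.2‖ ^ 2 * ((splitTwo k t).2.2 * (splitTwo k t).2.2) := by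
        positivity
      have p6 : 0 < ‖γ (splitTwo k u).2.1‖ ^ 2 + ‖ξ (splitTwo k u).2.2‖ ^ 2 := by positivity
      have s4 := mul_nonneg p6.le (add_nonneg s2 s3)
      have z1 := (mul_eq_zero.1 (by linarith : (‖γ (splitTwo k u).2.1 * ξ (splitTwo k u).2.2‖ ^ 2 *
        ‖fderiv ℝ p (splitTwo k u).1 (splitTwo k t).1‖ ^ 2 : ℝ) = 0)).resolve_left (by positivity)
      have z2 := (mul_eq_zero.1 (le_antisymm (by linarith) s4)).resolve_left p6.ne'
      have z3 := (mul_eq_zero.1 (le_antisymm (by linarith) s2)).resolve_left (by positivity)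
      have z4 := (mul_eq_zero.1 (le_antisymm (by linarith) s3)).resolve_left (by positivity)
      have y1 : (splitTwo k t).1 = 0 := by
        refine hρ.2 _ h1 ?_
        rw [map_zero]
        simpa using z1
      have : splitTwo k t = 0 := Prod.ext y1 (Prod.ext (mul_self_eq_zero.1 z3) (mul_self_eq_zero.1 z4))
      simpa using this
  refine ⟨ψ, ⟨hadapt, fun u hu => ?_⟩, ?_⟩
  swap
  · simpa [hψ, productChart] using hqρ
  obtain ⟨h1, hx, hy, h2⟩ := mem_productChart_target hu
  obtain ⟨hq1, hq3, R₀, hR₀⟩ := hρ' _ h1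
  refine ⟨fun t t' => ?_, ?_, ?_⟩
  · rw [hinner u hu, Complex.add_im, Complex.im_ofReal_mul, hq3, Complex.ofReal_im]
    simp
  · have hlp : ∀ v ∈ ψ.target, ((fun q : N × J₁ × J₂ => linkPrimitive γ ξ β δ Kγ Kξ q.2.1 q.2.2) ∘
        ψ.symm) v = linkPrimitive γ ξ β δ Kγ Kξ (splitTwo k v).2.1 (splitTwo k v).2.2 := by
      intro v hv
      obtain ⟨-, _, _, h⟩ := mem_productChart_target hv
      simp only [Function.comp_apply, hψ, h]
    have hlp' : ((fun q : N × J₁ × J₂ => linkPrimitive γ ξ β δ Kγ Kξ q.2.1 q.2.2) ∘ ψ.symm) =ᶠ[𝓝 u]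
        fun v => linkPrimitive γ ξ β δ Kγ Kξ (splitTwo k v).2.1 (splitTwo k v).2.2 := by
      filter_upwards [ψ.open_target.mem_nhds hu] with v hv using hlp v hv
    have e2 : HasFDerivAt (fun v => (splitTwo k v).2.1) (((ContinuousLinearMap.fst ℝ ℝ ℝ).comp
      (ContinuousLinearMap.snd ℝ (Rn k) (ℝ × ℝ))).comp
        (splitTwo k : Rn (k + 2) →L[ℝ] Rn k × ℝ × ℝ)) u :=
      ContinuousLinearMap.hasFDerivAt (((ContinuousLinearMap.fst ℝ ℝ ℝ).comp
      (ContinuousLinearMap.snd ℝ (Rn k) (ℝ × ℝ))).comp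
        (splitTwo k : Rn (k + 2) →L[ℝ] Rn k × ℝ × ℝ))
    have e3 : HasFDerivAt (fun v => (splitTwo k v).2.2) (((ContinuousLinearMap.snd ℝ ℝ ℝ).comp
      (ContinuousLinearMap.snd ℝ (Rn k) (ℝ × ℝ))).comp
        (splitTwo k : Rn (k + 2) →L[ℝ] Rn k × ℝ × ℝ)) u :=
      ContinuousLinearMap.hasFDerivAt (((ContinuousLinearMap.snd ℝ ℝ ℝ).comp
      (ContinuousLinearMap.snd ℝ (Rn k) (ℝ × ℝ))).comp
        (splitTwo k : Rn (k + 2) →L[ℝ] Rn k × ℝ × ℝ))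
    have d1 := (hasDerivAt_normSq_half (hγ.hasDerivAt hx)).hasFDerivAt.comp u e2
    have d2 := (hasDerivAt_normSq_half (hξ.hasDerivAt hy)).hasFDerivAt.comp u e3
    have d3 := (hγ.hasDerivAt_beta _ hx).hasFDerivAt.comp u e2
    have d4 := (hξ.hasDerivAt_beta _ hy).hasFDerivAt.comp u e3
    have d5 := (hKγ _ hx).hasFDerivAt.comp u e2
    have d6 := (hKξ _ hy).hasFDerivAt.comp u e3
    have dd := ((((d2.mul d3).add (d1.mul d4)).add d6).add d5).congr_of_eventuallyEq hlp'
    refine ⟨dd.differentiableAt, fun t => ?_⟩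
    rw [dd.fderiv, hD u hu]
    have hfu : f (ψ.symm u) = pair ((γ (splitTwo k u).2.1 * ξ (splitTwo k u).2.2) •
        p (splitTwo k u).1) (halfSq ξ δ (splitTwo k u).2.2 - halfSq γ β (splitTwo k u).2.1) :=
      hfψ u hu
    have hq1' : ∀ v, inner ℂ (p (splitTwo k u).1) (fderiv ℝ p (splitTwo k u).1 v) = 0 := hq1
    rw [hfu, inner_pair]
    simp only [inner_add_right, inner_smul_left, inner_smul_right, hq1', hpn _ h1]
    have n1 := Complex.sq_norm (γ (splitTwo k u).2.1)
    have n2 := Complex.sq_norm (ξ (splitTwo k u).2.2)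
    rw [Complex.normSq_apply] at n1 n2
    simp [halfSq_re, halfSq_im]
    rw [n1, n2]
    ring
  · obtain ⟨R₁, hR₁⟩ := hγ.phase _ hx
    obtain ⟨R₂, hR₂⟩ := hξ.phase _ hy
    refine ⟨R₀ * R₁ * R₂ * (‖γ (splitTwo k u).2.1‖ ^ 2 + ‖ξ (splitTwo k u).2.2‖ ^ 2), ?_⟩
    -- The bracket equals γ'ξ'(|γ|² + |ξ|²), so up to a positive factor the determinant is (γ^k
    -- γ')(ξ^k ξ') times that of the cone over the link.
    have hdet : (jac (f ∘ ψ.symm) u).det = (γ (splitTwo k u).2.1 * ξ (splitTwo k u).2.2) ^ k *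
        ((deriv γ (splitTwo k u).2.1 * ξ (splitTwo k u).2.2) *
          ((starRingEnd ℂ) (ξ (splitTwo k u).2.2) * deriv ξ (splitTwo k u).2.2) -
        (γ (splitTwo k u).2.1 * deriv ξ (splitTwo k u).2.2) *
          (-((starRingEnd ℂ) (γ (splitTwo k u).2.1) * deriv γ (splitTwo k u).2.1))) *
            (coneMatrix p (splitTwo k u).1).det := by
      apply det_reduced
      · intro j
        simp only [jac, Matrix.of_apply, hD u hu, splitTwo_castSucc, pair_last]
        simp
      · simp only [jac, Matrix.of_apply, hD u hu, splitTwo_last_castSucc, pair_last]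
        simp
      · simp only [jac, Matrix.of_apply, hD u hu, splitTwo_last, pair_last]
        simp
      · intro i j
        simp only [jac, Matrix.of_apply, hD u hu, splitTwo_castSucc, pair_castSucc, coneMatrix]
        simp
      · intro i
        simp only [jac, Matrix.of_apply, hD u hu, splitTwo_last_castSucc, pair_castSucc, coneMatrix]
        simp
      · intro i
        simp only [jac, Matrix.of_apply, hD u hu, splitTwo_last, pair_castSucc, coneMatrix]
        simp
    have hfu : f (ψ.symm u) = pair ((γ (splitTwo k u).2.1 * ξ (splitTwo k u).2.2) •
        p (splitTwo k u).1) (halfSq ξ δ (splitTwo k u).2.2 - halfSq γ β (splitTwo k u).2.1) :=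
      hfψ u hu
    have hang : ((f (ψ.symm u)) (Fin.last _)).im = δ (splitTwo k u).2.2 - β (splitTwo k u).2.1 := by
      rw [hfu, pair_last]
      rw [Complex.sub_im, halfSq_im, halfSq_im]
    have hR₀' : (coneMatrix p (splitTwo k u).1).det = R₀ * Complex.exp (Complex.I * θ₀) := hR₀
    rw [hdet, hR₀']
    beta_reduce
    rw [hang]
    have hexp : Complex.exp (Complex.I * ((δ (splitTwo k u).2.2 - β (splitTwo k u).2.1 +
        (θ₀ + θ₁ + θ₂) : ℝ) : ℂ)) = Complex.exp (Complex.I * θ₀) *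
        Complex.exp (Complex.I * (θ₁ + -1 * β (splitTwo k u).2.1 : ℝ)) *
        Complex.exp (Complex.I * (θ₂ + 1 * δ (splitTwo k u).2.2 : ℝ)) := by
      rw [← Complex.exp_add, ← Complex.exp_add]
      congr 1
      push_cast
      ring
    rw [hexp]
    push_cast
    rw [← Complex.conj_mul', ← Complex.conj_mul']
    push_cast at hR₁ hR₂
    linear_combination (R₀ * Complex.exp (Complex.I * θ₀)) *
      ((starRingEnd ℂ) (γ (splitTwo k u).2.1) * γ (splitTwo k u).2.1 +
        (starRingEnd ℂ) (ξ (splitTwo k u).2.2) * ξ (splitTwo k u).2.2) *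
      (ξ (splitTwo k u).2.2 ^ k * deriv ξ (splitTwo k u).2.2 * hR₁ +
        R₁ * Complex.exp (Complex.I * (θ₁ + -1 * β (splitTwo k u).2.1)) * hR₂)

end LagTrans
end

noncomputable section

namespace LagTrans

/-! ### Profile curves -/

theorem hasDerivAt_integral_of_continuousOn {g : ℝ → ℝ} {J : Set ℝ} (hJ : IsOpen J)
    (hc : J.OrdConnected) (hg : ContinuousOn g J) {x₀ x : ℝ} (hx₀ : x₀ ∈ J) (hx : x ∈ J) :
    HasDerivAt (fun x => ∫ t in x₀..x, g t) (g x) x := by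
  refine intervalIntegral.integral_hasDerivAt_right ?_ ?_ (hg.continuousAt (hJ.mem_nhds hx))
  · exact (hg.mono (hc.uIcc_subset hx₀ hx)).intervalIntegrable
  · exact hg.stronglyMeasurableAtFilter hJ x hx

theorem re_conj_mul_I_mul (z w : ℂ) :
    ((starRingEnd ℂ) z * (Complex.I * w)).re = -((starRingEnd ℂ) z * w).im := by
  rw [mul_left_comm, Complex.I_mul_re]

theorem hasDerivAt_beta {γ : ℝ → ℂ} {J : Set ℝ} (hJ : IsOpen J) (hc : J.OrdConnected)
    (hγ : ContDiffOn ℝ ∞ γ J) {x₀ x : ℝ} (hx₀ : x₀ ∈ J) (hx : x ∈ J) :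
    HasDerivAt (beta γ x₀) ((starRingEnd ℂ) (γ x) * deriv γ x).im x := by
  have h1 : ContinuousOn (deriv γ) J := hγ.continuousOn_deriv_of_isOpen hJ (by simp)
  have h2 : ContinuousOn (fun t => ((starRingEnd ℂ) (γ t) * (Complex.I * deriv γ t)).re) J :=
    Complex.continuous_re.comp_continuousOn
      ((Complex.continuous_conj.comp_continuousOn hγ.continuousOn).mul
        (continuousOn_const.mul h1))
  have h3 := (hasDerivAt_integral_of_continuousOn hJ hc h2 hx₀ hx).neg
  rw [re_conj_mul_I_mul, neg_neg] at h3
  exact h3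

theorem contDiffOn_beta {γ : ℝ → ℂ} {J : Set ℝ} (hJ : IsOpen J) (hc : J.OrdConnected)
    (hγ : ContDiffOn ℝ ∞ γ J) {x₀ : ℝ} (hx₀ : x₀ ∈ J) : ContDiffOn ℝ ∞ (beta γ x₀) J := by
  rw [contDiffOn_infty_iff_deriv_of_isOpen hJ]
  refine ⟨fun x hx => (hasDerivAt_beta hJ hc hγ hx₀ hx).differentiableAt.differentiableWithinAt, ?_⟩
  have h1 : ContDiffOn ℝ ∞ (deriv γ) J := ((contDiffOn_infty_iff_deriv_of_isOpen hJ).1 hγ).2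
  have h2 : ContDiffOn ℝ ∞ (fun x => ((starRingEnd ℂ) (γ x) * deriv γ x).im) J :=
    Complex.imCLM.contDiff.comp_contDiffOn
      ((Complex.conjCLE.toContinuousLinearMap.contDiff.comp_contDiffOn hγ).mul h1)
  exact h2.congr fun x hx => (hasDerivAt_beta hJ hc hγ hx₀ hx).deriv

/-- A smooth polar graph `γ(s) = r(s) e^{is}` over an open interval. -/
structure IsPolarGraph (J : Set ℝ) (γ : ℝ → ℂ) (r : ℝ → ℝ) : Prop where
  isOpen : IsOpen J
  ordConnected : J.OrdConnected
  smooth : ContDiffOn ℝ ∞ r J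
  pos : ∀ s ∈ J, 0 < r s
  eq : ∀ s ∈ J, γ s = (r s : ℂ) * Complex.exp ((s : ℂ) * Complex.I)

namespace IsPolarGraph

variable {J : Set ℝ} {γ : ℝ → ℂ} {r : ℝ → ℝ}

theorem contDiffOn (h : IsPolarGraph J γ r) : ContDiffOn ℝ ∞ γ J := by
  have h1 : ContDiffOn ℝ ∞ (fun s : ℝ => (r s : ℂ) * Complex.exp ((s : ℂ) * Complex.I)) J :=
    (Complex.ofRealCLM.contDiff.comp_contDiffOn h.smooth).mul
      ((Complex.ofRealCLM.contDiff.mul contDiff_const).cexp.contDiffOn)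
  exact h1.congr h.eq

theorem hasDerivAt_radius (h : IsPolarGraph J γ r) {s : ℝ} (hs : s ∈ J) :
    HasDerivAt r (deriv r s) s :=
  ((h.smooth.contDiffAt (h.isOpen.mem_nhds hs)).differentiableAt (by simp)).hasDerivAt

theorem hasDerivAt_deriv_radius (h : IsPolarGraph J γ r) {s : ℝ} (hs : s ∈ J) :
    HasDerivAt (deriv r) (deriv (deriv r) s) s :=
  ((((contDiffOn_infty_iff_deriv_of_isOpen h.isOpen).1 h.smooth).2.contDiffAt
    (h.isOpen.mem_nhds hs)).differentiableAt (by simp)).hasDerivAt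

theorem hasDerivAt_exp (s : ℝ) : HasDerivAt (fun s : ℝ => Complex.exp ((s : ℂ) * Complex.I))
    (Complex.exp ((s : ℂ) * Complex.I) * Complex.I) s := by
  simpa using ((hasDerivAt_id s).ofReal_comp.mul_const Complex.I).cexp

theorem hasDerivAt (h : IsPolarGraph J γ r) {s : ℝ} (hs : s ∈ J) :
    HasDerivAt γ ((deriv r s + Complex.I * r s) * Complex.exp ((s : ℂ) * Complex.I)) s := by
  have h1 := (h.hasDerivAt_radius hs).ofReal_comp.mul (hasDerivAt_exp s)
  have h2 : γ =ᶠ[𝓝 s] ((fun s => (r s : ℂ)) * fun s : ℝ => Complex.exp ((s : ℂ) * Complex.I)) := by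
    filter_upwards [h.isOpen.mem_nhds hs] with t ht using h.eq t ht
  refine (h1.congr_of_eventuallyEq h2).congr_deriv ?_
  ring

theorem deriv_eq (h : IsPolarGraph J γ r) {s : ℝ} (hs : s ∈ J) :
    deriv γ s = (deriv r s + Complex.I * r s) * Complex.exp ((s : ℂ) * Complex.I) :=
  (h.hasDerivAt hs).deriv

theorem deriv_deriv_eq (h : IsPolarGraph J γ r) {s : ℝ} (hs : s ∈ J) :
    deriv (deriv γ) s = (((deriv (deriv r) s : ℝ) : ℂ) - r s + 2 * Complex.I * ((deriv r s : ℝ) : ℂ)) *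
      Complex.exp ((s : ℂ) * Complex.I) := by
  have h1 := ((h.hasDerivAt_deriv_radius hs).ofReal_comp.add
    ((h.hasDerivAt_radius hs).ofReal_comp.const_mul Complex.I)).mul (hasDerivAt_exp s)
  have h2 : deriv γ =ᶠ[𝓝 s] (((fun s => ((deriv r s : ℝ) : ℂ)) + fun s => Complex.I * (r s : ℂ)) *
      fun s : ℝ => Complex.exp ((s : ℂ) * Complex.I)) := by
    filter_upwards [h.isOpen.mem_nhds hs] with t ht using h.deriv_eq ht
  rw [(h1.congr_of_eventuallyEq h2).deriv]
  simp only [Pi.add_apply]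
  linear_combination r s * Complex.exp ((s : ℂ) * Complex.I) * Complex.I_mul_I

theorem exp_conj_mul (s : ℝ) : (starRingEnd ℂ) (Complex.exp ((s : ℂ) * Complex.I)) *
    Complex.exp ((s : ℂ) * Complex.I) = 1 := by
  rw [Complex.conj_mul', Complex.norm_exp_ofReal_mul_I]; simp

theorem ne_zero (h : IsPolarGraph J γ r) {s : ℝ} (hs : s ∈ J) : γ s ≠ 0 := by
  rw [h.eq s hs]
  exact mul_ne_zero (by exact_mod_cast (h.pos s hs).ne') (Complex.exp_ne_zero _)

theorem normSq_deriv (h : IsPolarGraph J γ r) {s : ℝ} (hs : s ∈ J) :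
    ‖deriv γ s‖ ^ 2 = deriv r s ^ 2 + r s ^ 2 := by
  rw [h.deriv_eq hs, norm_mul, Complex.norm_exp_ofReal_mul_I, mul_one, Complex.sq_norm,
    Complex.normSq_apply]
  simp
  ring

theorem deriv_ne_zero (h : IsPolarGraph J γ r) {s : ℝ} (hs : s ∈ J) : deriv γ s ≠ 0 := by
  intro h0
  have h1 := h.normSq_deriv hs
  rw [h0] at h1
  have := h.pos s hs
  simp at h1
  nlinarith [sq_nonneg (deriv r s)]

theorem norm_eq (h : IsPolarGraph J γ r) {s : ℝ} (hs : s ∈ J) : ‖γ s‖ = r s := by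
  rw [h.eq s hs, norm_mul, Complex.norm_exp_ofReal_mul_I, mul_one, Complex.norm_real,
    Real.norm_of_nonneg (h.pos s hs).le]

theorem conj_mul_deriv (h : IsPolarGraph J γ r) {s : ℝ} (hs : s ∈ J) :
    (starRingEnd ℂ) (γ s) * deriv γ s = r s * (((deriv r s : ℝ) : ℂ) + Complex.I * r s) := by
  rw [h.eq s hs, h.deriv_eq hs, map_mul, Complex.conj_ofReal]
  linear_combination (r s * (((deriv r s : ℝ) : ℂ) + Complex.I * r s)) * exp_conj_mul s

theorem conj_mul_deriv_im (h : IsPolarGraph J γ r) {s : ℝ} (hs : s ∈ J) :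
    ((starRingEnd ℂ) (γ s) * deriv γ s).im = r s ^ 2 := by
  rw [h.conj_mul_deriv hs]
  simp
  ring

theorem hasDerivAt_beta (h : IsPolarGraph J γ r) {x₀ : ℝ} (hx₀ : x₀ ∈ J) {s : ℝ} (hs : s ∈ J) :
    HasDerivAt (beta γ x₀) (r s ^ 2) s := by
  rw [← h.conj_mul_deriv_im hs]
  exact LagTrans.hasDerivAt_beta h.isOpen h.ordConnected h.contDiffOn hx₀ hs

/-- The tangential part is a real multiple of γ' and drops out. Since all terms of the profile
equation are normal, this one component along iγ' carries all of its content. -/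
theorem curveNormal_im (γ : ℝ → ℂ) (s : ℝ) (w : ℂ) :
    ((starRingEnd ℂ) (deriv γ s) * curveNormal γ s w).im = ((starRingEnd ℂ) (deriv γ s) * w).im := by
  rw [curveNormal, mul_sub, Complex.sub_im, mul_left_comm, Complex.conj_mul', ← Complex.ofReal_pow,
    ← Complex.ofReal_mul, Complex.ofReal_im, sub_zero]

/-- The profile equation in polar coordinates. -/
theorem profileEq (h : IsPolarGraph J γ r) {k : ℕ} {a : ℝ} (hP : ProfileEq (k + 1) a J γ) {s : ℝ}
    (hs : s ∈ J) :
    (2 * deriv r s ^ 2 - r s * deriv (deriv r) s + r s ^ 2) / (deriv r s ^ 2 + r s ^ 2) + k =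
      -a * r s ^ 2 := by
  have h1 := congrArg (fun w => ((starRingEnd ℂ) (deriv γ s) * w).im) (hP s hs)
  simp only [curvatureVector, mul_sub, Complex.sub_im] at h1
  rw [mul_left_comm, Complex.im_ofReal_mul, mul_left_comm, Complex.im_ofReal_mul,
    mul_left_comm _ (a : ℂ), Complex.im_ofReal_mul, curveNormal_im, curveNormal_im,
    h.normSq_deriv hs, h.norm_eq hs, h.deriv_deriv_eq hs] at h1
  have h2 : ((starRingEnd ℂ) (deriv γ s) * γ s).im = -r s ^ 2 := by
    rw [← h.conj_mul_deriv_im hs, ← Complex.conj_im]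
    simp [mul_comm]
  have h3 : ((starRingEnd ℂ) (deriv γ s) * ((((deriv (deriv r) s : ℝ) : ℂ) - r s + 2 * Complex.I * ((deriv r s : ℝ) : ℂ)) *
      Complex.exp ((s : ℂ) * Complex.I))).im =
      2 * deriv r s ^ 2 - r s * deriv (deriv r) s + r s ^ 2 := by
    have : (starRingEnd ℂ) (deriv γ s) * ((((deriv (deriv r) s : ℝ) : ℂ) - r s + 2 * Complex.I * ((deriv r s : ℝ) : ℂ)) *
      Complex.exp ((s : ℂ) * Complex.I)) = (((deriv r s : ℝ) : ℂ) - Complex.I * r s) *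
        (((deriv (deriv r) s : ℝ) : ℂ) - r s + 2 * Complex.I * ((deriv r s : ℝ) : ℂ)) := by
      rw [h.deriv_eq hs]
      simp only [map_mul, map_add, Complex.conj_ofReal, Complex.conj_I]
      linear_combination ((((deriv r s : ℝ) : ℂ) - Complex.I * r s) *
        (((deriv (deriv r) s : ℝ) : ℂ) - r s + 2 * Complex.I * ((deriv r s : ℝ) : ℂ))) * exp_conj_mul s
    rw [this]
    simp
    ring
  rw [h2, h3] at h1
  have hr := (h.pos s hs).ne'
  have h4 : deriv r s ^ 2 + r s ^ 2 ≠ 0 := by have := h.pos s hs; positivity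
  push_cast at h1
  field_simp at h1 ⊢
  linarith

/-- The tangent angle relation obtained by integrating the profile equation. -/
theorem exists_angle (h : IsPolarGraph J γ r) {k : ℕ} {a : ℝ} (hP : ProfileEq (k + 1) a J γ)
    {x₀ : ℝ} (hx₀ : x₀ ∈ J) : ∃ θ : ℝ, ∀ s ∈ J,
      (k + 1) * s + (π / 2 - Real.arctan (deriv r s / r s)) = θ + -a * beta γ x₀ s := by
  -- The left side of the claim is an argument of γ^k γ': the polar angle enters k + 1 times, and r'
  -- + ir has argument π/2 - arctan(r'/r). By the profile equation its derivative is -a r², while β'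
  -- = r².
  have h1 : ∀ s ∈ J, HasDerivAt (fun s => (k + 1) * s + (π / 2 - Real.arctan (deriv r s / r s)) +
      a * beta γ x₀ s) 0 s := by
    intro s hs
    have hr := (h.pos s hs).ne'
    have d1 := ((h.hasDerivAt_deriv_radius hs).div (h.hasDerivAt_radius hs) hr).arctan
    have d2 := (((hasDerivAt_id s).const_mul ((k : ℝ) + 1)).add (d1.const_sub (π / 2))).add
      ((h.hasDerivAt_beta hx₀ hs).const_mul a)
    refine d2.congr_deriv ?_
    have h2 := h.profileEq hP hs
    have h4 : deriv r s ^ 2 + r s ^ 2 ≠ 0 := by have := h.pos s hs; positivity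
    have h5 : 1 + (deriv r s / r s) ^ 2 ≠ 0 := by positivity
    have h6 : 1 / (1 + (deriv r s / r s) ^ 2) *
        ((deriv (deriv r) s * r s - deriv r s * deriv r s) / r s ^ 2) =
        (deriv (deriv r) s * r s - deriv r s ^ 2) / (deriv r s ^ 2 + r s ^ 2) := by
      have h7 : 1 + (deriv r s / r s) ^ 2 = (deriv r s ^ 2 + r s ^ 2) / r s ^ 2 := by
        field_simp; ring
      rw [h7]
      field_simp
    simp only [Pi.div_apply] at *
    rw [h6]
    have h8 : (2 * deriv r s ^ 2 - r s * deriv (deriv r) s + r s ^ 2) / (deriv r s ^ 2 + r s ^ 2) =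
      1 - (deriv (deriv r) s * r s - deriv r s ^ 2) / (deriv r s ^ 2 + r s ^ 2) := by
      field_simp
      ring
    rw [h8] at h2
    linarith
  obtain ⟨θ, hθ⟩ := h.isOpen.exists_is_const_of_deriv_eq_zero h.ordConnected.isPreconnected
    (fun s hs => (h1 s hs).differentiableAt.differentiableWithinAt) (fun s hs => (h1 s hs).deriv)
  exact ⟨θ, fun s hs => by linarith [hθ s hs]⟩

/-- One has γ^k γ' = r^k (r' + ir) e^{i(k+1)s}. A shrinker, a = -1, thus gets the sign 1 needed for
ξ, and an expander, a = 1, the sign -1 needed for γ. -/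
theorem isPhaseCurve (h : IsPolarGraph J γ r) {k : ℕ} {a θ : ℝ} {x₀ : ℝ} (hx₀ : x₀ ∈ J)
    (hθ : ∀ s ∈ J, (k + 1) * s + (π / 2 - Real.arctan (deriv r s / r s)) =
      θ + -a * beta γ x₀ s) : IsPhaseCurve k (-a) J γ (beta γ x₀) θ where
  isOpen := h.isOpen
  smooth := h.contDiffOn
  smooth_beta := contDiffOn_beta h.isOpen h.ordConnected h.contDiffOn hx₀
  ne_zero _ hs := h.ne_zero hs
  deriv_ne_zero _ hs := h.deriv_ne_zero hs
  hasDerivAt_beta _ hs := LagTrans.hasDerivAt_beta h.isOpen h.ordConnected h.contDiffOn hx₀ hs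
  phase s hs := by
    have hp : 0 < √(1 + (deriv r s / r s) ^ 2) := Real.sqrt_pos.2 (by positivity)
    have hcos := Real.cos_arctan (deriv r s / r s)
    have hsin := Real.sin_arctan (deriv r s / r s)
    obtain ⟨S, hS⟩ : ∃ S, S = √(1 + (deriv r s / r s) ^ 2) := ⟨_, rfl⟩
    rw [← hS] at hp hcos hsin
    refine ⟨r s ^ k * (r s * S), ?_⟩
    have hr : (r s : ℂ) ≠ 0 := by exact_mod_cast (h.pos s hs).ne'
    rw [← hθ s hs, h.deriv_eq hs, h.eq s hs]
    have h1 : Complex.exp (Complex.I * ((π / 2 - Real.arctan (deriv r s / r s) : ℝ) : ℂ)) * S =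
        ((deriv r s : ℝ) : ℂ) / r s + Complex.I := by
      rw [mul_comm Complex.I, Complex.exp_mul_I, ← Complex.ofReal_cos, ← Complex.ofReal_sin,
        Real.cos_pi_div_two_sub, Real.sin_pi_div_two_sub, hcos, hsin]
      have hp' : (S : ℂ) ≠ 0 := by exact_mod_cast hp.ne'
      push_cast
      field_simp
    have h2 : Complex.exp (Complex.I * (((k + 1) * s + (π / 2 - Real.arctan (deriv r s / r s)) : ℝ)
        : ℂ)) = Complex.exp ((s : ℂ) * Complex.I) ^ (k + 1) *
        Complex.exp (Complex.I * ((π / 2 - Real.arctan (deriv r s / r s) : ℝ) : ℂ)) := by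
      rw [← Complex.exp_nat_mul, ← Complex.exp_add]
      congr 1
      push_cast
      ring
    rw [h2]
    push_cast at h1 ⊢
    rw [pow_succ, mul_pow]
    have h3 : ((deriv r s : ℝ) : ℂ) = r s * (deriv r s / r s) := by field_simp
    linear_combination (r s : ℂ) ^ k * Complex.exp ((s : ℂ) * Complex.I) ^ k *
      Complex.exp ((s : ℂ) * Complex.I) * (h3 - r s * h1)

/-- As ±β is the imaginary part of the last coordinate when the other curve is a line, this
monotonicity makes the constructions with a line embedded, even if the profile itself winds or
crosses itself in ℂ. -/
theorem strictMonoOn_beta (h : IsPolarGraph J γ r) {x₀ : ℝ} (hx₀ : x₀ ∈ J) :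
    StrictMonoOn (beta γ x₀) J := by
  refine strictMonoOn_of_deriv_pos h.ordConnected.convex
    (fun s hs => (h.hasDerivAt_beta hx₀ hs).continuousAt.continuousWithinAt) fun s hs => ?_
  rw [h.isOpen.interior_eq] at hs
  rw [(h.hasDerivAt_beta hx₀ hs).deriv]
  exact pow_pos (h.pos s hs) 2

/-- Inverting `β`. -/
theorem exists_inverse_beta (h : IsPolarGraph J γ r) {x₀ : ℝ} (hx₀ : x₀ ∈ J) :
    ∃ Y : ℝ → ℝ, (∀ s ∈ J, Y (beta γ x₀ s) = s) ∧ ContinuousOn Y (beta γ x₀ '' J) := by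
  have hm := h.strictMonoOn_beta hx₀
  have hinj := hm.injOn
  refine ⟨Function.invFunOn (beta γ x₀) J, fun s hs => hinj.leftInvOn_invFunOn hs, ?_⟩
  rintro _ ⟨s, hs, rfl⟩
  have hd := h.hasDerivAt_beta hx₀ hs
  have hst : HasStrictDerivAt (beta γ x₀) (r s ^ 2) s := by
    have := (((contDiffOn_beta h.isOpen h.ordConnected h.contDiffOn hx₀).contDiffAt
      (h.isOpen.mem_nhds hs)).hasStrictDerivAt (by simp))
    rwa [hd.deriv] at this
  have hne : r s ^ 2 ≠ 0 := (pow_pos (h.pos s hs) 2).ne'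
  have hmap := hst.map_nhds_eq hne
  refine ContinuousAt.continuousWithinAt ?_
  rw [ContinuousAt, hinj.leftInvOn_invFunOn hs, ← hmap, Filter.tendsto_map'_iff]
  refine Filter.Tendsto.congr' ?_ Filter.tendsto_id
  filter_upwards [h.isOpen.mem_nhds hs] with t ht
  exact (hinj.leftInvOn_invFunOn ht).symm

theorem exists_primitive (h : IsPolarGraph J γ r) {x₀ : ℝ} (hx₀ : x₀ ∈ J) :
    ∃ K : ℝ → ℝ, ∀ x ∈ J, HasDerivAt K (‖γ x‖ ^ 2 / 2 * ((starRingEnd ℂ) (γ x) * deriv γ x).im -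
      beta γ x₀ x * ((starRingEnd ℂ) (γ x) * deriv γ x).re) x := by
  have h1 : ContinuousOn (deriv γ) J := h.contDiffOn.continuousOn_deriv_of_isOpen h.isOpen (by simp)
  have h2 : ContinuousOn (fun x => (starRingEnd ℂ) (γ x) * deriv γ x) J :=
    (Complex.continuous_conj.comp_continuousOn h.contDiffOn.continuousOn).mul h1
  have h3 := (contDiffOn_beta h.isOpen h.ordConnected h.contDiffOn hx₀).continuousOn
  refine ⟨_, fun x hx => hasDerivAt_integral_of_continuousOn (x₀ := x₀) h.isOpen h.ordConnected ?_ hx₀ hx⟩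
  exact (((h.contDiffOn.continuousOn.norm.pow 2).div_const 2).mul
    (Complex.continuous_im.comp_continuousOn h2)).sub
    (h3.mul (Complex.continuous_re.comp_continuousOn h2))

end IsPolarGraph

theorem IsAnciauxShrinkerProfile.isPolarGraph {n : ℕ} {σ : ℝ → ℂ}
    (h : IsAnciauxShrinkerProfile n σ) :
    ∃ r, IsPolarGraph Set.univ σ r ∧ ProfileEq n (-1) Set.univ σ := by
  obtain ⟨r, h1, h2, h3, -, h5⟩ := h
  exact ⟨r, ⟨isOpen_univ, Set.ordConnected_univ, h1.contDiffOn, fun s _ => h2 s, fun s _ => h3 s⟩, h5⟩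

theorem IsAnciauxExpanderProfile.isPolarGraph {n : ℕ} {α : ℝ} {ε : ℝ → ℂ}
    (h : IsAnciauxExpanderProfile n α ε) :
    ∃ r, IsPolarGraph (Set.Ioo (-(α / 2)) (α / 2)) ε r ∧
      ProfileEq n 1 (Set.Ioo (-(α / 2)) (α / 2)) ε := by
  obtain ⟨-, -, r, h1, h2, -, -, h5⟩ := h
  exact ⟨r, ⟨isOpen_Ioo, Set.ordConnected_Ioo, h1, fun s hs => (h2 s hs).1,
    fun s hs => (h2 s hs).2.2⟩, h5⟩

/-- The total variation of `β` along an expander profile is less than `π`. -/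
theorem IsAnciauxExpanderProfile.beta_sub_le {k : ℕ} {α : ℝ} {ε : ℝ → ℂ}
    (h : IsAnciauxExpanderProfile (k + 1) α ε) {x y : ℝ} (hx : x ∈ Set.Ioo (-(α / 2)) (α / 2))
    (hy : y ∈ Set.Ioo (-(α / 2)) (α / 2)) :
    beta ε 0 y - beta ε 0 x ≤ π - α / 2 := by
  have hα := h.1
  obtain ⟨r, hr, hP⟩ := h.isPolarGraph
  have h0 : (0 : ℝ) ∈ Set.Ioo (-(α / 2)) (α / 2) := ⟨by linarith, by linarith⟩
  obtain ⟨θ, hθ⟩ := hr.exists_angle hP h0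
  have hmono := (hr.strictMonoOn_beta h0).monotoneOn
  -- Moving the endpoints outwards, at least to ±α/4, can only increase the difference of the
  -- increasing function β. The angle relation bounds the new difference by π, from the two
  -- arctangents, minus (k + 1) times a length of at least α/2, so the bound stays uniformly below
  -- π.
  have hx' : min x (-(α / 4)) ∈ Set.Ioo (-(α / 2)) (α / 2) :=
    ⟨lt_min hx.1 (by linarith), (min_le_left _ _).trans_lt hx.2⟩
  have hy' : max y (α / 4) ∈ Set.Ioo (-(α / 2)) (α / 2) :=
    ⟨hy.1.trans_le (le_max_left _ _), max_lt hy.2 (by linarith)⟩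
  have e1 := hmono hx' hx (min_le_left _ _)
  have e2 := hmono hy hy' (le_max_left _ _)
  have a1 := hθ _ hx'
  have a2 := hθ _ hy'
  have b1 := Real.arctan_lt_pi_div_two (deriv r (max y (α / 4)) / r (max y (α / 4)))
  have b2 := Real.neg_pi_div_two_lt_arctan (deriv r (min x (-(α / 4))) / r (min x (-(α / 4))))
  have b3 := Real.neg_pi_div_two_lt_arctan (deriv r (max y (α / 4)) / r (max y (α / 4)))
  have b4 := Real.arctan_lt_pi_div_two (deriv r (min x (-(α / 4))) / r (min x (-(α / 4))))
  have c1 : min x (-(α / 4)) ≤ -(α / 4) := min_le_right _ _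
  have c2 : α / 4 ≤ max y (α / 4) := le_max_right _ _
  have c3 : α / 2 ≤ (k + 1) * (max y (α / 4) - min x (-(α / 4))) := by
    have : (0 : ℝ) ≤ k * (max y (α / 4) - min x (-(α / 4))) :=
      mul_nonneg (Nat.cast_nonneg k) (by linarith)
    linarith
  linarith

theorem beta_rotate (φ : ℝ) (γ : ℝ → ℂ) (x₀ : ℝ) : beta (rotate φ γ) x₀ = beta γ x₀ := by
  funext s
  unfold beta
  congr 1
  refine intervalIntegral.integral_congr fun t _ => ?_
  have h1 : deriv (rotate φ γ) t = Complex.exp (Complex.I * φ) * deriv γ t := by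
    unfold rotate
    exact deriv_const_mul_field _
  have h2 : (starRingEnd ℂ) (Complex.exp (Complex.I * φ)) * Complex.exp (Complex.I * φ) = 1 := by
    rw [mul_comm Complex.I]
    exact IsPolarGraph.exp_conj_mul φ
  simp only [h1]
  congr 1
  rw [rotate, map_mul]
  linear_combination (starRingEnd ℂ) (γ t) * Complex.I * deriv γ t * h2

theorem beta_line (φ x₀ : ℝ) : beta (line φ) x₀ = 0 := by
  funext s
  have h1 : ∀ t, deriv (line φ) t = Complex.exp (Complex.I * φ) := fun t => by
    have h : HasDerivAt (line φ) (Complex.exp (Complex.I * φ) * ((1 : ℝ) : ℂ)) t :=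
      (hasDerivAt_id t).ofReal_comp.const_mul (Complex.exp (Complex.I * φ))
    rw [h.deriv, Complex.ofReal_one, mul_one]
  have h2 : (starRingEnd ℂ) (Complex.exp (Complex.I * φ)) * Complex.exp (Complex.I * φ) = 1 := by
    rw [mul_comm Complex.I]
    exact IsPolarGraph.exp_conj_mul φ
  have h3 : ∀ t, ((starRingEnd ℂ) (line φ t) * (Complex.I * deriv (line φ) t)).re = 0 := by
    intro t
    have : (starRingEnd ℂ) (line φ t) * (Complex.I * deriv (line φ) t) = Complex.I * t := by
      rw [h1, line, map_mul, Complex.conj_ofReal]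
      linear_combination (t : ℂ) * Complex.I * h2
    rw [this]; simp
  simp [beta, h3]

theorem isPhaseCurve_rotate {k : ℕ} {s θ : ℝ} {J : Set ℝ} {γ : ℝ → ℂ} {x₀ : ℝ}
    (h : IsPhaseCurve k s J γ (beta γ x₀) θ) (φ : ℝ) :
    IsPhaseCurve k s J (rotate φ γ) (beta (rotate φ γ) x₀) (θ + (k + 1) * φ) := by
  have h1 : ∀ t, deriv (rotate φ γ) t = Complex.exp (Complex.I * φ) * deriv γ t := fun t => by
    unfold rotate
    exact deriv_const_mul_field _
  have h2 : (starRingEnd ℂ) (Complex.exp (Complex.I * φ)) * Complex.exp (Complex.I * φ) = 1 := by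
    rw [mul_comm Complex.I]
    exact IsPolarGraph.exp_conj_mul φ
  rw [beta_rotate]
  refine ⟨h.isOpen, contDiffOn_const.mul h.smooth, h.smooth_beta,
    fun x hx => mul_ne_zero (Complex.exp_ne_zero _) (h.ne_zero x hx),
    fun x hx => by rw [h1]; exact mul_ne_zero (Complex.exp_ne_zero _) (h.deriv_ne_zero x hx),
    fun x hx => ?_, fun x hx => ?_⟩
  · have := h.hasDerivAt_beta x hx
    convert this using 2
    rw [h1, rotate, map_mul]
    linear_combination (starRingEnd ℂ) (γ x) * deriv γ x * h2
  · obtain ⟨R, hR⟩ := h.phase x hx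
    refine ⟨R, ?_⟩
    have h3 : Complex.exp (Complex.I * (θ + (k + 1) * φ + s * beta γ x₀ x : ℝ)) =
        Complex.exp (Complex.I * φ) ^ (k + 1) * Complex.exp (Complex.I * (θ + s * beta γ x₀ x : ℝ)) := by
      rw [← Complex.exp_nat_mul, ← Complex.exp_add]
      congr 1
      push_cast
      ring
    rw [h3, h1, rotate, mul_pow]
    linear_combination Complex.exp (Complex.I * φ) ^ (k + 1) * hR

/-- Since β vanishes, the condition holds for either sign `s`, so a line can stand for γ or for ξ.
Phase curves avoid the origin, whence the half-line. -/
theorem isPhaseCurve_line (k : ℕ) (s φ x₀ : ℝ) :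
    IsPhaseCurve k s (Set.Ioi 0) (line φ) (beta (line φ) x₀) ((k + 1) * φ) := by
  have h1 : ∀ t, deriv (line φ) t = Complex.exp (Complex.I * φ) := fun t => by
    have h : HasDerivAt (line φ) (Complex.exp (Complex.I * φ) * ((1 : ℝ) : ℂ)) t :=
      (hasDerivAt_id t).ofReal_comp.const_mul (Complex.exp (Complex.I * φ))
    rw [h.deriv, Complex.ofReal_one, mul_one]
  have h2 : (starRingEnd ℂ) (Complex.exp (Complex.I * φ)) * Complex.exp (Complex.I * φ) = 1 := by
    rw [mul_comm Complex.I]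
    exact IsPolarGraph.exp_conj_mul φ
  rw [beta_line]
  refine ⟨isOpen_Ioi, (contDiff_const.mul Complex.ofRealCLM.contDiff).contDiffOn, contDiffOn_const,
    fun x hx => mul_ne_zero (Complex.exp_ne_zero _) (by exact_mod_cast (ne_of_gt hx)),
    fun x hx => by rw [h1]; exact Complex.exp_ne_zero _, fun x hx => ?_, fun x hx => ?_⟩
  · have : (starRingEnd ℂ) (line φ x) * deriv (line φ) x = x := by
      rw [h1, line, map_mul, Complex.conj_ofReal]
      linear_combination (x : ℂ) * h2
    rw [this, Complex.ofReal_im]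
    exact hasDerivAt_const x (0 : ℝ)
  · refine ⟨x ^ k, ?_⟩
    have h3 : Complex.exp (Complex.I * ((k + 1) * φ + s * (0 : ℝ → ℝ) x : ℝ)) =
        Complex.exp (Complex.I * φ) ^ (k + 1) := by
      rw [← Complex.exp_nat_mul]
      congr 1
      simp
      ring
    rw [h3, h1, line]
    push_cast
    ring

end LagTrans
end

/-! ### Closed subgroups of a Banach algebra and their Lie algebras -/

noncomputable section

namespace LagTrans

theorem exists_projection {F : Type*} [NormedAddCommGroup F] [NormedSpace ℝ F]
    [FiniteDimensional ℝ F] (W : Submodule ℝ F) :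
    ∃ s : F →L[ℝ] F, (∀ x, s x ∈ W) ∧ ∀ x ∈ W, s x = x := by
  obtain ⟨s₀, hs₀⟩ := LinearMap.exists_leftInverse_of_injective W.subtype (Submodule.ker_subtype _)
  exact ⟨(W.subtype ∘ₗ s₀).toContinuousLinearMap, fun x => (s₀ x).2,
    fun x hx => congrArg Subtype.val (LinearMap.congr_fun hs₀ ⟨x, hx⟩)⟩

section ClosedGroups

open Filter NormedSpace

variable {𝔸 : Type*} [NormedRing 𝔸] [NormedAlgebra ℝ 𝔸] [CompleteSpace 𝔸]

theorem exp_add_smul (X : 𝔸) (s t : ℝ) : exp ((s + t) • X) = exp (s • X) * exp (t • X) := by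
  let _ :  NormedAlgebra ℚ 𝔸 := NormedAlgebra.restrictScalars ℚ ℝ 𝔸
  rw [add_smul, exp_add_of_commute]
  exact ((Commute.refl X).smul_left s).smul_right t

theorem exp_mul_exp_neg (X : 𝔸) : exp X * exp (-X) = 1 := by
  have h := exp_add_smul X 1 (-1)
  simpa [exp_zero] using h.symm

theorem exp_neg_mul_exp (X : 𝔸) : exp (-X) * exp X = 1 := by
  simpa using exp_mul_exp_neg (-X)

theorem exp_nat_smul (X : 𝔸) (m : ℕ) : exp ((m : ℝ) • X) = exp X ^ m := by
  let _ :  NormedAlgebra ℚ 𝔸 := NormedAlgebra.restrictScalars ℚ ℝ 𝔸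
  rw [Nat.cast_smul_eq_nsmul, exp_nsmul]

theorem continuous_exp : Continuous (exp : 𝔸 → 𝔸) := by
  let _ :  NormedAlgebra ℚ 𝔸 := NormedAlgebra.restrictScalars ℚ ℝ 𝔸
  exact exp_continuous

/-- A closed group of units of a Banach algebra. -/
structure IsClosedGroup (S : Set 𝔸) : Prop where
  isClosed : IsClosed S
  one_mem : 1 ∈ S
  mul_mem : ∀ {a b}, a ∈ S → b ∈ S → a * b ∈ S
  exists_inv : ∀ {a}, a ∈ S → ∃ b ∈ S, a * b = 1 ∧ b * a = 1

/-- The Lie algebra of a closed group of units. -/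
def expAlg (S : Set 𝔸) : Submodule ℝ 𝔸 := Submodule.span ℝ {X | ∀ t : ℝ, exp (t • X) ∈ S}

variable {S : Set 𝔸}

theorem IsClosedGroup.exp_neg_mem (hS : IsClosedGroup S) {X : 𝔸} (h : exp X ∈ S) :
    exp (-X) ∈ S := by
  obtain ⟨b, hb, hb1, hb2⟩ := hS.exists_inv h
  have : exp (-X) = b := by
    calc exp (-X) = exp (-X) * (exp X * b) := by rw [hb1, mul_one]
      _ = b := by rw [← mul_assoc, exp_neg_mul_exp, one_mul]
  rwa [this]

theorem IsClosedGroup.pow_mem (hS : IsClosedGroup S) {a : 𝔸} (h : a ∈ S) (m : ℕ) : a ^ m ∈ S := by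
  induction m with
  | zero => simpa using hS.one_mem
  | succ m ih => rw [pow_succ]; exact hS.mul_mem ih h

/-- Limits of rescaled logarithms of elements of a closed group generate one-parameter
subgroups. -/
theorem IsClosedGroup.exp_smul_mem_of_tendsto (hS : IsClosedGroup S) {ι : Type*} {l : Filter ι}
    [l.NeBot] {Y : ι → 𝔸} {c : ι → ℝ} {Z : 𝔸} (hmem : ∀ᶠ j in l, exp (Y j) ∈ S)
    (hc : Tendsto c l atTop) (h : Tendsto (fun j => c j • Y j) l (𝓝 Z)) (t : ℝ) :
    exp (t • Z) ∈ S := by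
  have key : ∀ t : ℝ, 0 ≤ t → exp (t • Z) ∈ S := by
    intro t ht
    -- The exponential of ⌊t cⱼ⌋ Yⱼ is a power of exp Yⱼ, hence in `S`, and ⌊t cⱼ⌋ / cⱼ tends to t.
    have h1 : Tendsto (fun j => ((⌊t * c j⌋₊ : ℝ) / c j) • (c j • Y j)) l (𝓝 (t • Z)) :=
      ((tendsto_nat_floor_mul_div_atTop ht).comp hc).smul h
    have h2 := (continuous_exp.tendsto (t • Z)).comp h1
    refine hS.isClosed.mem_of_tendsto h2 ?_
    filter_upwards [hmem, hc.eventually (eventually_gt_atTop 0)] with j hj hcj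
    rw [Function.comp_apply, smul_smul, div_mul_cancel₀ _ hcj.ne', exp_nat_smul]
    exact hS.pow_mem hj _
  rcases le_total 0 t with ht | ht
  · exact key t ht
  · have := hS.exp_neg_mem (key (-t) (by linarith))
    simpa using this

/-- The velocity of a curve in a closed group generates a one-parameter subgroup. -/
theorem IsClosedGroup.exp_smul_mem_of_hasDerivAt (hS : IsClosedGroup S) {c : ℝ → 𝔸} {Y : 𝔸}
    (h0 : c 0 = 1) (hd : HasDerivAt c Y 0) (hc : ∀ t, c t ∈ S) (t : ℝ) : exp (t • Y) ∈ S := by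
  have he : HasStrictFDerivAt (exp : 𝔸 → 𝔸) ((ContinuousLinearEquiv.refl ℝ 𝔸 : 𝔸 ≃L[ℝ] 𝔸) : 𝔸 →L[ℝ] 𝔸) 0 :=
    hasStrictFDerivAt_exp_zero (𝕂 := ℝ)
  set lg := he.localInverse with hlg
  have hl : HasFDerivAt lg ((ContinuousLinearEquiv.refl ℝ 𝔸 : 𝔸 ≃L[ℝ] 𝔸) : 𝔸 →L[ℝ] 𝔸) (c 0) := by
    rw [h0]
    have := he.to_localInverse.hasFDerivAt
    rw [exp_zero] at this
    exact this
  have hlc : HasDerivAt (lg ∘ c) Y 0 := hl.comp_hasDerivAt 0 hd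
  have h00 : (lg ∘ c) 0 = 0 := by
    have := he.localInverse_apply_image
    rw [exp_zero] at this
    simp [h0, hlg, this]
  have hr : ∀ᶠ t in 𝓝[>] (0 : ℝ), exp ((lg ∘ c) t) ∈ S := by
    have h1 := he.eventually_right_inverse
    rw [exp_zero, ← h0] at h1
    filter_upwards [(hd.continuousAt.eventually h1).filter_mono nhdsWithin_le_nhds] with t ht
    rw [Function.comp_apply, ht]; exact hc t
  -- The rescaled logarithms (1/t) log c(t) converge to the velocity as t decreases to 0.
  refine hS.exp_smul_mem_of_tendsto hr (tendsto_inv_nhdsGT_zero (𝕜 := ℝ)) ?_ t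
  have h2 := (hasDerivAt_iff_tendsto_slope.1 hlc).mono_left
    (nhdsWithin_mono 0 (fun x (hx : 0 < x) => (hx.ne' : x ≠ 0)))
  refine h2.congr fun s => ?_
  have h00' : lg (c 0) = 0 := h00
  simp [slope_def_module, h00']

/-- Closedness makes the generating set of the span a subspace already: X + Y is the velocity of
exp(tX) exp(tY) at 0. -/
theorem IsClosedGroup.mem_expAlg (hS : IsClosedGroup S) {X : 𝔸} :
    X ∈ expAlg S ↔ ∀ t : ℝ, exp (t • X) ∈ S := by
  refine ⟨fun hX => ?_, fun hX => Submodule.subset_span hX⟩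
  refine Submodule.span_induction (p := fun X _ => ∀ t : ℝ, exp (t • X) ∈ S) (fun _ h => by exact h) ?_ ?_ ?_ hX
  · intro t; simpa [exp_zero] using hS.one_mem
  · intro X Y _ _ hX hY
    have h1 := hasDerivAt_exp_smul_const (𝕂 := ℝ) X 0
    have h2 := hasDerivAt_exp_smul_const (𝕂 := ℝ) Y 0
    have h3 := h1.mul h2
    refine hS.exp_smul_mem_of_hasDerivAt (c := fun t => exp (t • X) * exp (t • Y)) (by simp [exp_zero])
      (h3.congr_deriv (by simp [exp_zero])) fun t => hS.mul_mem (hX t) (hY t)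
  · intro a X _ hX t
    rw [smul_smul]; exact hX _

theorem IsClosedGroup.velocity_mem (hS : IsClosedGroup S) {c : ℝ → 𝔸} {Y : 𝔸}
    (h0 : c 0 = 1) (hd : HasDerivAt c Y 0) (hc : ∀ t, c t ∈ S) : Y ∈ expAlg S :=
  hS.mem_expAlg.2 (hS.exp_smul_mem_of_hasDerivAt h0 hd hc)

theorem IsClosedGroup.exp_mem (hS : IsClosedGroup S) {X : 𝔸} (hX : X ∈ expAlg S) : exp X ∈ S := by
  simpa using hS.mem_expAlg.1 hX 1

/-- Elements of a closed group near `1` are products of exponentials, with respect to any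
splitting of its Lie algebra. -/
theorem IsClosedGroup.eventually_eq_exp_mul_exp [FiniteDimensional ℝ 𝔸] (hS : IsClosedGroup S)
    (s : 𝔸 →L[ℝ] 𝔸) (hs : ∀ X ∈ expAlg S, s X ∈ expAlg S) {U : Set 𝔸} (hU : U ∈ 𝓝 0) :
    ∀ᶠ g in 𝓝[S] 1, ∃ X ∈ expAlg S, X ∈ U ∧ g = exp (X - s X) * exp (s X) := by
  obtain ⟨r, hr1, hr2⟩ := exists_projection (expAlg S)
  set p : 𝔸 →L[ℝ] 𝔸 := ContinuousLinearMap.id ℝ 𝔸 - r with hp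
  have he : HasStrictFDerivAt (exp : 𝔸 → 𝔸) (1 : 𝔸 →L[ℝ] 𝔸) 0 := hasStrictFDerivAt_exp_zero
  have hcomp : ∀ q : 𝔸 →L[ℝ] 𝔸, HasStrictFDerivAt (fun A => exp (q A)) q 0 := by
    intro q
    have h0 : HasStrictFDerivAt (exp : 𝔸 → 𝔸) (1 : 𝔸 →L[ℝ] 𝔸) (q 0) := by rwa [map_zero]
    exact h0.comp 0 q.hasStrictFDerivAt
  -- Coordinates at 1 adapted to the Lie algebra, the range of `r`, further split by `s`, and to the
  -- complementary directions, the range of `p`.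
  have hΨ : HasStrictFDerivAt (fun A => exp (r A - s (r A)) * exp (s (r A)) * exp (p A))
      ((ContinuousLinearEquiv.refl ℝ 𝔸 : 𝔸 ≃L[ℝ] 𝔸) : 𝔸 →L[ℝ] 𝔸) 0 := by
    have h := ((hcomp (r - s.comp r)).mul' (hcomp (s.comp r))).mul' (hcomp p)
    refine (h.congr_of_eventuallyEq (Eventually.of_forall fun A => ?_)).congr_fderiv ?_
    · simp
    · ext A
      simp [exp_zero, hp]
  set Θ := hΨ.localInverse with hΘ
  have hv : exp (r 0 - s (r 0)) * exp (s (r 0)) * exp (p 0) = 1 := by simp [exp_zero]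
  have hri : ∀ᶠ g in 𝓝 (1 : 𝔸),
      exp (r (Θ g) - s (r (Θ g))) * exp (s (r (Θ g))) * exp (p (Θ g)) = g := by
    have := hΨ.eventually_right_inverse
    rwa [hv] at this
  have hΘt : Tendsto Θ (𝓝 1) (𝓝 0) := by
    have := hΨ.localInverse_tendsto
    rwa [hv] at this
  have hrt : Tendsto (fun g => r (Θ g)) (𝓝 1) (𝓝 0) := by
    simpa [Function.comp_def] using (r.continuous.tendsto 0).comp hΘt
  have hpt : Tendsto (fun g => p (Θ g)) (𝓝 1) (𝓝 0) := by
    simpa [Function.comp_def] using (p.continuous.tendsto 0).comp hΘt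
  have hpS : ∀ᶠ g in 𝓝[S] (1 : 𝔸), exp (p (Θ g)) ∈ S := by
    filter_upwards [hri.filter_mono nhdsWithin_le_nhds, self_mem_nhdsWithin] with g hg hgS
    set X := r (Θ g)
    have hX : X ∈ expAlg S := hr1 _
    have e1 : exp (-(s X)) ∈ S := hS.exp_neg_mem (hS.exp_mem (hs X hX))
    have e2 : exp (-(X - s X)) ∈ S :=
      hS.exp_neg_mem (hS.exp_mem ((expAlg S).sub_mem hX (hs X hX)))
    have : exp (p (Θ g)) = exp (-(s X)) * (exp (-(X - s X)) * g) := by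
      conv_rhs => rw [← hg]
      rw [← mul_assoc (exp (-(X - s X))), ← mul_assoc (exp (-(X - s X))), exp_neg_mul_exp, one_mul,
        ← mul_assoc, exp_neg_mul_exp, one_mul]
    rw [this]
    exact hS.mul_mem e1 (hS.mul_mem e2 hgS)
  -- Otherwise the normalized vectors p(Θ g) accumulate at a unit vector Z. It lies in the Lie
  -- algebra since exp(p(Θ g)) is in `S`, so Z = rZ; but `r` kills the range of `p`, so rZ = 0.
  have hp0 : ∀ᶠ g in 𝓝[S] (1 : 𝔸), p (Θ g) = 0 := by
    by_contra hcon
    rw [not_eventually] at hcon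
    set l := 𝓝[S] (1 : 𝔸) ⊓ 𝓟 {g | ¬ p (Θ g) = 0} with hl
    have : l.NeBot := frequently_mem_iff_neBot.1 hcon
    set 𝒰 := Ultrafilter.of l with h𝒰
    have hle : (𝒰 : Filter 𝔸) ≤ 𝓝[S] 1 := (Ultrafilter.of_le l).trans inf_le_left
    have hne : ∀ᶠ g in (𝒰 : Filter 𝔸), p (Θ g) ≠ 0 :=
      (Ultrafilter.of_le l).trans inf_le_right (mem_principal_self _)
    set c : 𝔸 → ℝ := fun g => ‖p (Θ g)‖⁻¹ with hc
    have hsph : Tendsto (fun g => c g • p (Θ g)) 𝒰 (𝓟 (Metric.sphere (0 : 𝔸) 1)) := by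
      rw [tendsto_principal]
      filter_upwards [hne] with g hg
      simp [hc, norm_smul, inv_mul_cancel₀ (norm_ne_zero_iff.2 hg)]
    have : ProperSpace 𝔸 := FiniteDimensional.proper ℝ 𝔸
    obtain ⟨Z, hZ, hZl⟩ := (isCompact_sphere (0 : 𝔸) 1).ultrafilter_le_nhds (𝒰.map fun g => c g • p (Θ g)) hsph
    have hZt : Tendsto (fun g => c g • p (Θ g)) 𝒰 (𝓝 Z) := hZl
    have hct : Tendsto c 𝒰 atTop := by
      refine tendsto_inv_nhdsGT_zero.comp (tendsto_nhdsWithin_iff.2 ⟨?_, ?_⟩)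
      · simpa using (hpt.mono_left (hle.trans nhdsWithin_le_nhds)).norm
      · filter_upwards [hne] with g hg
        exact norm_pos_iff.2 hg
    have hZV : Z ∈ expAlg S :=
      hS.mem_expAlg.2 (hS.exp_smul_mem_of_tendsto (hle hpS) hct hZt)
    have hrZ : r Z = 0 := by
      have h1 := (r.continuous.tendsto Z).comp hZt
      have h2 : Tendsto (r ∘ fun g => c g • p (Θ g)) 𝒰 (𝓝 0) := by
        refine tendsto_const_nhds.congr fun g => ?_
        simp [hp, hr2 _ (hr1 _)]
      exact tendsto_nhds_unique h1 h2
    rw [hr2 Z hZV] at hrZ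
    simp [hrZ] at hZ
  filter_upwards [hp0, hri.filter_mono nhdsWithin_le_nhds,
    (hrt.eventually hU).filter_mono nhdsWithin_le_nhds] with g h1 h2 h3
  refine ⟨r (Θ g), hr1 _, h3, ?_⟩
  conv_lhs => rw [← h2]
  rw [h1, exp_zero, mul_one]

end ClosedGroups

end LagTrans

end

/-! ### Compact unitary groups, isotropic orbits and slices -/

noncomputable section

namespace LagTrans

section UnitaryGroups

open Filter NormedSpace

variable {d : ℕ}

/-- The Banach algebra of endomorphisms of `ℂ^d`. -/
abbrev Endo (d : ℕ) := Cn d →L[ℂ] Cn d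

instance : NormedAlgebra ℝ (Endo d) := NormedAlgebra.complexToReal

instance : SMul ℝ (Endo d) := Algebra.toSMul

instance : Module ℝ (Endo d) := Algebra.toModule

/-- A compact group of unitary endomorphisms of `ℂ^d`. -/
structure IsUnitaryGroup (S : Set (Endo d)) : Prop extends IsClosedGroup S where
  isCompact : IsCompact S
  inner_map : ∀ {A}, A ∈ S → ∀ v w, inner ℂ (A v) (A w) = inner ℂ v w

/-- Evaluation at `v`. -/
def evalAt (v : Cn d) : Endo d →L[ℝ] Cn d :=
  (ContinuousLinearMap.apply ℂ (Cn d) v).restrictScalars ℝ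

@[simp] theorem evalAt_apply (v : Cn d) (A : Endo d) : evalAt v A = A v := rfl

/-- The tangent space at `v` of the orbit of `v`. -/
def orbitTangent (S : Set (Endo d)) (v : Cn d) : Submodule ℝ (Cn d) :=
  (expAlg S).map (evalAt v : Endo d →ₗ[ℝ] Cn d)

/-- The orbit of `v`. -/
def orbitOf (S : Set (Endo d)) (v : Cn d) : Set (Cn d) := (fun A : Endo d => A v) '' S

/-- The moment map of the group `S` vanishes at `v`. -/
def IsNull (S : Set (Endo d)) (v : Cn d) : Prop := ∀ X ∈ expAlg S, inner ℂ v (X v) = 0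

theorem hasDerivAt_exp_smul_apply (X : Endo d) (v : Cn d) (t : ℝ) :
    HasDerivAt (fun t : ℝ => exp (t • X) v) (exp (t • X) (X v)) t :=
  (evalAt v).hasFDerivAt.comp_hasDerivAt t (hasDerivAt_exp_smul_const (𝕂 := ℝ) X t)

theorem exp_apply_eq_self {X : Endo d} {v : Cn d} (h : X v = 0) : exp X v = v := by
  have h1 : ∀ t : ℝ, HasDerivAt (fun t : ℝ => exp (t • X) v) 0 t := fun t => by
    simpa [h] using hasDerivAt_exp_smul_apply X v t
  have h2 := is_const_of_deriv_eq_zero (fun t => (h1 t).differentiableAt) (fun t => (h1 t).deriv) 1 0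
  simpa [exp_zero] using h2

theorem contDiff_exp : ContDiff ℝ ∞ (exp : Endo d → Endo d) :=
  AnalyticOnNhd.contDiff fun x _ => exp_analytic x

namespace IsUnitaryGroup

variable {S : Set (Endo d)}

theorem norm_map (hS : IsUnitaryGroup S) {A : Endo d} (hA : A ∈ S) (v : Cn d) : ‖A v‖ = ‖v‖ := by
  rw [@norm_eq_sqrt_re_inner ℂ, @norm_eq_sqrt_re_inner ℂ, hS.inner_map hA]

theorem skew (hS : IsUnitaryGroup S) {X : Endo d} (hX : X ∈ expAlg S) (v w : Cn d) :
    inner ℂ (X v) w = -inner ℂ v (X w) := by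
  have h1 := (hasDerivAt_exp_smul_apply X v 0).inner ℂ (hasDerivAt_exp_smul_apply X w 0)
  have h2 : HasDerivAt (fun t : ℝ => inner ℂ (exp (t • X) v) (exp (t • X) w)) 0 0 := by
    simp_rw [fun t : ℝ => hS.inner_map (hS.mem_expAlg.1 hX t) v w]
    exact hasDerivAt_const _ _
  have h3 := h1.unique h2
  simp only [zero_smul, exp_zero, one_apply_eq_self] at h3
  linear_combination h3

theorem conj_mem (hS : IsUnitaryGroup S) {A B X : Endo d} (hA : A ∈ S) (hB : B ∈ S)
    (hAB : A * B = 1) (hX : X ∈ expAlg S) : A * X * B ∈ expAlg S := by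
  refine hS.velocity_mem (c := fun t => A * exp (t • X) * B) (by simp [exp_zero, hAB]) ?_
    fun t => hS.mul_mem (hS.mul_mem hA (hS.mem_expAlg.1 hX t)) hB
  have := ((hasDerivAt_exp_smul_const (𝕂 := ℝ) X 0).const_mul A).mul_const B
  exact this.congr_deriv (by simp [exp_zero])

theorem isNull_map (hS : IsUnitaryGroup S) {A : Endo d} (hA : A ∈ S) {v : Cn d} (hv : IsNull S v) :
    IsNull S (A v) := by
  intro X hX
  obtain ⟨B, hB, h1, h2⟩ := hS.exists_inv hA
  have h3 := hv _ (hS.conj_mem hB hA h2 hX)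
  rw [← hS.inner_map hA] at h3
  have h4 : A ((B * X * A) v) = X (A v) := by
    change (A * (B * X * A)) v = (X * A) v
    rw [← mul_assoc, ← mul_assoc, h1, one_mul]
  rwa [h4] at h3

/-- Nullity propagates along the orbit, so ⟨exp(tX)v, Y exp(tX)v⟩ is identically zero. Its
derivative at 0 is ⟨Xv, Yv⟩ - ⟨Yv, Xv⟩, as Y is skew. -/
theorem isotropic (hS : IsUnitaryGroup S) {v : Cn d} (hv : IsNull S v) {X Y : Endo d}
    (hX : X ∈ expAlg S) (hY : Y ∈ expAlg S) : (inner ℂ (X v) (Y v)).im = 0 := by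
  have h1 := (hasDerivAt_exp_smul_apply X v 0).inner ℂ
    (((Y.restrictScalars ℝ).hasFDerivAt.comp_hasDerivAt 0 (hasDerivAt_exp_smul_apply X v 0)))
  have h2 : HasDerivAt (fun t : ℝ => inner ℂ (exp (t • X) v) (Y (exp (t • X) v))) 0 0 := by
    simp_rw [fun t : ℝ => hS.isNull_map (hS.mem_expAlg.1 hX t) hv Y hY]
    exact hasDerivAt_const _ _
  have h3 := h1.unique h2
  simp only [zero_smul, exp_zero, one_apply_eq_self, Function.comp_apply,
    ContinuousLinearMap.coe_restrictScalars'] at h3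
  have h4 := hS.skew hY v (X v)
  rw [← neg_eq_iff_eq_neg] at h4
  rw [← h4] at h3
  have h5 := congrArg Complex.im h3
  have h6 : (inner ℂ (Y v) (X v)).im = -(inner ℂ (X v) (Y v)).im := by
    rw [← inner_conj_symm, Complex.conj_im]
  simp [h6] at h5
  linarith

theorem inner_orbitTangent (hS : IsUnitaryGroup S) {v : Cn d} (hv : IsNull S v) {x y : Cn d}
    (hx : x ∈ orbitTangent S v) (hy : y ∈ orbitTangent S v) : (inner ℂ x y).im = 0 := by
  obtain ⟨X, hX, rfl⟩ := hx
  obtain ⟨Y, hY, rfl⟩ := hy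
  exact hS.isotropic hv hX hY

end IsUnitaryGroup

theorem inner_self_orbitTangent {S : Set (Endo d)} {v : Cn d} (hv : IsNull S v) {x : Cn d}
    (hx : x ∈ orbitTangent S v) : inner ℂ v x = 0 := by
  obtain ⟨X, hX, rfl⟩ := hx
  exact hv X hX

theorem IsNull.smul {S : Set (Endo d)} {v : Cn d} (hv : IsNull S v) (c : ℂ) : IsNull S (c • v) := by
  intro X hX
  simp [inner_smul_left, inner_smul_right, hv X hX]

/-- An isotropic real subspace `W` of `ℂ^d` and its multiple `i W` are disjoint. -/
theorem disjoint_map_I {W : Submodule ℝ (Cn d)} (hW : ∀ x ∈ W, ∀ y ∈ W, (inner ℂ x y).im = 0) :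
    Disjoint W (W.map ((LinearMap.lsmul ℂ (Cn d) Complex.I).restrictScalars ℝ)) := by
  rw [Submodule.disjoint_def]
  rintro x hx ⟨y, hy, rfl⟩
  have h := hW y hy _ hx
  have h1 : inner ℂ y (Complex.I • y) = Complex.I * ((‖y‖ : ℂ) ^ 2) := by
    rw [inner_smul_right, inner_self_eq_norm_sq_to_K]; rfl
  simp only [LinearMap.coe_restrictScalars, LinearMap.lsmul_apply] at h ⊢
  rw [h1] at h
  have h2 : ‖y‖ ^ 2 = 0 := by
    have h3 : (Complex.I * ((‖y‖ : ℂ) ^ 2)).im = ‖y‖ ^ 2 := by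
      rw [← Complex.ofReal_pow, Complex.I_mul_im, Complex.ofReal_re]
    rw [← h3, h]
  rw [norm_eq_zero.1 (pow_eq_zero_iff two_ne_zero |>.1 h2), smul_zero]

theorem finrank_map_I (W : Submodule ℝ (Cn d)) :
    Module.finrank ℝ (W.map ((LinearMap.lsmul ℂ (Cn d) Complex.I).restrictScalars ℝ)) =
      Module.finrank ℝ W := by
  refine (LinearEquiv.finrank_eq (Submodule.equivMapOfInjective _ ?_ W)).symm
  intro x y h
  simpa using h

theorem finrank_real_Cn : Module.finrank ℝ (Cn d) = 2 * d := by
  rw [finrank_real_of_complex]; simp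

/-- `W` and iW are disjoint subspaces of equal dimension in a real space of dimension 2d. -/
theorem finrank_le_of_isotropic {W : Submodule ℝ (Cn d)}
    (hW : ∀ x ∈ W, ∀ y ∈ W, (inner ℂ x y).im = 0) : Module.finrank ℝ W ≤ d := by
  have := Submodule.finrank_add_finrank_le_of_disjoint (disjoint_map_I hW)
  rw [finrank_map_I, finrank_real_Cn] at this
  omega

/-- An isotropic real subspace of dimension `d` spans `ℂ^d`. -/
theorem exists_add_I_smul_of_isotropic {W : Submodule ℝ (Cn d)}
    (hW : ∀ x ∈ W, ∀ y ∈ W, (inner ℂ x y).im = 0) (hd : Module.finrank ℝ W = d) (v : Cn d) :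
    ∃ x ∈ W, ∃ y ∈ W, v = x + Complex.I • y := by
  have h1 := Submodule.finrank_sup_add_finrank_inf_eq W
    (W.map ((LinearMap.lsmul ℂ (Cn d) Complex.I).restrictScalars ℝ))
  rw [(disjoint_map_I hW).eq_bot, finrank_bot, finrank_map_I, hd] at h1
  have h2 : W ⊔ W.map ((LinearMap.lsmul ℂ (Cn d) Complex.I).restrictScalars ℝ) = ⊤ :=
    Submodule.eq_top_of_finrank_eq (by rw [finrank_real_Cn]; omega)
  have h3 : v ∈ W ⊔ W.map ((LinearMap.lsmul ℂ (Cn d) Complex.I).restrictScalars ℝ) := by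
    rw [h2]; trivial
  obtain ⟨x, hx, _, ⟨y, hy, rfl⟩, rfl⟩ := Submodule.mem_sup.1 h3
  exact ⟨x, hx, y, hy, rfl⟩

/-- The tangent space of the cone over the orbit of `v`. -/
def coneTangent (S : Set (Endo d)) (v : Cn d) : Submodule ℝ (Cn d) :=
  orbitTangent S v ⊔ Submodule.span ℝ {v}

theorem IsUnitaryGroup.inner_coneTangent {S : Set (Endo d)} (hS : IsUnitaryGroup S) {v : Cn d}
    (hv : IsNull S v) : ∀ x ∈ coneTangent S v, ∀ y ∈ coneTangent S v, (inner ℂ x y).im = 0 := by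
  intro x hx y hy
  obtain ⟨x', hx', _, hxs, rfl⟩ := Submodule.mem_sup.1 hx
  obtain ⟨y', hy', _, hys, rfl⟩ := Submodule.mem_sup.1 hy
  obtain ⟨a, rfl⟩ := Submodule.mem_span_singleton.1 hxs
  obtain ⟨b, rfl⟩ := Submodule.mem_span_singleton.1 hys
  have e1 := hS.inner_orbitTangent hv hx' hy'
  have e2 := inner_self_orbitTangent hv hx'
  have e3 := inner_self_orbitTangent hv hy'
  have e4 : inner ℂ x' v = 0 := by rw [← inner_conj_symm, e2, map_zero]
  have e5 : inner ℂ v v = ((‖v‖ ^ 2 : ℝ) : ℂ) := by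
    rw [inner_self_eq_norm_sq_to_K]; norm_cast
  rw [← Complex.coe_smul, ← Complex.coe_smul]
  simp only [inner_add_left, inner_add_right, inner_smul_left, inner_smul_right, e3, e4, e5,
    Complex.conj_ofReal, ← Complex.ofReal_mul]
  simp [e1, ← Complex.ofReal_pow]

theorem finrank_coneTangent {S : Set (Endo d)} {v : Cn d} (hv : IsNull S v) (hv0 : v ≠ 0) :
    Module.finrank ℝ (coneTangent S v) = Module.finrank ℝ (orbitTangent S v) + 1 := by
  have h1 := Submodule.finrank_sup_add_finrank_inf_eq (orbitTangent S v) (Submodule.span ℝ {v})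
  have h2 : Disjoint (orbitTangent S v) (Submodule.span ℝ {v}) := by
    rw [Submodule.disjoint_def]
    intro x hx hx'
    obtain ⟨a, rfl⟩ := Submodule.mem_span_singleton.1 hx'
    have h3 := inner_self_orbitTangent hv hx
    rw [← Complex.coe_smul, inner_smul_right] at h3
    rcases mul_eq_zero.1 h3 with h | h
    · rw [Complex.ofReal_eq_zero.1 h, zero_smul]
    · exact absurd (inner_self_eq_zero.1 h) hv0
  rw [h2.eq_bot, finrank_bot, finrank_span_singleton hv0, add_zero] at h1
  exact h1

theorem IsUnitaryGroup.finrank_orbitTangent_lt {S : Set (Endo d)} (hS : IsUnitaryGroup S)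
    {v : Cn d} (hv : IsNull S v) (hv0 : v ≠ 0) : Module.finrank ℝ (orbitTangent S v) + 1 ≤ d := by
  rw [← finrank_coneTangent hv hv0]
  exact finrank_le_of_isotropic (hS.inner_coneTangent hv)

/-- A slice theorem: near `v` the orbit of `v` is parametrized by the exponential map of
a complement of the isotropy algebra. -/
theorem IsUnitaryGroup.exists_slice {S : Set (Endo d)} (hS : IsUnitaryGroup S) (v : Cn d) :
    ∃ W : Submodule ℝ (Endo d), W ≤ expAlg S ∧ (∀ X ∈ W, X v = 0 → X = 0) ∧
      W.map (evalAt v : Endo d →ₗ[ℝ] Cn d) = orbitTangent S v ∧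
      ∀ U ∈ 𝓝 (0 : Endo d), ∀ᶠ q in 𝓝[orbitOf S v] v, ∃ X ∈ W, X ∈ U ∧ q = exp X v := by
  -- The isotropy algebra of `v`. The slice `W` is the complement of it in the Lie algebra cut out
  -- by the projection `s`; the factor exp(sX) of a group element fixes `v`.
  set 𝔥 : Submodule ℝ (Endo d) := expAlg S ⊓ LinearMap.ker (evalAt v : Endo d →ₗ[ℝ] Cn d) with h𝔥
  obtain ⟨s, hs0, hs⟩ := exists_projection 𝔥
  have hs1 : ∀ A, s A ∈ expAlg S := fun A => (hs0 A).1
  have hs2 : ∀ A, s A v = 0 := fun A => (hs0 A).2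
  have hs3 : ∀ X ∈ expAlg S, X v = 0 → s X = X := fun X hX h => hs X ⟨hX, h⟩
  refine ⟨expAlg S ⊓ LinearMap.ker (s : Endo d →ₗ[ℝ] Endo d), inf_le_left, ?_, ?_, ?_⟩
  · rintro X ⟨hX, hX'⟩ h
    rw [← hs3 X hX h]; exact hX'
  · apply le_antisymm
    · exact Submodule.map_mono inf_le_left
    · rintro _ ⟨X, hX, rfl⟩
      refine ⟨X - s X, ⟨(expAlg S).sub_mem hX (hs1 X), ?_⟩, ?_⟩
      · change s (X - s X) = 0
        rw [map_sub, hs3 (s X) (hs1 X) (hs2 X), sub_self]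
      · simp [hs2]
  · intro U hU
    set P : Cn d → Prop := fun q =>
      ∃ X ∈ expAlg S ⊓ LinearMap.ker (s : Endo d →ₗ[ℝ] Endo d), X ∈ U ∧ q = exp X v with hP
    have hU' : {X | X - s X ∈ U} ∈ 𝓝 (0 : Endo d) := by
      have hc : Continuous fun X : Endo d => X - s X := continuous_id.sub s.continuous
      refine hc.continuousAt.preimage_mem_nhds ?_
      simpa using hU
    have h1 : ∀ᶠ g in 𝓝[S] (1 : Endo d), P (g v) := by
      filter_upwards [hS.eventually_eq_exp_mul_exp s (fun X _ => hs1 X) hU'] with g hg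
      obtain ⟨X, hX, hXU, rfl⟩ := hg
      refine ⟨X - s X, ⟨(expAlg S).sub_mem hX (hs1 X), ?_⟩, hXU, ?_⟩
      · change s (X - s X) = 0
        rw [map_sub, hs3 (s X) (hs1 X) (hs2 X), sub_self]
      · rw [mul_apply_eq_comp, exp_apply_eq_self (hs2 X)]
    -- A point A v near `v` need not come from A near 1. By compactness an ultrafilter of bad A
    -- converges to some A₀ fixing `v`; then A A₀⁻¹ is close to 1 and still maps `v` to A v.
    by_contra hcon
    rw [not_eventually] at hcon
    have hfr : ∃ᶠ A in comap (fun A : Endo d => A v) (𝓝 v) ⊓ 𝓟 S, ¬ P (A v) := by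
      rw [frequently_iff]
      intro B hB
      rw [mem_inf_principal, mem_comap] at hB
      obtain ⟨Q, hQ, hQB⟩ := hB
      obtain ⟨q, hq, hqP⟩ := frequently_iff.1 hcon (inter_mem_nhdsWithin (orbitOf S v) hQ)
      obtain ⟨⟨A, hA, rfl⟩, hqQ⟩ := hq
      exact ⟨A, hQB hqQ hA, hqP⟩
    set l := (comap (fun A : Endo d => A v) (𝓝 v) ⊓ 𝓟 S) ⊓ 𝓟 {A | ¬ P (A v)} with hl
    have : l.NeBot := frequently_mem_iff_neBot.1 hfr
    set 𝒰 := Ultrafilter.of l with h𝒰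
    have hle := Ultrafilter.of_le l
    have hle1 : (𝒰 : Filter (Endo d)) ≤ 𝓟 S := hle.trans (inf_le_left.trans inf_le_right)
    have hle2 : Tendsto (fun A : Endo d => A v) 𝒰 (𝓝 v) :=
      tendsto_iff_comap.2 (hle.trans (inf_le_left.trans inf_le_left))
    have hne : ∀ᶠ A in (𝒰 : Filter (Endo d)), ¬ P (A v) :=
      hle.trans inf_le_right (mem_principal_self _)
    obtain ⟨A₀, hA₀, hA₀l⟩ := hS.isCompact.ultrafilter_le_nhds 𝒰 hle1
    have hfix : A₀ v = v :=
      tendsto_nhds_unique (((evalAt v).continuous.tendsto A₀).comp hA₀l) hle2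
    obtain ⟨B, hB, hAB, hBA⟩ := hS.exists_inv hA₀
    have hBv : B v = v := by
      conv_lhs => rw [← hfix]
      change (B * A₀) v = v
      rw [hBA]; rfl
    have ht : Tendsto (fun A => A * B) 𝒰 (𝓝[S] 1) := by
      refine tendsto_nhdsWithin_iff.2 ⟨?_, ?_⟩
      · rw [← hAB]
        exact ((continuous_id.mul continuous_const).tendsto A₀).comp hA₀l
      · filter_upwards [hle1 (mem_principal_self _)] with A hA using hS.mul_mem hA hB
    have hev := ht.eventually h1
    obtain ⟨A, hA1, hA2⟩ := (hev.and hne).exists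
    rw [mul_apply_eq_comp, hBv] at hA1
    exact hA2 hA1

/-- The derivative of the exponential map, translated to the identity, preserves the Lie
algebra. -/
theorem IsUnitaryGroup.fderiv_exp_mem {S : Set (Endo d)} (hS : IsUnitaryGroup S) {X H : Endo d}
    (hX : X ∈ expAlg S) (hH : H ∈ expAlg S) : exp (-X) * fderiv ℝ exp X H ∈ expAlg S := by
  refine hS.velocity_mem (c := fun t => exp (-X) * exp (X + t • H))
    (by simp [exp_neg_mul_exp]) ?_ fun t => hS.mul_mem (hS.exp_neg_mem (hS.exp_mem hX))
      (hS.exp_mem ((expAlg S).add_mem hX ((expAlg S).smul_mem t hH)))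
  have h1 : HasDerivAt (fun t : ℝ => X + t • H) H 0 := by
    simpa using ((hasDerivAt_id (0 : ℝ)).smul_const H).const_add X
  have h2 : HasFDerivAt (exp : Endo d → Endo d) (fderiv ℝ exp X) (X + (0 : ℝ) • H) := by
    simpa using (contDiff_exp.differentiable (by simp) X).hasFDerivAt
  exact (h2.comp_hasDerivAt 0 h1).const_mul _

end UnitaryGroups

end LagTrans

end

/-! ### Orbit charts; maximal null orbits are special Legendrian -/

noncomputable section

namespace LagTrans

section OrbitCharts

open Filter NormedSpace

/-- The coefficient matrix is real, so modulo π the phase of a complex determinant depends only on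
the real span of its columns. -/
theorem det_of_mem_span {m : ℕ} {c a : Fin m → Cn m}
    (h : ∀ j, a j ∈ Submodule.span ℝ (Set.range c)) :
    ∃ R : ℝ, (Matrix.of fun i j => a j i).det = R * (Matrix.of fun i j => c j i).det := by
  choose N hN using fun j => (Submodule.mem_span_range_iff_exists_fun ℝ).1 (h j)
  refine ⟨(Matrix.of fun i j => N j i).det, ?_⟩
  have e : (Matrix.of fun i j => a j i) =
      (Matrix.of fun i j => c j i) * (Matrix.of fun i j => N j i).map (fun t : ℝ => (t : ℂ)) := by
    ext i j
    have h1 := congrArg (fun w : Cn m => w i) (hN j)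
    simp only [WithLp.ofLp_sum, Finset.sum_apply, WithLp.ofLp_smul, Pi.smul_apply] at h1
    simp only [Matrix.of_apply, Matrix.mul_apply, Matrix.map_apply]
    rw [← h1]
    exact Finset.sum_congr rfl fun l _ => by rw [Complex.real_smul, mul_comm]
  have hdet : ((Matrix.of fun i j => N j i).map (fun t : ℝ => (t : ℂ))).det =
      ((Matrix.of fun i j => N j i).det : ℂ) :=
    (RingHom.map_det Complex.ofRealHom (Matrix.of fun i j => N j i)).symm
  rw [e, Matrix.det_mul, hdet, mul_comm]

theorem det_map_endo {m : ℕ} (A : Endo m) (a : Fin m → Cn m) :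
    (Matrix.of fun i j => A (a j) i).det =
      (Matrix.toEuclideanCLM (n := Fin m) (𝕜 := ℂ).symm A).det * (Matrix.of fun i j => a j i).det := by
  rw [← Matrix.det_mul]
  congr 1
  ext i j
  obtain ⟨M, rfl⟩ : ∃ M, Matrix.toEuclideanCLM (n := Fin m) (𝕜 := ℂ) M = A :=
    (Matrix.toEuclideanCLM (n := Fin m) (𝕜 := ℂ)).surjective A
  rw [StarAlgEquiv.symm_apply_apply]
  rfl

/-- A unitary endomorphism carries orbit points to orbit points. -/
theorem IsUnitaryGroup.map_mem_orbitOf {k : ℕ} {S : Set (Endo k)} (hS : IsUnitaryGroup S)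
    {A : Endo k} (hA : A ∈ S) {v q : Cn k} (hq : q ∈ orbitOf S v) : A q ∈ orbitOf S v := by
  obtain ⟨B, hB, rfl⟩ := hq
  exact ⟨A * B, hS.mul_mem hA hB, rfl⟩

/-- Homogeneous charts: if near `v` the orbit of `v` is the image of a parametrization `m` with
smooth left inverse, then every orbit point has a chart, with inverse a translate of `m`. -/
theorem IsUnitaryGroup.exists_orbit_chart {k d : ℕ} {S : Set (Endo d)} (hS : IsUnitaryGroup S)
    {v : Cn d} {m : Rn k → Cn d} (hm : ContDiff ℝ ∞ m) (h0 : m 0 = v)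
    (hmem : ∀ u, m u ∈ orbitOf S v) (hinj : Function.Injective (fderiv ℝ m 0))
    (hnear : ∀ U ∈ 𝓝 (0 : Rn k), ∀ᶠ q in 𝓝[orbitOf S v] v, ∃ u ∈ U, q = m u)
    (q₀ : orbitOf S v) :
    ∃ (A : Endo d) (ρ : OpenPartialHomeomorph (orbitOf S v) (Rn k)), A ∈ S ∧ q₀ ∈ ρ.source ∧
      (∀ u, (ρ.symm u : Cn d) = A (m u)) ∧
      IsAdaptedChart k (Subtype.val : orbitOf S v → Cn d) ρ := by
  obtain ⟨l, hl, hlm⟩ := exists_contDiffAt_leftInverse hm.contDiffAt hinj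
  rw [h0] at hl
  obtain ⟨U, hU, hUo, hU0⟩ := eventually_nhds_iff.1 hlm
  have hl1 : ∀ᶠ q in 𝓝 v, ContDiffAt ℝ 1 l q :=
    (hl.of_le (by exact_mod_cast le_top)).eventually (by simp)
  have hl2 := eventually_nhdsWithin_iff.1 (hnear U (hUo.mem_nhds hU0))
  obtain ⟨Ω, hΩ, hΩo, hΩv⟩ := eventually_nhds_iff.1 (hl1.and hl2)
  obtain ⟨_, A, hA, rfl⟩ := q₀
  obtain ⟨B, hB, hAB, hBA⟩ := hS.exists_inv hA
  have hBAv : ∀ w, B (A w) = w := fun w => by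
    change (B * A) w = w; rw [hBA]; rfl
  have hABv : ∀ w, A (B w) = w := fun w => by
    change (A * B) w = w; rw [hAB]; rfl
  let ρ : OpenPartialHomeomorph (orbitOf S v) (Rn k) :=
    { toFun := fun q => l (B q)
      invFun := fun u => ⟨A (m u), hS.map_mem_orbitOf hA (hmem u)⟩
      source := {q | B q ∈ Ω}
      target := {u | u ∈ U ∧ m u ∈ Ω}
      map_source' := by
        intro q hq
        obtain ⟨u, hu, hqu⟩ := (hΩ _ hq).2 (hS.map_mem_orbitOf hB q.2)
        have hq' : B q ∈ Ω := hq
        change l (B q) ∈ U ∧ m (l (B q)) ∈ Ω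
        rw [hqu] at hq' ⊢
        rw [hU u hu]
        exact ⟨hu, hq'⟩
      map_target' := by
        intro u hu
        change B (A (m u)) ∈ Ω
        rw [hBAv]; exact hu.2
      left_inv' := by
        intro q hq
        obtain ⟨u, hu, hqu⟩ := (hΩ _ hq).2 (hS.map_mem_orbitOf hB q.2)
        apply Subtype.ext
        change A (m (l (B q))) = q
        rw [hqu, hU u hu, ← hqu, hABv]
      right_inv' := by
        intro u hu
        change l (B (A (m u))) = u
        rw [hBAv, hU u hu.1]
      open_source := hΩo.preimage (B.continuous.comp continuous_subtype_val)
      open_target := hUo.inter (hΩo.preimage hm.continuous)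
      continuousOn_toFun := by
        intro q hq
        have h1 : ContinuousAt l (B q) := (hΩ _ hq).1.continuousAt
        exact (ContinuousAt.comp (f := fun q : orbitOf S v => B q) h1
          (B.continuous.comp continuous_subtype_val).continuousAt).continuousWithinAt
      continuousOn_invFun :=
        ((A.continuous.comp hm.continuous).subtype_mk _).continuousOn }
  refine ⟨A, ρ, hA, ?_, fun u => rfl, ?_, ?_⟩
  · change B (A v) ∈ Ω
    rw [hBAv]; exact hΩv
  · exact ((A.restrictScalars ℝ).contDiff.comp hm).contDiffOn
  · intro u hu
    have h1 : HasFDerivAt (Subtype.val ∘ ρ.symm) ((A.restrictScalars ℝ).comp (fderiv ℝ m u)) u :=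
      (A.restrictScalars ℝ).hasFDerivAt.comp u ((hm.differentiable (by simp)) u).hasFDerivAt
    have h2 : HasFDerivAt (l ∘ m) ((fderiv ℝ l (m u)).comp (fderiv ℝ m u)) u :=
      ((hΩ _ hu.2).1.differentiableAt (by simp)).hasFDerivAt.comp u
        ((hm.differentiable (by simp)) u).hasFDerivAt
    -- Injectivity of the differential of `m` is assumed at 0 only; the left inverse `l` extends it
    -- to the whole target of the chart.
    have h3 : HasFDerivAt (l ∘ m) (ContinuousLinearMap.id ℝ (Rn k)) u := by
      refine (hasFDerivAt_id u).congr_of_eventuallyEq ?_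
      filter_upwards [hUo.mem_nhds hu.1] with w hw using hU w hw
    have h4 := h2.unique h3
    rw [h1.fderiv]
    intro x y hxy
    have h5 : fderiv ℝ m u x = fderiv ℝ m u y := by
      have := congrArg B hxy
      simpa [hBAv] using this
    have h6 := congrArg (fderiv ℝ l (m u)) h5
    have h7 : ∀ w, fderiv ℝ l (m u) (fderiv ℝ m u w) = w := fun w => by
      rw [← ContinuousLinearMap.comp_apply, h4]; rfl
    rwa [h7, h7] at h6

theorem exists_linear_parametrization {k : ℕ} {E F : Type*} [NormedAddCommGroup F]
    [NormedSpace ℝ F] [FiniteDimensional ℝ F] [NormedAddCommGroup E] [NormedSpace ℝ E]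
    (W : Submodule ℝ F) (e : F →L[ℝ] E) (he : ∀ x ∈ W, e x = 0 → x = 0)
    (hk : Module.finrank ℝ (W.map (e : F →ₗ[ℝ] E)) = k) :
    ∃ (b : Rn k →L[ℝ] F) (a : F →L[ℝ] Rn k), (∀ u, b u ∈ W) ∧ (∀ x ∈ W, b (a x) = x) ∧
      Function.Injective fun u => e (b u) := by
  have hWinj : Function.Injective ((e : F →ₗ[ℝ] E).domRestrict W) := by
    refine (injective_iff_map_eq_zero _).2 fun x hx => ?_
    exact Subtype.ext (he x x.2 hx)
  have hWdim : Module.finrank ℝ (Rn k) = Module.finrank ℝ W := by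
    have h1 : Module.finrank ℝ (W.map (e : F →ₗ[ℝ] E)) = Module.finrank ℝ W := by
      rw [← LinearMap.range_domRestrict]
      exact LinearMap.finrank_range_of_inj hWinj
    rw [hk] at h1
    rw [← h1]; simp
  let b₀ : Rn k ≃ₗ[ℝ] W := LinearEquiv.ofFinrankEq _ _ hWdim
  obtain ⟨c, hc1, hc2⟩ := exists_projection W
  refine ⟨(W.subtype ∘ₗ b₀.toLinearMap).toContinuousLinearMap,
    (b₀.symm.toLinearMap ∘ₗ (c : F →ₗ[ℝ] F).codRestrict W hc1).toContinuousLinearMap,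
    fun u => (b₀ u).2, fun x hx => ?_, fun x y hxy => b₀.injective (hWinj hxy)⟩
  change (b₀ (b₀.symm ⟨c x, hc1 x⟩) : F) = x
  rw [LinearEquiv.apply_symm_apply]
  exact hc2 x hx

/-- The orbit of a zero of the moment map is special Legendrian if it has the maximal
dimension. -/
theorem IsUnitaryGroup.isSpecialLegendrian_orbitOf {k : ℕ} {S : Set (Endo (k + 1))}
    (hS : IsUnitaryGroup S)
    (hdet : ∀ A ∈ S, ∃ R : ℝ, (Matrix.toEuclideanCLM (n := Fin (k + 1)) (𝕜 := ℂ).symm A).det = R)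
    {v : Cn (k + 1)} (hv1 : ‖v‖ = 1) (hv : IsNull S v)
    (hdim : Module.finrank ℝ (orbitTangent S v) = k) :
    ∃ θ₀, IsSpecialLegendrian (orbitOf S v) θ₀ := by
  obtain ⟨W, hWS, hW0, hWmap, hslice⟩ := hS.exists_slice v
  obtain ⟨b, a, hbW, hba, hbinj⟩ := exists_linear_parametrization W (evalAt v) hW0
    (by rw [hWmap, hdim])
  have hbS : ∀ u, b u ∈ expAlg S := fun u => hWS (hbW u)
  let m : Rn k → Cn (k + 1) := fun u => exp (b u) v
  have hm : ContDiff ℝ ∞ m := (evalAt v).contDiff.comp (contDiff_exp.comp b.contDiff)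
  have hmem : ∀ u, m u ∈ orbitOf S v := fun u => ⟨_, hS.exp_mem (hbS u), rfl⟩
  have h0 : m 0 = v := by simp [m, exp_zero]
  have hmd : ∀ u w, fderiv ℝ m u w = fderiv ℝ exp (b u) (b w) v := by
    intro u w
    have h : HasFDerivAt m ((evalAt v).comp ((fderiv ℝ exp (b u)).comp b)) u :=
      (evalAt v).hasFDerivAt.comp u
        (((contDiff_exp.differentiable (by simp)) (b u)).hasFDerivAt.comp u b.hasFDerivAt)
    rw [h.fderiv]; rfl
  -- Tangent vectors of the orbit at `m u` are translates by exp(b u) of tangent vectors at `v`, so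
  -- the Legendrian conditions need only be checked at `v`.
  have hmd' : ∀ u w, ∃ Y ∈ expAlg S, fderiv ℝ m u w = exp (b u) (Y v) := by
    intro u w
    refine ⟨_, hS.fderiv_exp_mem (hbS u) (hbS w), ?_⟩
    rw [hmd]
    change _ = (exp (b u) * (exp (-b u) * fderiv ℝ exp (b u) (b w))) v
    rw [← mul_assoc, exp_mul_exp_neg, one_mul]
  have hexp0 : fderiv ℝ (exp : Endo (k + 1) → Endo (k + 1)) 0 = 1 :=
    (hasStrictFDerivAt_exp_zero (𝕂 := ℝ)).hasFDerivAt.fderiv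
  have hinj : Function.Injective (fderiv ℝ m 0) := by
    intro x y hxy
    rw [hmd, hmd, map_zero, hexp0] at hxy
    exact hbinj hxy
  have hnear : ∀ U ∈ 𝓝 (0 : Rn k), ∀ᶠ q in 𝓝[orbitOf S v] v, ∃ u ∈ U, q = m u := by
    intro U hU
    have hpre : a ⁻¹' U ∈ 𝓝 (0 : Endo (k + 1)) :=
      a.continuous.continuousAt.preimage_mem_nhds (by simpa using hU)
    filter_upwards [hslice _ hpre] with q hq
    obtain ⟨X, hX, hXU, rfl⟩ := hq
    exact ⟨a X, hXU, by simp only [m, hba X hX]⟩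
  set bT := Module.finBasisOfFinrankEq ℝ (orbitTangent S v) hdim
  let c : Fin (k + 1) → Cn (k + 1) := Fin.snoc (α := fun _ => Cn (k + 1)) (fun j => (bT j : Cn (k + 1))) v
  have hcT : ∀ x ∈ orbitTangent S v, x ∈ Submodule.span ℝ (Set.range c) := by
    intro x hx
    have h1 := bT.sum_repr ⟨x, hx⟩
    have h2 := congrArg (Submodule.subtype _) h1
    simp only [map_sum, map_smul, Submodule.subtype_apply] at h2
    rw [← h2]
    refine Submodule.sum_mem _ fun j _ => Submodule.smul_mem _ _ (Submodule.subset_span ⟨j.castSucc, ?_⟩)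
    simp [c]
  have hcv : v ∈ Submodule.span ℝ (Set.range c) :=
    Submodule.subset_span ⟨Fin.last k, by simp [c]⟩
  -- The determinant of a real basis of the cone's tangent space at `v`; its argument is the phase.
  -- At other points the frame is the image, under an operator with real determinant, of vectors in
  -- the same real span.
  obtain ⟨D, hD⟩ : ∃ D, D = (Matrix.of fun i j => c j i).det := ⟨_, rfl⟩
  refine ⟨Complex.arg D, ?_, fun q₀ => ?_⟩
  · rintro _ ⟨A, hA, rfl⟩
    simp only [hS.norm_map hA, hv1]
  obtain ⟨A, ρ, hA, hq₀, hρ, hρa⟩ := hS.exists_orbit_chart hm h0 hmem hinj hnear q₀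
  refine ⟨ρ, ⟨hρa, fun u hu => ?_⟩, hq₀⟩
  have hBS : A * exp (b u) ∈ S := hS.mul_mem hA (hS.exp_mem (hbS u))
  have hval : (ρ.symm u : Cn (k + 1)) = (A * exp (b u)) v := hρ u
  have hder : ∀ w, fderiv ℝ (Subtype.val ∘ ρ.symm) u w = A (fderiv ℝ m u w) := by
    intro w
    have h1 : HasFDerivAt (Subtype.val ∘ ρ.symm) ((A.restrictScalars ℝ).comp (fderiv ℝ m u)) u := by
      have h2 : HasFDerivAt (fun u => A (m u)) ((A.restrictScalars ℝ).comp (fderiv ℝ m u)) u :=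
        (A.restrictScalars ℝ).hasFDerivAt.comp u ((hm.differentiable (by simp)) u).hasFDerivAt
      exact h2.congr_of_eventuallyEq (Eventually.of_forall hρ)
    rw [h1.fderiv]; rfl
  have hder' : ∀ w, ∃ y ∈ orbitTangent S v,
      fderiv ℝ (Subtype.val ∘ ρ.symm) u w = (A * exp (b u)) y := by
    intro w
    obtain ⟨Y, hY, hYe⟩ := hmd' u w
    exact ⟨Y v, ⟨Y, hY, rfl⟩, by rw [hder, hYe]; rfl⟩
  refine ⟨fun w => ?_, fun w w' => ?_, ?_⟩
  · obtain ⟨y, hy, hye⟩ := hder' w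
    rw [hval, hye, hS.inner_map hBS]
    exact inner_self_orbitTangent hv hy
  · obtain ⟨y, hy, hye⟩ := hder' w
    obtain ⟨y', hy', hye'⟩ := hder' w'
    rw [hye, hye', hS.inner_map hBS]
    exact hS.inner_orbitTangent hv hy hy'
  · choose y hy hye using hder'
    let a : Fin (k + 1) → Cn (k + 1) :=
      Fin.snoc (α := fun _ => Cn (k + 1)) (fun j => y (stdBasis k j)) v
    have hcm : coneMatrix (Subtype.val ∘ ρ.symm) u =
        Matrix.of fun i j => (A * exp (b u)) (a j) i := by
      ext i j
      refine Fin.lastCases ?_ (fun j => ?_) j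
      · simp only [coneMatrix, Matrix.of_apply, Fin.snoc_last, a, Function.comp_apply]
        rw [hval]
      · simp only [coneMatrix, Matrix.of_apply, Fin.snoc_castSucc, a]
        rw [hye]
    obtain ⟨R₁, hR₁⟩ := hdet _ hBS
    have haT : ∀ j, a j ∈ Submodule.span ℝ (Set.range c) := by
      intro j
      refine Fin.lastCases ?_ (fun j => ?_) j
      · simp only [a, Fin.snoc_last]; exact hcv
      · simp only [a, Fin.snoc_castSucc]; exact hcT _ (hy _)
    obtain ⟨R₂, hR₂⟩ := det_of_mem_span haT
    refine ⟨R₁ * R₂ * ‖D‖, ?_⟩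
    rw [hcm, det_map_endo, hR₁, hR₂, ← hD]
    conv_lhs => rw [← Complex.norm_mul_exp_arg_mul_I D]
    push_cast
    ring_nf

end OrbitCharts

end LagTrans

end

/-! ### Matrix groups as operator groups; adjoining -1 -/

noncomputable section

namespace LagTrans

section MatrixGroups

open Filter NormedSpace

variable {n : ℕ}

theorem finrank_map_add_finrank_inf_ker {E F : Type*} [AddCommGroup E] [Module ℝ E]
    [FiniteDimensional ℝ E] [AddCommGroup F] [Module ℝ F] (W : Submodule ℝ E) (f : E →ₗ[ℝ] F) :
    Module.finrank ℝ (W.map f) + Module.finrank ℝ ↥(W ⊓ LinearMap.ker f) = Module.finrank ℝ W := by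
  rw [← (f.domRestrict W).finrank_range_add_finrank_ker, LinearMap.range_domRestrict,
    LinearMap.ker_domRestrict, ← Submodule.map_comap_subtype]
  congr 1
  exact Submodule.finrank_map_subtype_eq _ _

/-- The endomorphism of `ℂ^n` given by a matrix. -/
def toEndo (n : ℕ) : Matrix (Fin n) (Fin n) ℂ ≃⋆ₐ[ℂ] Endo n :=
  Matrix.toEuclideanCLM (n := Fin n) (𝕜 := ℂ)

/-- The real linear equivalence underlying `toEndo`. -/
def toEndoReal (n : ℕ) : Matrix (Fin n) (Fin n) ℂ ≃ₗ[ℝ] Endo n where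
  toFun := toEndo n
  invFun := (toEndo n).symm
  left_inv := (toEndo n).symm_apply_apply
  right_inv := (toEndo n).apply_symm_apply
  map_add' := map_add (toEndo n)
  map_smul' c A := by
    change toEndo n (c • A) = c • toEndo n A
    rw [← Complex.coe_smul, map_smul]
    ext v : 1
    simp

theorem toEndo_smul (c : ℝ) (A : Matrix (Fin n) (Fin n) ℂ) : toEndo n (c • A) = c • toEndo n A :=
  (toEndoReal n).map_smul c A

theorem toEndo_apply (A : Matrix (Fin n) (Fin n) ℂ) (v : Cn n) :
    toEndo n A v = WithLp.toLp 2 (A.mulVec v.ofLp) := rfl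

theorem continuous_toEndo : Continuous (toEndo n) :=
  (toEndo n).toAlgEquiv.toLinearMap.continuous_of_finiteDimensional

theorem toEndo_exp (A : Matrix (Fin n) (Fin n) ℂ) : toEndo n (exp A) = exp (toEndo n A) := by
  let e : Matrix (Fin n) (Fin n) ℂ ≃L[ℂ] Endo n :=
    (toEndo n).toAlgEquiv.toLinearEquiv.toContinuousLinearEquiv
  have h := e.map_tsum (f := fun m => ((m.factorial : ℂ)⁻¹) • A ^ m) (L := SummationFilter.unconditional ℕ)
  rw [exp_eq_tsum ℂ, exp_eq_tsum ℂ]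
  refine h.trans (tsum_congr fun m => ?_)
  change toEndo n _ = _
  rw [map_smul, map_pow]

/-- The endomorphisms given by the elements of a matrix group. -/
def opSet (G : Subgroup (SU n)) : Set (Endo n) :=
  (fun g : SU n => toEndo n (g : Matrix (Fin n) (Fin n) ℂ)) '' G

theorem act_eq (g : SU n) (v : Cn n) : act g v = toEndo n (g : Matrix (Fin n) (Fin n) ℂ) v := rfl

theorem inner_act (g : SU n) (v w : Cn n) : inner ℂ (act g v) (act g w) = inner ℂ v w := by
  have h1 : star (g : Matrix (Fin n) (Fin n) ℂ) * g = 1 :=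
    (Matrix.mem_unitaryGroup_iff'.1 (Matrix.mem_specialUnitaryGroup_iff.1 g.2).1)
  have h2 : star (toEndo n (g : Matrix (Fin n) (Fin n) ℂ)) * toEndo n (g : Matrix (Fin n) (Fin n) ℂ) = 1 := by
    rw [← map_star, ← map_mul, h1, map_one]
  rw [act_eq, act_eq, ← ContinuousLinearMap.adjoint_inner_right]
  change inner ℂ v ((star (toEndo n (g : Matrix (Fin n) (Fin n) ℂ)) *
    toEndo n (g : Matrix (Fin n) (Fin n) ℂ)) w) = _
  rw [h2]; rfl

theorem isUnitaryGroup_opSet {G : Subgroup (SU n)} (hG : IsCompact (G : Set (SU n))) :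
    IsUnitaryGroup (opSet G) := by
  have hc : IsCompact (opSet G) := hG.image (continuous_toEndo.comp continuous_subtype_val)
  refine { isClosed := hc.isClosed, one_mem := ⟨1, G.one_mem, by simp⟩, mul_mem := ?_, exists_inv := ?_,
           isCompact := hc, inner_map := ?_ }
  · rintro _ _ ⟨g, hg, rfl⟩ ⟨h, hh, rfl⟩
    exact ⟨g * h, G.mul_mem hg hh, by simp⟩
  · rintro _ ⟨g, hg, rfl⟩
    refine ⟨_, ⟨g⁻¹, G.inv_mem hg, rfl⟩, ?_, ?_⟩
    · change toEndo n g * toEndo n (g⁻¹ : SU n) = 1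
      rw [← map_mul, ← Submonoid.coe_mul, mul_inv_cancel]; simp
    · change toEndo n (g⁻¹ : SU n) * toEndo n g = 1
      rw [← map_mul, ← Submonoid.coe_mul, inv_mul_cancel]; simp
  · rintro _ ⟨g, hg, rfl⟩ v w
    exact inner_act g v w

theorem expAlg_opSet (G : Subgroup (SU n)) :
    expAlg (opSet G) = (lieAlg G).map (toEndoReal n).toLinearMap := by
  rw [expAlg, lieAlg, Submodule.map_span]
  congr 1
  ext X
  constructor
  · intro hX
    refine ⟨(toEndoReal n).symm X, fun t => ?_, (toEndoReal n).apply_symm_apply X⟩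
    obtain ⟨g, hg, hgX⟩ := hX t
    refine ⟨g, hg, (toEndo n).injective ?_⟩
    refine hgX.trans (Eq.trans ?_ (toEndo_exp _).symm)
    rw [toEndo_smul]
    congr 2
    exact ((toEndoReal n).apply_symm_apply X).symm
  · rintro ⟨Y, hY, rfl⟩ t
    obtain ⟨g, hg, hgY⟩ := hY t
    refine ⟨g, hg, ?_⟩
    change toEndo n g = exp (t • toEndo n Y)
    rw [hgY, toEndo_exp, toEndo_smul]

theorem lieDim_eq (G : Subgroup (SU n)) : lieDim G = Module.finrank ℝ (expAlg (opSet G)) := by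
  rw [expAlg_opSet]
  exact ((toEndoReal n).finrank_map_eq (lieAlg G)).symm

/-- The moment map sees only the imaginary part of ⟨z, Yz⟩, with the factor -½; the real part
vanishes because Y is skew. -/
theorem isNull_of_mem_zeroLevel {G : Subgroup (SU n)} (hG : IsCompact (G : Set (SU n))) {z : Cn n}
    (hz : z ∈ zeroLevel G) : IsNull (opSet G) z := by
  intro X hX
  have hsk := (isUnitaryGroup_opSet hG).skew hX z z
  rw [expAlg_opSet] at hX
  obtain ⟨Y, hY, rfl⟩ := hX
  have h1 : momentMap G z ⟨Y, hY⟩ = 0 := congrFun hz _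
  have h2 : momentMap G z ⟨Y, hY⟩ = -(1 / 2) * (inner ℂ z (toEndo n Y z)).im := by
    have h3 : ((((-(1 / 2 : ℂ) * Complex.I) • Matrix.vecMulVec z.ofLp (star z.ofLp)).conjTranspose *
        Y).trace) = (1 / 2 : ℂ) * Complex.I * inner ℂ z (toEndo n Y z) := by
      rw [Matrix.conjTranspose_smul, Matrix.conjTranspose_vecMulVec, star_star, Matrix.smul_mul,
        Matrix.trace_smul, Matrix.vecMulVec_mul, Matrix.trace_vecMulVec, toEndo_apply,
        EuclideanSpace.inner_eq_star_dotProduct, smul_eq_mul, dotProduct_comm (Matrix.mulVec _ _),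
        Matrix.dotProduct_mulVec, dotProduct_comm z.ofLp]
      simp
    unfold momentMap
    rw [h3]
    simp
  rw [h1] at h2
  have h4 : (inner ℂ z (toEndo n Y z)).im = 0 := by linarith
  have h5 : (inner ℂ z (toEndo n Y z)).re = 0 := by
    have h6 := congrArg Complex.re hsk
    have h7 : (inner ℂ (toEndo n Y z) z).re = (inner ℂ z (toEndo n Y z)).re := by
      rw [← inner_conj_symm, Complex.conj_re]
    change (inner ℂ (toEndo n Y z) z).re = (-inner ℂ z (toEndo n Y z)).re at h6
    rw [h7, Complex.neg_re] at h6
    linarith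
  exact Complex.ext h5 h4

theorem IsUnitaryGroup.expAlg_stabilizer {S T : Set (Endo n)} (hS : IsUnitaryGroup S)
    (hT : IsUnitaryGroup T) {z : Cn n} (hTS : ∀ A, A ∈ T ↔ A ∈ S ∧ A z = z) :
    expAlg T = expAlg S ⊓ LinearMap.ker (evalAt z : Endo n →ₗ[ℝ] Cn n) := by
  ext X
  rw [hT.mem_expAlg, Submodule.mem_inf, hS.mem_expAlg]
  constructor
  · intro h
    refine ⟨fun t => ((hTS _).1 (h t)).1, ?_⟩
    have h1 := hasDerivAt_exp_smul_apply X z 0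
    have h2 : HasDerivAt (fun t : ℝ => exp (t • X) z) 0 0 := by
      simp_rw [fun t : ℝ => ((hTS _).1 (h t)).2]
      exact hasDerivAt_const _ _
    have h3 := h1.unique h2
    simpa [exp_zero] using h3
  · rintro ⟨h1, h2⟩ t
    refine (hTS _).2 ⟨h1 t, exp_apply_eq_self ?_⟩
    have h3 : X z = 0 := h2
    simp [h3]

theorem isCompact_stab {G : Subgroup (SU n)} (hG : IsCompact (G : Set (SU n))) (z : Cn n) :
    IsCompact (stab G z : Set (SU n)) := by
  have h : (stab G z : Set (SU n)) = (G : Set (SU n)) ∩ {g | act g z = z} := rfl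
  rw [h]
  refine hG.inter_right (isClosed_eq ?_ continuous_const)
  exact (evalAt z).continuous.comp (continuous_toEndo.comp continuous_subtype_val)

/-- Infinitesimal orbit-stabilizer theorem: the Lie algebra of the stabilizer is the kernel of
evaluation at `z`. It turns the hypothesis on dim G/H into the dimension of an orbit. -/
theorem lieDim_eq_add {G : Subgroup (SU n)} (hG : IsCompact (G : Set (SU n))) (z : Cn n) :
    lieDim G = Module.finrank ℝ (orbitTangent (opSet G) z) + lieDim (stab G z) := by
  have h1 := (isUnitaryGroup_opSet hG).expAlg_stabilizer (isUnitaryGroup_opSet (isCompact_stab hG z))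
    (z := z) ?_
  · rw [lieDim_eq, lieDim_eq, h1]
    exact (finrank_map_add_finrank_inf_ker (expAlg (opSet G)) (evalAt z : Endo n →ₗ[ℝ] Cn n)).symm
  · intro A
    constructor
    · rintro ⟨g, ⟨hg, hgz⟩, rfl⟩
      exact ⟨⟨g, hg, rfl⟩, hgz⟩
    · rintro ⟨⟨g, hg, rfl⟩, h⟩
      exact ⟨g, ⟨hg, h⟩, rfl⟩

theorem lieDim_map_conj (H : Subgroup (SU n)) (g : SU n) :
    lieDim (H.map (MulAut.conj g).toMonoidHom) = lieDim H := by
  have e1 : (g : Matrix (Fin n) (Fin n) ℂ) * (g⁻¹ : SU n) = 1 := by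
    rw [← Submonoid.coe_mul, mul_inv_cancel]; rfl
  have e2 : ((g⁻¹ : SU n) : Matrix (Fin n) (Fin n) ℂ) * g = 1 := by
    rw [← Submonoid.coe_mul, inv_mul_cancel]; rfl
  let u : (Matrix (Fin n) (Fin n) ℂ)ˣ := ⟨g, (g⁻¹ : SU n), e1, e2⟩
  let c : Matrix (Fin n) (Fin n) ℂ ≃ₗ[ℝ] Matrix (Fin n) (Fin n) ℂ :=
    { toFun := fun Y => u * Y * (u⁻¹ : (Matrix (Fin n) (Fin n) ℂ)ˣ)
      invFun := fun Y => (u⁻¹ : (Matrix (Fin n) (Fin n) ℂ)ˣ) * Y * u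
      left_inv := fun Y => by
        simp only [mul_assoc, Units.inv_mul, mul_one, Units.inv_mul_cancel_left]
      right_inv := fun Y => by
        simp only [mul_assoc, Units.mul_inv, mul_one, Units.mul_inv_cancel_left]
      map_add' := fun X Y => by simp [mul_add, add_mul]
      map_smul' := fun t Y => by simp }
  have hexp : ∀ (t : ℝ) Y, exp (t • c Y) = c (exp (t • Y)) := fun t Y => by
    rw [← map_smul]
    exact Matrix.exp_units_conj u (t • Y)
  have h : lieAlg (H.map (MulAut.conj g).toMonoidHom) = (lieAlg H).map c.toLinearMap := by
    rw [lieAlg, lieAlg, Submodule.map_span]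
    congr 1
    ext X
    constructor
    · intro hX
      refine ⟨c.symm X, fun t => ?_, c.apply_symm_apply X⟩
      obtain ⟨_, ⟨k, hk, rfl⟩, hkX⟩ := hX t
      refine ⟨k, hk, c.injective ?_⟩
      rw [← hexp, c.apply_symm_apply, ← hkX]
      rfl
    · rintro ⟨Y, hY, rfl⟩ t
      obtain ⟨k, hk, hkY⟩ := hY t
      refine ⟨_, ⟨k, hk, rfl⟩, ?_⟩
      change _ = exp (t • c Y)
      rw [hexp, ← hkY]
      rfl
  rw [lieDim, lieDim, h]
  exact c.finrank_map_eq (lieAlg H)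

/-- The orbits of a cohomogeneity-one Lagrangian have codimension one in it. -/
theorem IsCohomogeneityOneLagrangian.finrank_orbitTangent {G : Subgroup (SU n)}
    (hG : IsCompact (G : Set (SU n))) {L : Set (Cn n)} (hL : IsCohomogeneityOneLagrangian G L) :
    ∃ z ∈ L, Module.finrank ℝ (orbitTangent (opSet G) z) + 1 = n := by
  obtain ⟨⟨z, hz⟩, -, -, H, -, hH, hdim⟩ := hL
  obtain ⟨g, -, hg⟩ := hH z hz
  refine ⟨z, hz, ?_⟩
  have h1 := lieDim_eq_add hG z
  rw [hg, lieDim_map_conj] at h1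
  omega

/-- The group generated by `S` and `-1`. -/
def symmetrize (S : Set (Endo n)) : Set (Endo n) := S ∪ -S

theorem IsUnitaryGroup.symmetrize {S : Set (Endo n)} (hS : IsUnitaryGroup S) :
    IsUnitaryGroup (symmetrize S) := by
  have hc : IsCompact (LagTrans.symmetrize S) := hS.isCompact.union hS.isCompact.neg
  refine { isClosed := hc.isClosed, one_mem := Or.inl hS.one_mem, mul_mem := ?_, exists_inv := ?_,
           isCompact := hc, inner_map := ?_ }
  · rintro a b (ha | ha) (hb | hb)
    · exact Or.inl (hS.mul_mem ha hb)
    · refine Or.inr ?_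
      have := hS.mul_mem ha hb
      rwa [mul_neg] at this
    · refine Or.inr ?_
      have := hS.mul_mem ha hb
      rwa [neg_mul] at this
    · refine Or.inl ?_
      have := hS.mul_mem ha hb
      rwa [neg_mul_neg] at this
  · rintro a (ha | ha)
    · obtain ⟨b, hb, h⟩ := hS.exists_inv ha
      exact ⟨b, Or.inl hb, h⟩
    · obtain ⟨b, hb, h1, h2⟩ := hS.exists_inv ha
      refine ⟨-b, Or.inr (by simpa using hb), ?_, ?_⟩
      · rw [← h1]; ext v : 1; simp
      · rw [← h2]; ext v : 1; simp
  · rintro A (hA | hA) v w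
    · exact hS.inner_map hA v w
    · have := hS.inner_map hA v w
      simpa using this

/-- exp(tX) is the square of exp(tX/2), and the square of an element of S ∪ -S lies in S. -/
theorem IsUnitaryGroup.expAlg_symmetrize {S : Set (Endo n)} (hS : IsUnitaryGroup S) :
    expAlg (LagTrans.symmetrize S) = expAlg S := by
  ext X
  rw [hS.mem_expAlg, hS.symmetrize.mem_expAlg]
  refine ⟨fun h t => ?_, fun h t => Or.inl (h t)⟩
  have e : exp (t • X) = exp ((t / 2) • X) * exp ((t / 2) • X) := by
    rw [← exp_add_smul, add_halves]
  rw [e]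
  rcases h (t / 2) with h1 | h1
  · exact hS.mul_mem h1 h1
  · rw [← neg_mul_neg]
    exact hS.mul_mem h1 h1

theorem IsUnitaryGroup.isNull_symmetrize {S : Set (Endo n)} (hS : IsUnitaryGroup S) {v : Cn n}
    (hv : IsNull S v) : IsNull (LagTrans.symmetrize S) v := by
  unfold IsNull
  rw [hS.expAlg_symmetrize]
  exact hv

theorem IsUnitaryGroup.orbitTangent_symmetrize {S : Set (Endo n)} (hS : IsUnitaryGroup S)
    (v : Cn n) : orbitTangent (LagTrans.symmetrize S) v = orbitTangent S v := by
  unfold orbitTangent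
  rw [hS.expAlg_symmetrize]

theorem mem_orbitOf_symmetrize {S : Set (Endo n)} {v q : Cn n} :
    q ∈ orbitOf (symmetrize S) v ↔ q ∈ orbitOf S v ∨ -q ∈ orbitOf S v := by
  constructor
  · rintro ⟨A, hA | hA, rfl⟩
    · exact Or.inl ⟨A, hA, rfl⟩
    · exact Or.inr ⟨-A, hA, by simp⟩
  · rintro (⟨A, hA, rfl⟩ | ⟨A, hA, h⟩)
    · exact ⟨A, Or.inl hA, rfl⟩
    · refine ⟨-A, Or.inr (by simpa using hA), ?_⟩
      have h' : A v = -q := h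
      simp [h']

/-- The determinant is 1 on the group and (-1)^n on its negatives. Its being real is enough to
preserve the phase condition, where any real factor is allowed. -/
theorem det_symm_opSet {G : Subgroup (SU n)} {A : Endo n} (hA : A ∈ symmetrize (opSet G)) :
    ∃ R : ℝ, ((toEndo n).symm A).det = R := by
  have h1 : ∀ B ∈ opSet G, ((toEndo n).symm B).det = 1 := by
    rintro _ ⟨g, -, rfl⟩
    simp only [StarAlgEquiv.symm_apply_apply]
    exact (Matrix.mem_specialUnitaryGroup_iff.1 g.2).2
  rcases hA with hA | hA
  · exact ⟨1, by rw [h1 A hA]; simp⟩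
  · refine ⟨(-1) ^ n, ?_⟩
    have h2 := h1 _ hA
    rw [map_neg, Matrix.det_neg] at h2
    have h3 : ((-1 : ℂ) ^ n) * ((-1 : ℂ) ^ n) = 1 := by
      rw [← mul_pow]; simp
    rw [Fintype.card_fin] at h2
    push_cast
    calc ((toEndo n).symm A).det = ((-1 : ℂ) ^ n * (-1) ^ n) * ((toEndo n).symm A).det := by
          rw [h3, one_mul]
      _ = (-1) ^ n * ((-1) ^ n * ((toEndo n).symm A).det) := by ring
      _ = (-1) ^ n := by rw [h2, mul_one]

theorem orbitTangent_smul (S : Set (Endo n)) (c : ℂ) (v : Cn n) :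
    orbitTangent S (c • v) =
      (orbitTangent S v).map ((LinearMap.lsmul ℂ (Cn n) c).restrictScalars ℝ) := by
  rw [orbitTangent, orbitTangent, ← Submodule.map_comp]
  congr 1
  ext X : 1
  simp

theorem finrank_orbitTangent_smul (S : Set (Endo n)) {c : ℂ} (hc : c ≠ 0) (v : Cn n) :
    Module.finrank ℝ (orbitTangent S (c • v)) = Module.finrank ℝ (orbitTangent S v) := by
  rw [orbitTangent_smul]
  refine (LinearEquiv.finrank_eq (Submodule.equivMapOfInjective _ ?_ _)).symm
  intro x y h
  simpa [hc] using h

end MatrixGroups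

end LagTrans

end

/-! ### Haar measure on the operator group and the volume of small balls -/

noncomputable section

namespace LagTrans

section InvariantMeasures

open Filter MeasureTheory Metric

variable {n : ℕ}

instance : ProperSpace (Endo n) := FiniteDimensional.proper ℝ (Endo n)

instance : SecondCountableTopology (Endo n) := secondCountable_of_proper

/-- A probability measure on a group of endomorphisms which is invariant under left
translations. -/
structure IsInvariantMeasure (S : Set (Endo n)) (ν : Measure (Endo n)) : Prop where
  isProbabilityMeasure : IsProbabilityMeasure ν
  ae_mem : ∀ᵐ A ∂ν, A ∈ S
  map_mul_left : ∀ A ∈ S, ν.map (fun X => A * X) = ν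

theorem continuous_inv_SU : Continuous fun g : SU n => g⁻¹ :=
  (continuous_star.comp continuous_subtype_val).subtype_mk _

theorem exists_isInvariantMeasure {G : Subgroup (SU n)} (hG : IsCompact (G : Set (SU n))) :
    ∃ ν, IsInvariantMeasure (opSet G) ν := by
  have : CompactSpace G := isCompact_iff_compactSpace.1 hG
  have : IsTopologicalGroup G :=
    { continuous_mul := ((continuous_subtype_val.comp continuous_fst).mul
        (continuous_subtype_val.comp continuous_snd)).subtype_mk _
      continuous_inv := (continuous_inv_SU.comp continuous_subtype_val).subtype_mk _ }
  let _ : MeasurableSpace G := borel G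
  have : BorelSpace G := ⟨rfl⟩
  let μ : Measure G := Measure.haarMeasure ⊤
  let ι : G → Endo n := fun g => toEndo n ((g : SU n) : Matrix (Fin n) (Fin n) ℂ)
  have hι : Continuous ι := continuous_toEndo.comp (continuous_subtype_val.comp continuous_subtype_val)
  refine ⟨μ.map ι, ?_, ?_, ?_⟩
  · have : IsProbabilityMeasure μ := ⟨by
      have := Measure.haarMeasure_self (K₀ := (⊤ : TopologicalSpace.PositiveCompacts G))
      simpa using this⟩
    exact Measure.isProbabilityMeasure_map hι.measurable.aemeasurable
  · refine (ae_map_iff (p := fun A => A ∈ opSet G) hι.measurable.aemeasurable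
      (isUnitaryGroup_opSet hG).isClosed.measurableSet).2 ?_
    exact Eventually.of_forall fun g => ⟨g, g.2, rfl⟩
  · rintro _ ⟨g, hg, rfl⟩
    have hT : Measurable fun X : Endo n => toEndo n (g : Matrix (Fin n) (Fin n) ℂ) * X :=
      (continuous_const.mul continuous_id).measurable
    refine (Measure.map_map hT hι.measurable).trans ?_
    have h1 : (fun X => toEndo n (g : Matrix (Fin n) (Fin n) ℂ) * X) ∘ ι =
        ι ∘ fun x : G => (⟨g, hg⟩ : G) * x := by
      ext x : 1
      simp [ι]
    have h2 := map_mul_left_eq_self μ (⟨g, hg⟩ : G)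
    have hT' : Measurable fun x : G => (⟨g, hg⟩ : G) * x :=
      (continuous_const.mul continuous_id).measurable
    rw [h1, ← Measure.map_map hι.measurable hT', h2]

theorem IsUnitaryGroup.norm_le_one {S : Set (Endo n)} (hS : IsUnitaryGroup S) {A : Endo n}
    (hA : A ∈ S) : ‖A‖ ≤ 1 :=
  A.opNorm_le_bound zero_le_one fun v => by rw [hS.norm_map hA, one_mul]

/-- The volume of small balls in a compact group is at least polynomial in the radius. -/
theorem IsInvariantMeasure.exists_le_measure_closedBall {S : Set (Endo n)} (hS : IsUnitaryGroup S)
    {ν : Measure (Endo n)} (hν : IsInvariantMeasure S ν) :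
    ∃ c > 0, ∃ D : ℕ, ∀ r : ℝ, 0 < r → r ≤ 1 → c * r ^ D ≤ ν.real (closedBall 1 r) := by
  have := hν.isProbabilityMeasure
  let lam : Measure (Endo n) := Measure.addHaar
  set D := Module.finrank ℝ (Endo n) with hD
  -- A ball that meets `S` lies in a ball of twice the radius about a point of `S`, which can be
  -- translated to 1; every other ball is null.
  have htrans : ∀ x : Endo n, ∀ r : ℝ, ν (closedBall x r) ≤ ν (closedBall 1 (2 * r)) := by
    intro x r
    by_cases h : ∃ A ∈ S, A ∈ closedBall x r
    · obtain ⟨A, hA, hAx⟩ := h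
      obtain ⟨B, hB, hAB, hBA⟩ := hS.exists_inv hA
      calc ν (closedBall x r) ≤ ν (closedBall A (2 * r)) :=
            measure_mono (closedBall_subset_closedBall' (by
              rw [mem_closedBall, dist_comm] at hAx; linarith))
        _ = (ν.map fun X => A * X) (closedBall A (2 * r)) := by rw [hν.map_mul_left A hA]
        _ = ν ((fun X => A * X) ⁻¹' closedBall A (2 * r)) :=
            Measure.map_apply (continuous_const.mul continuous_id).measurable
              isClosed_closedBall.measurableSet
        _ ≤ ν (closedBall 1 (2 * r)) := measure_mono fun X hX => by
            rw [Set.mem_preimage, mem_closedBall, dist_eq_norm] at hX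
            rw [mem_closedBall, dist_eq_norm]
            have e : X - 1 = B * (A * X - A) := by
              rw [mul_sub, ← mul_assoc, hBA, one_mul]
            rw [e]
            calc ‖B * (A * X - A)‖ ≤ ‖B‖ * ‖A * X - A‖ := norm_mul_le _ _
              _ ≤ 1 * ‖A * X - A‖ := by gcongr; exact hS.norm_le_one hB
              _ ≤ 2 * r := by rwa [one_mul]
    · have : ν (closedBall x r) = 0 := by
        refine measure_mono_null (t := Sᶜ) (fun A hA hAS => h ⟨A, hAS, hA⟩) ?_
        exact hν.ae_mem
      rw [this]; exact zero_le
  -- By Fubini the integral of ν(B(x, r)) over Lebesgue measure is the Lebesgue volume of one ball,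
  -- a multiple of r^D. For r ≤ 1 the integrand is at most ν(B(1, 2r)) and vanishes outside the ball
  -- of radius 2, which bounds ν(B(1, 2r)) from below without any smooth structure on `S`.
  have hfub : ∀ r : ℝ, ∫⁻ x, ν (closedBall x r) ∂lam = lam (closedBall 0 r) := by
    intro r
    have hmeas : MeasurableSet {p : Endo n × Endo n | dist p.1 p.2 ≤ r} :=
      (isClosed_le continuous_dist continuous_const).measurableSet
    have h1 : ∀ x, ν (closedBall x r) =
        ∫⁻ A, {p : Endo n × Endo n | dist p.1 p.2 ≤ r}.indicator 1 (x, A) ∂ν := by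
      intro x
      rw [← lintegral_indicator_one isClosed_closedBall.measurableSet]
      refine lintegral_congr fun A => ?_
      simp only [Set.indicator, mem_closedBall, Set.mem_ofPred_eq, dist_comm A x]
      rfl
    have h2 : ∀ A, ∫⁻ x, {p : Endo n × Endo n | dist p.1 p.2 ≤ r}.indicator 1 (x, A) ∂lam =
        lam (closedBall 0 r) := by
      intro A
      rw [← Measure.addHaar_closedBall_center lam A r,
        ← lintegral_indicator_one isClosed_closedBall.measurableSet]
      refine lintegral_congr fun x => ?_
      simp only [Set.indicator, mem_closedBall, Set.mem_ofPred_eq]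
      rfl
    simp_rw [h1]
    rw [lintegral_lintegral_swap]
    · simp_rw [h2]; simp
    · exact (measurable_one.indicator hmeas).aemeasurable
  have hbound : ∀ r : ℝ, r ≤ 1 →
      lam (closedBall 0 r) ≤ ν (closedBall 1 (2 * r)) * lam (closedBall 0 2) := by
    intro r hr
    rw [← hfub r]
    calc ∫⁻ x, ν (closedBall x r) ∂lam
        ≤ ∫⁻ x, (closedBall (0 : Endo n) 2).indicator (fun _ => ν (closedBall 1 (2 * r))) x ∂lam := by
          refine lintegral_mono fun x => ?_
          by_cases hx : x ∈ closedBall (0 : Endo n) 2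
          · rw [Set.indicator_of_mem hx]; exact htrans x r
          · rw [Set.indicator_of_notMem hx]
            refine (measure_mono_null (t := Sᶜ) (fun A hA hAS => hx ?_) hν.ae_mem).le
            have h1 := hS.norm_le_one hAS
            rw [mem_closedBall, dist_eq_norm] at hA
            rw [mem_closedBall, dist_zero_right]
            have h2 := norm_sub_norm_le x A
            rw [← norm_neg (A - x), neg_sub] at hA
            linarith
      _ = _ := lintegral_indicator_const isClosed_closedBall.measurableSet _
  have hpos : 0 < lam.real (ball 0 1) :=
    ENNReal.toReal_pos (measure_ball_pos lam _ one_pos).ne' measure_ball_lt_top.ne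
  have hpos2 : 0 < lam.real (closedBall 0 2) :=
    ENNReal.toReal_pos (measure_closedBall_pos lam _ two_pos).ne' measure_closedBall_lt_top.ne
  refine ⟨(1 / 2) ^ D * lam.real (ball 0 1) / lam.real (closedBall 0 2), by positivity, D,
    fun r hr hr1 => ?_⟩
  have h1 := hbound (r / 2) (by linarith)
  rw [Measure.addHaar_closedBall lam _ (by positivity : (0 : ℝ) ≤ r / 2), mul_div_cancel₀ r two_ne_zero] at h1
  have h2 := ENNReal.toReal_mono (ENNReal.mul_ne_top (measure_ne_top _ _) measure_closedBall_lt_top.ne) h1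
  rw [ENNReal.toReal_mul, ENNReal.toReal_mul, ENNReal.toReal_ofReal (by positivity)] at h2
  change (r / 2) ^ D * lam.real (ball 0 1) ≤ ν.real (closedBall 1 r) * lam.real (closedBall 0 2) at h2
  rw [div_mul_eq_mul_div, div_le_iff₀ hpos2]
  refine le_trans (le_of_eq ?_) h2
  rw [div_pow, div_pow]; ring

end InvariantMeasures

end LagTrans

end

/-! ### Averages of powers at a null vector do not decay exponentially -/

noncomputable section

namespace LagTrans

section Return

open Filter MeasureTheory Metric NormedSpace

variable {n : ℕ}

theorem IsInvariantMeasure.integrable {S : Set (Endo n)} (hS : IsUnitaryGroup S)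
    {ν : Measure (Endo n)} (hν : IsInvariantMeasure S ν) {f : Endo n → ℂ} (hf : Continuous f) :
    Integrable f ν := by
  have := hν.isProbabilityMeasure
  obtain ⟨C, hC⟩ := hS.isCompact.exists_bound_of_continuousOn hf.continuousOn
  refine Integrable.of_bound hf.aestronglyMeasurable C ?_
  filter_upwards [hν.ae_mem] with A hA using hC A hA

theorem norm_one_add_pow_sub_one_le (z : ℂ) (N : ℕ) : ‖(1 + z) ^ N - 1‖ ≤ (1 + ‖z‖) ^ N - 1 := by
  induction N with
  | zero => simp
  | succ N ih =>
    have e : (1 + z) ^ (N + 1) - 1 = (1 + z) * ((1 + z) ^ N - 1) + z := by ring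
    have h1 : ‖1 + z‖ ≤ 1 + ‖z‖ := by simpa using norm_add_le (1 : ℂ) z
    have h2 : (0 : ℝ) ≤ (1 + ‖z‖) ^ N - 1 := (norm_nonneg _).trans ih
    calc ‖(1 + z) ^ (N + 1) - 1‖ ≤ ‖1 + z‖ * ‖(1 + z) ^ N - 1‖ + ‖z‖ := by
          rw [e]; refine (norm_add_le _ _).trans ?_
          rw [norm_mul]
      _ ≤ (1 + ‖z‖) * ((1 + ‖z‖) ^ N - 1) + ‖z‖ := by gcongr
      _ = (1 + ‖z‖) ^ (N + 1) - 1 := by ring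

/-- Powers of complex numbers close to the real axis have positive real part. -/
theorem le_re_pow {w : ℂ} {N : ℕ} (hw : 0 < w.re) (h : N * |w.im| ≤ w.re / 2) :
    w.re ^ N / 4 ≤ (w ^ N).re := by
  set z : ℂ := ((w.im / w.re : ℝ) : ℂ) * Complex.I with hz
  have e : w = (w.re : ℂ) * (1 + z) := by
    apply Complex.ext
    · simp [hz]
    · simp [hz, mul_div_cancel₀ _ hw.ne']
  have hzn : N * ‖z‖ ≤ 1 / 2 := by
    rw [hz, norm_mul, Complex.norm_I, mul_one, Complex.norm_real, Real.norm_eq_abs, abs_div,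
      abs_of_pos hw, mul_div_assoc', div_le_iff₀ hw]
    linarith
  -- The bound is (1 + |z|)^N - 1 ≤ e^{N|z|} - 1 ≤ e^{1/2} - 1 ≤ 3/4, which leaves a real part of at
  -- least 1/4.
  have h1 : ‖(1 + z) ^ N - 1‖ ≤ 3 / 4 := by
    have h2 : (1 + ‖z‖) ^ N ≤ Real.exp (1 / 2) := by
      calc (1 + ‖z‖) ^ N ≤ Real.exp ‖z‖ ^ N := by
            gcongr; rw [add_comm]; exact Real.add_one_le_exp _
        _ = Real.exp (N * ‖z‖) := by rw [← Real.exp_nat_mul]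
        _ ≤ _ := Real.exp_le_exp.2 hzn
    have h3 : Real.exp (1 / 2) ^ 2 < 2.7182818286 := by
      rw [← Real.exp_nat_mul]; rw [show ((2 : ℕ) : ℝ) * (1 / 2) = 1 by norm_num]; exact Real.exp_one_lt_d9
    have h4 : Real.exp (1 / 2) ≤ 7 / 4 := by
      by_contra hcon
      push Not at hcon
      nlinarith
    linarith [norm_one_add_pow_sub_one_le z N]
  have h2 : (1 / 4 : ℝ) ≤ ((1 + z) ^ N).re := by
    have h3 := (Complex.abs_re_le_norm _).trans h1
    rw [Complex.sub_re, Complex.one_re, abs_le] at h3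
    linarith
  have h3 : (w ^ N).re = w.re ^ N * ((1 + z) ^ N).re := by
    conv_lhs => rw [e, mul_pow, ← Complex.ofReal_pow, Complex.re_ofReal_mul]
  rw [h3]
  have : 0 ≤ w.re ^ N := by positivity
  nlinarith

/-- The imaginary part of `⟪exp(X) u, u⟫` vanishes to third order at zeros of the moment map. -/
theorem IsUnitaryGroup.abs_im_inner_exp_le {S : Set (Endo n)} (hS : IsUnitaryGroup S) {u : Cn n}
    (hu1 : ‖u‖ = 1) (hu : IsNull S u) {X : Endo n} (hX : X ∈ expAlg S) :
    |(inner ℂ (exp X u) u).im| ≤ ‖X‖ ^ 3 := by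
  have hd : ∀ (w : Cn n) (t : ℝ), HasDerivAt (fun t : ℝ => (inner ℂ (exp (t • X) w) u).im)
      (inner ℂ (exp (t • X) (X w)) u).im t := by
    intro w t
    have h1 := (hasDerivAt_exp_smul_apply X w t).inner ℂ (hasDerivAt_const t u)
    have h2 := Complex.imCLM.hasFDerivAt.comp_hasDerivAt t h1
    simpa [Function.comp_def] using h2
  -- One Taylor step by the mean value inequality. It is applied to X²u, Xu and u in turn; the
  -- initial values vanish since ⟨X²u, u⟩ = -|Xu|² is real, ⟨Xu, u⟩ = 0 by nullity, and ⟨u, u⟩ is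
  -- real.
  have hstep : ∀ (w : Cn n) (C : ℝ), (inner ℂ w u).im = 0 →
      (∀ t ∈ Set.Icc (0 : ℝ) 1, |(inner ℂ (exp (t • X) (X w)) u).im| ≤ C) →
      ∀ t ∈ Set.Icc (0 : ℝ) 1, |(inner ℂ (exp (t • X) w) u).im| ≤ C := by
    intro w C h0 hb t ht
    have h1 := (convex_Icc (0 : ℝ) 1).norm_image_sub_le_of_norm_hasDerivWithin_le
      (f := fun t : ℝ => (inner ℂ (exp (t • X) w) u).im) (fun s hs => (hd w s).hasDerivWithinAt)
      (fun s hs => hb s hs) (Set.left_mem_Icc.2 zero_le_one) ht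
    simp only [zero_smul, exp_zero, one_apply_eq_self, h0, sub_zero, Real.norm_eq_abs] at h1
    have h2 : |t| ≤ 1 := by rw [abs_of_nonneg ht.1]; exact ht.2
    have h3 : 0 ≤ C := (abs_nonneg _).trans (hb t ht)
    nlinarith
  have h3 : ∀ t ∈ Set.Icc (0 : ℝ) 1, |(inner ℂ (exp (t • X) (X (X (X u)))) u).im| ≤ ‖X‖ ^ 3 := by
    intro t _
    calc |(inner ℂ (exp (t • X) (X (X (X u)))) u).im|
        ≤ ‖inner ℂ (exp (t • X) (X (X (X u)))) u‖ := Complex.abs_im_le_norm _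
      _ ≤ ‖exp (t • X) (X (X (X u)))‖ * ‖u‖ := norm_inner_le_norm _ _
      _ = ‖X (X (X u))‖ := by rw [hS.norm_map (hS.mem_expAlg.1 hX t), hu1, mul_one]
      _ ≤ ‖X‖ * (‖X‖ * (‖X‖ * ‖u‖)) := by
          refine (X.le_opNorm _).trans ?_
          gcongr
          refine (X.le_opNorm _).trans ?_
          gcongr
          exact X.le_opNorm _
      _ = ‖X‖ ^ 3 := by rw [hu1]; ring
  have e0 : (inner ℂ u u).im = 0 := by
    rw [inner_self_eq_norm_sq_to_K, hu1]; simp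
  have e1 : (inner ℂ (X u) u).im = 0 := by
    rw [hS.skew hX, hu X hX]; simp
  have e2 : (inner ℂ (X (X u)) u).im = 0 := by
    rw [hS.skew hX, inner_self_eq_norm_sq_to_K, Complex.neg_im, neg_eq_zero]
    norm_cast
  have h := hstep u _ e0 (hstep (X u) _ e1 (hstep (X (X u)) _ e2 h3)) 1 (by simp)
  simpa using h

theorem exists_mul_norm_le {E F : Type*} [NormedAddCommGroup F] [NormedSpace ℝ F]
    [FiniteDimensional ℝ F] [NormedAddCommGroup E] [NormedSpace ℝ E] (W : Submodule ℝ F)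
    (e : F →L[ℝ] E) (he : ∀ x ∈ W, e x = 0 → x = 0) : ∃ c > 0, ∀ x ∈ W, c * ‖x‖ ≤ ‖e x‖ := by
  have hinj : LinearMap.ker ((e.comp W.subtypeL : W →L[ℝ] E) : W →ₗ[ℝ] E) = ⊥ :=
    LinearMap.ker_eq_bot'.2 fun x hx => Subtype.ext (he x x.2 hx)
  obtain ⟨K, hK, hKa⟩ := LinearMap.exists_antilipschitzWith _ hinj
  refine ⟨(K : ℝ)⁻¹, by positivity, fun x hx => ?_⟩
  have h := hKa.le_mul_dist ⟨x, hx⟩ 0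
  simp only [dist_zero_right, map_zero] at h
  rw [inv_mul_le_iff₀ (by positivity)]
  exact h

/-- The imaginary part of `⟪A u, u⟫` is cubic in the displacement of `u`. -/
theorem IsUnitaryGroup.exists_abs_im_inner_le {S : Set (Endo n)} (hS : IsUnitaryGroup S) {u : Cn n}
    (hu1 : ‖u‖ = 1) (hu : IsNull S u) :
    ∃ C : ℝ, 0 ≤ C ∧ ∀ A ∈ S, |(inner ℂ (A u) u).im| ≤ C * ‖A u - u‖ ^ 3 := by
  -- Along the slice |X| is controlled by the displacement |Au - u|, so the cubic bound in X becomes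
  -- one in the displacement. Away from `u` the trivial bound 1 suffices, which accounts for the
  -- summand (1/δ)³.
  obtain ⟨W, hWS, hW0, -, hslice⟩ := hS.exists_slice u
  obtain ⟨c, hc, hcW⟩ : ∃ c > 0, ∀ X ∈ W, c * ‖X‖ ≤ ‖X u‖ :=
    exists_mul_norm_le W (evalAt u) hW0
  have hlo : ∀ᶠ X in 𝓝 (0 : Endo n), ‖exp X - 1 - X‖ ≤ c / 2 * ‖X‖ := by
    have h := ((hasStrictFDerivAt_exp_zero (𝕂 := ℝ) (𝔸 := Endo n)).hasFDerivAt.isLittleO).def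
      (half_pos hc)
    simpa [exp_zero] using h
  have hev := hslice _ hlo
  obtain ⟨δ, hδ, hball⟩ := Metric.eventually_nhds_iff.1 (eventually_nhdsWithin_iff.1 hev)
  refine ⟨(2 / c) ^ 3 + (1 / δ) ^ 3, by positivity, fun A hA => ?_⟩
  by_cases hd : ‖A u - u‖ < δ
  · obtain ⟨X, hXW, hX, hAX⟩ := hball (by rwa [dist_eq_norm]) ⟨A, hA, rfl⟩
    have hX' : ‖exp X - 1 - X‖ ≤ c / 2 * ‖X‖ := hX
    replace hAX : A u = exp X u := hAX
    have h1 := hcW X hXW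
    have h2 : ‖X u‖ ≤ ‖A u - u‖ + c / 2 * ‖X‖ := by
      have e : X u = (A u - u) - (exp X - 1 - X) u := by
        rw [hAX]; simp
      calc ‖X u‖ ≤ ‖A u - u‖ + ‖(exp X - 1 - X) u‖ := by rw [e]; exact norm_sub_le _ _
        _ ≤ _ := by
          gcongr
          refine ((exp X - 1 - X).le_opNorm u).trans ?_
          rwa [hu1, mul_one]
    have h3 : ‖X‖ ≤ 2 / c * ‖A u - u‖ := by
      rw [div_mul_eq_mul_div, le_div_iff₀ hc]; nlinarith
    have h4 := hS.abs_im_inner_exp_le hu1 hu (hWS hXW)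
    rw [← hAX] at h4
    calc |(inner ℂ (A u) u).im| ≤ ‖X‖ ^ 3 := h4
      _ ≤ (2 / c * ‖A u - u‖) ^ 3 := by gcongr
      _ = (2 / c) ^ 3 * ‖A u - u‖ ^ 3 := by ring
      _ ≤ _ := by gcongr; simp; positivity
  · push Not at hd
    have h1 : |(inner ℂ (A u) u).im| ≤ 1 := by
      refine (Complex.abs_im_le_norm _).trans ((norm_inner_le_norm _ _).trans ?_)
      rw [hS.norm_map hA, hu1, mul_one]
    have h2 : 1 ≤ (1 / δ) ^ 3 * ‖A u - u‖ ^ 3 := by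
      rw [← mul_pow]
      refine one_le_pow₀ ?_
      rw [one_div, inv_mul_eq_div, one_le_div hδ]; exact hd
    refine (h1.trans h2).trans ?_
    gcongr
    simp; positivity

theorem false_of_pow_le {c p q : ℝ} {D : ℕ} (hc : 0 < c) (hp0 : 0 ≤ p) (hp : p < 1) (hq0 : 0 ≤ q)
    (hq : q < 1) (h : ∀ M : ℕ, 1 ≤ M → c ≤ (M : ℝ) ^ D * p ^ M + (M : ℝ) ^ D * q ^ M) : False := by
  have h1 := (tendsto_pow_const_mul_const_pow_of_abs_lt_one D (r := p) (by rwa [abs_of_nonneg hp0])).add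
    (tendsto_pow_const_mul_const_pow_of_abs_lt_one D (r := q) (by rwa [abs_of_nonneg hq0]))
  have h2 := ge_of_tendsto h1 (eventually_atTop.2 ⟨1, h⟩)
  linarith

/-- For a unit zero `u` of the moment map the averages of the powers of `⟪A u, u⟫` do not decay
exponentially. -/
theorem IsInvariantMeasure.exists_lt_norm_integral_pow {S : Set (Endo n)} (hS : IsUnitaryGroup S)
    {ν : Measure (Endo n)} (hν : IsInvariantMeasure S ν) {u : Cn n} (hu1 : ‖u‖ = 1)
    (hu : IsNull S u) {ρ : ℝ} (hρ0 : 0 ≤ ρ) (hρ : ρ < 1) :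
    ∃ k : ℕ, 1 ≤ k ∧ ρ ^ k < ‖∫ A, (inner ℂ (A u) u) ^ k ∂ν‖ := by
  -- Two estimates of ∫ ((1 + ⟨Au, u⟩)/2)^N are compared for N = M⁶. If every moment were at most
  -- ρ^k, the binomial theorem would bound it by ((1 + ρ)/2)^N. But near A = 1 the integrand has
  -- real part bounded below, so the integral is at least polynomial in 1/M up to an exponentially
  -- small error.
  by_contra hcon
  push Not at hcon
  have := hν.isProbabilityMeasure
  obtain ⟨C, hC0, hC⟩ := hS.exists_abs_im_inner_le hu1 hu
  obtain ⟨c, hc, D, hvol⟩ := hν.exists_le_measure_closedBall hS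
  set φ : Endo n → ℂ := fun A => inner ℂ (A u) u with hφ
  have hφc : Continuous φ := (evalAt u).continuous.inner continuous_const
  have hint : ∀ f : Endo n → ℂ, Continuous f → Integrable f ν := fun f hf => hν.integrable hS hf
  have hak : ∀ k : ℕ, ‖∫ A, φ A ^ k ∂ν‖ ≤ ρ ^ k := by
    intro k
    rcases Nat.eq_zero_or_pos k with rfl | hk
    · simp
    · exact hcon k hk
  -- the upper bound
  have hup : ∀ N : ℕ, ‖∫ A, ((1 + φ A) / 2) ^ N ∂ν‖ ≤ ((1 + ρ) / 2) ^ N := by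
    intro N
    have e : ∀ A, ((1 + φ A) / 2) ^ N =
        ∑ k ∈ Finset.range (N + 1), (1 / 2) ^ N * (N.choose k : ℂ) * φ A ^ k := by
      intro A
      rw [div_pow, add_comm, add_pow, Finset.sum_div]
      refine Finset.sum_congr rfl fun k _ => ?_
      rw [one_pow, one_div, inv_pow]; ring
    have e' : ((1 + ρ) / 2) ^ N =
        ∑ k ∈ Finset.range (N + 1), (1 / 2) ^ N * (N.choose k : ℝ) * ρ ^ k := by
      rw [div_pow, add_comm, add_pow, Finset.sum_div]
      refine Finset.sum_congr rfl fun k _ => ?_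
      rw [one_pow, one_div, inv_pow]; ring
    simp_rw [e]
    rw [integral_finsetSum _ fun k _ => hint _ (by fun_prop), e']
    refine (norm_sum_le _ _).trans (Finset.sum_le_sum fun k _ => ?_)
    rw [integral_const_mul, norm_mul]
    have h1 : ‖(1 / 2 : ℂ) ^ N * (N.choose k : ℂ)‖ = (1 / 2) ^ N * (N.choose k : ℝ) := by
      simp
    rw [h1]
    gcongr
    exact hak k
  -- Three scales for t = |Au - u| with N = M⁶. For A within a/M³ of 1, Nt² ≤ 1 and Re w^N ≥ 3/16.
  -- For t ≤ a/M², Nt³ ≤ a³, so by the cubic bound w^N stays close to the real axis and Re w^N ≥ 0.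
  -- For t > a/M², |w|^N ≤ exp(-Nt²/8) is exponentially small in M. The choice of `a` ensures a ≤ 1
  -- and C a³ ≤ 1/2.
  set a : ℝ := 1 / (2 * (1 + C)) with ha
  have ha0 : 0 < a := by positivity
  have ha1 : a ≤ 1 := by
    rw [ha, div_le_one (by positivity)]; linarith
  have haC : C * a ^ 3 ≤ 1 / 2 := by
    have h1 : C * a ≤ 1 / 2 := by
      rw [ha, mul_one_div, div_le_div_iff₀ (by positivity) two_pos]; linarith
    have h2 : a ^ 2 ≤ 1 := pow_le_one₀ ha0.le ha1
    nlinarith [sq_nonneg a]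
  -- the lower bound
  have hlow : ∀ M : ℕ, 1 ≤ M → ∀ A ∈ S,
      (closedBall (1 : Endo n) (a / (M : ℝ) ^ 3)).indicator (fun _ => (3 / 16 : ℝ)) A -
        Real.exp (-(a ^ 2 / 8)) ^ M ≤ (((1 + φ A) / 2) ^ (M ^ 6)).re := by
    intro M hM A hA
    have hM' : (1 : ℝ) ≤ M := by exact_mod_cast hM
    have hM0 : (0 : ℝ) < M := by linarith
    set t := ‖A u - u‖ with ht
    set w := (1 + φ A) / 2 with hw
    have hre : (φ A).re = 1 - t ^ 2 / 2 := by
      have h1 := @norm_sub_sq ℂ _ _ _ _ (A u) u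
      rw [hS.norm_map hA, hu1] at h1
      change t ^ 2 = 1 ^ 2 - 2 * (φ A).re + 1 ^ 2 at h1
      linarith
    have hwre : w.re = 1 - t ^ 2 / 4 := by
      rw [hw]; simp [hre]; ring
    have hwim : w.im = (φ A).im / 2 := by
      rw [hw]; simp
    have hφ1 : ‖φ A‖ ≤ 1 := by
      refine (norm_inner_le_norm _ _).trans ?_
      rw [hS.norm_map hA, hu1, mul_one]
    have hwn : ‖w‖ ^ 2 ≤ 1 - t ^ 2 / 4 := by
      have h1 : ‖φ A‖ ^ 2 = (φ A).re ^ 2 + (φ A).im ^ 2 := by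
        rw [← Complex.normSq_eq_norm_sq, Complex.normSq_apply]; ring
      have h2 : ‖w‖ ^ 2 = w.re ^ 2 + w.im ^ 2 := by
        rw [← Complex.normSq_eq_norm_sq, Complex.normSq_apply]; ring
      have h3 : ‖φ A‖ ^ 2 ≤ 1 := pow_le_one₀ (norm_nonneg _) hφ1
      rw [h2, hwre, hwim]
      rw [h1, hre] at h3
      nlinarith
    have htA : t ≤ ‖A - 1‖ := by
      have h1 := (A - 1).le_opNorm u
      rw [hu1, mul_one] at h1
      simpa using h1
    by_cases hsmall : t ≤ a / (M : ℝ) ^ 2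
    · have ht0 : 0 ≤ t := norm_nonneg _
      have ht1 : t ≤ 1 := hsmall.trans ((div_le_self ha0.le (one_le_pow₀ hM')).trans ha1)
      have hw0 : 3 / 4 ≤ w.re := by rw [hwre]; nlinarith
      have hNim : ((M ^ 6 : ℕ) : ℝ) * |w.im| ≤ w.re / 2 := by
        rw [hwim, abs_div, abs_two]
        have h1 := hC A hA
        have h2 : ((M ^ 6 : ℕ) : ℝ) * t ^ 3 ≤ a ^ 3 := by
          push_cast
          calc (M : ℝ) ^ 6 * t ^ 3 ≤ (M : ℝ) ^ 6 * (a / (M : ℝ) ^ 2) ^ 3 := by gcongr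
            _ = a ^ 3 := by field_simp
        have h3 : ((M ^ 6 : ℕ) : ℝ) * |(φ A).im| ≤ C * a ^ 3 := by
          calc ((M ^ 6 : ℕ) : ℝ) * |(φ A).im| ≤ ((M ^ 6 : ℕ) : ℝ) * (C * t ^ 3) := by gcongr
            _ = C * (((M ^ 6 : ℕ) : ℝ) * t ^ 3) := by ring
            _ ≤ _ := by gcongr
        linarith
      have hlow := le_re_pow (by linarith) hNim
      have hexp : 0 ≤ Real.exp (-(a ^ 2 / 8)) ^ M := by positivity
      by_cases hA1 : A ∈ closedBall (1 : Endo n) (a / (M : ℝ) ^ 3)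
      · rw [Set.indicator_of_mem hA1]
        rw [mem_closedBall, dist_eq_norm] at hA1
        have ht3 : t ≤ a / (M : ℝ) ^ 3 := htA.trans hA1
        have hbern : 3 / 4 ≤ w.re ^ (M ^ 6) := by
          have h1 := one_add_mul_le_pow (a := -(t ^ 2 / 4)) (by nlinarith) (M ^ 6)
          have h2 : (M : ℝ) ^ 6 * t ^ 2 ≤ 1 := by
            calc (M : ℝ) ^ 6 * t ^ 2 ≤ (M : ℝ) ^ 6 * (a / (M : ℝ) ^ 3) ^ 2 := by gcongr
              _ = a ^ 2 := by field_simp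
              _ ≤ 1 := pow_le_one₀ ha0.le ha1
          rw [hwre, sub_eq_add_neg]
          refine le_trans ?_ h1
          push_cast
          nlinarith
        linarith
      · rw [Set.indicator_of_notMem hA1]
        have : 0 ≤ w.re ^ (M ^ 6) := pow_nonneg (by linarith) _
        linarith
    · push Not at hsmall
      have hA1 : A ∉ closedBall (1 : Endo n) (a / (M : ℝ) ^ 3) := by
        intro hA1
        rw [mem_closedBall, dist_eq_norm] at hA1
        have h1 : a / (M : ℝ) ^ 3 ≤ a / (M : ℝ) ^ 2 := by
          exact div_le_div_of_nonneg_left ha0.le (by positivity)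
            (pow_le_pow_right₀ hM' (by norm_num))
        linarith
      rw [Set.indicator_of_notMem hA1, zero_sub, neg_le]
      have h1 : -(w ^ (M ^ 6)).re ≤ ‖w‖ ^ (M ^ 6) := by
        rw [← norm_pow]
        exact (neg_le_abs _).trans (Complex.abs_re_le_norm _)
      refine h1.trans ?_
      have h2 : ‖w‖ ≤ Real.exp (-(t ^ 2 / 8)) := by
        rw [← pow_le_pow_iff_left₀ (norm_nonneg _) (Real.exp_pos _).le two_ne_zero]
        refine hwn.trans ?_
        rw [← Real.exp_nat_mul]
        refine le_trans ?_ (Real.add_one_le_exp _)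
        push_cast; linarith
      calc ‖w‖ ^ (M ^ 6) ≤ Real.exp (-(t ^ 2 / 8)) ^ (M ^ 6) := by gcongr
        _ = Real.exp ((M ^ 6 : ℕ) * (-(t ^ 2 / 8))) := by rw [← Real.exp_nat_mul]
        _ ≤ Real.exp (M * (-(a ^ 2 / 8))) := by
            refine Real.exp_le_exp.2 ?_
            have h3 : a ^ 2 ≤ (M : ℝ) ^ 4 * t ^ 2 := by
              calc a ^ 2 = (M : ℝ) ^ 4 * (a / (M : ℝ) ^ 2) ^ 2 := by field_simp
                _ ≤ _ := by gcongr
            have h4 : (M : ℝ) * a ^ 2 ≤ (M : ℝ) ^ 6 * t ^ 2 := by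
              calc (M : ℝ) * a ^ 2 ≤ (M : ℝ) ^ 2 * a ^ 2 := by
                    gcongr; nlinarith
                _ ≤ (M : ℝ) ^ 2 * ((M : ℝ) ^ 4 * t ^ 2) := by gcongr
                _ = _ := by ring
            push_cast
            linarith
        _ = _ := by rw [← Real.exp_nat_mul]
  refine false_of_pow_le (c := 3 / 16 * (c * a ^ D)) (p := Real.exp (-(a ^ 2 / 8)))
    (q := (1 + ρ) / 2) (D := 3 * D) (by positivity) (Real.exp_pos _).le
    (Real.exp_lt_one_iff.2 (by linarith [show 0 < a ^ 2 / 8 by positivity])) (by linarith) (by linarith)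
    fun M hM => ?_
  have hM' : (1 : ℝ) ≤ M := by exact_mod_cast hM
  set r := a / (M : ℝ) ^ 3 with hr
  have hr0 : 0 < r := by positivity
  have hr1 : r ≤ 1 := (div_le_self ha0.le (one_le_pow₀ hM')).trans ha1
  have hI : Integrable (fun A => ((1 + φ A) / 2) ^ (M ^ 6)) ν := hint _ (by fun_prop)
  have hI1 : Integrable ((closedBall (1 : Endo n) r).indicator (fun _ => (3 / 16 : ℝ))) ν :=
    (integrable_const _).indicator isClosed_closedBall.measurableSet
  have h1 : 3 / 16 * ν.real (closedBall (1 : Endo n) r) - Real.exp (-(a ^ 2 / 8)) ^ M ≤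
      (∫ A, ((1 + φ A) / 2) ^ (M ^ 6) ∂ν).re := by
    have h2 : (∫ A, ((1 + φ A) / 2) ^ (M ^ 6) ∂ν).re = ∫ A, (((1 + φ A) / 2) ^ (M ^ 6)).re ∂ν :=
      (integral_re hI).symm
    rw [h2]
    have h3 : ∫ A, ((closedBall (1 : Endo n) r).indicator (fun _ => (3 / 16 : ℝ)) A -
        Real.exp (-(a ^ 2 / 8)) ^ M) ∂ν =
        3 / 16 * ν.real (closedBall (1 : Endo n) r) - Real.exp (-(a ^ 2 / 8)) ^ M := by
      rw [integral_sub hI1 (integrable_const _), integral_indicator isClosed_closedBall.measurableSet]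
      simp [mul_comm]
    rw [← h3]
    refine integral_mono_ae (hI1.sub (integrable_const _)) hI.re ?_
    filter_upwards [hν.ae_mem] with A hA using hlow M hM A hA
  have h4 := ((Complex.re_le_norm _).trans (hup (M ^ 6)))
  have h5 := hvol r hr0 hr1
  have h6 : ((1 + ρ) / 2) ^ (M ^ 6) ≤ ((1 + ρ) / 2) ^ M :=
    pow_le_pow_of_le_one (by linarith) (by linarith) (Nat.le_self_pow (by norm_num) M)
  have h7 : 3 / 16 * (c * r ^ D) ≤ Real.exp (-(a ^ 2 / 8)) ^ M + ((1 + ρ) / 2) ^ M := by linarith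
  have h8 : (M : ℝ) ^ (3 * D) * (3 / 16 * (c * r ^ D)) = 3 / 16 * (c * a ^ D) := by
    rw [hr, div_pow, ← pow_mul]
    field_simp
  rw [← h8, ← mul_add]
  gcongr

end Return

end LagTrans

end

/-! ### Holomorphic invariants and the uniqueness of the orbit dimension -/

noncomputable section

namespace LagTrans

section Invariants

open Filter MeasureTheory Metric NormedSpace

variable {n : ℕ}

/-- The average of the `k`-th power of the linear form `⟪w, ·⟫` over a group. -/
def averagedPower (ν : Measure (Endo n)) (w : Cn n) (k : ℕ) (v : Cn n) : ℂ :=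
  ∫ A, (inner ℂ (A w) v) ^ k ∂ν

theorem averagedPower_smul (ν : Measure (Endo n)) (w : Cn n) (k : ℕ) (c : ℂ) (v : Cn n) :
    averagedPower ν w k (c • v) = c ^ k * averagedPower ν w k v := by
  simp_rw [averagedPower, inner_smul_right, mul_pow]
  exact integral_const_mul _ _

theorem averagedPower_map {S : Set (Endo n)} (hS : IsUnitaryGroup S) {ν : Measure (Endo n)}
    (hν : IsInvariantMeasure S ν) (w : Cn n) (k : ℕ) {B : Endo n} (hB : B ∈ S) (v : Cn n) :
    averagedPower ν w k (B v) = averagedPower ν w k v := by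
  have hc : Continuous fun A : Endo n => (inner ℂ (A w) (B v)) ^ k :=
    ((evalAt w).continuous.inner continuous_const).pow k
  have hm : Measurable fun X : Endo n => B * X := (continuous_const.mul continuous_id).measurable
  unfold averagedPower
  rw [← hν.map_mul_left B hB, integral_map hm.aemeasurable hc.aestronglyMeasurable,
    hν.map_mul_left B hB]
  refine integral_congr_ae (Eventually.of_forall fun A => ?_)
  simp only [mul_apply_eq_comp, hS.inner_map hB]

/-- Expanding the power of the sum in coordinates shows a polynomial in `v` whose coefficients are
averages. -/
theorem differentiable_averagedPower {S : Set (Endo n)} (hS : IsUnitaryGroup S)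
    {ν : Measure (Endo n)} (hν : IsInvariantMeasure S ν) (w : Cn n) (k : ℕ) :
    Differentiable ℂ (averagedPower ν w k) := by
  have e : averagedPower ν w k = fun v : Cn n => ∑ p : Fin k → Fin n,
      (∫ A, ∏ j, (starRingEnd ℂ) (A w (p j)) ∂ν) * ∏ j, v (p j) := by
    ext v
    have h1 : ∀ A : Endo n, (inner ℂ (A w) v) ^ k =
        ∑ p : Fin k → Fin n, (∏ j, (starRingEnd ℂ) (A w (p j))) * ∏ j, v (p j) := by
      intro A
      rw [PiLp.inner_apply, Fintype.sum_pow]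
      refine Finset.sum_congr rfl fun p _ => ?_
      rw [← Finset.prod_mul_distrib]
      refine Finset.prod_congr rfl fun j _ => ?_
      rw [RCLike.inner_apply, mul_comm]
    unfold averagedPower
    simp_rw [h1]
    have hcont : ∀ p : Fin k → Fin n,
        Continuous fun A : Endo n => ∏ j, (starRingEnd ℂ) (A w (p j)) := fun p => by
      refine continuous_finsetProd _ fun j _ => Complex.continuous_conj.comp ?_
      exact (PiLp.continuous_apply 2 (fun _ : Fin n => ℂ) (p j)).comp (evalAt w).continuous
    rw [integral_finsetSum _ fun p _ => (hν.integrable hS (hcont p)).mul_const _]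
    refine Finset.sum_congr rfl fun p _ => ?_
    exact integral_mul_const _ _
  rw [e]
  have hcoord : ∀ i, Differentiable ℂ fun v : Cn n => v i := fun i =>
    (PiLp.proj 2 (𝕜 := ℂ) (fun _ : Fin n => ℂ) i).differentiable
  refine Differentiable.fun_sum fun p _ => Differentiable.const_mul ?_ _
  intro v
  exact (HasFDerivAt.finsetProd fun j _ => (hcoord (p j) v).hasFDerivAt).differentiableAt

theorem eq_of_eq_on_real {f : ℂ → ℂ} (hf : Differentiable ℂ f) {c : ℂ}
    (h : ∀ t : ℝ, f t = c) (ζ : ℂ) : f ζ = c := by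
  have h1 : AnalyticOnNhd ℂ f Set.univ := fun x _ => hf.analyticAt x
  have h2 : AnalyticOnNhd ℂ (fun _ : ℂ => c) Set.univ := fun x _ => analyticAt_const
  have h3 : ∃ᶠ z in 𝓝[≠] (0 : ℂ), f z = c := by
    have ht : Tendsto (fun t : ℝ => (t : ℂ)) (𝓝[≠] 0) (𝓝[≠] 0) := by
      refine tendsto_nhdsWithin_iff.2 ⟨?_, ?_⟩
      · exact (Complex.continuous_ofReal.tendsto' 0 0 rfl).mono_left nhdsWithin_le_nhds
      · filter_upwards [self_mem_nhdsWithin] with t ht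
        simpa using ht
    exact ht.frequently (Frequently.of_forall h)
  exact congrFun (AnalyticOnNhd.eq_of_frequently_eq h1 h2 h3) ζ

/-- Holomorphic invariants are invariant under the complexified group. -/
theorem IsUnitaryGroup.apply_exp_smul {S : Set (Endo n)} (hS : IsUnitaryGroup S) {F : Cn n → ℂ}
    (hF : Differentiable ℂ F) (hinv : ∀ A ∈ S, ∀ v, F (A v) = F v) {Y : Endo n}
    (hY : Y ∈ expAlg S) (v : Cn n) (ζ : ℂ) : F (exp (ζ • Y) v) = F v := by
  refine eq_of_eq_on_real (f := fun ζ : ℂ => F (exp (ζ • Y) v)) ?_ (fun t => ?_) ζ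
  · intro ζ
    have h1 : HasDerivAt (fun ζ : ℂ => exp (ζ • Y) v) ((exp (ζ • Y) * Y) v) ζ :=
      (ContinuousLinearMap.apply ℂ (Cn n) v).hasFDerivAt.comp_hasDerivAt ζ
        (hasDerivAt_exp_smul_const (𝕂 := ℂ) Y ζ)
    exact DifferentiableAt.comp ζ (hF _) h1.differentiableAt
  · have h2 := hinv _ (hS.mem_expAlg.1 hY t) v
    rw [← h2]
    congr 3

theorem hasStrictFDerivAt_exp_mul_exp {𝔸 P : Type*} [NormedRing 𝔸] [NormedAlgebra ℝ 𝔸]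
    [CompleteSpace 𝔸] [NormedAddCommGroup P] [NormedSpace ℝ P] (LX LY : P →L[ℝ] 𝔸) {p₀ : P}
    (hX : LX p₀ = 0) (hY : LY p₀ = 0) :
    HasStrictFDerivAt (fun p => exp (LY p) * exp (LX p)) (LY + LX) p₀ := by
  have hcomp : ∀ q : P →L[ℝ] 𝔸, q p₀ = 0 → HasStrictFDerivAt (fun p => exp (q p)) q p₀ := by
    intro q hq
    have h0 : HasStrictFDerivAt (exp : 𝔸 → 𝔸) (1 : 𝔸 →L[ℝ] 𝔸) (q p₀) := by
      rw [hq]; exact hasStrictFDerivAt_exp_zero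
    exact h0.comp p₀ q.hasStrictFDerivAt
  refine ((hcomp LY hY).mul' (hcomp LX hX)).congr_fderiv ?_
  ext q
  simp [hX, hY, exp_zero, add_comm]

theorem exists_hasStrictFDerivAt_cone {P : Type*} [NormedAddCommGroup P] [NormedSpace ℝ P]
    (LX LY : P →L[ℝ] Endo n) (Lc : P →L[ℝ] ℂ) {p₀ : P} (hX : LX p₀ = 0) (hY : LY p₀ = 0)
    (hc : Lc p₀ = 1) (z : Cn n) :
    ∃ T : P →L[ℝ] Cn n,
      HasStrictFDerivAt (fun p => Lc p • exp (LY p) (exp (LX p) z)) T p₀ ∧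
      ∀ q, T q = LY q z + LX q z + Lc q • z := by
  have hev := (evalAt z).hasStrictFDerivAt.comp p₀ (hasStrictFDerivAt_exp_mul_exp LX LY hX hY)
  have hsm := (Lc.hasStrictFDerivAt (x := p₀)).smul hev
  refine ⟨_, hsm, fun q => ?_⟩
  simp [hX, hY, hc, exp_zero]

/-- The complex cone over an orbit of maximal dimension is open in `ℂ^n`, infinitesimally. -/
theorem IsUnitaryGroup.eventually_mem_cone {S : Set (Endo n)} (hS : IsUnitaryGroup S) {z : Cn n}
    (hz : IsNull S z) (hz0 : z ≠ 0) (hdim : Module.finrank ℝ (orbitTangent S z) + 1 = n) :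
    ∀ᶠ v in 𝓝 z, ∃ c : ℂ, ∃ X ∈ expAlg S, ∃ Y ∈ expAlg S,
      v = c • exp (Complex.I • Y) (exp X z) := by
  obtain ⟨r, hr1, hr2⟩ := exists_projection (expAlg S)
  let iL : Endo n →L[ℝ] Endo n :=
    ((ContinuousLinearMap.lsmul ℂ ℂ Complex.I : Endo n →L[ℂ] Endo n)).restrictScalars ℝ
  let LX : Endo n × Endo n × ℂ →L[ℝ] Endo n := r.comp (ContinuousLinearMap.fst ℝ _ _)
  let LY : Endo n × Endo n × ℂ →L[ℝ] Endo n := iL.comp (r.comp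
    ((ContinuousLinearMap.fst ℝ _ _).comp (ContinuousLinearMap.snd ℝ (Endo n) (Endo n × ℂ))))
  let Lc : Endo n × Endo n × ℂ →L[ℝ] ℂ :=
    (ContinuousLinearMap.snd ℝ _ _).comp (ContinuousLinearMap.snd ℝ (Endo n) (Endo n × ℂ))
  have hX0 : LX (0, 0, 1) = 0 := map_zero r
  have hY0 : LY (0, 0, 1) = 0 := by
    change iL (r 0) = 0
    rw [map_zero, map_zero]
  have hc1 : Lc (0, 0, 1) = 1 := rfl
  obtain ⟨T, hsm, hT⟩ := exists_hasStrictFDerivAt_cone LX LY Lc hX0 hY0 hc1 z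
  -- The derivative at (0, 0, 1) is (X, Y, c) ↦ Xz + iYz + cz. The cone's tangent space is isotropic
  -- of dimension n, so together with i times itself it fills ℂ^n.
  have hsurj := hsm.map_nhds_eq_of_surj ?_
  · rw [hX0, hY0, hc1, exp_zero, one_smul] at hsurj
    have h1 : ∀ᶠ v in 𝓝 z, v ∈ Set.range fun p => Lc p • exp (LY p) (exp (LX p) z) := by
      rw [show 𝓝 z = _ from hsurj.symm]
      exact range_mem_map
    filter_upwards [h1] with v hv
    obtain ⟨p, rfl⟩ := hv
    exact ⟨p.2.2, r p.1, hr1 _, r p.2.1, hr1 _, rfl⟩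
  · rw [LinearMap.range_eq_top]
    intro v
    obtain ⟨x, hx, y, hy, rfl⟩ := exists_add_I_smul_of_isotropic (hS.inner_coneTangent hz)
      (by rw [finrank_coneTangent hz hz0, hdim]) v
    obtain ⟨_, ⟨X, hX, rfl⟩, _, hxs, rfl⟩ := Submodule.mem_sup.1 hx
    obtain ⟨_, ⟨Y, hY, rfl⟩, _, hys, rfl⟩ := Submodule.mem_sup.1 hy
    obtain ⟨a, rfl⟩ := Submodule.mem_span_singleton.1 hxs
    obtain ⟨b, rfl⟩ := Submodule.mem_span_singleton.1 hys
    refine ⟨(X, Y, (a : ℂ) + Complex.I * b), ?_⟩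
    refine (hT _).trans ?_
    change (Complex.I • r Y) z + (r X) z + ((a : ℂ) + Complex.I * b) • z =
      X z + a • z + Complex.I • (Y z + b • z)
    rw [hr2 X hX, hr2 Y hY, add_smul, mul_smul, smul_add, Complex.coe_smul, Complex.coe_smul,
      smul_apply]
    abel

/-- A homogeneous holomorphic invariant vanishing at `z` is zero, if the orbit of `z` has maximal
dimension. -/
theorem IsUnitaryGroup.invariant_eq_zero {S : Set (Endo n)} (hS : IsUnitaryGroup S) {z : Cn n}
    (hz : IsNull S z) (hz0 : z ≠ 0) (hdim : Module.finrank ℝ (orbitTangent S z) + 1 = n)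
    {F : Cn n → ℂ} (hF : Differentiable ℂ F) (hinv : ∀ A ∈ S, ∀ v, F (A v) = F v) {K : ℕ}
    (hhom : ∀ (c : ℂ) v, F (c • v) = c ^ K * F v) (hFz : F z = 0) (v : Cn n) : F v = 0 := by
  have h1 : ∀ᶠ v in 𝓝 z, F v = 0 := by
    filter_upwards [hS.eventually_mem_cone hz hz0 hdim] with v hv
    obtain ⟨c, X, hX, Y, hY, rfl⟩ := hv
    rw [hhom, hS.apply_exp_smul hF hinv hY, hinv _ (hS.exp_mem hX), hFz, mul_zero]
  -- Vanishing near `z` spreads to `v` by the identity theorem on the complex line through the two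
  -- points.
  have hline : Differentiable ℂ fun ζ : ℂ => z + ζ • (v - z) := by fun_prop
  have h2 : AnalyticOnNhd ℂ (fun ζ : ℂ => F (z + ζ • (v - z))) Set.univ := fun x _ =>
    (hF.comp hline).analyticAt x
  have h3 : (fun ζ : ℂ => F (z + ζ • (v - z))) =ᶠ[𝓝 0] fun _ => 0 := by
    have hc : Tendsto (fun ζ : ℂ => z + ζ • (v - z)) (𝓝 0) (𝓝 z) := by
      simpa using hline.continuous.tendsto 0
    exact hc.eventually h1
  have h4 := congrFun (h2.eq_of_eventuallyEq (fun _ _ => analyticAt_const) h3) 1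
  simpa using h4

/-- All unit zeros of the moment map have orbits of maximal dimension, if one of them has. -/
theorem IsUnitaryGroup.finrank_orbitTangent_eq {S : Set (Endo n)} (hS : IsUnitaryGroup S)
    {ν : Measure (Endo n)} (hν : IsInvariantMeasure S ν) {z u : Cn n} (hz1 : ‖z‖ = 1)
    (hz : IsNull S z) (hdim : Module.finrank ℝ (orbitTangent S z) + 1 = n) (hu1 : ‖u‖ = 1)
    (hu : IsNull S u) : Module.finrank ℝ (orbitTangent S u) + 1 = n := by
  have := hν.isProbabilityMeasure
  have hz0 : z ≠ 0 := by rintro rfl; simp at hz1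
  have hu0 : u ≠ 0 := by rintro rfl; simp at hu1
  by_cases h : ∃ A ∈ S, ∃ c : ℂ, u = c • A z
  · obtain ⟨A, hA, c, rfl⟩ := h
    have hc : c ≠ 0 := by rintro rfl; simp at hu0
    refine le_antisymm (hS.finrank_orbitTangent_lt hu hu0) ?_
    rw [finrank_orbitTangent_smul S hc]
    have h1 : (orbitTangent S z).map (A.restrictScalars ℝ : Cn n →ₗ[ℝ] Cn n) ≤
        orbitTangent S (A z) := by
      rintro _ ⟨_, ⟨X, hX, rfl⟩, rfl⟩
      obtain ⟨B, hB, hAB, hBA⟩ := hS.exists_inv hA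
      refine ⟨A * X * B, hS.conj_mem hA hB hAB hX, ?_⟩
      change (A * X * (B * A)) z = A (X z)
      rw [hBA, mul_one]; rfl
    have h2 := Submodule.finrank_mono h1
    have h3 : Module.finrank ℝ ((orbitTangent S z).map (A.restrictScalars ℝ : Cn n →ₗ[ℝ] Cn n)) =
        Module.finrank ℝ (orbitTangent S z) := by
      refine (LinearEquiv.finrank_eq (Submodule.equivMapOfInjective _ ?_ _)).symm
      refine (injective_iff_map_eq_zero _).2 fun x hx => ?_
      have h4 := hS.norm_map hA x
      have h5 : A x = 0 := hx
      rw [h5, norm_zero] at h4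
      exact norm_eq_zero.1 h4.symm
    omega
  -- If `u` is not in ℂ·Sz, the equality case of Cauchy–Schwarz makes the largest overlap ρ smaller
  -- than 1. The exponents l and k give the invariants F and E the common degree kl, so F(u)E(z) =
  -- E(u)F(z). The left side is at most ρ^{2kl}, while both factors on the right exceed ρ^{kl}.
  exfalso
  obtain ⟨A₀, hA₀, hmax⟩ := hS.isCompact.exists_isMaxOn ⟨1, hS.one_mem⟩
    (f := fun A : Endo n => ‖inner ℂ (A z) u‖)
    (((evalAt z).continuous.inner continuous_const).norm.continuousOn)
  set ρ := ‖inner ℂ (A₀ z) u‖ with hρ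
  have hρ0 : 0 ≤ ρ := norm_nonneg _
  have hle : ∀ A ∈ S, ‖inner ℂ (A z) u‖ ≤ ρ := fun A hA => hmax hA
  have hρ1 : ρ < 1 := by
    refine lt_of_le_of_ne ?_ fun heq => ?_
    · refine (norm_inner_le_norm _ _).trans ?_
      rw [hS.norm_map hA₀, hz1, hu1, mul_one]
    · have h1 : ‖inner ℂ (A₀ z) u‖ = ‖A₀ z‖ * ‖u‖ := by
        rw [hS.norm_map hA₀, hz1, hu1, mul_one]; exact heq
      have h2 : A₀ z ≠ 0 := by
        rw [← norm_ne_zero_iff, hS.norm_map hA₀, hz1]; norm_num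
      obtain ⟨c, -, hc⟩ := (norm_inner_eq_norm_iff h2 hu0).1 h1
      exact h ⟨A₀, hA₀, c, hc⟩
  have hle' : ∀ A ∈ S, ‖inner ℂ (A u) z‖ ≤ ρ := by
    intro A hA
    obtain ⟨B, hB, hAB, hBA⟩ := hS.exists_inv hA
    have h1 : inner ℂ (A u) z = inner ℂ u (B z) := by
      rw [← hS.inner_map hB]
      congr 1
      change (B * A) u = u
      rw [hBA]; rfl
    rw [h1, ← inner_conj_symm, RCLike.norm_conj]
    exact hle B hB
  obtain ⟨k, hk, hkz⟩ := hν.exists_lt_norm_integral_pow hS hz1 hz hρ0 hρ1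
  obtain ⟨l, hl, hlu⟩ := hν.exists_lt_norm_integral_pow hS hu1 hu hρ0 hρ1
  have hbd : ∀ (w v : Cn n) (j : ℕ), (∀ A ∈ S, ‖inner ℂ (A w) v‖ ≤ ρ) →
      ‖averagedPower ν w j v‖ ≤ ρ ^ j := by
    intro w v j hwv
    refine (norm_integral_le_of_norm_le_const (C := ρ ^ j) ?_).trans (by simp)
    filter_upwards [hν.ae_mem] with A hA
    rw [norm_pow]
    gcongr
    exact hwv A hA
  set F : Cn n → ℂ := fun v => averagedPower ν z k v ^ l with hF
  set E : Cn n → ℂ := fun v => averagedPower ν u l v ^ k with hE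
  have hD := hS.invariant_eq_zero hz hz0 hdim (F := fun v => F v * E z - E v * F z) (K := k * l)
    ((((differentiable_averagedPower hS hν z k).pow l).mul_const _).sub
      (((differentiable_averagedPower hS hν u l).pow k).mul_const _))
    (fun A hA v => by simp only [hF, hE, averagedPower_map hS hν _ _ hA])
    (fun c v => by
      simp only [hF, hE, averagedPower_smul, mul_pow, ← pow_mul, mul_comm l k]; ring)
    (by ring) u
  have hD' : F u * E z = E u * F z := sub_eq_zero.1 hD
  have h1 : ‖F u‖ ≤ ρ ^ (k * l) := by
    rw [hF, norm_pow, pow_mul]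
    gcongr
    exact hbd z u k hle
  have h2 : ‖E z‖ ≤ ρ ^ (k * l) := by
    rw [hE, norm_pow, mul_comm k l, pow_mul]
    gcongr
    exact hbd u z l hle'
  have h3 : ρ ^ (k * l) < ‖F z‖ := by
    rw [hF, norm_pow, pow_mul]
    exact pow_lt_pow_left₀ hkz (by positivity) (by omega)
  have h4 : ρ ^ (k * l) < ‖E u‖ := by
    rw [hE, norm_pow, mul_comm k l, pow_mul]
    exact pow_lt_pow_left₀ hlu (by positivity) (by omega)
  have h5 : ‖F u‖ * ‖E z‖ = ‖E u‖ * ‖F z‖ := by rw [← norm_mul, hD', norm_mul]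
  have h6 : ‖F u‖ * ‖E z‖ ≤ ρ ^ (k * l) * ρ ^ (k * l) := by gcongr
  have h7 : ρ ^ (k * l) * ρ ^ (k * l) < ‖E u‖ * ‖F z‖ :=
    mul_lt_mul'' h4 h3 (by positivity) (by positivity)
  linarith

end Invariants

end LagTrans

end

/-! ### Cone sets: one of the two curves is a line -/

noncomputable section

namespace LagTrans

section ConeSets

open Filter Set Topology

variable {k : ℕ}

/-- The map `(q, x, y) ↦ (e^{iφ} x ς(y) q, s (½(|ς(y)|² - x²) + iβ(y)))`. -/
def coneMap (s φ : ℝ) (ς : ℝ → ℂ) (β : ℝ → ℝ) (q : Cn k) (x y : ℝ) : Cn (k + 1) :=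
  pair ((Complex.exp (Complex.I * φ) * x * ς y) • q) (s * (halfSq ς β y - (x ^ 2 / 2 : ℝ)))

/-- The image of `N × X × J` under `coneMap`. -/
def coneSet (s φ : ℝ) (ς : ℝ → ℂ) (β : ℝ → ℝ) (N : Set (Cn k)) (X J : Set ℝ) : Set (Cn (k + 1)) :=
  {p | ∃ q ∈ N, ∃ x ∈ X, ∃ y ∈ J, p = coneMap s φ ς β q x y}

theorem norm_exp_I_mul (φ : ℝ) : ‖Complex.exp (Complex.I * φ)‖ = 1 := by
  rw [mul_comm]; exact Complex.norm_exp_ofReal_mul_I φ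

theorem coneMap_last (s φ : ℝ) (ς : ℝ → ℂ) (β : ℝ → ℝ) (q : Cn k) (x y : ℝ) :
    coneMap s φ ς β q x y (Fin.last k) = s * (halfSq ς β y - (x ^ 2 / 2 : ℝ)) :=
  pair_last _ _

theorem coneMap_last_im (s φ : ℝ) (ς : ℝ → ℂ) (β : ℝ → ℝ) (q : Cn k) (x y : ℝ) :
    (coneMap s φ ς β q x y (Fin.last k)).im = s * β y := by
  rw [coneMap_last, Complex.im_ofReal_mul, Complex.sub_im, halfSq_im, Complex.ofReal_im, sub_zero]

theorem coneMap_last_re (s φ : ℝ) (ς : ℝ → ℂ) (β : ℝ → ℝ) (q : Cn k) (x y : ℝ) :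
    (coneMap s φ ς β q x y (Fin.last k)).re = s * (‖ς y‖ ^ 2 / 2 - x ^ 2 / 2) := by
  rw [coneMap_last, Complex.re_ofReal_mul, Complex.sub_re, halfSq_re, Complex.ofReal_re]

/-- The first `k` coordinates. -/
def initCLM (k : ℕ) : Cn (k + 1) →L[ℝ] Cn k :=
  LinearMap.toContinuousLinearMap
    { toFun := fun p => WithLp.toLp 2 (Fin.init p.ofLp)
      map_add' := fun _ _ => rfl
      map_smul' := fun _ _ => rfl }

theorem initCLM_pair (z : Cn k) (w : ℂ) : initCLM k (pair z w) = z := by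
  ext i
  exact pair_castSucc z w i

theorem initCLM_coneMap (s φ : ℝ) (ς : ℝ → ℂ) (β : ℝ → ℝ) (q : Cn k) (x y : ℝ) :
    initCLM k (coneMap s φ ς β q x y) = (Complex.exp (Complex.I * φ) * x * ς y) • q :=
  initCLM_pair _ _

theorem coneMap_neg (s φ : ℝ) (ς : ℝ → ℂ) (β : ℝ → ℝ) (q : Cn k) (x y : ℝ) :
    coneMap s φ ς β (-q) (-x) y = coneMap s φ ς β q x y := by
  unfold coneMap
  congr 1
  · rw [smul_neg, ← neg_smul]
    congr 1
    push_cast; ring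
  · rw [neg_sq]

theorem isEmbedding_of_continuousOn_leftInverse {T E E' : Type*} [TopologicalSpace T]
    [TopologicalSpace E] [TopologicalSpace E'] {F : T → E} {g : E → E'} {v : T → E'}
    (hv : IsEmbedding v) (hF : Continuous F) (hg : ContinuousOn g (range F))
    (h : ∀ t, g (F t) = v t) : IsEmbedding F := by
  have h1 : IsEmbedding (rangeFactorization F) := by
    refine IsEmbedding.of_comp (hF.subtype_mk _) (continuousOn_iff_continuous_domRestrict.1 hg) ?_
    exact (funext h : (range F).domRestrict g ∘ rangeFactorization F = v) ▸ hv
  exact IsEmbedding.subtypeVal.comp h1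

/-- The map `coneMap` on `N × (0, ∞) × J`. -/
def coneEmbedding (s φ : ℝ) (ς : ℝ → ℂ) (β : ℝ → ℝ) (N : Set (Cn k)) (J : Set ℝ)
    (t : N × Ioi (0 : ℝ) × J) : Cn (k + 1) :=
  coneMap s φ ς β t.1 t.2.1 t.2.2

theorem continuous_pair {T : Type*} [TopologicalSpace T] {f : T → Cn k} {g : T → ℂ}
    (hf : Continuous f) (hg : Continuous g) : Continuous fun t => pair (f t) (g t) := by
  have e : (fun t => pair (f t) (g t)) = fun t => pairCLM k (f t, g t) := by
    funext t; rw [pairCLM_apply]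
  rw [e]
  exact (pairCLM k).continuous.comp (hf.prodMk hg)

theorem continuous_halfSq {J : Set ℝ} {ς : ℝ → ℂ} {β : ℝ → ℝ} (hς : ContinuousOn ς J)
    (hβ : ContinuousOn β J) : ContinuousOn (halfSq ς β) J := by
  unfold halfSq
  exact (Complex.continuous_ofReal.comp_continuousOn ((hς.norm.pow 2).div_const 2)).add
    (continuousOn_const.mul (Complex.continuous_ofReal.comp_continuousOn hβ))

variable {s φ : ℝ} {ς : ℝ → ℂ} {β Y : ℝ → ℝ} {J : Set ℝ}

/-- The coordinates are recovered continuously one after another: y from the imaginary part of the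
last coordinate by inverting β, then x > 0 from the norm of the others since |q| = 1, then q by
division. -/
theorem isEmbedding_coneEmbedding (hs : s * s = 1) (hς : ContinuousOn ς J) (hς0 : ∀ y ∈ J, ς y ≠ 0)
    (hβ : ContinuousOn β J) (hY : ∀ y ∈ J, Y (β y) = y) (hYc : ContinuousOn Y (β '' J))
    {N : Set (Cn k)} (hN : ∀ q ∈ N, ‖q‖ = 1) :
    IsEmbedding (coneEmbedding s φ ς β N J) := by
  have hv : IsEmbedding (fun t : N × Ioi (0 : ℝ) × J => ((t.1 : Cn k), (t.2.1 : ℝ), (t.2.2 : ℝ))) :=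
    IsEmbedding.subtypeVal.prodMap (IsEmbedding.subtypeVal.prodMap IsEmbedding.subtypeVal)
  have hςc : Continuous fun t : N × Ioi (0 : ℝ) × J => ς t.2.2 :=
    (continuousOn_iff_continuous_domRestrict.1 hς).comp (continuous_snd.comp continuous_snd)
  have hhc : Continuous fun t : N × Ioi (0 : ℝ) × J => halfSq ς β t.2.2 :=
    (continuousOn_iff_continuous_domRestrict.1 (continuous_halfSq hς hβ)).comp
      (continuous_snd.comp continuous_snd)
  have hxc : Continuous fun t : N × Ioi (0 : ℝ) × J => (t.2.1 : ℝ) :=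
    continuous_subtype_val.comp (continuous_fst.comp continuous_snd)
  let yf : Cn (k + 1) → ℝ := fun p => Y (s * (p (Fin.last k)).im)
  let xf : Cn (k + 1) → ℝ := fun p => ‖initCLM k p‖ / ‖ς (yf p)‖
  have hyf : ∀ t : N × Ioi (0 : ℝ) × J, yf (coneEmbedding s φ ς β N J t) = t.2.2 := by
    intro t
    simp only [yf, coneEmbedding, coneMap_last_im]
    rw [← mul_assoc, hs, one_mul, hY _ t.2.2.2]
  have hxf : ∀ t : N × Ioi (0 : ℝ) × J, xf (coneEmbedding s φ ς β N J t) = t.2.1 := by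
    intro t
    simp only [xf, hyf]
    rw [coneEmbedding, initCLM_coneMap, norm_smul, hN _ t.1.2, mul_one, norm_mul, norm_mul,
      norm_exp_I_mul, one_mul, Complex.norm_real, Real.norm_of_nonneg (le_of_lt t.2.1.2),
      mul_div_cancel_right₀ _ (norm_ne_zero_iff.2 (hς0 _ t.2.2.2))]
  have hyfc : ContinuousOn yf (range (coneEmbedding s φ ς β N J)) := by
    refine hYc.comp (continuous_const.mul (Complex.continuous_im.comp
      (PiLp.continuous_apply 2 (fun _ : Fin (k + 1) => ℂ) (Fin.last k)))).continuousOn ?_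
    rintro _ ⟨t, rfl⟩
    refine ⟨t.2.2, t.2.2.2, ?_⟩
    change _ = s * (coneMap s φ ς β t.1 t.2.1 t.2.2 (Fin.last k)).im
    rw [coneMap_last_im, ← mul_assoc, hs, one_mul]
  have hςyc : ContinuousOn (fun p => ς (yf p)) (range (coneEmbedding s φ ς β N J)) := by
    refine hς.comp hyfc ?_
    rintro _ ⟨t, rfl⟩
    rw [hyf]; exact t.2.2.2
  have hxfc : ContinuousOn xf (range (coneEmbedding s φ ς β N J)) := by
    refine (initCLM k).continuous.norm.continuousOn.div hςyc.norm ?_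
    rintro _ ⟨t, rfl⟩
    rw [hyf]
    exact norm_ne_zero_iff.2 (hς0 _ t.2.2.2)
  refine isEmbedding_of_continuousOn_leftInverse
    (g := fun p => ((Complex.exp (Complex.I * φ) * xf p * ς (yf p))⁻¹ • initCLM k p, xf p, yf p))
    hv ?_ ?_ ?_
  · refine continuous_pair (((continuous_const.mul (Complex.continuous_ofReal.comp hxc)).mul hςc).smul
      (continuous_subtype_val.comp continuous_fst)) ?_
    exact continuous_const.mul (hhc.sub (Complex.continuous_ofReal.comp ((hxc.pow 2).div_const 2)))
  · refine ContinuousOn.prodMk (ContinuousOn.fun_smul ?_ (initCLM k).continuous.continuousOn)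
      (hxfc.prodMk hyfc)
    refine ContinuousOn.fun_inv₀
      ((continuousOn_const.mul (Complex.continuous_ofReal.comp_continuousOn hxfc)).mul hςyc) ?_
    · rintro _ ⟨t, rfl⟩
      rw [hyf, hxf]
      exact mul_ne_zero (mul_ne_zero (Complex.exp_ne_zero _)
        (Complex.ofReal_ne_zero.2 (ne_of_gt t.2.1.2))) (hς0 _ t.2.2.2)
  · intro t
    simp only [hyf, hxf]
    rw [coneEmbedding, initCLM_coneMap, inv_smul_smul₀]
    exact mul_ne_zero (mul_ne_zero (Complex.exp_ne_zero _)
        (Complex.ofReal_ne_zero.2 (ne_of_gt t.2.1.2))) (hς0 _ t.2.2.2)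

/-- Negative x over `O` is the same as positive x over -O. So x > 0 over the union `N` of `O` and -O
covers the complement of the vertex curve exactly once, whether or not `O` equals -O. -/
theorem coneSet_diff {O N : Set (Cn k)} (hς0 : ∀ y ∈ J, ς y ≠ 0) (hO : ∀ q ∈ O, ‖q‖ = 1)
    (hN : ∀ q, q ∈ N ↔ q ∈ O ∨ -q ∈ O) :
    coneSet s φ ς β O univ J \ coneSet s φ ς β O {0} J = range (coneEmbedding s φ ς β N J) := by
  have hne : ∀ q ∈ O, ∀ x : ℝ, x ≠ 0 → ∀ y ∈ J, coneMap s φ ς β q x y ∉ coneSet s φ ς β O {0} J := by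
    rintro q hq x hx y hy ⟨q', hq', x', hx', y', hy', h⟩
    have h1 := congrArg (initCLM k) h
    rw [mem_singleton_iff.1 hx', initCLM_coneMap, initCLM_coneMap, Complex.ofReal_zero, mul_zero,
      zero_mul, zero_smul, smul_eq_zero] at h1
    rcases h1 with h1 | h1
    · exact mul_ne_zero (mul_ne_zero (Complex.exp_ne_zero _) (Complex.ofReal_ne_zero.2 hx))
        (hς0 y hy) h1
    · have := hO q hq
      rw [h1, norm_zero] at this
      exact zero_ne_one this
  ext p
  constructor
  · rintro ⟨⟨q, hq, x, -, y, hy, rfl⟩, hp⟩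
    rcases lt_trichotomy x 0 with hx | hx | hx
    · exact ⟨(⟨-q, (hN _).2 (Or.inr (by rwa [neg_neg]))⟩, ⟨-x, neg_pos.2 hx⟩, ⟨y, hy⟩),
        coneMap_neg _ _ _ _ _ _ _⟩
    · exact absurd ⟨q, hq, x, hx, y, hy, rfl⟩ hp
    · exact ⟨(⟨q, (hN _).2 (Or.inl hq)⟩, ⟨x, hx⟩, ⟨y, hy⟩), rfl⟩
  · rintro ⟨⟨⟨q, hq⟩, ⟨x, hx⟩, ⟨y, hy⟩⟩, rfl⟩
    have hx' : x ≠ 0 := ne_of_gt hx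
    rcases (hN q).1 hq with hq' | hq'
    · exact ⟨⟨q, hq', x, trivial, y, hy, rfl⟩, hne q hq' x hx' y hy⟩
    · have e : coneEmbedding s φ ς β N J (⟨q, hq⟩, ⟨x, hx⟩, ⟨y, hy⟩) =
          coneMap s φ ς β (-q) (-x) y := (coneMap_neg _ _ _ _ _ _ _).symm
      rw [e]
      exact ⟨⟨-q, hq', -x, trivial, y, hy, rfl⟩, hne _ hq' _ (neg_ne_zero.2 hx') y hy⟩

end ConeSets

section ConeTranslators

open Filter Set

variable {k : ℕ} {φ : ℝ} {ς : ℝ → ℂ} {J : Set ℝ} {r : ℝ → ℝ} {x₀ : ℝ}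

theorem line_im (φ x : ℝ) : ((starRingEnd ℂ) (line φ x) * deriv (line φ) x).im = 0 := by
  have h := (isPhaseCurve_line 0 1 φ 0)
  have h1 : HasDerivAt (line φ) (Complex.exp (Complex.I * φ) * ((1 : ℝ) : ℂ)) x :=
    (hasDerivAt_id x).ofReal_comp.const_mul (Complex.exp (Complex.I * φ))
  have h2 : (starRingEnd ℂ) (Complex.exp (Complex.I * φ)) * Complex.exp (Complex.I * φ) = 1 := by
    rw [mul_comm Complex.I]
    exact IsPolarGraph.exp_conj_mul φ
  have e : (starRingEnd ℂ) (line φ x) * deriv (line φ) x = x := by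
    rw [h1.deriv, Complex.ofReal_one, mul_one, line, map_mul, Complex.conj_ofReal]
    linear_combination (x : ℂ) * h2
  rw [e, Complex.ofReal_im]

theorem norm_line (φ x : ℝ) : ‖line φ x‖ ^ 2 = x ^ 2 := by
  rw [line, norm_mul, norm_exp_I_mul, one_mul, Complex.norm_real, Real.norm_eq_abs, sq_abs]

/-- With s = 1 the line is the first curve, as in L_(d). With s = -1, treated next, it is the second
one, as in L_(e), and the last coordinate changes sign. -/
theorem coneMap_one (φ : ℝ) (ς : ℝ → ℂ) (x₀ : ℝ) (q : Cn k) (x y : ℝ) :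
    coneMap 1 φ ς (beta ς x₀) q x y = pair ((profileSurface (line φ) ς 0 x₀ x y).1 • q)
      (profileSurface (line φ) ς 0 x₀ x y).2 := by
  rw [coneMap, profileSurface_snd, profileSurface, Complex.ofReal_one, one_mul]
  congr 1
  rw [halfSq, halfSq, beta_line, norm_line, Pi.zero_apply, Complex.ofReal_zero, mul_zero, add_zero]

theorem coneMap_neg_one (φ : ℝ) (ς : ℝ → ℂ) (x₀ : ℝ) (q : Cn k) (x y : ℝ) :
    coneMap (-1) φ ς (beta ς x₀) q x y = pair ((profileSurface ς (line φ) x₀ 0 y x).1 • q)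
      (profileSurface ς (line φ) x₀ 0 y x).2 := by
  rw [coneMap, profileSurface_snd, profileSurface]
  congr 1
  · rw [line, mul_comm (ς y)]
  · rw [halfSq, halfSq, beta_line, norm_line, Pi.zero_apply, Complex.ofReal_zero, mul_zero,
      add_zero, Complex.ofReal_neg, Complex.ofReal_one]
    ring

/-- The complement of the vertex set of a cone construction has calibrated charts. -/
theorem IsPolarGraph.cone_calibrated (h : IsPolarGraph J ς r) (hx₀ : x₀ ∈ J) {s : ℝ}
    (hs : s = 1 ∨ s = -1) (hP : ProfileEq (k + 1) (-s) J ς) (φ : ℝ) {N : Set (Cn (k + 1))} {θ₀ : ℝ}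
    (hN : IsSpecialLegendrian N θ₀) :
    ∃ (c : ℝ) (K : ℝ → ℝ), ContinuousOn K J ∧ ∀ t : N × Ioi (0 : ℝ) × J,
      ∃ ψ, IsCalibratedChart (coneEmbedding s φ ς (beta ς x₀) N J)
        (fun t => (t.2.1 : ℝ) ^ 2 / 2 * beta ς x₀ t.2.2 + K t.2.2)
        (fun t => (coneEmbedding s φ ς (beta ς x₀) N J t (Fin.last _)).im + c) ψ ∧
        t ∈ ψ.source := by
  obtain ⟨θ, hθ⟩ := h.exists_angle hP hx₀
  have hph := h.isPhaseCurve hx₀ hθ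
  rw [neg_neg] at hph
  obtain ⟨K, hK⟩ := h.exists_primitive hx₀
  -- On a line both β and Im(γ̄γ') vanish, so it contributes no correction term to the primitive.
  have hKl : ∀ x ∈ Ioi (0 : ℝ), HasDerivAt (fun _ : ℝ => (0 : ℝ))
      (‖line φ x‖ ^ 2 / 2 * ((starRingEnd ℂ) (line φ x) * deriv (line φ) x).im -
        beta (line φ) 0 x * ((starRingEnd ℂ) (line φ x) * deriv (line φ) x).re) x := by
    intro x _
    rw [line_im, beta_line]
    simpa using hasDerivAt_const x (0 : ℝ)
  have hKc : ContinuousOn K J := fun x hx => (hK x hx).continuousAt.continuousWithinAt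
  rcases hs with rfl | rfl
  · refine ⟨θ₀ + (k + 1) * φ + θ, K, hKc, fun t => ?_⟩
    obtain ⟨ψ, hψ, ht⟩ := link_calibrated hN (isPhaseCurve_line k (-1) φ 0) hph hKl hK t
    have e : ∀ t, coneEmbedding 1 φ ς (beta ς x₀) N J t =
        linkMap N (line φ) ς 0 x₀ (Ioi 0) J t := fun t => coneMap_one _ _ _ _ _ _
    refine ⟨_, hψ.transport (Homeomorph.refl _) e (fun t => ?_) (fun t => ?_), ?_⟩
    · simp only [linkPrimitive, beta_line, norm_line, Homeomorph.refl_apply]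
      simp
    · simp only [e, Homeomorph.refl_apply, id]
    · simpa using ht
  · refine ⟨θ₀ + θ + (k + 1) * φ, K, hKc, fun t => ?_⟩
    let e : N × Ioi (0 : ℝ) × J ≃ₜ N × J × Ioi (0 : ℝ) :=
      (Homeomorph.refl N).prodCongr (Homeomorph.prodComm _ _)
    have hF : ∀ t : N × Ioi (0 : ℝ) × J, coneEmbedding (-1) φ ς (beta ς x₀) N J t =
        linkMap N ς (line φ) x₀ 0 J (Ioi 0) (e t) := fun t => coneMap_neg_one _ _ _ _ _ _
    obtain ⟨ψ, hψ, ht⟩ := link_calibrated hN hph (isPhaseCurve_line k 1 φ 0) hK hKl (e t)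
    refine ⟨_, hψ.transport e hF (fun t => ?_) (fun t => ?_), ?_⟩
    · change _ = linkPrimitive ς (line φ) (beta ς x₀) (beta (line φ) 0) K (fun _ => 0) t.2.2 t.2.1
      simp only [linkPrimitive, beta_line, norm_line]
      simp
    · simp only [hF]
    · simpa using ht

end ConeTranslators

end LagTrans

end

/-! ### Images of embeddings; cone sets away from and along the vertex curve -/

noncomputable section

namespace LagTrans

section EmbeddedImages

open Filter Set Topology

/-- An embedding with image `M`, as a homeomorphism onto `M`, inverted. -/
theorem exists_homeomorph_of_isEmbedding {T E : Type*} [TopologicalSpace T] [TopologicalSpace E]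
    {F : T → E} (hF : IsEmbedding F) {M : Set E} (hM : M = range F) :
    ∃ e : M ≃ₜ T, ∀ p : M, (p : E) = F (e p) := by
  subst hM
  refine ⟨hF.toHomeomorph.symm, fun p => ?_⟩
  have := congrArg Subtype.val (hF.toHomeomorph.apply_symm_apply p)
  exact this.symm

theorem isEmbeddedSubmanifold_range {T : Type*} [TopologicalSpace T] {d k : ℕ} {F : T → Cn d}
    (hF : IsEmbedding F) (him : IsSmoothImmersion k F) {M : Set (Cn d)} (hM : M = range F) :
    IsEmbeddedSubmanifold k M := by
  obtain ⟨e, he⟩ := exists_homeomorph_of_isEmbedding hF hM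
  intro p
  obtain ⟨φ, hφ, hp⟩ := him (e p)
  refine ⟨e.toOpenPartialHomeomorph.trans φ, ?_, by simpa using hp⟩
  have h1 : (Subtype.val : M → Cn d) ∘ (e.toOpenPartialHomeomorph.trans φ).symm =
      F ∘ φ.symm := by
    funext u
    simp [he]
  have ht : (e.toOpenPartialHomeomorph.trans φ).target = φ.target := by simp
  unfold IsAdaptedChart at *
  rw [h1, ht]
  exact hφ

/-- The image of an embedding with calibrated charts is an embedded translator. -/
theorem isEmbeddedTranslatorOff_range {T : Type*} [TopologicalSpace T] {n : ℕ} {F : T → Cn (n + 1)}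
    (hF : IsEmbedding F) {L S : Set (Cn (n + 1))} (hM : L \ S = range F) {h : Cn (n + 1) → ℝ}
    (hc : ContinuousOn h L) {c : ℝ}
    (H : ∀ t, ∃ ψ, IsCalibratedChart F (fun t => h (F t))
      (fun t => (F t (Fin.last n)).im + c) ψ ∧ t ∈ ψ.source) :
    IsEmbeddedTranslatorOff (-eLast n) L S ∧
      IsLagrangianAngle (Subtype.val : ↥(L \ S) → Cn (n + 1))
        (fun p => ((p : Cn (n + 1)) (Fin.last n)).im + c) := by
  obtain ⟨e, he⟩ := exists_homeomorph_of_isEmbedding hF hM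
  have H' : ∀ p : ↥(L \ S), ∃ ψ, IsCalibratedChart (Subtype.val : ↥(L \ S) → Cn (n + 1))
      (fun p => h p) (fun p => ((p : Cn (n + 1)) (Fin.last n)).im + c) ψ ∧ p ∈ ψ.source := by
    intro p
    obtain ⟨ψ, hψ, hp⟩ := H (e p)
    refine ⟨_, hψ.transport e he (fun p => ?_) (fun p => ?_), by simpa using hp⟩ <;>
    simp only [he p]
  obtain ⟨h1, h2, h3, h4⟩ := calibrated_conclusions H' (fun _ => rfl)
  have hθ : Continuous fun p : Cn (n + 1) => (p (Fin.last n)).im + c := by fun_prop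
  exact ⟨⟨h1.1, h1, ⟨h, hc, h2⟩, ⟨_, hθ.continuousOn, h3⟩, h4⟩, h3⟩

/-- An injectively immersed open set with a continuous inverse. -/
theorem isAdaptedChart_coeChart {d k : ℕ} {Ω : Set (Rn k)} (hΩ : IsOpen Ω) {p : Rn k → Cn d}
    (hp : ContDiffOn ℝ ∞ p Ω) (hinj : ∀ u ∈ Ω, Function.Injective (fderiv ℝ p u)) (x : Ω) :
    IsAdaptedChart k (fun u : Ω => p u) (coeChart hΩ x) := by
  have h1 : EqOn ((fun u : Ω => p u) ∘ (coeChart hΩ x).symm) p Ω := fun u hu => by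
    simp only [Function.comp_apply, coeChart_symm hΩ x hu]
  rw [IsAdaptedChart, coeChart_target]
  refine ⟨hp.congr h1, fun u hu => ?_⟩
  rw [(h1.eventuallyEq_of_mem (hΩ.mem_nhds hu)).fderiv_eq]
  exact hinj u hu

/-- The isomorphism `ℝ ≃ ℝ^1`. -/
def lineEquiv : Rn 1 ≃L[ℝ] ℝ :=
  (EuclideanSpace.equiv (Fin 1) ℝ).trans (ContinuousLinearEquiv.funUnique (Fin 1) ℝ ℝ)

/-- Regular embedded curves are embedded submanifolds. -/
theorem isEmbeddedSubmanifold_one {d : ℕ} {J : Set ℝ} (hJ : IsOpen J) {c : ℝ → Cn d}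
    (hc : ContDiffOn ℝ ∞ c J) (hc' : ∀ t ∈ J, deriv c t ≠ 0) {l : Cn d → ℝ}
    (hl : ContinuousOn l (c '' J)) (hlc : ∀ t ∈ J, l (c t) = t) :
    IsEmbeddedSubmanifold 1 (c '' J) := by
  have hΩ : IsOpen (lineEquiv ⁻¹' J) := hJ.preimage lineEquiv.continuous
  have hr : c '' J = range (fun u : (lineEquiv ⁻¹' J : Set (Rn 1)) => c (lineEquiv u)) := by
    ext p
    constructor
    · rintro ⟨t, ht, rfl⟩
      exact ⟨⟨lineEquiv.symm t, by simpa using ht⟩, by simp⟩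
    · rintro ⟨⟨u, hu⟩, rfl⟩
      exact ⟨_, hu, rfl⟩
  refine isEmbeddedSubmanifold_range (F := fun u : (lineEquiv ⁻¹' J : Set (Rn 1)) => c (lineEquiv u))
    (isEmbedding_of_continuousOn_leftInverse (g := fun p => lineEquiv.symm (l p))
      IsEmbedding.subtypeVal ?_ ?_ ?_) (fun x => ⟨coeChart hΩ x, ?_, by simp⟩) hr
  · exact hc.continuousOn.comp_continuous (lineEquiv.continuous.comp continuous_subtype_val)
      fun u => u.2
  · exact hr ▸ lineEquiv.symm.continuous.comp_continuousOn hl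
  · intro t
    rw [hlc _ t.2, ContinuousLinearEquiv.symm_apply_apply]
  · refine isAdaptedChart_coeChart hΩ (p := fun u => c (lineEquiv u))
      (hc.comp lineEquiv.contDiff.contDiffOn fun u hu => hu) (fun u hu => ?_) x
    have hd : HasFDerivAt (fun u => c (lineEquiv u))
        ((ContinuousLinearMap.toSpanSingleton ℝ (deriv c (lineEquiv u))).comp
          (lineEquiv : Rn 1 →L[ℝ] ℝ)) u :=
      (((hc.contDiffAt (hJ.mem_nhds hu)).differentiableAt
        (by simp)).hasDerivAt.hasFDerivAt).comp u lineEquiv.hasFDerivAt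
    rw [hd.fderiv]
    refine Function.Injective.comp (g := ContinuousLinearMap.toSpanSingleton ℝ (deriv c (lineEquiv u)))
      (fun a b hab => ?_) lineEquiv.injective
    simp only [ContinuousLinearMap.toSpanSingleton_apply] at hab
    exact smul_left_injective ℝ (hc' _ hu) hab

end EmbeddedImages

section ConeResults

open Filter Set Topology

variable {k : ℕ} {ς : ℝ → ℂ} {J : Set ℝ} {r : ℝ → ℝ} {x₀ : ℝ}

/-- The coordinate `y` of a point of a cone set is a continuous function on it. -/
theorem continuousOn_coneSet {s φ : ℝ} {β Y : ℝ → ℝ} (hs : s * s = 1)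
    (hYc : ContinuousOn Y (β '' J)) {N : Set (Cn k)} {X : Set ℝ} :
    ContinuousOn (fun p : Cn (k + 1) => Y (s * (p (Fin.last k)).im)) (coneSet s φ ς β N X J) := by
  refine hYc.comp (continuous_const.mul (Complex.continuous_im.comp
    (PiLp.continuous_apply 2 (fun _ : Fin (k + 1) => ℂ) (Fin.last k)))).continuousOn ?_
  rintro _ ⟨q, -, x, -, y, hy, rfl⟩
  refine ⟨y, hy, ?_⟩
  change _ = s * (coneMap s φ ς β q x y (Fin.last k)).im
  rw [coneMap_last_im, ← mul_assoc, hs, one_mul]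

theorem mul_coneMap_last_im {s φ : ℝ} {β : ℝ → ℝ} (hs : s * s = 1) (q : Cn k) (x y : ℝ) :
    s * (coneMap s φ ς β q x y (Fin.last k)).im = β y := by
  rw [coneMap_last_im, ← mul_assoc, hs, one_mul]

/-- The primitive of the Liouville form on a cone set, as an ambient function. -/
theorem exists_ambient_primitive {s φ : ℝ} {β Y K : ℝ → ℝ} (hs : s * s = 1)
    (hς : ContinuousOn ς J) (hK : ContinuousOn K J) (hY : ∀ y ∈ J, Y (β y) = y)
    (hYc : ContinuousOn Y (β '' J)) {N : Set (Cn k)} {X : Set ℝ} :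
    ∃ h : Cn (k + 1) → ℝ, ContinuousOn h (coneSet s φ ς β N X J) ∧
      ∀ q x, ∀ y ∈ J, h (coneMap s φ ς β q x y) = x ^ 2 / 2 * β y + K y := by
  have hYm : MapsTo (fun p : Cn (k + 1) => Y (s * (p (Fin.last k)).im))
      (coneSet s φ ς β N X J) J := by
    rintro _ ⟨q, -, x, -, y, hy, rfl⟩
    change Y (s * (coneMap s φ ς β q x y (Fin.last k)).im) ∈ J
    rw [mul_coneMap_last_im hs, hY y hy]
    exact hy
  have hYcc := continuousOn_coneSet (ς := ς) (φ := φ) (N := N) (X := X) hs hYc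
  have hlast : Continuous fun p : Cn (k + 1) => p (Fin.last k) :=
    PiLp.continuous_apply 2 (fun _ : Fin (k + 1) => ℂ) (Fin.last k)
  -- From the last coordinate alone one reads y through β and x² = |ς(y)|² - 2s Re z_m. There is no
  -- division by x, so the function is continuous across the vertex curve.
  refine ⟨fun p => (‖ς (Y (s * (p (Fin.last k)).im))‖ ^ 2 / 2 - s * (p (Fin.last k)).re) *
    (s * (p (Fin.last k)).im) + K (Y (s * (p (Fin.last k)).im)), ?_, fun q x y hy => ?_⟩
  · refine ((((hς.comp hYcc hYm).norm.pow 2).div_const 2).sub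
      (continuous_const.mul (Complex.continuous_re.comp hlast)).continuousOn).mul
      (continuous_const.mul (Complex.continuous_im.comp hlast)).continuousOn |>.add
      (hK.comp hYcc hYm)
  · simp only
    rw [mul_coneMap_last_im hs, hY y hy, coneMap_last_re, ← mul_assoc, hs]
    ring

theorem mul_self_of_eq_one_or {s : ℝ} (hs : s = 1 ∨ s = -1) : s * s = 1 := by
  rcases hs with rfl | rfl <;> norm_num

/-- Cone sets over special Legendrians are embedded translators away from the vertex curve. -/
theorem IsPolarGraph.isEmbeddedTranslatorOff (h : IsPolarGraph J ς r) (hx₀ : x₀ ∈ J) {s : ℝ}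
    (hs : s = 1 ∨ s = -1) (hP : ProfileEq (k + 1) (-s) J ς) (φ : ℝ) {N O : Set (Cn (k + 1))}
    {θ₀ : ℝ} (hN : IsSpecialLegendrian N θ₀) (hO : ∀ q ∈ O, ‖q‖ = 1)
    (hON : ∀ q, q ∈ N ↔ q ∈ O ∨ -q ∈ O) :
    ∃ c : ℝ, IsEmbeddedTranslatorOff (-eLast (k + 1)) (coneSet s φ ς (beta ς x₀) O univ J)
        (coneSet s φ ς (beta ς x₀) O {0} J) ∧
      IsLagrangianAngle (Subtype.val : ↥(coneSet s φ ς (beta ς x₀) O univ J \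
          coneSet s φ ς (beta ς x₀) O {0} J) → Cn (k + 2))
        (fun p => ((p : Cn (k + 2)) (Fin.last _)).im + c) := by
  have hss := mul_self_of_eq_one_or hs
  have hς := h.contDiffOn.continuousOn
  have hβ := (contDiffOn_beta h.isOpen h.ordConnected h.contDiffOn hx₀).continuousOn
  obtain ⟨Y, hY, hYc⟩ := h.exists_inverse_beta hx₀
  obtain ⟨c, K, hK, H⟩ := h.cone_calibrated hx₀ hs hP φ hN
  obtain ⟨f, hf, hf'⟩ := exists_ambient_primitive (φ := φ) (N := O) (X := univ) hss hς hK hY hYc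
  refine ⟨c, isEmbeddedTranslatorOff_range
    (isEmbedding_coneEmbedding hss hς (fun y hy => h.ne_zero hy) hβ hY hYc hN.1)
    (coneSet_diff (fun y hy => h.ne_zero hy) hO hON) hf fun t => ?_⟩
  obtain ⟨ψ, hψ, ht⟩ := H t
  refine ⟨ψ, ?_, ht⟩
  have e : (fun t => f (coneEmbedding s φ ς (beta ς x₀) N J t)) =
      fun t => (t.2.1 : ℝ) ^ 2 / 2 * beta ς x₀ t.2.2 + K t.2.2 :=
    funext fun t => hf' _ _ _ t.2.2.2
  rw [e]
  exact hψ

/-- The vertex curve of a cone set. -/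
theorem coneSet_zero {s φ : ℝ} {β : ℝ → ℝ} {O : Set (Cn k)} (hO : O.Nonempty) :
    coneSet s φ ς β O {0} J = (fun y => pair (0 : Cn k) (s * halfSq ς β y)) '' J := by
  have e : ∀ q y, coneMap s φ ς β q 0 y = pair (0 : Cn k) (s * halfSq ς β y) := by
    intro q y
    simp [coneMap]
  ext p
  constructor
  · rintro ⟨q, -, x, rfl, y, hy, rfl⟩
    exact ⟨y, hy, (e q y).symm⟩
  · rintro ⟨y, hy, rfl⟩
    obtain ⟨q, hq⟩ := hO
    exact ⟨q, hq, 0, rfl, y, hy, (e q y).symm⟩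

theorem IsPolarGraph.hasDerivAt_halfSq (h : IsPolarGraph J ς r) (hx₀ : x₀ ∈ J) {y : ℝ} (hy : y ∈ J) :
    HasDerivAt (halfSq ς (beta ς x₀)) ((starRingEnd ℂ) (ς y) * deriv ς y) y :=
  LagTrans.hasDerivAt_halfSq ((h.contDiffOn.contDiffAt (h.isOpen.mem_nhds hy)).differentiableAt
    (by simp)).hasDerivAt
    (LagTrans.hasDerivAt_beta h.isOpen h.ordConnected h.contDiffOn hx₀ hy)

theorem IsPolarGraph.contDiffOn_halfSq (h : IsPolarGraph J ς r) (hx₀ : x₀ ∈ J) :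
    ContDiffOn ℝ ∞ (halfSq ς (beta ς x₀)) J := by
  have h1 : ContDiffOn ℝ ∞ (fun x => ‖ς x‖ ^ 2 / 2) J := (h.contDiffOn.norm_sq ℝ).div_const 2
  exact (Complex.ofRealCLM.contDiff.comp_contDiffOn h1).add
    (contDiffOn_const.mul (Complex.ofRealCLM.contDiff.comp_contDiffOn
      (contDiffOn_beta h.isOpen h.ordConnected h.contDiffOn hx₀)))

theorem IsPolarGraph.isEmbeddedSubmanifold_vertex (h : IsPolarGraph J ς r) (hx₀ : x₀ ∈ J) {s : ℝ}
    (hs : s = 1 ∨ s = -1) (φ : ℝ) {O : Set (Cn k)} (hO : O.Nonempty) :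
    IsEmbeddedSubmanifold 1 (coneSet s φ ς (beta ς x₀) O {0} J) := by
  have hss := mul_self_of_eq_one_or hs
  have hs0 : (s : ℂ) ≠ 0 := by
    rcases hs with rfl | rfl <;> norm_num
  obtain ⟨Y, hY, hYc⟩ := h.exists_inverse_beta hx₀
  have hc := continuousOn_coneSet (ς := ς) (φ := φ) (N := O) (X := {0}) hss hYc
  rw [coneSet_zero hO] at hc ⊢
  refine isEmbeddedSubmanifold_one h.isOpen ?_ (fun y hy => ?_) hc fun y hy => ?_
  · exact (pairCLM k).contDiff.comp_contDiffOn
      (contDiffOn_const.prodMk (contDiffOn_const.mul (h.contDiffOn_halfSq hx₀)))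
  · have hd : HasDerivAt (fun y => pair (0 : Cn k) (s * halfSq ς (beta ς x₀) y))
        (pair (0 : Cn k) (s * ((starRingEnd ℂ) (ς y) * deriv ς y))) y :=
      (pairCLM k).hasFDerivAt.comp_hasDerivAt y
        ((hasDerivAt_const y (0 : Cn k)).prodMk ((h.hasDerivAt_halfSq hx₀ hy).const_mul (s : ℂ)))
    rw [hd.deriv, Ne, pair_eq_zero]
    exact fun h0 => mul_ne_zero hs0 (mul_ne_zero ((map_ne_zero _).2 (h.ne_zero hy))
      (h.deriv_ne_zero hy)) h0.2
  · simp only [pair_last]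
    rw [Complex.im_ofReal_mul, halfSq_im, ← mul_assoc, hss, one_mul, hY y hy]

end ConeResults

end LagTrans

end

/-! ### Genuine singularities along the vertex curve -/

noncomputable section

namespace LagTrans

section Singularities

open Filter Set Topology

/-- The velocities of all curves in an embedded submanifold lie in its tangent space. -/
theorem IsEmbeddedSubmanifold.exists_tangentSpace {d k : ℕ} {M : Set (Cn d)}
    (hM : IsEmbeddedSubmanifold k M) {p : Cn d} (hp : p ∈ M) :
    ∃ T : Submodule ℝ (Cn d), Module.finrank ℝ T ≤ k ∧ ∀ (c : ℝ → Cn d) (v : Cn d),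
      HasDerivAt c v 0 → c 0 = p → (∀ᶠ t in 𝓝 0, c t ∈ M) → v ∈ T := by
  obtain ⟨φ, hφ, hpφ⟩ := hM ⟨p, hp⟩
  set u := φ ⟨p, hp⟩ with hu
  have hut : u ∈ φ.target := φ.map_source hpφ
  have hPu : ((Subtype.val : M → Cn d) ∘ φ.symm) u = p := by
    rw [Function.comp_apply, hu, φ.left_inv hpφ]
  obtain ⟨l, hl, hlP⟩ := exists_contDiffAt_leftInverse (hφ.contDiffAt hut) (hφ.2 u hut)
  rw [hPu] at hl
  have h1 : ∀ᶠ y : M in 𝓝 (⟨p, hp⟩ : M), ((Subtype.val : M → Cn d) ∘ φ.symm) (l y) = y := by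
    filter_upwards [φ.open_source.mem_nhds hpφ, (φ.continuousAt hpφ).eventually hlP] with y hy hy'
    simp only [Function.comp_apply, φ.left_inv hy] at hy' ⊢
    rw [hy', φ.left_inv hy]
  -- Here the subspace topology enters: all points of `M` near `p` lie in the one chart, so the
  -- parametrization composed with `l` fixes them.
  have h2 : ∀ᶠ q in 𝓝[M] p, ((Subtype.val : M → Cn d) ∘ φ.symm) (l q) = q := by
    rw [nhdsWithin_eq_map_subtype_coe hp]
    exact h1
  have hlp : l p = u := by
    rw [← hPu]; exact hlP.self_of_nhds
  refine ⟨LinearMap.range (fderiv ℝ ((Subtype.val : M → Cn d) ∘ φ.symm) u : Rn k →ₗ[ℝ] Cn d), ?_,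
    fun c v hc hc0 hcM => ?_⟩
  · refine (LinearMap.finrank_range_le _).trans ?_
    simp
  · have h3 : Tendsto c (𝓝 0) (𝓝[M] p) :=
      tendsto_nhdsWithin_iff.2 ⟨hc0 ▸ hc.continuousAt, hcM⟩
    have h4 : (fun t => ((Subtype.val : M → Cn d) ∘ φ.symm) (l (c t))) =ᶠ[𝓝 0] c := h3.eventually h2
    have h5 : HasDerivAt (fun t => l (c t)) (fderiv ℝ l p v) 0 := by
      have := (hl.differentiableAt (by simp)).hasFDerivAt
      rw [← hc0] at this
      rw [← hc0]
      exact this.comp_hasDerivAt 0 hc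
    have h6 : HasDerivAt (fun t => ((Subtype.val : M → Cn d) ∘ φ.symm) (l (c t)))
        (fderiv ℝ ((Subtype.val : M → Cn d) ∘ φ.symm) u (fderiv ℝ l p v)) 0 := by
      have := ((hφ.contDiffAt hut).differentiableAt (by simp)).hasFDerivAt
      rw [← hlp, ← hc0] at this
      rw [← hlp, ← hc0]
      rw [← hc0] at h5
      exact this.comp_hasDerivAt 0 h5
    exact ⟨_, h6.unique (hc.congr_of_eventuallyEq h4)⟩

/-- If `O` spans a large space then a cone set over `O` is singular along its vertex curve. -/
theorem IsPolarGraph.isSingularAlong {k : ℕ} {ς : ℝ → ℂ} {J : Set ℝ} {r : ℝ → ℝ} {x₀ : ℝ}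
    (h : IsPolarGraph J ς r) (hx₀ : x₀ ∈ J) {s : ℝ} (hs : s = 1 ∨ s = -1) (φ : ℝ) {O : Set (Cn k)}
    (hO : k < Module.finrank ℝ (Submodule.span ℝ O)) :
    IsSingularAlong (coneSet s φ ς (beta ς x₀) O univ J) (coneSet s φ ς (beta ς x₀) O {0} J) := by
  rintro p ⟨q, hq, x, rfl, y, hy, rfl⟩ U hU hpU hM
  have hs0 : (s : ℂ) ≠ 0 := by
    rcases hs with rfl | rfl <;> norm_num
  have e : ∀ q', coneMap s φ ς (beta ς x₀) q' 0 y = coneMap s φ ς (beta ς x₀) q 0 y := by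
    intro q'
    simp [coneMap]
  -- Through a vertex pass the rulings of all points q' of `O`. Their velocities (a q', 0) and the
  -- velocity (0, w) of the vertex curve would have to lie in `T`, but they span a real space of
  -- dimension dim span O + 1 > k + 1.
  obtain ⟨T, hT, hTc⟩ := hM.exists_tangentSpace ⟨⟨q, hq, 0, trivial, y, hy, rfl⟩, hpU⟩
  set a := Complex.exp (Complex.I * φ) * ς y with ha
  set w := (s : ℂ) * ((starRingEnd ℂ) (ς y) * deriv ς y) with hw
  have ha0 : a ≠ 0 := mul_ne_zero (Complex.exp_ne_zero _) (h.ne_zero hy)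
  have hw0 : w ≠ 0 := mul_ne_zero hs0 (mul_ne_zero ((map_ne_zero _).2 (h.ne_zero hy))
    (h.deriv_ne_zero hy))
  have h1 : pair (0 : Cn k) w ∈ T := by
    have hd : HasDerivAt (fun t => coneMap s φ ς (beta ς x₀) q 0 (y + t)) (pair (0 : Cn k) w) 0 := by
      have h2 : HasDerivAt (fun t => pair (0 : Cn k) (s * halfSq ς (beta ς x₀) t)) (pair 0 w)
          (y + 0) := by
        rw [add_zero]
        exact (pairCLM k).hasFDerivAt.comp_hasDerivAt y ((hasDerivAt_const y (0 : Cn k)).prodMk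
          ((h.hasDerivAt_halfSq hx₀ hy).const_mul (s : ℂ)))
      have h3 := h2.comp_const_add y 0
      refine h3.congr_of_eventuallyEq (Eventually.of_forall fun t => ?_)
      simp [coneMap]
    have hty : Tendsto (fun t : ℝ => y + t) (𝓝 0) (𝓝 y) := by
      simpa using (by fun_prop : Continuous fun t : ℝ => y + t).tendsto 0
    refine hTc _ _ hd (by simp) ?_
    filter_upwards [hty.eventually (h.isOpen.mem_nhds hy),
      hd.continuousAt.eventually (hU.mem_nhds (by simpa using hpU))] with t ht ht'
    exact ⟨⟨q, hq, 0, trivial, _, ht, rfl⟩, ht'⟩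
  have h2 : ∀ q' ∈ O, pair (a • q') (0 : ℂ) ∈ T := by
    intro q' hq'
    have hd : HasDerivAt (fun t => coneMap s φ ς (beta ς x₀) q' t y) (pair (a • q') 0) 0 := by
      have d1 : HasDerivAt (fun t : ℝ => (Complex.exp (Complex.I * φ) * t * ς y) • q') (a • q') 0 := by
        refine HasDerivAt.smul_const ?_ q'
        have := ((hasDerivAt_id (0 : ℝ)).ofReal_comp.const_mul
          (Complex.exp (Complex.I * φ))).mul_const (ς y)
        simpa [ha] using this
      have d2 : HasDerivAt (fun t : ℝ => (s : ℂ) * (halfSq ς (beta ς x₀) y - (t ^ 2 / 2 : ℝ))) 0 0 := by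
        have := (((((hasDerivAt_id (0 : ℝ)).pow 2).div_const 2).ofReal_comp).const_sub
          (halfSq ς (beta ς x₀) y)).const_mul (s : ℂ)
        simpa using this
      exact (pairCLM k).hasFDerivAt.comp_hasDerivAt 0 (d1.prodMk d2)
    have hpU' : coneMap s φ ς (beta ς x₀) q' 0 y ∈ U := by rw [e q']; exact hpU
    refine hTc _ _ hd (e q') ?_
    filter_upwards [hd.continuousAt.eventually (hU.mem_nhds hpU')] with t ht
    exact ⟨⟨q', hq', t, trivial, _, hy, rfl⟩, ht⟩
  let A : Cn k →ₗ[ℝ] Cn (k + 1) :=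
    { toFun := fun z => pair (a • z) 0
      map_add' := fun z z' => by
        have := (pairCLM k).map_add (a • z, 0) (a • z', 0)
        simpa [pairCLM_apply, smul_add] using this
      map_smul' := fun t z => by
        have := (pairCLM k).map_smul t (a • z, 0)
        simpa [pairCLM_apply, smul_comm a t z] using this }
  have h3 : ∀ z ∈ Submodule.span ℝ O, A z ∈ T := by
    intro z hz
    exact (Submodule.span_le.2 (fun q' hq' => h2 q' hq') : Submodule.span ℝ O ≤ T.comap A) hz
  let B : (Submodule.span ℝ O × ℝ) →ₗ[ℝ] T :=
    LinearMap.codRestrict T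
      ((A ∘ₗ (Submodule.span ℝ O).subtype).coprod (LinearMap.toSpanSingleton ℝ _ (pair 0 w)))
      fun z => T.add_mem (h3 _ z.1.2) (T.smul_mem _ h1)
  have hB : Function.Injective B := by
    rw [← LinearMap.ker_eq_bot, LinearMap.ker_eq_bot']
    rintro ⟨z, t⟩ hz
    have h4 : pair (a • (z : Cn k)) 0 + t • pair (0 : Cn k) w = 0 := congrArg Subtype.val hz
    have h5 : pair (a • (z : Cn k)) (t • w) = 0 := by
      have := (pairCLM k).map_add (a • (z : Cn k), 0) (t • ((0 : Cn k), w))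
      rw [(pairCLM k).map_smul] at this
      simp only [pairCLM_apply] at this
      rw [h4] at this
      simpa using this
    obtain ⟨h6, h7⟩ := pair_eq_zero.1 h5
    have h8 : (z : Cn k) = 0 := (smul_eq_zero.1 h6).resolve_left ha0
    have h9 : t = 0 := (smul_eq_zero.1 h7).resolve_right hw0
    exact Prod.ext (Subtype.ext h8) h9
  have h4 := LinearMap.finrank_le_finrank_of_injective hB
  rw [Module.finrank_prod, Module.finrank_self] at h4
  omega

end Singularities

end LagTrans

end

/-! ### The special orthogonal group: reflections, null vectors, orbits -/

noncomputable section

namespace LagTrans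

section Householder

variable {n : ℕ}

/-- The reflection in the hyperplane orthogonal to a unit vector `w`. -/
def householder (w : Fin n → ℝ) : Matrix (Fin n) (Fin n) ℝ := 1 - Matrix.vecMulVec ((2 : ℝ) • w) w

theorem householder_mulVec (w v : Fin n → ℝ) :
    (householder w).mulVec v = v - (2 * (w ⬝ᵥ v)) • w := by
  rw [householder, Matrix.sub_mulVec, Matrix.one_mulVec, Matrix.vecMulVec_mulVec]
  ext i
  simp
  ring

theorem householder_transpose (w : Fin n → ℝ) : (householder w).transpose = householder w := by
  ext i j
  simp [householder, Matrix.vecMulVec_apply, Matrix.one_apply, eq_comm]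
  ring

theorem householder_mul_self {w : Fin n → ℝ} (hw : w ⬝ᵥ w = 1) :
    householder w * householder w = 1 := by
  refine Matrix.ext_of_mulVec_single fun i => ?_
  rw [← Matrix.mulVec_mulVec, Matrix.one_mulVec, householder_mulVec, householder_mulVec,
    dotProduct_sub, dotProduct_smul, hw]
  ext j
  simp
  ring

theorem det_householder {w : Fin n → ℝ} (hw : w ⬝ᵥ w = 1) : (householder w).det = -1 := by
  have h : householder w = 1 + Matrix.replicateCol Unit ((-2 : ℝ) • w) * Matrix.replicateRow Unit w := by
    ext i j
    simp [householder, Matrix.vecMulVec_apply, Matrix.mul_apply]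
    ring
  rw [h, Matrix.det_one_add_replicateCol_mul_replicateRow, dotProduct_smul, hw]
  norm_num

theorem householder_mul_mem {w w' : Fin n → ℝ} (hw : w ⬝ᵥ w = 1) (hw' : w' ⬝ᵥ w' = 1) :
    householder w * householder w' ∈ Matrix.specialOrthogonalGroup (Fin n) ℝ := by
  rw [Matrix.mem_specialOrthogonalGroup_iff, Matrix.mem_orthogonalGroup_iff]
  refine ⟨?_, ?_⟩
  · rw [Matrix.transpose_mul, householder_transpose, householder_transpose, Matrix.mul_assoc,
      ← Matrix.mul_assoc (householder w'), householder_mul_self hw', Matrix.one_mul,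
      householder_mul_self hw]
  · rw [Matrix.det_mul, det_householder hw, det_householder hw']
    norm_num

/-- The special orthogonal group acts transitively on the projective space of lines. -/
theorem exists_specialOrthogonal_mulVec {e e' : Fin n → ℝ} (he : e ⬝ᵥ e = 1) (he' : e' ⬝ᵥ e' = 1) :
    ∃ A ∈ Matrix.specialOrthogonalGroup (Fin n) ℝ, A.mulVec e = e' ∨ A.mulVec e = -e' := by
  by_cases h : e = e'
  · exact ⟨1, one_mem _, Or.inl (by rw [Matrix.one_mulVec, h])⟩
  · set d := e - e' with hd
    have hd0 : 0 < d ⬝ᵥ d := by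
      refine lt_of_le_of_ne (Finset.sum_nonneg fun i _ => mul_self_nonneg _) fun h0 => ?_
      exact h (sub_eq_zero.1 (dotProduct_self_eq_zero.1 h0.symm))
    have hde : 2 * (d ⬝ᵥ e) = d ⬝ᵥ d := by
      simp only [hd, sub_dotProduct, dotProduct_sub, he, he', dotProduct_comm e' e]
      ring
    set w := (√(d ⬝ᵥ d))⁻¹ • d with hw
    have hww : w ⬝ᵥ w = 1 := by
      rw [hw, smul_dotProduct, dotProduct_smul, smul_smul, ← mul_inv, Real.mul_self_sqrt hd0.le,
        smul_eq_mul, inv_mul_cancel₀ hd0.ne']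
    -- One reflection takes `e` to `e'`; the reflection along `e'` restores determinant 1 at the
    -- price of a sign. The sign is unavoidable for n = 1 and harmless for lines.
    refine ⟨householder e' * householder w, householder_mul_mem he' hww, Or.inr ?_⟩
    have h1 : (householder w).mulVec e = e' := by
      rw [householder_mulVec, hw, smul_dotProduct, smul_eq_mul, smul_smul]
      have : 2 * ((√(d ⬝ᵥ d))⁻¹ * (d ⬝ᵥ e)) * (√(d ⬝ᵥ d))⁻¹ = 1 := by
        calc _ = (2 * (d ⬝ᵥ e)) * (√(d ⬝ᵥ d) * √(d ⬝ᵥ d))⁻¹ := by rw [mul_inv]; ring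
          _ = 1 := by rw [hde, Real.mul_self_sqrt hd0.le, mul_inv_cancel₀ hd0.ne']
      rw [this, one_smul, hd, sub_sub_cancel]
    rw [← Matrix.mulVec_mulVec, h1, householder_mulVec, he']
    ext i
    simp
    ring

end Householder

section StandardSO

variable {n : ℕ}

/-- A real matrix as a complex one. -/
def complexify (A : Matrix (Fin n) (Fin n) ℝ) : Matrix (Fin n) (Fin n) ℂ :=
  A.map fun t : ℝ => (t : ℂ)

/-- A real vector as a complex one. -/
def realCLM (n : ℕ) : Rn n →L[ℝ] Cn n :=
  LinearMap.toContinuousLinearMap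
    { toFun := fun v => WithLp.toLp 2 fun i => (v i : ℂ)
      map_add' := fun _ _ => by ext; simp
      map_smul' := fun _ _ => by ext; simp }

@[simp] theorem realCLM_apply (v : Rn n) (i : Fin n) : realCLM n v i = (v i : ℂ) := rfl

theorem inner_realCLM (v w : Rn n) : inner ℂ (realCLM n v) (realCLM n w) = (inner ℝ v w : ℂ) := by
  simp [PiLp.inner_apply]

theorem norm_realCLM (v : Rn n) : ‖realCLM n v‖ = ‖v‖ := by
  rw [EuclideanSpace.norm_eq, EuclideanSpace.norm_eq]
  simp

theorem toEndo_complexify (A : Matrix (Fin n) (Fin n) ℝ) (v : Rn n) :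
    toEndo n (complexify A) (realCLM n v) = realCLM n (WithLp.toLp 2 (A.mulVec v.ofLp)) := by
  ext i
  change ∑ j, complexify A i j * realCLM n v j = ((∑ j, A i j * v j : ℝ) : ℂ)
  simp [complexify]

theorem complexify_mem {A : Matrix (Fin n) (Fin n) ℝ}
    (hA : A ∈ Matrix.specialOrthogonalGroup (Fin n) ℝ) :
    complexify A ∈ Matrix.specialUnitaryGroup (Fin n) ℂ := by
  rw [Matrix.mem_specialOrthogonalGroup_iff, Matrix.mem_orthogonalGroup_iff] at hA
  rw [Matrix.mem_specialUnitaryGroup_iff, Matrix.mem_unitaryGroup_iff]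
  constructor
  · have h1 : star (complexify A) = complexify (star A) := by
      ext i j
      simp [complexify, Matrix.star_apply]
    have h2 : complexify A * complexify (star A) = complexify (A * star A) :=
      ((Complex.ofRealHom.mapMatrix).map_mul A (star A)).symm
    rw [h1, h2, show A * star A = 1 from hA.1]
    exact (Complex.ofRealHom.mapMatrix).map_one
  · have := (Complex.ofRealHom.map_det A).symm
    rw [hA.2] at this
    exact this.trans Complex.ofReal_one

theorem IsStandardSO.mem_opSet {G : Subgroup (SU n)} (hG : IsStandardSO G) {B : Endo n} :
    B ∈ opSet G ↔ ∃ A ∈ Matrix.specialOrthogonalGroup (Fin n) ℝ, B = toEndo n (complexify A) := by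
  constructor
  · rintro ⟨g, hg, rfl⟩
    obtain ⟨A, hA, hgA⟩ := (hG g).1 hg
    exact ⟨A, hA, congrArg (toEndo n) hgA⟩
  · rintro ⟨A, hA, rfl⟩
    exact ⟨⟨complexify A, complexify_mem hA⟩, (hG _).2 ⟨A, hA, rfl⟩, rfl⟩

/-- `complexify`, as a linear map to operators. -/
def complexEndo (n : ℕ) : Matrix (Fin n) (Fin n) ℝ →ₗ[ℝ] Endo n where
  toFun A := toEndo n (complexify A)
  map_add' A B := by
    rw [← map_add]
    congr 1
    ext x y
    simp [complexify]
  map_smul' c A := by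
    rw [← toEndo_smul]
    congr 1
    ext x y
    simp [complexify]

/-- The null vectors of `SO(n)` have real ratios of coordinates. -/
theorem IsStandardSO.im_eq_zero_of_isNull {G : Subgroup (SU n)} (hG : IsStandardSO G)
    (hc : IsCompact (G : Set (SU n))) {v : Cn n} (hv : IsNull (opSet G) v) (i j : Fin n) :
    ((starRingEnd ℂ) (v i) * v j).im = 0 := by
  by_cases hij : i = j
  · subst hij
    rw [Complex.conj_mul', ← Complex.ofReal_pow, Complex.ofReal_im]
  -- A rotation in the (i, j)-plane as a product of two reflections. Its velocity at 0 is -2(E_ij +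
  -- E_ji)(1 - 2E_ii) = -2(E_ij - E_ji), and nullity for this generator is the vanishing of Im(v̄ᵢ
  -- vⱼ).
  let w : ℝ → Fin n → ℝ := fun t => Real.cos t • Pi.single i 1 + Real.sin t • Pi.single j 1
  have hw : ∀ t, w t ⬝ᵥ w t = 1 := by
    intro t
    have h1 : (Pi.single i (1 : ℝ) : Fin n → ℝ) ⬝ᵥ Pi.single j 1 = 0 := by
      simp [Ne.symm hij]
    have h2 : (Pi.single j (1 : ℝ) : Fin n → ℝ) ⬝ᵥ Pi.single i 1 = 0 := by
      simp [hij]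
    have h3 : ∀ k : Fin n, (Pi.single k (1 : ℝ) : Fin n → ℝ) ⬝ᵥ Pi.single k 1 = 1 := by
      intro k; simp
    simp only [w, add_dotProduct, dotProduct_add, smul_dotProduct, dotProduct_smul, h1, h2, h3,
      smul_eq_mul]
    linarith [Real.cos_sq_add_sin_sq t]
  let Λ : Matrix (Fin n) (Fin n) ℝ →ₗ[ℝ] Endo n := complexEndo n ∘ₗ LinearMap.mulRight ℝ (householder (w 0))
  have hcm : ∀ t, Λ (householder (w t)) ∈ opSet G :=
    fun t => hG.mem_opSet.2 ⟨_, householder_mul_mem (hw t) (hw 0), rfl⟩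
  have hc0 : Λ (householder (w 0)) = 1 := by
    have : complexify (householder (w 0) * householder (w 0)) = 1 := by
      rw [householder_mul_self (hw 0)]
      exact (Complex.ofRealHom.mapMatrix).map_one
    change toEndo n (complexify (householder (w 0) * householder (w 0))) = 1
    rw [this, map_one]
  let P : Fin n → Fin n → Endo n := fun a b => Λ (Matrix.single a b 1)
  have hct : (fun t => Λ (householder (w t))) = fun t => Λ 1 -
      ((2 * Real.cos t ^ 2) • P i i + (2 * (Real.cos t * Real.sin t)) • (P i j + P j i) +
        (2 * Real.sin t ^ 2) • P j j) := by
    funext t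
    simp only [householder, w, P, Matrix.single_eq_single_vecMulVec_single, smul_add,
      Matrix.add_vecMulVec, Matrix.vecMulVec_add, Matrix.smul_vecMulVec, Matrix.vecMulVec_smul,
      map_sub, map_add, map_smul, smul_smul]
    module
  have hd : HasDerivAt (fun t => Λ (householder (w t))) (-(2 : ℝ) • (P i j + P j i)) 0 := by
    have h1 := (((Real.hasDerivAt_cos 0).pow 2).const_mul 2).smul_const (P i i)
    have h2 := (((Real.hasDerivAt_cos 0).mul (Real.hasDerivAt_sin 0)).const_mul 2).smul_const
      (P i j + P j i)
    have h3 := (((Real.hasDerivAt_sin 0).pow 2).const_mul 2).smul_const (P j j)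
    have h4 := ((h1.add h2).add h3).const_sub (Λ 1)
    rw [hct]
    refine h4.congr_deriv ?_
    simp only [Real.sin_zero, Real.cos_zero]
    module
  have h1 := hv _ ((isUnitaryGroup_opSet hc).velocity_mem hc0 hd hcm)
  have hP : ∀ a b, inner ℂ v (P a b v) = (starRingEnd ℂ) (v a) * (v b - 2 * v i * (Pi.single i 1 : Fin n → ℂ) b) := by
    intro a b
    have hw0 : w 0 = Pi.single i 1 := by simp [w]
    have e : P a b v = EuclideanSpace.single a (v b - 2 * v i * (Pi.single i 1 : Fin n → ℂ) b) := by
      ext x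
      change ∑ y, complexify (Matrix.single a b 1 * householder (w 0)) x y * v y = _
      simp only [complexify, Matrix.map_apply, hw0]
      by_cases hx : x = a
      · subst hx
        simp [householder, Matrix.vecMulVec_apply, Matrix.one_apply, sub_mul, Pi.single_apply,
          Finset.sum_sub_distrib, apply_ite Complex.ofReal]
      · simp [hx]
    rw [e, EuclideanSpace.inner_single_right, mul_comm]
  rw [smul_apply, add_apply, inner_smul_right_eq_smul, inner_add_right, hP, hP] at h1
  simp [hij] at h1
  have h2 := congrArg Complex.im h1
  simp only [Complex.add_im, Complex.neg_im, Complex.mul_im, Complex.sub_re, Complex.sub_im,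
    Complex.mul_re, Complex.conj_re, Complex.conj_im, Complex.re_ofNat, Complex.im_ofNat,
    Complex.zero_im] at h2 ⊢
  linarith

/-- Unit null vectors of `SO(n)` are multiples of real vectors. -/
theorem IsStandardSO.exists_phase {G : Subgroup (SU n)} (hG : IsStandardSO G)
    (hc : IsCompact (G : Set (SU n))) {v : Cn n} (hv : IsNull (opSet G) v) (hv1 : ‖v‖ = 1) :
    ∃ (ψ : ℝ) (e : Rn n), ‖e‖ = 1 ∧ v = Complex.exp (Complex.I * ψ) • realCLM n e := by
  obtain ⟨i, hi⟩ : ∃ i, v i ≠ 0 := by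
    by_contra! h
    have : v = 0 := by ext i; exact h i
    rw [this, norm_zero] at hv1
    exact zero_ne_one hv1
  have hψ : (‖v i‖ : ℂ) * Complex.exp (Complex.I * (Complex.arg (v i) : ℝ)) = v i := by
    rw [mul_comm Complex.I]
    exact Complex.norm_mul_exp_arg_mul_I _
  have hn : (‖v i‖ : ℂ) ≠ 0 := Complex.ofReal_ne_zero.2 (norm_ne_zero_iff.2 hi)
  refine ⟨Complex.arg (v i), WithLp.toLp 2 fun j => ((starRingEnd ℂ) (v i) * v j).re / ‖v i‖, ?_⟩
  have hj : ∀ j, v j = Complex.exp (Complex.I * (Complex.arg (v i) : ℝ)) *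
      ((((starRingEnd ℂ) (v i) * v j).re / ‖v i‖ : ℝ) : ℂ) := by
    intro j
    have h1 : ((((starRingEnd ℂ) (v i) * v j).re : ℝ) : ℂ) = (starRingEnd ℂ) (v i) * v j :=
      Complex.ext (by simp) (by
        rw [Complex.ofReal_im, hG.im_eq_zero_of_isNull hc hv])
    rw [Complex.ofReal_div, h1]
    have h2 : v i * (starRingEnd ℂ) (v i) = (‖v i‖ : ℂ) ^ 2 := Complex.mul_conj' _
    rw [mul_div_assoc', eq_div_iff hn]
    apply mul_left_cancel₀ hn
    linear_combination (-(starRingEnd ℂ) (v i) * v j) * hψ - v j * h2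
  have he : v = Complex.exp (Complex.I * (Complex.arg (v i) : ℝ)) •
      realCLM n (WithLp.toLp 2 fun j => ((starRingEnd ℂ) (v i) * v j).re / ‖v i‖) := by
    ext j
    rw [PiLp.smul_apply, realCLM_apply, smul_eq_mul]
    exact hj j
  refine ⟨?_, he⟩
  have h3 := congrArg norm he
  rw [norm_smul, norm_exp_I_mul, one_mul, norm_realCLM, hv1] at h3
  exact h3.symm

theorem dotProduct_self_eq_one {e : Rn n} (he : ‖e‖ = 1) : e.ofLp ⬝ᵥ e.ofLp = 1 := by
  have h1 := real_inner_self_eq_norm_sq e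
  rw [he, one_pow, PiLp.inner_apply] at h1
  simpa [dotProduct, ← sq] using h1

/-- The lines spanned by the orbit of a real vector are all real lines. -/
theorem IsStandardSO.exists_mem_orbitOf {G : Subgroup (SU n)} (hG : IsStandardSO G) {e X : Rn n}
    (he : ‖e‖ = 1) (c : ℂ) : ∃ q ∈ orbitOf (opSet G) (c • realCLM n e), ∃ x : ℝ,
      x ^ 2 = ‖X‖ ^ 2 ∧ (x : ℂ) • q = c • realCLM n X := by
  by_cases hX : X = 0
  · exact ⟨_, ⟨1, hG.mem_opSet.2 ⟨1, one_mem _, by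
      rw [show complexify (1 : Matrix (Fin n) (Fin n) ℝ) = 1 from
        (Complex.ofRealHom.mapMatrix).map_one, map_one]⟩, rfl⟩, 0, by simp [hX], by simp [hX]⟩
  have hX0 : ‖X‖ ≠ 0 := norm_ne_zero_iff.2 hX
  have he' : ‖‖X‖⁻¹ • X‖ = 1 := by
    rw [norm_smul, norm_inv, norm_norm, inv_mul_cancel₀ hX0]
  have hXX : ‖X‖ • ‖X‖⁻¹ • X = X := smul_inv_smul₀ hX0 X
  obtain ⟨A, hA, hAe⟩ := exists_specialOrthogonal_mulVec (dotProduct_self_eq_one he)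
    (dotProduct_self_eq_one he')
  have hq : toEndo n (complexify A) (c • realCLM n e) ∈ orbitOf (opSet G) (c • realCLM n e) :=
    ⟨_, hG.mem_opSet.2 ⟨A, hA, rfl⟩, rfl⟩
  have hq' : ∀ x : ℝ, (x : ℂ) • toEndo n (complexify A) (c • realCLM n e) =
      c • realCLM n (x • WithLp.toLp 2 (A.mulVec e.ofLp)) := by
    intro x
    rw [map_smul, toEndo_complexify, map_smul, smul_comm]
    rfl
  rcases hAe with h | h
  · refine ⟨_, hq, ‖X‖, rfl, ?_⟩
    rw [hq', h]
    exact congrArg (fun v => c • realCLM n v) hXX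
  · refine ⟨_, hq, -‖X‖, neg_sq _, ?_⟩
    rw [hq', h]
    refine congrArg (fun v => c • realCLM n v) ?_
    rw [neg_smul, WithLp.toLp_neg, smul_neg, neg_neg]
    exact hXX

theorem IsStandardSO.eq_of_mem_orbitOf {G : Subgroup (SU n)} (hG : IsStandardSO G) {e : Rn n}
    (he : ‖e‖ = 1) {c : ℂ} {q : Cn n} (hq : q ∈ orbitOf (opSet G) (c • realCLM n e)) :
    ∃ e' : Rn n, ‖e'‖ = 1 ∧ q = c • realCLM n e' := by
  obtain ⟨B, hB, rfl⟩ := hq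
  obtain ⟨A, hA, rfl⟩ := hG.mem_opSet.1 hB
  refine ⟨WithLp.toLp 2 (A.mulVec e.ofLp), ?_, by
    simp only [map_smul, toEndo_complexify]⟩
  have hA' := (Matrix.mem_specialOrthogonalGroup_iff.1 hA).1
  have h1 : (A.mulVec e.ofLp) ⬝ᵥ (A.mulVec e.ofLp) = 1 := by
    rw [Matrix.dotProduct_mulVec, Matrix.vecMul_mulVec, ← Matrix.dotProduct_mulVec]
    have : A.transpose * A = 1 := (Matrix.mem_orthogonalGroup_iff' _ _).1 hA'
    rw [this, Matrix.one_mulVec, dotProduct_self_eq_one he]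
  rw [EuclideanSpace.norm_eq, Real.sqrt_eq_one]
  simpa [dotProduct, ← sq] using h1

end StandardSO

end LagTrans

end

/-! ### The smooth parametrization over a real n-plane -/

noncomputable section

namespace LagTrans

/-- Schur complement of the scalar block `a`. -/
theorem det_arrow {n : ℕ} {a b d ρ : ℂ} {x : Fin n → ℂ} (ha : a ≠ 0)
    {M : Matrix (Fin (n + 1)) (Fin (n + 1)) ℂ}
    (h1 : ∀ i j : Fin n, M i.castSucc j.castSucc = if i = j then a else 0)
    (h2 : ∀ i : Fin n, M i.castSucc (Fin.last n) = b * x i)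
    (h3 : ∀ j : Fin n, M (Fin.last n) j.castSucc = ρ * x j) (h4 : M (Fin.last n) (Fin.last n) = d) :
    M.det = a ^ n * (d - ρ * b / a * ∑ i, x i ^ 2) := by
  let e : Fin n ⊕ Fin 1 ≃ Fin (n + 1) := finSumFinEquiv
  have hl : ∀ i : Fin n, e (Sum.inl i) = i.castSucc := fun i => rfl
  have hr : ∀ i : Fin 1, e (Sum.inr i) = Fin.last n := fun i => by
    rw [Subsingleton.elim i 0]; rfl
  let A : Matrix (Fin n) (Fin n) ℂ := Matrix.scalar (Fin n) a
  let A' : Matrix (Fin n) (Fin n) ℂ := Matrix.scalar (Fin n) a⁻¹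
  have hAA : A' * A = 1 := by
    rw [← map_mul, inv_mul_cancel₀ ha, map_one]
  have hAA' : A * A' = 1 := by
    rw [← map_mul, mul_inv_cancel₀ ha, map_one]
  have hM : M.submatrix e e = Matrix.fromBlocks A (Matrix.of fun i _ => b * x i)
      (Matrix.of fun _ j => ρ * x j) (Matrix.of fun _ _ => d) := by
    ext i j
    rcases i with i | i <;> rcases j with j | j
    · simp [hl, h1, A, Matrix.diagonal_apply]
    · simp [hl, hr, h2]
    · simp [hl, hr, h3]
    · simp [hr, h4]
  let : Invertible A := ⟨A', hAA, hAA'⟩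
  rw [← Matrix.det_submatrix_equiv_self e, hM, Matrix.det_fromBlocks₁₁, Matrix.det_fin_one]
  congr 1
  · simp [A]
  · have : ⅟A = A' := rfl
    rw [this, Matrix.sub_apply, Matrix.mul_apply]
    simp only [A', Matrix.scalar_apply, Matrix.mul_diagonal, Matrix.of_apply, Finset.mul_sum]
    congr 1
    refine Finset.sum_congr rfl fun i _ => ?_
    field_simp

/-- Splitting off the last coordinate. -/
def splitLast (k : ℕ) : Rn (k + 1) ≃L[ℝ] Rn k × ℝ :=
  LinearEquiv.toContinuousLinearEquiv
    { toFun := fun u => (WithLp.toLp 2 fun i => u i.castSucc, u (Fin.last k))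
      map_add' := fun u v => by ext <;> simp
      map_smul' := fun c u => by ext <;> simp
      invFun := fun p => WithLp.toLp 2 (Fin.snoc (α := fun _ => ℝ) p.1.ofLp p.2)
      left_inv := fun u => by
        ext i
        refine Fin.lastCases ?_ (fun i => ?_) i <;> simp
      right_inv := fun p => by
        ext <;> simp }

theorem splitLast_apply {k : ℕ} (u : Rn (k + 1)) :
    splitLast k u = (WithLp.toLp 2 fun i => u i.castSucc, u (Fin.last k)) := rfl

theorem splitLast_castSucc {k : ℕ} (j : Fin k) :
    splitLast k (stdBasis (k + 1) j.castSucc) = (stdBasis k j, 0) := by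
  rw [splitLast_apply]
  refine Prod.ext ?_ ?_
  · ext i; simp [stdBasis]
  · simp [stdBasis, Fin.ext_iff]; omega

theorem splitLast_last {k : ℕ} :
    splitLast k (stdBasis (k + 1) (Fin.last k)) = (0, 1) := by
  rw [splitLast_apply]
  refine Prod.ext ?_ ?_
  · ext i; simp [stdBasis, Fin.ext_iff]; omega
  · simp [stdBasis]

section RealCone

open Filter Set Topology

variable {n : ℕ}

/-- The map `(X, y) ↦ (c ς(y) X, s (½(|ς(y)|² - |X|²) + iβ(y)))`. -/
def realConeMap (c : ℂ) (s : ℝ) (ς : ℝ → ℂ) (β : ℝ → ℝ) (q : Rn n × ℝ) : Cn (n + 1) :=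
  pairCLM n ((c * ς q.2) • realCLM n q.1, s * (halfSq ς β q.2 - (‖q.1‖ ^ 2 / 2 : ℝ)))

theorem hasFDerivAt_realConeMap {c : ℂ} {s : ℝ} {ς : ℝ → ℂ} {β : ℝ → ℝ} {X : Rn n} {y : ℝ} {ς' : ℂ}
    (hς : HasDerivAt ς ς' y) (hβ : HasDerivAt β ((starRingEnd ℂ) (ς y) * ς').im y) :
    ∃ L : (Rn n × ℝ) →L[ℝ] Cn (n + 1), HasFDerivAt (realConeMap c s ς β) L (X, y) ∧
      ∀ t : Rn n × ℝ, L t = pair ((c * ς y) • realCLM n t.1 + (t.2 * (c * ς')) • realCLM n X)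
        (s * (t.2 * ((starRingEnd ℂ) (ς y) * ς') - (inner ℝ X t.1 : ℝ))) := by
  have e1 : HasFDerivAt (fun q : Rn n × ℝ => q.1) (ContinuousLinearMap.fst ℝ (Rn n) ℝ) (X, y) :=
    hasFDerivAt_fst
  have e2 : HasFDerivAt (fun q : Rn n × ℝ => q.2) (ContinuousLinearMap.snd ℝ (Rn n) ℝ) (X, y) :=
    hasFDerivAt_snd
  have g1 := (realCLM n).hasFDerivAt.comp (X, y) e1
  have g2 := (hς.hasFDerivAt.comp (X, y) e2).const_mul c
  have g3 := (hasDerivAt_halfSq hς hβ).hasFDerivAt.comp (X, y) e2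
  have g4 := Complex.ofRealCLM.hasFDerivAt.comp (X, y) ((e1.norm_sq).const_mul (1 / 2 : ℝ))
  have g5 := (pairCLM n).hasFDerivAt.comp (X, y)
    ((g2.smul g1).prodMk ((g3.sub g4).const_mul (s : ℂ)))
  refine ⟨_, g5.congr_of_eventuallyEq (Eventually.of_forall fun q => ?_), fun t => ?_⟩
  · simp only [realConeMap, Function.comp_apply, Pi.sub_apply, Complex.ofRealCLM_apply]
    congr 3
    rw [div_eq_mul_one_div, mul_comm]
  · simp only [ContinuousLinearMap.comp_apply, pairCLM_apply]
    congr 1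
    · simp
      congr 1
      ring
    · simp

/-- The mixed terms of the two blocks cancel as for a link. The real form that remains is positive
definite for z, z' ≠ 0, also at X = 0, where polar coordinates degenerate. -/
theorem inner_realConeMap_deriv {c z z' : ℂ} {s : ℝ} (hc : ‖c‖ = 1) (hs : s * s = 1) (X : Rn n)
    (t t' : Rn n × ℝ) :
    inner ℂ (pair ((c * z) • realCLM n t.1 + (t.2 * (c * z')) • realCLM n X)
        (s * (t.2 * ((starRingEnd ℂ) z * z') - (inner ℝ X t.1 : ℝ))))
      (pair ((c * z) • realCLM n t'.1 + (t'.2 * (c * z')) • realCLM n X)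
        (s * (t'.2 * ((starRingEnd ℂ) z * z') - (inner ℝ X t'.1 : ℝ)))) =
      ((‖z‖ ^ 2 * inner ℝ t.1 t'.1 + ‖z'‖ ^ 2 * (‖X‖ ^ 2 + ‖z‖ ^ 2) * (t.2 * t'.2) +
        inner ℝ X t.1 * inner ℝ X t'.1 : ℝ) : ℂ) := by
  have h1 : (starRingEnd ℂ) c * c = 1 := by
    rw [Complex.conj_mul', hc, Complex.ofReal_one, one_pow]
  have h2 : ((s : ℂ)) * s = 1 := by exact_mod_cast hs
  rw [inner_pair]
  simp only [inner_add_left, inner_add_right, inner_smul_left, inner_smul_right, inner_realCLM,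
    real_inner_self_eq_norm_sq, real_inner_comm X t.1]
  push_cast
  simp only [← Complex.conj_mul', map_mul, map_sub, Complex.conj_ofReal, Complex.conj_conj]
  linear_combination ((starRingEnd ℂ) z * z * (inner ℝ t.1 t'.1 : ℝ) +
    t'.2 * ((starRingEnd ℂ) z * z') * (inner ℝ X t.1 : ℝ) +
    t.2 * ((starRingEnd ℂ) z' * z) * (inner ℝ X t'.1 : ℝ) +
    t.2 * t'.2 * ((starRingEnd ℂ) z' * z') * (‖X‖ : ℂ) ^ 2) * h1 +
    (t'.2 * ((starRingEnd ℂ) z * z') - (inner ℝ X t'.1 : ℝ)) *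
      (t.2 * (z * (starRingEnd ℂ) z') - (inner ℝ X t.1 : ℝ)) * h2

/-- The domain of `realConeMap`, with a Euclidean model space. -/
def realConeDomain (n : ℕ) (J : Set ℝ) : Set (Rn (n + 1)) := {u | (splitLast n u).2 ∈ J}

theorem isOpen_realConeDomain {J : Set ℝ} (hJ : IsOpen J) : IsOpen (realConeDomain n J) :=
  hJ.preimage (continuous_snd.comp (splitLast n).continuous)

variable {k : ℕ} {ς : ℝ → ℂ} {J : Set ℝ} {r : ℝ → ℝ} {x₀ : ℝ}

/-- X = xq replaces link and half-line by a single chart that is smooth across the vertex. The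
determinant is s c^{k+1} ς^k ς' (|ς|² + |X|²), so its phase is again that of ς^k ς' up to a constant
and a real sign. -/
theorem IsPolarGraph.realCone_calibrated (h : IsPolarGraph J ς r) (hx₀ : x₀ ∈ J) {s : ℝ}
    (hs : s = 1 ∨ s = -1) (hP : ProfileEq (k + 1) (-s) J ς) (χ : ℝ) :
    ∃ (c : ℝ) (K : ℝ → ℝ), ContinuousOn K J ∧ ∀ x : realConeDomain (k + 1) J,
      IsCalibratedChart
        (fun u : realConeDomain (k + 1) J => realConeMap (Complex.exp (Complex.I * χ)) s ς
          (beta ς x₀) (splitLast (k + 1) u))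
        (fun u => ‖(splitLast (k + 1) u).1‖ ^ 2 / 2 * beta ς x₀ (splitLast (k + 1) u).2 +
          K (splitLast (k + 1) u).2)
        (fun u => (realConeMap (Complex.exp (Complex.I * χ)) s ς
          (beta ς x₀) (splitLast (k + 1) u) (Fin.last _)).im + c)
        (coeChart (isOpen_realConeDomain h.isOpen) x) := by
  obtain ⟨θ, hθ⟩ := h.exists_angle hP hx₀
  have hph := h.isPhaseCurve hx₀ hθ
  rw [neg_neg] at hph
  obtain ⟨K, hK⟩ := h.exists_primitive hx₀
  have hss := mul_self_of_eq_one_or hs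
  set c := Complex.exp (Complex.I * χ) with hc
  have hc1 : ‖c‖ = 1 := norm_exp_I_mul χ
  set β := beta ς x₀ with hβ
  have hς : ∀ y ∈ J, HasDerivAt ς (deriv ς y) y := fun y hy => hph.hasDerivAt hy
  set p : Rn (k + 2) → Cn (k + 2) := fun u => realConeMap c s ς β (splitLast (k + 1) u) with hp
  have hD : ∀ u ∈ realConeDomain (k + 1) J, ∀ t, fderiv ℝ p u t =
      pair ((c * ς (splitLast (k + 1) u).2) • realCLM _ (splitLast (k + 1) t).1 +
          ((splitLast (k + 1) t).2 * (c * deriv ς (splitLast (k + 1) u).2)) •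
            realCLM _ (splitLast (k + 1) u).1)
        (s * ((splitLast (k + 1) t).2 * ((starRingEnd ℂ) (ς (splitLast (k + 1) u).2) *
          deriv ς (splitLast (k + 1) u).2) -
            (inner ℝ (splitLast (k + 1) u).1 (splitLast (k + 1) t).1 : ℝ))) := by
    intro u hu t
    obtain ⟨L, hL, hL'⟩ := hasFDerivAt_realConeMap (c := c) (s := s) (X := (splitLast (k + 1) u).1)
      (hς _ hu) (hph.hasDerivAt_beta _ hu)
    have h2 : HasFDerivAt p (L.comp (splitLast (k + 1) : Rn (k + 2) →L[ℝ] Rn (k + 1) × ℝ)) u :=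
      HasFDerivAt.comp (g := realConeMap c s ς β) u hL (splitLast (k + 1)).hasFDerivAt
    rw [h2.fderiv, ContinuousLinearMap.comp_apply, hL']
    rfl
  have hinj : ∀ u ∈ realConeDomain (k + 1) J, Function.Injective (fderiv ℝ p u) := by
    intro u hu
    refine (injective_iff_map_eq_zero _).2 fun t ht => ?_
    have h2 := inner_realConeMap_deriv (z := ς (splitLast (k + 1) u).2)
      (z' := deriv ς (splitLast (k + 1) u).2) hc1 hss (splitLast (k + 1) u).1
      (splitLast (k + 1) t) (splitLast (k + 1) t)
    rw [← hD u hu, ht, inner_zero_left, eq_comm, Complex.ofReal_eq_zero,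
      real_inner_self_eq_norm_sq] at h2
    have p1 : 0 < ‖ς (splitLast (k + 1) u).2‖ := norm_pos_iff.2 (h.ne_zero hu)
    have p2 : 0 < ‖deriv ς (splitLast (k + 1) u).2‖ := norm_pos_iff.2 (h.deriv_ne_zero hu)
    have q1 : 0 ≤ ‖ς (splitLast (k + 1) u).2‖ ^ 2 * ‖(splitLast (k + 1) t).1‖ ^ 2 := by positivity
    have q3 := mul_self_nonneg (splitLast (k + 1) t).2
    have q2 : 0 ≤ ‖deriv ς (splitLast (k + 1) u).2‖ ^ 2 *
      (‖(splitLast (k + 1) u).1‖ ^ 2 + ‖ς (splitLast (k + 1) u).2‖ ^ 2) *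
      ((splitLast (k + 1) t).2 * (splitLast (k + 1) t).2) := by positivity
    have q4 := mul_self_nonneg (inner ℝ (splitLast (k + 1) u).1 (splitLast (k + 1) t).1)
    have z1 := (mul_eq_zero.1 (le_antisymm (by linarith) q1)).resolve_left (by positivity)
    have z2 := (mul_eq_zero.1 (le_antisymm (by linarith) q2)).resolve_left (by positivity)
    have y1 : (splitLast (k + 1) t).1 = 0 := by simpa using z1
    have : splitLast (k + 1) t = 0 := Prod.ext y1 (mul_self_eq_zero.1 z2)
    simpa using this
  have hpc : ContDiffOn ℝ ∞ p (realConeDomain (k + 1) J) := by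
    have m1 : ContDiffOn ℝ ∞ (fun u : Rn (k + 2) => (splitLast (k + 1) u).1)
        (realConeDomain (k + 1) J) := (contDiff_fst.comp (splitLast (k + 1)).contDiff).contDiffOn
    have m2 : ContDiffOn ℝ ∞ (fun u : Rn (k + 2) => (splitLast (k + 1) u).2)
        (realConeDomain (k + 1) J) := (contDiff_snd.comp (splitLast (k + 1)).contDiff).contDiffOn
    have g1 : ContDiffOn ℝ ∞ (fun u : Rn (k + 2) => ς (splitLast (k + 1) u).2)
        (realConeDomain (k + 1) J) := h.contDiffOn.comp m2 fun u hu => hu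
    have g2 : ContDiffOn ℝ ∞ (fun u : Rn (k + 2) => halfSq ς β (splitLast (k + 1) u).2)
        (realConeDomain (k + 1) J) :=
      ContDiffOn.comp (g := halfSq ς β) (h.contDiffOn_halfSq hx₀) m2 fun u hu => hu
    have g3 : ContDiffOn ℝ ∞ (fun u : Rn (k + 2) => ((‖(splitLast (k + 1) u).1‖ ^ 2 / 2 : ℝ) : ℂ))
        (realConeDomain (k + 1) J) :=
      Complex.ofRealCLM.contDiff.comp_contDiffOn ((m1.norm_sq ℝ).div_const 2)
    exact (pairCLM (k + 1)).contDiff.comp_contDiffOn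
      (((contDiffOn_const.mul g1).smul ((realCLM (k + 1)).contDiff.comp_contDiffOn m1)).prodMk
        (contDiffOn_const.mul (g2.sub g3)))
  refine ⟨(k + 1) * χ + θ, K, fun x hx => (hK x hx).continuousAt.continuousWithinAt, fun x =>
    ⟨isAdaptedChart_coeChart _ hpc hinj x, ?_⟩⟩
  rw [coeChart_target]
  intro u hu
  have hval : ((coeChart (isOpen_realConeDomain h.isOpen) x).symm u : Rn (k + 2)) = u := by
    rw [coeChart_symm _ _ hu]
  have hev : ∀ {E : Type} (g : Rn (k + 2) → E),
      ((fun v : realConeDomain (k + 1) J => g v) ∘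
        (coeChart (isOpen_realConeDomain h.isOpen) x).symm) =ᶠ[𝓝 u] g := by
    intro E g
    filter_upwards [(isOpen_realConeDomain h.isOpen).mem_nhds hu] with v hv
    simp only [Function.comp_apply, coeChart_symm _ _ hv]
  have hfd : fderiv ℝ ((fun v : realConeDomain (k + 1) J => p v) ∘
      (coeChart (isOpen_realConeDomain h.isOpen) x).symm) u = fderiv ℝ p u := (hev p).fderiv_eq
  set X := (splitLast (k + 1) u).1 with hX
  set y := (splitLast (k + 1) u).2 with hy
  have hβy := hph.hasDerivAt_beta y hu
  refine ⟨fun v w => ?_, ?_, ?_⟩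
  · rw [hfd, hD u hu, hD u hu, inner_realConeMap_deriv hc1 hss, Complex.ofReal_im]
  · have e1 : HasFDerivAt (fun v => (splitLast (k + 1) v).1)
        ((ContinuousLinearMap.fst ℝ (Rn (k + 1)) ℝ).comp
          (splitLast (k + 1) : Rn (k + 2) →L[ℝ] Rn (k + 1) × ℝ)) u :=
      hasFDerivAt_fst.comp u (splitLast (k + 1)).hasFDerivAt
    have e2 : HasFDerivAt (fun v => (splitLast (k + 1) v).2)
        ((ContinuousLinearMap.snd ℝ (Rn (k + 1)) ℝ).comp
          (splitLast (k + 1) : Rn (k + 2) →L[ℝ] Rn (k + 1) × ℝ)) u :=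
      hasFDerivAt_snd.comp u (splitLast (k + 1)).hasFDerivAt
    have e3 := (((e1.norm_sq).const_mul (1 / 2 : ℝ)).mul (hβy.hasFDerivAt.comp u e2)).add
      ((hK y hu).hasFDerivAt.comp u e2)
    have e4 := e3.congr_of_eventuallyEq (((hev fun v => ‖(splitLast (k + 1) v).1‖ ^ 2 / 2 *
      beta ς x₀ (splitLast (k + 1) v).2 + K (splitLast (k + 1) v).2)).trans
        (Eventually.of_forall fun v => by
          simp only [Pi.add_apply, Pi.mul_apply, Function.comp_apply]
          ring))
    refine ⟨e4.differentiableAt, fun v => ?_⟩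
    rw [e4.fderiv, hfd, hD u hu]
    have e5 : inner ℂ (p u) (pair ((c * ς y) • realCLM _ (splitLast (k + 1) v).1 +
          ((splitLast (k + 1) v).2 * (c * deriv ς y)) • realCLM _ X)
        (s * ((splitLast (k + 1) v).2 * ((starRingEnd ℂ) (ς y) * deriv ς y) -
          (inner ℝ X (splitLast (k + 1) v).1 : ℝ)))) =
        ((‖ς y‖ ^ 2 * inner ℝ X (splitLast (k + 1) v).1 : ℝ) : ℂ) +
        (((splitLast (k + 1) v).2 * ‖X‖ ^ 2 : ℝ) : ℂ) * ((starRingEnd ℂ) (ς y) * deriv ς y) +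
        (((splitLast (k + 1) v).2 : ℂ) * ((starRingEnd ℂ) (ς y) * deriv ς y) -
          (inner ℝ X (splitLast (k + 1) v).1 : ℝ)) *
          (starRingEnd ℂ) (halfSq ς β y - (‖X‖ ^ 2 / 2 : ℝ)) := by
      have h1 : (starRingEnd ℂ) c * c = 1 := by
        rw [Complex.conj_mul', hc1, Complex.ofReal_one, one_pow]
      have h2 : ((s : ℂ)) * s = 1 := by exact_mod_cast hss
      change inner ℂ (pair ((c * ς y) • realCLM (k + 1) X)
        (s * (halfSq ς β y - (‖X‖ ^ 2 / 2 : ℝ)))) _ = _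
      rw [inner_pair]
      simp only [inner_add_right, inner_smul_left, inner_smul_right, inner_realCLM,
        real_inner_self_eq_norm_sq]
      push_cast
      simp only [← Complex.conj_mul', map_mul, map_sub, Complex.conj_ofReal]
      linear_combination ((starRingEnd ℂ) (ς y) * ς y * (inner ℝ X (splitLast (k + 1) v).1 : ℝ) +
        (splitLast (k + 1) v).2 * ((starRingEnd ℂ) (ς y) * deriv ς y) * (‖X‖ : ℂ) ^ 2) * h1 +
        ((splitLast (k + 1) v).2 * ((starRingEnd ℂ) (ς y) * deriv ς y) -
          (inner ℝ X (splitLast (k + 1) v).1 : ℝ)) *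
          ((starRingEnd ℂ) (halfSq ς β y) - (starRingEnd ℂ) ((‖X‖ : ℂ) ^ 2 / 2)) * h2
    have e6 : (p ((coeChart (isOpen_realConeDomain h.isOpen) x).symm u)) = p u := by rw [hval]
    change _ = (inner ℂ (p ((coeChart (isOpen_realConeDomain h.isOpen) x).symm u)) _).im
    rw [e6, e5]
    simp only [Complex.add_im, Complex.ofReal_im, Complex.mul_im,
      Complex.sub_re, Complex.sub_im, Complex.ofReal_re, Complex.conj_re, Complex.conj_im,
      halfSq_re, halfSq_im, Complex.mul_re]
    simp [← hX, ← hy]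
    ring
  · obtain ⟨R, hR⟩ := hph.phase y hu
    have ha : c * ς y ≠ 0 := mul_ne_zero (Complex.exp_ne_zero _) (h.ne_zero hu)
    have hdet : (jac p u).det = (c * ς y) ^ (k + 1) * (s * ((starRingEnd ℂ) (ς y) * deriv ς y) -
        (-s) * (c * deriv ς y) / (c * ς y) * ∑ i, (X i : ℂ) ^ 2) := by
      refine det_arrow ha (fun i j => ?_)
        (fun i => ?_) (fun j => ?_) ?_
      · rw [jac, Matrix.of_apply, hD u hu, pair_castSucc, splitLast_castSucc]
        simp [stdBasis, apply_ite Complex.ofReal, hy]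
      · rw [jac, Matrix.of_apply, hD u hu, pair_castSucc, splitLast_last]
        simp [hX, hy]
      · rw [jac, Matrix.of_apply, hD u hu, pair_last, splitLast_castSucc]
        simp [stdBasis, EuclideanSpace.inner_single_right, hX]
      · rw [jac, Matrix.of_apply, hD u hu, pair_last, splitLast_last]
        simp [hy]
    refine ⟨R * s * (‖ς y‖ ^ 2 + ‖X‖ ^ 2), ?_⟩
    have e1 : jac ((fun v : realConeDomain (k + 1) J => p v) ∘
      (coeChart (isOpen_realConeDomain h.isOpen) x).symm) u = jac p u := by
      unfold jac; rw [hfd]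
    have e2 : ∑ i, (X i : ℂ) ^ 2 = (‖X‖ : ℂ) ^ 2 := by
      rw [← Complex.ofReal_pow, EuclideanSpace.real_norm_sq_eq]
      push_cast
      rfl
    have hς0 : ς y ≠ 0 := h.ne_zero hu
    have hc0 : c ≠ 0 := Complex.exp_ne_zero _
    have e3 : Complex.exp (Complex.I * (((realConeMap c s ς β (splitLast (k + 1)
        ((coeChart (isOpen_realConeDomain h.isOpen) x).symm u)) (Fin.last _)).im +
          ((k + 1) * χ + θ) : ℝ) : ℂ)) =
        c ^ (k + 1) * Complex.exp (Complex.I * (θ + s * β y : ℝ)) := by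
      rw [hval, realConeMap, pairCLM_apply, pair_last, Complex.im_ofReal_mul, Complex.sub_im,
        halfSq_im, Complex.ofReal_im, sub_zero, hc, ← Complex.exp_nat_mul, ← Complex.exp_add]
      congr 1
      push_cast
      ring
    rw [e1, hdet, e2, e3]
    have e4 : (starRingEnd ℂ) (ς y) * ς y = (‖ς y‖ : ℂ) ^ 2 := Complex.conj_mul' _
    push_cast
    have e5 : (c * ς y) ^ (k + 1) * (s * ((starRingEnd ℂ) (ς y) * deriv ς y) -
        (-s) * (c * deriv ς y) / (c * ς y) * (‖X‖ : ℂ) ^ 2) =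
        c ^ (k + 1) * (ς y ^ k * deriv ς y) * s * ((starRingEnd ℂ) (ς y) * ς y + (‖X‖ : ℂ) ^ 2) := by
      rw [mul_pow, pow_succ (ς y)]
      field_simp
      ring
    rw [e5, hR, e4]
    push_cast
    ring

end RealCone

end LagTrans

end

/-! ### Cone sets of SO(n) are smooth across the vertex -/

noncomputable section

namespace LagTrans

section RealConeSet

open Filter Set Topology

variable {k n : ℕ} {ς : ℝ → ℂ} {J : Set ℝ} {r : ℝ → ℝ} {x₀ : ℝ}

/-- The real part of a complex vector. -/
def reCLM (n : ℕ) : Cn n →L[ℝ] Rn n :=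
  LinearMap.toContinuousLinearMap
    { toFun := fun v => WithLp.toLp 2 fun i => (v i).re
      map_add' := fun _ _ => by ext; simp
      map_smul' := fun _ _ => by ext; simp }

theorem reCLM_realCLM (v : Rn n) : reCLM n (realCLM n v) = v := by
  ext i
  exact Complex.ofReal_re _

/-- Here X is recovered as a real part after division by cς(y); no positive radius is needed. -/
theorem isEmbedding_realConeMap {c : ℂ} (hc : c ≠ 0) {s : ℝ} (hs : s * s = 1) {β Y : ℝ → ℝ}
    (hς : ContinuousOn ς J) (hς0 : ∀ y ∈ J, ς y ≠ 0) (hβ : ContinuousOn β J)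
    (hY : ∀ y ∈ J, Y (β y) = y) (hYc : ContinuousOn Y (β '' J)) :
    IsEmbedding (fun u : realConeDomain n J => realConeMap c s ς β (splitLast n u)) := by
  set F : realConeDomain n J → Cn (n + 1) := fun u => realConeMap c s ς β (splitLast n u) with hF
  have hx : Continuous fun u : realConeDomain n J => (splitLast n u).1 :=
    continuous_fst.comp ((splitLast n).continuous.comp continuous_subtype_val)
  have hy : Continuous fun u : realConeDomain n J => (splitLast n u).2 :=
    continuous_snd.comp ((splitLast n).continuous.comp continuous_subtype_val)
  have hlast : Continuous fun p : Cn (n + 1) => s * (p (Fin.last n)).im :=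
    continuous_const.mul (Complex.continuous_im.comp
      (PiLp.continuous_apply 2 (fun _ : Fin (n + 1) => ℂ) (Fin.last n)))
  have him : ∀ u, s * (F u (Fin.last n)).im = β (splitLast n u).2 := by
    intro u
    simp only [hF, realConeMap, pairCLM_apply]
    rw [pair_last, Complex.im_ofReal_mul, Complex.sub_im, halfSq_im,
      Complex.ofReal_im, sub_zero, ← mul_assoc, hs, one_mul]
  have hYu : ∀ u : realConeDomain n J, Y (s * (F u (Fin.last n)).im) = (splitLast n u).2 := by
    intro u
    rw [him, hY _ u.2]
  have hYcc : ContinuousOn (fun p : Cn (n + 1) => Y (s * (p (Fin.last n)).im)) (range F) := by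
    refine hYc.comp hlast.continuousOn ?_
    rintro _ ⟨u, rfl⟩
    exact ⟨_, u.2, (him u).symm⟩
  refine isEmbedding_of_continuousOn_leftInverse
    (g := fun p => (splitLast n).symm
      (reCLM n ((c * ς (Y (s * (p (Fin.last n)).im)))⁻¹ • initCLM n p), Y (s * (p (Fin.last n)).im)))
    IsEmbedding.subtypeVal ?_ ?_ fun u => ?_
  · refine (pairCLM n).continuous.comp (Continuous.prodMk (Continuous.smul
      (continuous_const.mul (hς.comp_continuous hy fun u => u.2))
      ((realCLM n).continuous.comp hx)) (continuous_const.mul (Continuous.sub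
        ((continuous_halfSq hς hβ).comp_continuous hy fun u => u.2)
        (Complex.continuous_ofReal.comp ((hx.norm.pow 2).div_const 2)))))
  · refine (splitLast n).symm.continuous.comp_continuousOn
      (ContinuousOn.prodMk ((reCLM n).continuous.comp_continuousOn
        (ContinuousOn.fun_smul ?_ (initCLM n).continuous.continuousOn)) hYcc)
    refine ContinuousOn.fun_inv₀ (continuousOn_const.mul (hς.comp hYcc ?_)) ?_
    · rintro _ ⟨u, rfl⟩
      change Y (s * (F u (Fin.last n)).im) ∈ J
      rw [hYu]
      exact u.2
    · rintro _ ⟨u, rfl⟩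
      rw [hYu]
      exact mul_ne_zero hc (hς0 _ u.2)
  · simp only [hYu]
    have h1 : initCLM n (F u) = (c * ς (splitLast n u).2) • realCLM n (splitLast n u).1 :=
      initCLM_pair _ _
    rw [h1, inv_smul_smul₀ (mul_ne_zero hc (hς0 _ u.2)), reCLM_realCLM, Prod.mk.eta,
      ContinuousLinearEquiv.symm_apply_apply]

variable {G : Subgroup (SU n)} {φ ψ s : ℝ} {β : ℝ → ℝ} {e : Rn n}

/-- `coneMap` depends on q and x only through xq and x². -/
theorem coneMap_eq_realConeMap {q : Cn n} {x y : ℝ} {X : Rn n} (hx : x ^ 2 = ‖X‖ ^ 2)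
    (hq : (x : ℂ) • q = Complex.exp (Complex.I * ψ) • realCLM n X) :
    coneMap s φ ς β q x y = realConeMap (Complex.exp (Complex.I * (φ + ψ : ℝ))) s ς β (X, y) := by
  rw [coneMap, realConeMap, pairCLM_apply, hx]
  congr 1
  rw [mul_assoc, mul_comm (x : ℂ), ← mul_assoc, mul_smul, hq, smul_smul, Complex.ofReal_add,
    mul_add, Complex.exp_add]
  congr 1
  ring

theorem IsStandardSO.realConeMap_mem (hG : IsStandardSO G) (he : ‖e‖ = 1) (X : Rn n) (y : ℝ) :
    ∃ q ∈ orbitOf (opSet G) (Complex.exp (Complex.I * ψ) • realCLM n e), ∃ x : ℝ,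
      x ^ 2 = ‖X‖ ^ 2 ∧ coneMap s φ ς β q x y =
        realConeMap (Complex.exp (Complex.I * (φ + ψ : ℝ))) s ς β (X, y) := by
  obtain ⟨q, hq, x, hx, hqx⟩ := hG.exists_mem_orbitOf (X := X) he (Complex.exp (Complex.I * ψ))
  exact ⟨q, hq, x, hx, coneMap_eq_realConeMap hx hqx⟩

/-- The orbit consists of a fixed phase times real unit vectors and meets every real line, so xq
runs through that phase times all of ℝ^n. -/
theorem IsStandardSO.coneSet_eq (hG : IsStandardSO G) (he : ‖e‖ = 1) :
    coneSet s φ ς β (orbitOf (opSet G) (Complex.exp (Complex.I * ψ) • realCLM n e)) univ J =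
      range (fun u : realConeDomain n J =>
        realConeMap (Complex.exp (Complex.I * (φ + ψ : ℝ))) s ς β (splitLast n u)) := by
  ext p
  constructor
  · rintro ⟨q, hq, x, -, y, hy, rfl⟩
    obtain ⟨e', he', rfl⟩ := hG.eq_of_mem_orbitOf he hq
    refine ⟨⟨(splitLast n).symm (x • e', y), ?_⟩, ?_⟩
    · change (splitLast n ((splitLast n).symm (x • e', y))).2 ∈ J
      rwa [ContinuousLinearEquiv.apply_symm_apply]
    · simp only [ContinuousLinearEquiv.apply_symm_apply]
      refine (coneMap_eq_realConeMap ?_ ?_).symm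
      · rw [norm_smul, he', mul_one, Real.norm_eq_abs, sq_abs]
      · rw [map_smul, smul_comm]
        rfl
  · rintro ⟨u, rfl⟩
    obtain ⟨q, hq, x, -, hx⟩ := hG.realConeMap_mem (ψ := ψ) (φ := φ) (s := s) (ς := ς) (β := β) he
      (splitLast n u).1 (splitLast n u).2
    exact ⟨q, hq, x, trivial, _, u.2, hx.symm⟩

/-- Cone sets over real spheres are embedded translators. -/
theorem IsPolarGraph.isEmbeddedTranslatorOff_empty (h : IsPolarGraph J ς r) (hx₀ : x₀ ∈ J) {s : ℝ}
    (hs : s = 1 ∨ s = -1) (hP : ProfileEq (k + 1) (-s) J ς) (φ : ℝ) {G : Subgroup (SU (k + 1))}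
    (hG : IsStandardSO G) (hc : IsCompact (G : Set (SU (k + 1)))) {v : Cn (k + 1)}
    (hv : IsNull (opSet G) v) (hv1 : ‖v‖ = 1) :
    ∃ c : ℝ, IsEmbeddedTranslatorOff (-eLast (k + 1))
        (coneSet s φ ς (beta ς x₀) (orbitOf (opSet G) v) univ J) ∅ ∧
      IsLagrangianAngle (Subtype.val : ↥(coneSet s φ ς (beta ς x₀) (orbitOf (opSet G) v) univ J \ ∅)
          → Cn (k + 2)) (fun p => ((p : Cn (k + 2)) (Fin.last _)).im + c) := by
  obtain ⟨ψ, e, he, rfl⟩ := hG.exists_phase hc hv hv1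
  have hss := mul_self_of_eq_one_or hs
  have hς := h.contDiffOn.continuousOn
  have hβ := (contDiffOn_beta h.isOpen h.ordConnected h.contDiffOn hx₀).continuousOn
  obtain ⟨Y, hY, hYc⟩ := h.exists_inverse_beta hx₀
  obtain ⟨c, K, hK, H⟩ := h.realCone_calibrated hx₀ hs hP (φ + ψ)
  obtain ⟨f, hf, hf'⟩ := exists_ambient_primitive (φ := φ) (X := univ)
    (N := orbitOf (opSet G) (Complex.exp (Complex.I * ψ) • realCLM (k + 1) e)) hss hς hK hY hYc
  refine ⟨c, isEmbeddedTranslatorOff_range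
    (isEmbedding_realConeMap (Complex.exp_ne_zero (Complex.I * (φ + ψ : ℝ))) hss hς
      (fun y hy => h.ne_zero hy) hβ hY hYc)
    (sdiff_empty.trans (hG.coneSet_eq he)) hf fun u =>
      ⟨coeChart (isOpen_realConeDomain h.isOpen) u, ?_, by rw [coeChart_source]; trivial⟩⟩
  have e1 : (fun u : realConeDomain (k + 1) J => f (realConeMap (Complex.exp (Complex.I *
      (φ + ψ : ℝ))) s ς (beta ς x₀) (splitLast (k + 1) u))) =
      fun u : realConeDomain (k + 1) J => ‖(splitLast (k + 1) u).1‖ ^ 2 / 2 *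
        beta ς x₀ (splitLast (k + 1) u).2 + K (splitLast (k + 1) u).2 := by
    funext u
    obtain ⟨q, -, x, hx, hq⟩ := hG.realConeMap_mem (ψ := ψ) (φ := φ) (s := s) (ς := ς)
      (β := beta ς x₀) he (splitLast (k + 1) u).1 (splitLast (k + 1) u).2
    have h2 := hf' q x _ u.2
    rw [hq, hx] at h2
    exact h2
  rw [e1]
  exact H u

end RealConeSet

/-! ### Translation of the ansatz into cone sets and links -/

section Assembly

open Filter Set Topology

variable {n : ℕ}

theorem IsCalibratedChart.continuous {X : Type*} [TopologicalSpace X] {d : ℕ} {f : X → Cn d}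
    {h θ : X → ℝ} (H : ∀ x, ∃ ψ, IsCalibratedChart f h θ ψ ∧ x ∈ ψ.source) : Continuous h := by
  refine continuous_iff_continuousAt.2 fun x => ?_
  obtain ⟨ψ, hψ, hx⟩ := H x
  have h1 : ContinuousAt ((h ∘ ψ.symm) ∘ ψ) x :=
    ContinuousAt.comp (hψ.2 _ (ψ.map_source hx)).2.1.1.continuousAt (ψ.continuousAt hx)
  refine h1.congr ?_
  filter_upwards [ψ.open_source.mem_nhds hx] with y hy
  simp [ψ.left_inv hy]

theorem orbitSet_eq {z' : Cn n} (G : Subgroup (SU n)) (Φ : (Submodule.span ℂ {z'}) ≃ₗᵢ[ℂ] ℂ) :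
    orbitSet G Φ = orbitOf (opSet G) (Φ.symm 1 : Cn n) := by
  ext v
  constructor
  · rintro ⟨g, hg, rfl⟩
    exact ⟨_, ⟨g, hg, rfl⟩, rfl⟩
  · rintro ⟨_, ⟨g, hg, rfl⟩, rfl⟩
    exact ⟨g, hg, rfl⟩

theorem ansatzImage_eq {z' : Cn n} (G : Subgroup (SU n)) (Φ : (Submodule.span ℂ {z'}) ≃ₗᵢ[ℂ] ℂ)
    (γ ξ : ℝ → ℂ) (x₀ y₀ : ℝ) (I₁ I₂ : Set ℝ) : ansatzImage G Φ γ ξ x₀ y₀ I₁ I₂ =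
      {p | ∃ q ∈ orbitOf (opSet G) (Φ.symm 1 : Cn n), ∃ x ∈ I₁, ∃ y ∈ I₂,
        p = pair ((profileSurface γ ξ x₀ y₀ x y).1 • q) (profileSurface γ ξ x₀ y₀ x y).2} := by
  rw [← range_reducedMap, ← orbitSet_eq]
  ext p
  constructor
  · rintro ⟨⟨q, x, y⟩, rfl⟩
    exact ⟨q, q.2, x, x.2, y, y.2, rfl⟩
  · rintro ⟨q, hq, x, hx, y, hy, rfl⟩
    exact ⟨(⟨q, hq⟩, ⟨x, hx⟩, ⟨y, hy⟩), rfl⟩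

theorem ansatzImage_line_left {z' : Cn n} (G : Subgroup (SU n))
    (Φ : (Submodule.span ℂ {z'}) ≃ₗᵢ[ℂ] ℂ) (φ : ℝ) (ς : ℝ → ℂ) (x₀ : ℝ) (X J : Set ℝ) :
    ansatzImage G Φ (line φ) ς 0 x₀ X J =
      coneSet 1 φ ς (beta ς x₀) (orbitOf (opSet G) (Φ.symm 1 : Cn n)) X J := by
  rw [ansatzImage_eq]
  simp only [coneSet, coneMap_one]

theorem ansatzImage_line_right {z' : Cn n} (G : Subgroup (SU n))
    (Φ : (Submodule.span ℂ {z'}) ≃ₗᵢ[ℂ] ℂ) (φ : ℝ) (ς : ℝ → ℂ) (x₀ : ℝ) (X J : Set ℝ) :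
    ansatzImage G Φ ς (line φ) x₀ 0 J X =
      coneSet (-1) φ ς (beta ς x₀) (orbitOf (opSet G) (Φ.symm 1 : Cn n)) X J := by
  rw [ansatzImage_eq]
  simp only [coneSet, coneMap_neg_one]
  ext p
  constructor
  · rintro ⟨q, hq, y, hy, x, hx, rfl⟩
    exact ⟨q, hq, x, hx, y, hy, rfl⟩
  · rintro ⟨q, hq, x, hx, y, hy, rfl⟩
    exact ⟨q, hq, y, hy, x, hx, rfl⟩

theorem norm_symm_one {z' : Cn n} (Φ : (Submodule.span ℂ {z'}) ≃ₗᵢ[ℂ] ℂ) :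
    ‖(Φ.symm 1 : Cn n)‖ = 1 := by
  have := Φ.symm.norm_map 1
  rw [norm_one] at this
  exact this

/-- Zeroes of the moment map in the component of a cohomogeneity-one Lagrangian have orbits of
maximal isotropic dimension. -/
theorem finrank_orbitTangent_of_mem {G : Subgroup (SU n)} (hG : IsCompact (G : Set (SU n)))
    {Z : Set (Cn n)} (hZ : Z ⊆ zeroLevel G) {L : Set (Cn n)} (hLZ : L ⊆ Z)
    (hL : IsCohomogeneityOneLagrangian G L) {v : Cn n} (hv1 : ‖v‖ = 1) (hv : IsNull (opSet G) v) :
    Module.finrank ℝ (orbitTangent (opSet G) v) + 1 = n := by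
  obtain ⟨z, hzL, hz⟩ := hL.finrank_orbitTangent hG
  have hS := isUnitaryGroup_opSet hG
  have hv0 : v ≠ 0 := by rintro rfl; simp at hv1
  by_cases hz0 : z = 0
  -- The point of the Lagrangian may be 0 only if n = 1; then the general bound already forces
  -- orbits of dimension 0.
  · have h1 := hS.finrank_orbitTangent_lt hv hv0
    have h2 : orbitTangent (opSet G) z = ⊥ := by
      rw [eq_bot_iff]
      rintro _ ⟨X, -, rfl⟩
      simp [hz0]
    rw [h2, finrank_bot] at hz
    omega
  · obtain ⟨ν, hν⟩ := exists_isInvariantMeasure hG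
    have hn : ((‖z‖⁻¹ : ℝ) : ℂ) ≠ 0 :=
      Complex.ofReal_ne_zero.2 (inv_ne_zero (norm_ne_zero_iff.2 hz0))
    refine hS.finrank_orbitTangent_eq hν (z := ((‖z‖⁻¹ : ℝ) : ℂ) • z) ?_
      ((isNull_of_mem_zeroLevel hG (hZ (hLZ hzL))).smul _) ?_ hv1 hv
    · rw [norm_smul, Complex.norm_real, norm_inv, norm_norm,
        inv_mul_cancel₀ (norm_ne_zero_iff.2 hz0)]
    · rw [finrank_orbitTangent_smul _ hn, hz]

theorem isNull_symm_one {G : Subgroup (SU n)} (hG : IsCompact (G : Set (SU n))) {z' : Cn n}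
    (hz' : z' ∈ zeroLevel G) (Φ : (Submodule.span ℂ {z'}) ≃ₗᵢ[ℂ] ℂ) :
    IsNull (opSet G) (Φ.symm 1 : Cn n) := by
  obtain ⟨c, hc⟩ := Submodule.mem_span_singleton.1 (Φ.symm 1).2
  rw [← hc]
  exact (isNull_of_mem_zeroLevel hG hz').smul c

/-- The orbit of a unit vector under a unitary group. -/
theorem IsUnitaryGroup.norm_of_mem_orbitOf {S : Set (Endo n)} (hS : IsUnitaryGroup S) {v : Cn n}
    (hv : ‖v‖ = 1) : ∀ q ∈ orbitOf S v, ‖q‖ = 1 := by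
  rintro _ ⟨A, hA, rfl⟩
  exact (hS.norm_map hA v).trans hv

/-- The orbit itself is the link for L_(f). The orbit together with its negative is the link for the
complements of the vertex curves. -/
theorem exists_isSpecialLegendrian {k : ℕ} {G : Subgroup (SU (k + 1))}
    (hG : IsCompact (G : Set (SU (k + 1)))) {v : Cn (k + 1)} (hv1 : ‖v‖ = 1)
    (hv : IsNull (opSet G) v) (hdim : Module.finrank ℝ (orbitTangent (opSet G) v) + 1 = k + 1) :
    (∃ θ₀, IsSpecialLegendrian (orbitOf (opSet G) v) θ₀) ∧
      ∃ θ₀, IsSpecialLegendrian (orbitOf (symmetrize (opSet G)) v) θ₀ := by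
  have hS := isUnitaryGroup_opSet hG
  refine ⟨hS.isSpecialLegendrian_orbitOf (fun A hA => det_symm_opSet (Or.inl hA)) hv1 hv (by omega),
    hS.symmetrize.isSpecialLegendrian_orbitOf (fun A hA => det_symm_opSet hA) hv1
      (hS.isNull_symmetrize hv) ?_⟩
  rw [hS.orbitTangent_symmetrize]
  omega

theorem IsAnciauxExpanderProfile.exists_beta_mem_Icc {k : ℕ} {α : ℝ} {ε : ℝ → ℂ}
    (h : IsAnciauxExpanderProfile (k + 1) α ε) :
    ∃ b, ∀ y ∈ Ioo (-(α / 2)) (α / 2), beta ε 0 y ∈ Icc b (b + (π - α / 2)) := by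
  have hα := h.1
  have h0 : (0 : ℝ) ∈ Ioo (-(α / 2)) (α / 2) := ⟨by linarith, by linarith⟩
  have hb : BddBelow (beta ε 0 '' Ioo (-(α / 2)) (α / 2)) := by
    refine ⟨beta ε 0 0 - (π - α / 2), ?_⟩
    rintro _ ⟨y, hy, rfl⟩
    linarith [h.beta_sub_le hy h0]
  refine ⟨sInf (beta ε 0 '' Ioo (-(α / 2)) (α / 2)), fun y hy => ⟨csInf_le hb ⟨y, hy, rfl⟩, ?_⟩⟩
  have : beta ε 0 y - (π - α / 2) ≤ sInf (beta ε 0 '' Ioo (-(α / 2)) (α / 2)) := by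
    refine le_csInf ⟨_, 0, h0, rfl⟩ ?_
    rintro _ ⟨x, hx, rfl⟩
    linarith [h.beta_sub_le hx hy]
  linarith

/-- Cone sets over expander profiles are almost calibrated. -/
theorem IsAnciauxExpanderProfile.isAlmostCalibratedOff {k : ℕ} {α φ c : ℝ} {ε : ℝ → ℂ}
    (h : IsAnciauxExpanderProfile (k + 1) α ε) {O : Set (Cn (k + 1))} {S : Set (Cn (k + 2))}
    (hθ : IsLagrangianAngle (Subtype.val : ↥(coneSet (-1) φ ε (beta ε 0) O univ
      (Ioo (-(α / 2)) (α / 2)) \ S) → Cn (k + 2))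
        (fun p => ((p : Cn (k + 2)) (Fin.last _)).im + c)) :
    IsAlmostCalibratedOff (coneSet (-1) φ ε (beta ε 0) O univ (Ioo (-(α / 2)) (α / 2))) S := by
  obtain ⟨b, hb⟩ := h.exists_beta_mem_Icc
  have hc : Continuous fun p : Cn (k + 2) => (p (Fin.last _)).im + c := by fun_prop
  -- For s = -1 the angle is c - β(y), so it varies over an interval of length at most π - α/2.
  refine ⟨_, hc.continuousOn, hθ, -(b + (π - α / 2)) + c, -b + c, by linarith [h.1], ?_⟩
  rintro _ ⟨q, -, x, -, y, hy, rfl⟩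
  have := hb y hy
  rw [coneMap_last_im]
  constructor <;> linarith [this.1, this.2]

end Assembly

end LagTrans

end

/-! ### Expander and shrinker profiles together -/

noncomputable section

namespace LagTrans

theorem IsPolarGraph.exists_primitive_rotate {γ : ℝ → ℂ} {J : Set ℝ} {r : ℝ → ℝ} {x₀ : ℝ}
    (h : IsPolarGraph J γ r) (hx₀ : x₀ ∈ J) (φ : ℝ) :
    ∃ K : ℝ → ℝ, ∀ x ∈ J, HasDerivAt K (‖rotate φ γ x‖ ^ 2 / 2 *
      ((starRingEnd ℂ) (rotate φ γ x) * deriv (rotate φ γ) x).im -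
      beta (rotate φ γ) x₀ x * ((starRingEnd ℂ) (rotate φ γ x) * deriv (rotate φ γ) x).re) x := by
  have h1 : ∀ t, deriv (rotate φ γ) t = Complex.exp (Complex.I * φ) * deriv γ t := fun t => by
    unfold rotate
    exact deriv_const_mul_field _
  have h2 : (starRingEnd ℂ) (Complex.exp (Complex.I * φ)) * Complex.exp (Complex.I * φ) = 1 := by
    rw [mul_comm Complex.I]
    exact IsPolarGraph.exp_conj_mul φ
  have h3 : ∀ x, (starRingEnd ℂ) (rotate φ γ x) * deriv (rotate φ γ) x =
      (starRingEnd ℂ) (γ x) * deriv γ x := by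
    intro x
    rw [h1, rotate, map_mul]
    linear_combination (starRingEnd ℂ) (γ x) * deriv γ x * h2
  have h4 : ∀ x, ‖rotate φ γ x‖ = ‖γ x‖ := by
    intro x
    rw [rotate, norm_mul, norm_exp_I_mul, one_mul]
  simp only [h3, h4, beta_rotate]
  exact h.exists_primitive hx₀

/-- The translator built from a special Legendrian, an expander profile and a shrinker profile. -/
theorem isExactZeroMaslovTranslator_linkMap {k : ℕ} {N : Set (Cn (k + 1))} {θ₀ : ℝ}
    (hN : IsSpecialLegendrian N θ₀) {α : ℝ} {ε σ : ℝ → ℂ} (hε : IsAnciauxExpanderProfile (k + 1) α ε)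
    (hσ : IsAnciauxShrinkerProfile (k + 1) σ) (φ s₀ : ℝ) :
    IsExactZeroMaslovTranslator (-eLast (k + 1))
      (linkMap N (rotate φ ε) σ 0 s₀ (Set.Ioo (-(α / 2)) (α / 2)) Set.univ) := by
  obtain ⟨r, hr, hP⟩ := hε.isPolarGraph
  obtain ⟨ρ, hρ, hQ⟩ := hσ.isPolarGraph
  have hα := hε.1
  have hx : (0 : ℝ) ∈ Set.Ioo (-(α / 2)) (α / 2) := ⟨by linarith, by linarith⟩
  obtain ⟨θ, hθ⟩ := hr.exists_angle hP hx
  obtain ⟨θ', hθ'⟩ := hρ.exists_angle hQ (Set.mem_univ s₀)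
  obtain ⟨K, hK⟩ := hr.exists_primitive_rotate hx φ
  obtain ⟨K', hK'⟩ := hρ.exists_primitive (Set.mem_univ s₀)
  -- Rotation by φ leaves β unchanged and shifts the constant in the phase condition by (k + 1)φ.
  have h1 := isPhaseCurve_rotate (hr.isPhaseCurve hx hθ) φ
  have h2 := hρ.isPhaseCurve (Set.mem_univ s₀) hθ'
  rw [neg_neg] at h2
  have H := link_calibrated hN h1 h2 hK hK'
  obtain ⟨a, b, c, d⟩ := calibrated_conclusions H (fun _ => rfl)
  exact ⟨a, ⟨_, IsCalibratedChart.continuous H, b⟩, ⟨_, c⟩, d⟩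

end LagTrans

end

open LagTrans in
theorem mainTheorem7 (n : ℕ) (hn : 1 ≤ n)
    (G : Subgroup (SU n)) (hGcompact : IsCompact (G : Set (SU n)))
    (hGconn : IsConnected (G : Set (SU n)))
    (Z : Set (Cn n)) (hZ : ∃ z₀ ∈ zeroLevel G, Z = connectedComponentIn (zeroLevel G) z₀)
    (hZL : ∃ L₀ ⊆ Z, IsCohomogeneityOneLagrangian G L₀)
    (z' : Cn n) (hz' : z' ∈ Z) (hz'0 : z' ≠ 0)
    (Φ : (Submodule.span ℂ {z'}) ≃ₗᵢ[ℂ] ℂ) :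
    -- the line `e^{iφ} c` and a shrinker profile
    (∀ (φ s₀ : ℝ) (σ : ℝ → ℂ), IsAnciauxShrinkerProfile n σ →
      IsEmbeddedTranslatorOff (-eLast n) (Ld G Φ φ σ s₀) (Sd G Φ φ σ s₀) ∧
      IsEmbeddedSubmanifold 1 (Sd G Φ φ σ s₀) ∧
      (n < Module.finrank ℝ (Submodule.span ℝ (orbitSet G Φ)) →
        IsSingularAlong (Ld G Φ φ σ s₀) (Sd G Φ φ σ s₀)) ∧
      (IsStandardSO G → IsEmbeddedTranslatorOff (-eLast n) (Ld G Φ φ σ s₀) ∅)) ∧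
    -- an expander profile and the line `e^{iφ} c`
    (∀ (φ α : ℝ) (ε : ℝ → ℂ), IsAnciauxExpanderProfile n α ε →
      IsEmbeddedTranslatorOff (-eLast n) (Le G Φ φ α ε) (Se G Φ φ α ε) ∧
      IsAlmostCalibratedOff (Le G Φ φ α ε) (Se G Φ φ α ε) ∧
      IsEmbeddedSubmanifold 1 (Se G Φ φ α ε) ∧
      (n < Module.finrank ℝ (Submodule.span ℝ (orbitSet G Φ)) →
        IsSingularAlong (Le G Φ φ α ε) (Se G Φ φ α ε)) ∧
      (IsStandardSO G →
        IsEmbeddedTranslatorOff (-eLast n) (Le G Φ φ α ε) ∅ ∧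
        IsAlmostCalibratedOff (Le G Φ φ α ε) ∅)) ∧
    -- an expander profile and a shrinker profile
    (∀ (φ α s₀ : ℝ) (ε σ : ℝ → ℂ), IsAnciauxExpanderProfile n α ε →
      IsAnciauxShrinkerProfile n σ →
      IsSmoothImmersion (n + 1) (Ff G Φ φ α ε σ s₀) ∧
      IsExactZeroMaslovTranslator (-eLast n) (Ff G Φ φ α ε σ s₀)) := by
  -- k = m - 2 is the dimension of the link, the exponent in γ^k γ' and the coefficient in the
  -- profile equation.
  obtain ⟨k, rfl⟩ : ∃ k, n = k + 1 := ⟨n - 1, by omega⟩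
  obtain ⟨L₀, hL₀Z, hL₀⟩ := hZL
  have hZ0 : Z ⊆ zeroLevel G := by
    obtain ⟨z₀, -, rfl⟩ := hZ
    exact connectedComponentIn_subset _ _
  have hv1 := norm_symm_one Φ
  have hv := isNull_symm_one hGcompact (hZ0 hz') Φ
  have hO := (isUnitaryGroup_opSet hGcompact).norm_of_mem_orbitOf hv1
  have hOne : (orbitOf (opSet G) (Φ.symm 1 : Cn (k + 1))).Nonempty :=
    ⟨_, 1, (isUnitaryGroup_opSet hGcompact).one_mem, rfl⟩
  obtain ⟨⟨θ₀, hleg⟩, θ₁, hleg'⟩ := exists_isSpecialLegendrian hGcompact hv1 hv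
    (finrank_orbitTangent_of_mem hGcompact hZ0 hL₀Z hL₀ hv1 hv)
  refine ⟨fun φ s₀ σ hσ => ?_, fun φ α ε hε => ?_, fun φ α s₀ ε σ hε hσ => ?_⟩
  · obtain ⟨r, hr, hP⟩ := hσ.isPolarGraph
    have hx := Set.mem_univ s₀
    rw [Ld, Sd, ansatzImage_line_left, ansatzImage_line_left]
    refine ⟨?_, hr.isEmbeddedSubmanifold_vertex hx (Or.inl rfl) φ hOne, fun hspan => ?_,
      fun hSO => ?_⟩
    · exact (hr.isEmbeddedTranslatorOff hx (Or.inl rfl) hP φ hleg' hO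
        fun q => mem_orbitOf_symmetrize).choose_spec.1
    · rw [orbitSet_eq] at hspan
      exact hr.isSingularAlong hx (Or.inl rfl) φ hspan
    · exact (hr.isEmbeddedTranslatorOff_empty hx (Or.inl rfl) hP φ hSO hGcompact hv hv1).choose_spec.1
  · obtain ⟨r, hr, hP⟩ := hε.isPolarGraph
    have hα := hε.1
    have hx : (0 : ℝ) ∈ Set.Ioo (-(α / 2)) (α / 2) := ⟨by linarith, by linarith⟩
    -- The results on cone sets take the profile equation with constant -s, and s = -1 here.
    rw [← neg_neg (1 : ℝ)] at hP
    rw [Le, Se, ansatzImage_line_right, ansatzImage_line_right]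
    obtain ⟨c, h1, h2⟩ := hr.isEmbeddedTranslatorOff hx (Or.inr rfl) hP φ hleg' hO
      fun q => mem_orbitOf_symmetrize
    refine ⟨h1, hε.isAlmostCalibratedOff h2,
      hr.isEmbeddedSubmanifold_vertex hx (Or.inr rfl) φ hOne, fun hspan => ?_, fun hSO => ?_⟩
    · rw [orbitSet_eq] at hspan
      exact hr.isSingularAlong hx (Or.inr rfl) φ hspan
    · obtain ⟨c, h1, h2⟩ :=
        hr.isEmbeddedTranslatorOff_empty hx (Or.inr rfl) hP φ hSO hGcompact hv hv1
      exact ⟨h1, hε.isAlmostCalibratedOff h2⟩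
  · rw [← orbitSet_eq] at hleg
    have h1 := isExactZeroMaslovTranslator_linkMap hleg hε hσ φ s₀
    exact ⟨h1.1.1, h1⟩
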